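/- **Setting.** Let $m\ge 1$ servers hold $n_1,\dots,n_m\ge 1$ observations, $N=\sum_{j=1}^m n_j\ge 2$. All $N$ observations $(Y,X)$ are i.i.d. from the law $P_f$: $X$ is uniform on $[0,1]$ and $Y=f(X)+\xi$ with $\xi\sim N(0,1)$ independent of $X$. Let $0<\varepsilon_j\le C_\varepsilon$ for a fixed constant $C_\varepsilon>0$, and let $\delta_j\ge 0$. A protocol in $\mathcal M(\boldsymbol\varepsilon,\boldsymbol\delta)$ consists of (i) for each $j$ a Markov kernel that produces from the local data $Z^{(j)}$ a transcript $T^{(j)}$ in a standard Borel space $\mathcal T$ and satisfies $\mathbb P(T^{(j)}\in B\mid Z^{(j)}=z)\le e^{\varepsilon_j}\,\mathbb P(T^{(j)}\in B\mid Z^{(j)}=z')+\delta_j$ for all measurable $B$ and all data sets $z,z'$ that differ in at most one observation, and (ii) a (jointly measurable) estimator $\hat f=\hat f(T^{(1)},\dots,T^{(m)})$, a function on $[0,1]$. Transcripts of different servers are produced independently, each from its own server's data. Let $\alpha>0$, $2\le p\le\infty$, $1\le q\le\infty$, $R>0$, and suppose that $\nu:=\alpha-1/p>1/2$. Let $(\psi_{lk})$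 be an orthonormal basis of $L^2[0,1]$ of compactly supported, continuous, boundary-corrected (Cohen--Daubechies--Vial type) wavelets with $A>\alpha$ vanishing moments. The coarsest level $l=l_0$ consists of the $2^{l_0+1}$ father functions of resolution $l_0+1$, and each level $l>l_0$ of $2^l$ wavelets; all but a fixed number of functions at each end of $[0,1]$ are of the form $2^{l/2}\psi(2^lx-k)$ (father functions: $2^{(l_0+1)/2}\varphi(2^{l_0+1}x-k)$), and the exceptional ones are dilates of fixed boundary functions. Let $\mathcal B^{\alpha,R}_{p,q}$ be the set of $f\in L^2[0,1]$ whose coefficients $f_{lk}=\langle f,\psi_{lk}\rangle$ satisfy $$\Big(\sum_{l\ge l_0}\big(2^{l(\alpha+1/2-1/p)}\|(f_{lk})_k\|_{\ell_p}\big)^q\Big)^{1/q}\le R$$ (a supremum over $l$ if $q=\infty$). Values $f(x_0)$ refer to the continuous version of $f$. **Theorem.** For every $\gamma>0$ the equation $$D^{2\gamma+2}=\sum_{j=1}^m (n_j^2\varepsilon_j^2)\wedge(n_jD)$$ has exactly one solution $D>0$. (1) *Global risk.* Let $D$ be the solution for $\gamma=\alpha$. Fix $\kappa>0$, $K>0$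 and $\bar\delta<1$. There are constants $c,C>0$, depending only on $\alpha,p,q,R$, the wavelet basis, $C_\varepsilon,\kappa,K,\bar\delta$, such that whenever $\min_j\delta_j\le\bar\delta$ and $\delta_j\le K\big(n_j^{1/2}\varepsilon_j^2(D\vee1)^{-1}\big)^{1+\kappa}$ for all $j$, there is a number $M\ge1$ with $M\le C\log(N)\log(1/\min_j\delta_j)$ (no upper bound on $M$ being claimed if $\min_j\delta_j=0$) and $$c\,(M D^{-2\alpha}\wedge 1)\;\le\;\inf_{\hat f\in\mathcal M(\boldsymbol\varepsilon,\boldsymbol\delta)}\ \sup_{f\in\mathcal B^{\alpha,R}_{p,q}}\mathbb E_f\|\hat f-f\|_2^2\;\le\; C\,(M D^{-2\alpha}\wedge 1).$$ (2) *Pointwise risk.* Let $D$ be the solution for $\gamma=\nu$. There are constants $\eta,c,C>0$, depending only on $\alpha,p,q,R$, the wavelet basis and $C_\varepsilon$, such that for every $x_0\in(0,1)$, whenever $\sum_j n_j\delta_j\le\eta$ (in particular, eventually along every sequence of problems with $\sum_j n_j\delta_j\to0$), there is a number $M\ge1$ with $M\le C\log(N)$ and $$c\,(M D^{-2\nu}\wedge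 1)\;\le\;\inf_{\hat f\in\mathcal M(\boldsymbol\varepsilon,\boldsymbol\delta)}\ \sup_{f\in\mathcal B^{\alpha,R}_{p,q}}\mathbb E_f\big(\hat f(x_0)-f(x_0)\big)^2\;\le\; C\,(M D^{-2\nu}\wedge 1).$$ -/

import Mathlib

open MeasureTheory ProbabilityTheory
open scoped ENNReal

noncomputable section

/-! ### Wavelet bases of `L²[0,1]` and Besov balls -/

/-- The `k`-th function (`0 ≤ k < 2 ^ l`) at resolution level `l` of a boundary-corrected
dilation-translation family on `[0,1]`: the first `e` functions are dilates of the left boundary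
generators `gL`, the last `e` are dilates of the right boundary generators `gR` (which are functions
of the rescaled distance to the right end point), and all the others are the dilated translates
`2 ^ (l / 2) g (2 ^ l x - k)` of a single function `g`. -/
def boundaryDilate (e : ℕ) (g : ℝ → ℝ) (gL gR : ℕ → ℝ → ℝ) (l k : ℕ) (x : ℝ) : ℝ :=
  (2 : ℝ) ^ ((l : ℝ) / 2) *
    (if k < e then gL k (2 ^ l * x)
      else if 2 ^ l ≤ k + e then gR (2 ^ l - 1 - k) (2 ^ l * (1 - x))
      else g (2 ^ l * x - k))

/-- The generators of a wavelet system on `[0,1]`: coarsest level `l₀`, number `e` of boundary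
functions at each end point, father `φ`, mother `ψ`, and their boundary versions. -/
structure WaveletSystem where
  l₀ : ℕ
  e : ℕ
  φ : ℝ → ℝ
  φL : ℕ → ℝ → ℝ
  φR : ℕ → ℝ → ℝ
  ψ : ℝ → ℝ
  ψL : ℕ → ℝ → ℝ
  ψR : ℕ → ℝ → ℝ

namespace WaveletSystem

variable (W : WaveletSystem)

/-- Levels are numbered `l = l₀ + i`. Level `l₀` (`i = 0`) carries the `2 ^ (l₀ + 1)` father
functions of resolution `l₀ + 1`; level `l > l₀` carries `2 ^ l` wavelets. -/
def count (i : ℕ) : ℕ := if i = 0 then 2 ^ (W.l₀ + 1) else 2 ^ (W.l₀ + i)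

/-- The function `ψ_{lk}` with `l = l₀ + i`, where `ψ_{l₀ k} = φ_{l₀ + 1, k}`. -/
def fn (i k : ℕ) (x : ℝ) : ℝ :=
  if i = 0 then boundaryDilate W.e W.φ W.φL W.φR (W.l₀ + 1) k x
  else boundaryDilate W.e W.ψ W.ψL W.ψR (W.l₀ + i) k x

/-- The wavelet coefficient `f_{lk} = ⟨f, ψ_{lk}⟩` in `L²[0,1]`, with `l = l₀ + i`. -/
def coeff (f : unitInterval → ℝ) (i k : ℕ) : ℝ := ∫ x : unitInterval, f x * W.fn i k x

/-- `W` generates an `A`-regular, compactly supported, orthonormal wavelet basis of `L²[0,1]`: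
the generators are continuous with compact support, the functions `ψ_{lk}` are an orthonormal basis,
and the wavelets proper (levels `l > l₀`) have `A` vanishing moments. -/
structure IsRegularBasis (A : ℕ) : Prop where
  two_mul_e_le : 2 * W.e ≤ 2 ^ (W.l₀ + 1)
  continuous_φ : Continuous W.φ
  continuous_φL : ∀ k, Continuous (W.φL k)
  continuous_φR : ∀ k, Continuous (W.φR k)
  continuous_ψ : Continuous W.ψ
  continuous_ψL : ∀ k, Continuous (W.ψL k)
  continuous_ψR : ∀ k, Continuous (W.ψR k)
  compact_φ : HasCompactSupport W.φ
  compact_φL : ∀ k, HasCompactSupport (W.φL k)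
  compact_φR : ∀ k, HasCompactSupport (W.φR k)
  compact_ψ : HasCompactSupport W.ψ
  compact_ψL : ∀ k, HasCompactSupport (W.ψL k)
  compact_ψR : ∀ k, HasCompactSupport (W.ψR k)
  orthonormal : ∀ i k i' k', k < W.count i → k' < W.count i' →
    ∫ x : unitInterval, W.fn i k x * W.fn i' k' x = if i = i' ∧ k = k' then 1 else 0
  complete : ∀ f : unitInterval → ℝ, MemLp f 2 volume →
    (∀ i k, k < W.count i → W.coeff f i k = 0) → f =ᵐ[volume] 0
  vanishing_moments : ∀ i k a, 1 ≤ i → k < W.count i → a < A →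
    ∫ x : unitInterval, (x : ℝ) ^ a * W.fn i k x = 0

end WaveletSystem

/-- The `ℓ_p` norm of a family of extended nonnegative numbers, `1 ≤ p ≤ ∞`. -/
def ellNorm {ι : Type} (p : ℝ≥0∞) (a : ι → ℝ≥0∞) : ℝ≥0∞ :=
  if p = ∞ then ⨆ i, a i else (∑' i, a i ^ p.toReal) ^ (1 / p.toReal)

/-- The Besov (quasi-)norm: the `ℓ_q` norm over the levels `l = l₀ + i` of
`2 ^ (l (α + 1/2 - 1/p)) ‖(f_{lk})_k‖_p`. -/
def besovNorm (W : WaveletSystem) (α : ℝ) (p q : ℝ≥0∞) (f : unitInterval → ℝ) : ℝ≥0∞ :=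
  ellNorm q fun i : ℕ =>
    ENNReal.ofReal ((2 : ℝ) ^ (((W.l₀ + i : ℕ) : ℝ) * (α + 1 / 2 - (p⁻¹).toReal))) *
      ellNorm p fun k : Fin (W.count i) => ‖W.coeff f i k‖ₑ

/-- The closed Besov ball of radius `R` in `L²[0,1]`. -/
def besovBall (W : WaveletSystem) (α : ℝ) (p q : ℝ≥0∞) (R : ℝ) : Set (unitInterval → ℝ) :=
  {f | MemLp f 2 volume ∧ besovNorm W α p q f ≤ ENNReal.ofReal R}

/-! ### Regression data, differential privacy, distributed protocols -/

/-- The law `P_f` of one observation `(Y, X)`: `X` is uniform on `[0,1]`, `ξ` is an independent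
standard Gaussian variable, and `Y = f X + ξ`. -/
def regressionLaw (f : unitInterval → ℝ) : Measure (ℝ × unitInterval) :=
  ((volume : Measure unitInterval).prod (gaussianReal 0 1)).map fun w => (f w.1 + w.2, w.1)

/-- `(ε, δ)`-differential privacy of a randomized transcript of a local data set of size `n`. -/
def IsDP {n : ℕ} {T : Type} [MeasurableSpace T] (ε δ : ℝ)
    (K : Kernel (Fin n → ℝ × unitInterval) T) : Prop :=
  ∀ z z' : Fin n → ℝ × unitInterval, hammingDist z z' ≤ 1 → ∀ A : Set T, MeasurableSet A →
    K z A ≤ ENNReal.ofReal (Real.exp ε) * K z' A + ENNReal.ofReal δ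

/-- A distributed estimation protocol for `m` servers with `n j` observations on server `j`: server
`j` releases an `(ε j, δ j)`-differentially private transcript of its own data, with values in a
standard Borel space `T`, and the central server computes from the `m` transcripts an estimate of
the regression function. -/
structure Protocol {m : ℕ} (n : Fin m → ℕ) (ε δ : Fin m → ℝ) where
  T : Type
  [instMeasurableSpace : MeasurableSpace T]
  [instStandardBorel : StandardBorelSpace T]
  K : ∀ j, Kernel (Fin (n j) → ℝ × unitInterval) T
  [instMarkov : ∀ j, IsMarkovKernel (K j)]
  isDP : ∀ j, IsDP (ε j) (δ j) (K j)
  est : (Fin m → T) → unitInterval → ℝ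
  measurable_est : Measurable (Function.uncurry est)

attribute [instance] Protocol.instMeasurableSpace Protocol.instStandardBorel Protocol.instMarkov

namespace Protocol

variable {m : ℕ} {n : Fin m → ℕ} {ε δ : Fin m → ℝ}

/-- The law of the vector of transcripts when all observations are i.i.d. from `P_f`. The servers
hold independent data and do not communicate, so it is the product over `j` of the laws of the
transcripts of the single servers. -/
def transcriptLaw (P : Protocol n ε δ) (f : unitInterval → ℝ) : Measure (Fin m → P.T) :=
  Measure.pi fun j => (Measure.pi fun _ : Fin (n j) => regressionLaw f).bind (P.K j)

/-- The integrated mean squared error `E_f ‖f̂ - f‖₂²`. -/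
def globalRisk (P : Protocol n ε δ) (f : unitInterval → ℝ) : ℝ≥0∞ :=
  ∫⁻ t, ∫⁻ x : unitInterval, ENNReal.ofReal ((P.est t x - f x) ^ 2) ∂volume ∂P.transcriptLaw f

/-- The mean squared error `E_f (f̂(x₀) - f(x₀))²` at `x₀`. -/
def pointwiseRisk (P : Protocol n ε δ) (x₀ : unitInterval) (f : unitInterval → ℝ) : ℝ≥0∞ :=
  ∫⁻ t, ENNReal.ofReal ((P.est t x₀ - f x₀) ^ 2) ∂P.transcriptLaw f

end Protocol

/-- The global minimax risk over a class `F` of functions. -/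
def globalMinimaxRisk {m : ℕ} (n : Fin m → ℕ) (ε δ : Fin m → ℝ)
    (F : Set (unitInterval → ℝ)) : ℝ≥0∞ :=
  ⨅ P : Protocol n ε δ, ⨆ f ∈ F, P.globalRisk f

/-- The pointwise minimax risk at `x₀` over a class `F` of functions in `L²[0,1]`. The value `f x₀`
is that of the continuous version of `f`, so the supremum is over the continuous members of `F`. -/
def pointwiseMinimaxRisk {m : ℕ} (n : Fin m → ℕ) (ε δ : Fin m → ℝ) (x₀ : unitInterval)
    (F : Set (unitInterval → ℝ)) : ℝ≥0∞ :=
  ⨅ P : Protocol n ε δ, ⨆ f ∈ {f ∈ F | Continuous f}, P.pointwiseRisk x₀ f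

/-- `D > 0` solves `D ^ (2γ + 2) = ∑ⱼ (nⱼ² εⱼ²) ∧ (nⱼ D)`. -/
def SolvesDimensionEq (γ : ℝ) {m : ℕ} (n : Fin m → ℕ) (ε : Fin m → ℝ) (D : ℝ) : Prop :=
  0 < D ∧ D ^ (2 * γ + 2) = ∑ j, min ((n j : ℝ) ^ 2 * ε j ^ 2) ((n j : ℝ) * D)

end

/-!
The factor `M` may absorb a logarithm, so it is enough to bound both minimax risks, up to constants,
from below by `D ^ (-2γ) ∧ 1` and from above by a logarithm times `D ^ (-2γ) ∧ 1`, with `γ = α` for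
the global and `γ = α - 1/p` for the pointwise risk (`exists_factor`). In fact the upper bounds are
obtained with Laplace noise, so they hold for `δ = 0`, and `M` never has to exceed a multiple of
`log N`.

Let `D'` be a power of two of the order of `D ∨ 1`; coefficients of the levels with `2 ^ l < D'` are
estimated, those of the other levels are set to zero, which costs `D' ^ (-2γ)` (`besovBall_approx`,
`sum_coeff_sq_le_of_mem`). Each server releases clipped empirical means of the functions
to be estimated with Laplace noise; the localization of the wavelets (`Localized`) keeps the
sensitivity of the whole vector of one server at the order of a single level. Weighting the
servers by `(n² ε²) ∧ (n D')` balances noise, variance and clipping bias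
(`exists_private_estimator`, `globalMinimaxRisk_le`, `pointwiseMinimaxRisk_le`).

The lower bound at a point is Le Cam's two point bound for `0` and a bump of height `D' ^ (-ν)` and
width `1 / D'`. The bump is a multiple of the reproducing kernel at the point
of a window of levels of fixed length. That kernel is large at the point because a tent function of
width `1 / D'` cannot be recovered without these levels (`IsRegularBasis.exists_window`,
`exists_bump`). The Hellinger affinity of the transcripts is multiplicative over the servers
(`AffinityGE.pi`). That of one server is at least the affinity of its data, and it is also bounded
below by privacy, since exchanging one observation of `0` for one of the bump changes the
conditional law of the transcript by a factor `e ^ ε` and the term `δ`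
(`affinityGE_transcript`, `affinityGE_private`).

The global lower bound is a van Trees argument with independent uniform priors on the coefficients
of one level (`exists_van_trees`). The information about a coefficient in the transcripts is the sum
over the servers of the second moment of the projection of the score of the data on the transcript
(`integral_mul_sum_le_of_projection`). It is at most that of the data; and, since the score of a
single observation has mean zero and the transcript depends on it only through the factor `e ^ ε`
and the term `δ`, it is also at most of the order `n² ε² / D'`. The condition on `δ` makes the
contribution of `δ` negligible after the score, which has Gaussian tails, has been clipped at a
suitable level (`exists_score_projection`, `exists_information_le`). By the equation for `D`, the
information adds up to `D' ^ (2α + 1)`, which is compensated by coefficients of the order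
`D' ^ (-α - 1/2)`.
-/

noncomputable section

/-! ### Product measures -/

/-- Refreshing one coordinate of a random vector with independent coordinates: replacing the `j`-th
coordinate by an independent draw from `μ j` yields the product measure `Measure.pi μ`, whatever the
law of the discarded coordinate was. -/
lemma measurePreserving_update_pi {ι : Type*} [Fintype ι] [DecidableEq ι] {X : ι → Type*}
    [∀ i, MeasurableSpace (X i)] (μ μ' : ∀ i, Measure (X i)) [∀ i, IsProbabilityMeasure (μ i)]
    [∀ i, IsProbabilityMeasure (μ' i)] (j : ι) (h : ∀ i, i ≠ j → μ' i = μ i) :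
    MeasurePreserving (fun p : (∀ i, X i) × X j => Function.update p.1 j p.2)
      ((Measure.pi μ').prod (μ j)) (Measure.pi μ) := by
  have hmeas : Measurable (fun p : (∀ i, X i) × X j => Function.update p.1 j p.2) := by
    rw [measurable_pi_iff]
    intro i
    by_cases hi : i = j
    · subst hi
      simpa using measurable_snd
    · simp only [Function.update_of_ne hi]
      exact (measurable_pi_apply i).comp measurable_fst
  refine ⟨hmeas, (Measure.pi_eq fun s hs => ?_).symm⟩
  rw [Measure.map_apply hmeas (MeasurableSet.univ_pi hs)]
  have : (fun p : (∀ i, X i) × X j => Function.update p.1 j p.2) ⁻¹' (Set.univ.pi s)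
      = (Set.univ.pi (Function.update s j Set.univ)) ×ˢ s j := by
    ext p
    simp only [Set.mem_preimage, Set.mem_pi, Set.mem_univ, true_imp_iff, Set.mem_prod]
    constructor
    · intro hp
      refine ⟨fun i => ?_, by simpa using hp j⟩
      by_cases hi : i = j
      · subst hi; simp
      · simpa [Function.update_of_ne hi] using hp i
    · rintro ⟨hp, hj⟩ i
      by_cases hi : i = j
      · subst hi; simpa using hj
      · simpa [Function.update_of_ne hi] using hp i
  rw [this, Measure.prod_prod, Measure.pi_pi, ← Finset.prod_erase_mul _ _ (Finset.mem_univ j)]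
  rw [← Finset.prod_erase_mul _ (fun i => (μ i) (s i)) (Finset.mem_univ j)]
  simp only [Function.update_self, measure_univ, mul_one]
  congr 1
  refine Finset.prod_congr rfl fun i hi => ?_
  rw [Function.update_of_ne (Finset.ne_of_mem_erase hi), h i (Finset.ne_of_mem_erase hi)]

/-- The product of measures with densities has the product density. -/
lemma pi_withDensity_eq {ι : Type*} [Fintype ι] {X : ι → Type*}
    [∀ i, MeasurableSpace (X i)] (μ : ∀ i, Measure (X i)) [∀ i, IsProbabilityMeasure (μ i)]
    (g : ∀ i, X i → ℝ≥0∞) (hg : ∀ i, Measurable (g i))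
    [∀ i, SigmaFinite ((μ i).withDensity (g i))] :
    Measure.pi (fun i => (μ i).withDensity (g i))
      = (Measure.pi μ).withDensity (fun x => ∏ i, g i (x i)) := by
  classical
  refine Measure.pi_eq fun s hs => ?_
  rw [withDensity_apply _ (MeasurableSet.univ_pi hs),
    ← lintegral_indicator (MeasurableSet.univ_pi hs)]
  have h1 : (fun x : ∀ i, X i => (Set.univ.pi s).indicator (fun x => ∏ i, g i (x i)) x)
      = fun x => ∏ i, (s i).indicator (g i) (x i) := by
    funext x
    by_cases hx : x ∈ Set.univ.pi s
    · rw [Set.indicator_of_mem hx]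
      refine Finset.prod_congr rfl fun i _ => ?_
      rw [Set.indicator_of_mem (hx i (Set.mem_univ i))]
    · rw [Set.indicator_of_notMem hx]
      simp only [Set.mem_pi, Set.mem_univ, true_imp_iff, not_forall] at hx
      obtain ⟨i, hi⟩ := hx
      exact (Finset.prod_eq_zero (Finset.mem_univ i) (Set.indicator_of_notMem hi _)).symm
  rw [h1]
  have h2 := lintegral_prod_eq_prod_lintegral_of_indepFun (μ := Measure.pi μ) Finset.univ
    (fun i (x : ∀ i, X i) => (s i).indicator (g i) (x i))
    (iIndepFun_pi (fun i => ((hg i).indicator (hs i)).aemeasurable))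
    (fun i => ((hg i).indicator (hs i)).comp (measurable_pi_apply i))
  rw [h2]
  refine Finset.prod_congr rfl fun i _ => ?_
  rw [withDensity_apply _ (hs i), ← lintegral_indicator (hs i)]
  exact (measurePreserving_eval μ i).lintegral_comp ((hg i).indicator (hs i))

/-- Orthogonality of independent centred square integrable variables. -/
lemma integral_sq_sum_pi {ι : Type*} [Fintype ι] {X : ι → Type*}
    [∀ i, MeasurableSpace (X i)] (μ : ∀ i, Measure (X i)) [∀ i, IsProbabilityMeasure (μ i)]
    (g : ∀ i, X i → ℝ) (hg : ∀ i, MemLp (g i) 2 (μ i)) (h0 : ∀ i, ∫ x, g i x ∂μ i = 0) :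
    ∫ x, (∑ i, g i (x i)) ^ 2 ∂Measure.pi μ = ∑ i, ∫ x, g i x ^ 2 ∂μ i := by
  have h := variance_sum_pi hg
  have hm : ∀ i, MemLp (fun ω : ∀ i, X i => g i (ω i)) 2 (Measure.pi μ) := fun i =>
    (hg i).comp_measurePreserving (measurePreserving_eval μ i)
  have hS : (∑ i, fun ω : ∀ i, X i => g i (ω i)) = fun ω => ∑ i, g i (ω i) := by
    funext ω; simp
  rw [hS, variance_of_integral_eq_zero] at h
  · rw [h]
    refine Finset.sum_congr rfl fun i _ => ?_
    rw [variance_of_integral_eq_zero (hg i).aestronglyMeasurable.aemeasurable (h0 i)]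
  · exact (memLp_finsetSum _ fun i _ => hm i).aestronglyMeasurable.aemeasurable
  · rw [integral_finsetSum _ fun i _ => (hm i).integrable (by norm_num)]
    refine Finset.sum_eq_zero fun i _ => ?_
    rw [← h0 i]
    exact integral_comp_eval (hg i).aestronglyMeasurable

/-- The hybrid argument: an estimate for the effect of exchanging the law of a single observation,
applied successively to all `n` observations. -/
lemma integral_pi_le_of_exchange {ι Z : Type*} [Fintype ι] [DecidableEq ι] [MeasurableSpace Z]
    (P P' : Measure Z) [IsProbabilityMeasure P] [IsProbabilityMeasure P'] {a b : ℝ} (ha : 0 ≤ a)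
    (hb : 0 ≤ b) (F : (ι → Z) → ℝ) (hF : Measurable F) (h0 : ∀ z, 0 ≤ F z) (h1 : ∀ z, F z ≤ 1)
    (h : ∀ z j, ∫ x, F (Function.update z j x) ∂P'
      ≤ (1 + a) * ∫ x, F (Function.update z j x) ∂P + b) :
    ∫ z, F z ∂(Measure.pi fun _ => P')
      ≤ (1 + a) ^ Fintype.card ι * (∫ z, F z ∂(Measure.pi fun _ => P) + Fintype.card ι * b) := by
  have hint : ∀ (ν : Measure (ι → Z)) [IsProbabilityMeasure ν], Integrable F ν := fun ν _ =>
    Integrable.of_bound hF.aestronglyMeasurable 1 (ae_of_all _ fun z => by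
      rw [Real.norm_eq_abs, abs_of_nonneg (h0 z)]; exact h1 z)
  -- The observations in `s` have already been exchanged.
  have key : ∀ s : Finset ι, ∫ z, F z ∂(Measure.pi fun i => if i ∈ s then P' else P)
      ≤ (1 + a) ^ s.card * (∫ z, F z ∂(Measure.pi fun _ => P) + s.card * b) := by
    intro s
    induction s using Finset.induction_on with
    | empty => simp
    | insert j s hj ih =>
      have hinst : ∀ (s : Finset ι) (i : ι), IsProbabilityMeasure (if i ∈ s then P' else P) := by
        intro s i; split_ifs <;> infer_instance
      -- Integrate over the observation `j` first, the others being fixed.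
      have hswap : ∀ (μ : ι → Measure Z) [∀ i, IsProbabilityMeasure (μ i)],
          (∀ i, i ≠ j → (if i ∈ s then P' else P) = μ i) →
          ∫ z, F z ∂(Measure.pi μ) = ∫ z, ∫ x, F (Function.update z j x) ∂(μ j)
            ∂(Measure.pi fun i => if i ∈ s then P' else P) := by
        intro μ _ hμ
        have hmp := measurePreserving_update_pi μ (fun i => if i ∈ s then P' else P) j hμ
        rw [← hmp.map_eq, integral_map hmp.measurable.aemeasurable hF.aestronglyMeasurable,
          integral_prod]
        exact (hmp.integrable_comp_of_integrable (hint _))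
      have e1 := hswap (fun i => if i ∈ insert j s then P' else P) (fun i hi => by
        simp [Finset.mem_insert, hi])
      have e2 := hswap (fun i => if i ∈ s then P' else P) (fun i hi => rfl)
      simp only [Finset.mem_insert_self, if_true] at e1
      simp only [hj, if_false] at e2
      have hmeasI : ∀ (Q : Measure Z) [IsProbabilityMeasure Q], Integrable
          (fun z => ∫ x, F (Function.update z j x) ∂Q)
          (Measure.pi fun i => if i ∈ s then P' else P) := by
        intro Q _
        have hm : Measurable (fun p : (ι → Z) × Z => F (Function.update p.1 j p.2)) := by
          refine hF.comp (measurable_pi_iff.2 fun i => ?_)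
          by_cases hi : i = j
          · subst hi; simpa using measurable_snd
          · simp only [Function.update_of_ne hi]
            exact (measurable_pi_apply i).comp measurable_fst
        refine Integrable.of_bound
          hm.stronglyMeasurable.integral_prod_right.aestronglyMeasurable 1 (ae_of_all _ fun z => ?_)
        refine (norm_integral_le_of_norm_le_const (C := 1)
          (ae_of_all _ fun x => ?_)).trans (by simp)
        rw [Real.norm_eq_abs, abs_of_nonneg (h0 _)]; exact h1 _
      rw [e1, Finset.card_insert_of_notMem hj]
      calc _ ≤ ∫ z, ((1 + a) * ∫ x, F (Function.update z j x) ∂P + b)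
              ∂(Measure.pi fun i => if i ∈ s then P' else P) :=
            integral_mono (hmeasI P') (((hmeasI P).const_mul _).add (integrable_const _))
              fun z => h z j
        _ = (1 + a) * ∫ z, F z ∂(Measure.pi fun i => if i ∈ s then P' else P) + b := by
            rw [integral_add ((hmeasI P).const_mul _) (integrable_const _), integral_const_mul, e2]
            simp
        _ ≤ (1 + a) * ((1 + a) ^ s.card * (∫ z, F z ∂(Measure.pi fun _ => P) + s.card * b))
              + (1 + a) ^ (s.card + 1) * b := by
            gcongr
            exact le_mul_of_one_le_left hb (one_le_pow₀ (by linarith))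
        _ = _ := by push_cast; ring
  simpa using key Finset.univ

/-! ### Continuous functions on the unit interval -/

lemma integrable_of_continuous_unitInterval {g : unitInterval → ℝ} (hg : Continuous g) :
    Integrable g volume :=
  hg.integrable_of_hasCompactSupport (HasCompactSupport.of_compactSpace g)

lemma memLp_of_continuous_unitInterval {g : unitInterval → ℝ} (hg : Continuous g) (p : ℝ≥0∞) :
    MemLp g p volume := by
  obtain ⟨M, hM⟩ := hg.bounded_above_of_compact_support (HasCompactSupport.of_compactSpace g)
  exact MemLp.of_bound hg.aestronglyMeasurable M (ae_of_all _ hM)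

lemma integral_abs_le_of_support {g : unitInterval → ℝ} (hg : Continuous g) {c ρ B : ℝ} (hρ : 0 ≤ ρ)
    (hB : ∀ x, |g x| ≤ B) (hs : ∀ x, g x ≠ 0 → |(x : ℝ) - c| ≤ ρ) :
    ∫ x, |g x| ≤ 2 * ρ * B := by
  have hB0 : 0 ≤ B := (abs_nonneg _).trans (hB 0)
  set S : Set unitInterval := {x | |(x : ℝ) - c| ≤ ρ}
  have hSm : MeasurableSet S := by
    refine measurableSet_le ?_ measurable_const
    fun_prop
  have hS : volume S ≤ ENNReal.ofReal (2 * ρ) := by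
    rw [unitInterval.volume_apply]
    refine (measure_mono (t := Set.Icc (c - ρ) (c + ρ)) ?_).trans ?_
    · rintro _ ⟨x, hx, rfl⟩
      have := abs_le.1 (show |(x : ℝ) - c| ≤ ρ from hx)
      constructor <;> linarith
    · rw [Real.volume_Icc]
      exact le_of_eq (by congr 1; ring)
  calc ∫ x, |g x| ≤ ∫ x, S.indicator (fun _ => B) x := by
        refine integral_mono (integrable_of_continuous_unitInterval hg.abs)
          ((integrable_const B).indicator hSm) fun x => ?_
        by_cases hx : x ∈ S
        · simpa [Set.indicator_of_mem hx] using hB x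
        · have : g x = 0 := by
            by_contra h0
            exact hx (hs x h0)
          simp [Set.indicator_of_notMem hx, this]
    _ = (volume S).toReal * B := by
        rw [integral_indicator_const _ hSm]; simp [Measure.real]
    _ ≤ 2 * ρ * B := by
        gcongr
        exact ENNReal.toReal_le_of_le_ofReal (by positivity) hS

/-! ### Localization of the wavelets and synthesis of functions from their coefficients -/

lemma exists_common_bound (h : ℝ → ℝ) (hc : Continuous h) (hs : HasCompactSupport h) :
    ∃ M : ℝ, 0 ≤ M ∧ ∀ y, |h y| ≤ M ∧ (h y ≠ 0 → |y| ≤ M) := by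
  obtain ⟨M₁, h₁⟩ := hc.bounded_above_of_compact_support hs
  obtain ⟨M₂, h₂⟩ := hs.isCompact.isBounded.exists_norm_le
  refine ⟨max M₁ (max M₂ 0), by positivity, fun y => ⟨(h₁ y).trans (le_max_left _ _), fun hy => ?_⟩⟩
  exact (h₂ y (subset_tsupport _ hy)).trans ((le_max_left _ _).trans (le_max_right _ _))

/-- At most `2 M + 1` integer translates of a function supported in `[-M, M]` meet a given point. -/
lemma sum_abs_translates_le {g : ℝ → ℝ} {M : ℝ} (hM : 0 ≤ M)
    (hg : ∀ y, |g y| ≤ M ∧ (g y ≠ 0 → |y| ≤ M)) (n : ℕ) (y : ℝ) :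
    ∑ k ∈ Finset.range n, |g (y - k)| ≤ (2 * M + 1) * M := by
  classical
  set s := (Finset.range n).filter fun k : ℕ => |y - k| ≤ M
  have h1 : ∑ k ∈ Finset.range n, |g (y - k)| ≤ ∑ k ∈ s, M := by
    rw [Finset.sum_filter]
    refine Finset.sum_le_sum fun k _ => ?_
    split_ifs with hk
    · exact (hg _).1
    · have : g (y - k) = 0 := by
        by_contra h0
        exact hk ((hg _).2 h0)
      simp [this]
  have h2 : (s.card : ℝ) ≤ 2 * M + 1 := by
    have hsub : s.map Nat.castEmbedding ⊆ Finset.Icc ⌈y - M⌉ ⌊y + M⌋ := by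
      intro k hk
      rw [Finset.mem_map] at hk
      obtain ⟨k', hk', rfl⟩ := hk
      have := abs_le.1 (Finset.mem_filter.1 hk').2
      rw [Finset.mem_Icc, Int.ceil_le, Int.le_floor]
      simp only [Nat.castEmbedding_apply, Int.cast_natCast]
      constructor <;> linarith
    have hcard := Finset.card_le_card hsub
    rw [Finset.card_map, Int.card_Icc] at hcard
    have h3 : (⌊y + M⌋ : ℝ) ≤ y + M := Int.floor_le _
    have h4 : y - M ≤ (⌈y - M⌉ : ℝ) := Int.le_ceil _
    rcases le_or_gt 0 (⌊y + M⌋ + 1 - ⌈y - M⌉) with h5 | h5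
    · have h6 : ((⌊y + M⌋ + 1 - ⌈y - M⌉).toNat : ℝ) = (⌊y + M⌋ : ℝ) + 1 - ⌈y - M⌉ := by
        have := Int.toNat_of_nonneg h5
        exact_mod_cast this
      have : (s.card : ℝ) ≤ ((⌊y + M⌋ + 1 - ⌈y - M⌉).toNat : ℝ) := by exact_mod_cast hcard
      linarith
    · rw [Int.toNat_eq_zero.2 h5.le] at hcard
      have : s.card = 0 := by omega
      rw [this]; push_cast; positivity
  calc _ ≤ _ := h1
    _ = s.card * M := by rw [Finset.sum_const, nsmul_eq_mul]
    _ ≤ _ := by gcongr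

/-- A boundary-corrected family of dilates is localized: at each point the `2 e` boundary functions
and the boundedly many overlapping translates of the interior function contribute, and every member
has a support of length of the order `2 ^ (-l)`. -/
lemma boundaryDilate_localized (e : ℕ) (g : ℝ → ℝ) (gL gR : ℕ → ℝ → ℝ) (hg : Continuous g)
    (hgL : ∀ k, Continuous (gL k)) (hgR : ∀ k, Continuous (gR k)) (sg : HasCompactSupport g)
    (sgL : ∀ k, HasCompactSupport (gL k)) (sgR : ∀ k, HasCompactSupport (gR k)) :
    ∃ C : ℝ, 0 ≤ C ∧ ∀ l : ℕ,
      (∀ x, ∑ k ∈ Finset.range (2 ^ l), |boundaryDilate e g gL gR l k x| ≤ C * √(2 ^ l)) ∧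
      (∀ k < 2 ^ l, ∃ c : ℝ, ∀ x, boundaryDilate e g gL gR l k x ≠ 0 → |x - c| ≤ C / 2 ^ l) := by
  obtain ⟨M, hM, hgM⟩ := exists_common_bound g hg sg
  choose ML hML hgML using fun k => exists_common_bound (gL k) (hgL k) (sgL k)
  choose MR hMR hgMR using fun k => exists_common_bound (gR k) (hgR k) (sgR k)
  set B : ℝ := ∑ k ∈ Finset.range e, (ML k + MR k) with hB
  have hB0 : 0 ≤ B := Finset.sum_nonneg fun k _ => add_nonneg (hML k) (hMR k)
  have hBk : ∀ k < e, ML k ≤ B ∧ MR k ≤ B := by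
    intro k hk
    have := Finset.single_le_sum (f := fun k => ML k + MR k)
      (fun k _ => add_nonneg (hML k) (hMR k)) (Finset.mem_range.2 hk)
    constructor <;> linarith [hML k, hMR k]
  refine ⟨(2 * M + 1) * M + 2 * e * B + M + B, by positivity, fun l => ⟨fun x => ?_, ?_⟩⟩
  · have hpow : (2 : ℝ) ^ ((l : ℝ) / 2) = √(2 ^ l) := by
      rw [Real.sqrt_eq_rpow, ← Real.rpow_natCast, ← Real.rpow_mul (by norm_num)]
      congr 1; ring
    -- The two indicators bound the left and right boundary functions.
    have hterm : ∀ k ∈ Finset.range (2 ^ l), |boundaryDilate e g gL gR l k x| ≤ √(2 ^ l) *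
        ((if k < e then B else 0) + (if 2 ^ l ≤ k + e then B else 0) + |g (2 ^ l * x - k)|) := by
      intro k hk
      rw [Finset.mem_range] at hk
      rw [boundaryDilate, hpow, abs_mul, abs_of_nonneg (Real.sqrt_nonneg _)]
      refine mul_le_mul_of_nonneg_left ?_ (Real.sqrt_nonneg _)
      have hr0 : 0 ≤ (if 2 ^ l ≤ k + e then B else 0) := by split_ifs <;> simp [hB0]
      split_ifs with h1 h2 h3
      · have := (hgML k (2 ^ l * x)).1
        linarith [(hBk k h1).1, abs_nonneg (g (2 ^ l * x - k))]
      · have := (hgML k (2 ^ l * x)).1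
        linarith [(hBk k h1).1, abs_nonneg (g (2 ^ l * x - k))]
      · have := (hgMR (2 ^ l - 1 - k) (2 ^ l * (1 - x))).1
        linarith [(hBk (2 ^ l - 1 - k) (by omega)).2, abs_nonneg (g (2 ^ l * x - k))]
      · simp
    refine (Finset.sum_le_sum hterm).trans ?_
    rw [← Finset.mul_sum, Finset.sum_add_distrib, Finset.sum_add_distrib, mul_comm]
    refine mul_le_mul_of_nonneg_right ?_ (Real.sqrt_nonneg _)
    have s1 : ∑ k ∈ Finset.range (2 ^ l), (if k < e then B else 0) ≤ e * B := by
      rw [← Finset.sum_filter, Finset.sum_const, nsmul_eq_mul]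
      refine mul_le_mul_of_nonneg_right ?_ hB0
      have : ((Finset.range (2 ^ l)).filter fun k => k < e).card ≤ (Finset.range e).card :=
        Finset.card_le_card fun k hk => Finset.mem_range.2 (Finset.mem_filter.1 hk).2
      rw [Finset.card_range] at this
      exact_mod_cast this
    have s2 : ∑ k ∈ Finset.range (2 ^ l), (if 2 ^ l ≤ k + e then B else 0) ≤ e * B := by
      rw [← Finset.sum_filter, Finset.sum_const, nsmul_eq_mul]
      refine mul_le_mul_of_nonneg_right ?_ hB0
      have : ((Finset.range (2 ^ l)).filter fun k => 2 ^ l ≤ k + e).card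
          ≤ (Finset.Ico (2 ^ l - e) (2 ^ l)).card :=
        Finset.card_le_card fun k hk => by
          have := Finset.mem_filter.1 hk
          rw [Finset.mem_range] at this
          rw [Finset.mem_Ico]; omega
      rw [Nat.card_Ico] at this
      have : ((Finset.range (2 ^ l)).filter fun k => 2 ^ l ≤ k + e).card ≤ e := by omega
      exact_mod_cast this
    have s3 := sum_abs_translates_le hM hgM (2 ^ l) (2 ^ l * x)
    linarith
  · intro k hk
    have h2l : (0 : ℝ) < 2 ^ l := by positivity
    have haux : ∀ (u c : ℝ) (x : ℝ), |2 ^ l * x - 2 ^ l * c| ≤ u → u ≤ M + B →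
        |x - c| ≤ ((2 * M + 1) * M + 2 * e * B + M + B) / 2 ^ l := by
      intro u c x h1 h2
      have h3 : |x - c| * 2 ^ l = |2 ^ l * x - 2 ^ l * c| := by
        rw [← mul_sub, abs_mul, abs_of_pos h2l, mul_comm]
      rw [le_div_iff₀ h2l, h3]
      have : 0 ≤ (2 * M + 1) * M + 2 * e * B := by positivity
      linarith
    simp only [boundaryDilate]
    split_ifs with h1 h2
    · refine ⟨0, fun x hx => haux (ML k) 0 x ?_ (by linarith [(hBk k h1).1])⟩
      simpa using (hgML k _).2 (right_ne_zero_of_mul hx)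
    · refine ⟨1, fun x hx => haux (MR (2 ^ l - 1 - k)) 1 x ?_
        (by linarith [(hBk (2 ^ l - 1 - k) (by omega)).2])⟩
      rw [abs_sub_comm, ← mul_sub]
      exact (hgMR _ _).2 (right_ne_zero_of_mul hx)
    · refine ⟨k / 2 ^ l, fun x hx => haux M _ x ?_ (by linarith)⟩
      rw [mul_div_cancel₀ _ h2l.ne']
      exact (hgM _).2 (right_ne_zero_of_mul hx)

namespace WaveletSystem

/-- The dyadic frequency `2 ^ l` of level `l = l₀ + i`. -/
def scale (W : WaveletSystem) (i : ℕ) : ℝ := 2 ^ (W.l₀ + i)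

lemma scale_pos (W : WaveletSystem) (i : ℕ) : 0 < W.scale i := by unfold scale; positivity

lemma one_le_scale (W : WaveletSystem) (i : ℕ) : 1 ≤ W.scale i := by
  unfold scale; exact one_le_pow₀ (by norm_num)

/-- A common constant for the localization of all basis functions in space: at each point the
functions of level `i` add up to at most `C √(2 ^ l)`, and each of them is supported in an interval
of radius `C / 2 ^ l`. -/
structure Localized (W : WaveletSystem) (C : ℝ) : Prop where
  one_le : 1 ≤ C
  sum_le : ∀ i x, ∑ k : Fin (W.count i), |W.fn i k x| ≤ C * √(W.scale i)
  center : ∀ i (k : Fin (W.count i)), ∃ c : ℝ, ∀ x, W.fn i k x ≠ 0 → |x - c| ≤ C / W.scale i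

lemma IsRegularBasis.exists_localized {W : WaveletSystem} {A : ℕ} (hW : W.IsRegularBasis A) :
    ∃ C, W.Localized C := by
  obtain ⟨C₁, h₁, H₁⟩ := boundaryDilate_localized W.e W.φ W.φL W.φR hW.continuous_φ
    hW.continuous_φL hW.continuous_φR hW.compact_φ hW.compact_φL hW.compact_φR
  obtain ⟨C₂, h₂, H₂⟩ := boundaryDilate_localized W.e W.ψ W.ψL W.ψR hW.continuous_ψ
    hW.continuous_ψL hW.continuous_ψR hW.compact_ψ hW.compact_ψL hW.compact_ψR
  refine ⟨2 * C₁ + C₂ + 1, by linarith, fun i x => ?_, fun i k => ?_⟩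
  -- The coarsest level consists of father functions of the next finer resolution; the factor `2`
  -- accounts for the ratio `√2` of their heights.
  · rcases Nat.eq_zero_or_pos i with rfl | hi
    · have h := (H₁ (W.l₀ + 1)).1 x
      rw [← Finset.sum_range fun k => |W.fn 0 k x|]
      simp only [fn, count, if_true]
      refine h.trans ?_
      have h3 : √((2 : ℝ) ^ (W.l₀ + 1)) ≤ 2 * √(W.scale 0) := by
        rw [scale, add_zero, pow_succ, Real.sqrt_le_left (by positivity), mul_pow,
          Real.sq_sqrt (by positivity)]
        have : (0 : ℝ) ≤ 2 ^ W.l₀ := by positivity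
        nlinarith
      calc C₁ * √((2 : ℝ) ^ (W.l₀ + 1)) ≤ C₁ * (2 * √(W.scale 0)) := by gcongr
        _ ≤ _ := by
          have := Real.sqrt_nonneg (W.scale 0)
          nlinarith
    · have h := (H₂ (W.l₀ + i)).1 x
      rw [← Finset.sum_range fun k => |W.fn i k x|]
      simp only [fn, count, hi.ne', if_false]
      refine h.trans ?_
      rw [scale]
      gcongr
      linarith
  · rcases Nat.eq_zero_or_pos i with rfl | hi
    · have hk := k.2
      simp only [count, if_true] at hk
      obtain ⟨c, hc⟩ := (H₁ (W.l₀ + 1)).2 k hk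
      refine ⟨c, fun x hx => ?_⟩
      simp only [fn, if_true] at hx
      refine (hc x hx).trans ?_
      rw [scale, add_zero]
      gcongr
      · linarith
      · norm_num
      · omega
    · have hk := k.2
      simp only [count, hi.ne', if_false] at hk
      obtain ⟨c, hc⟩ := (H₂ (W.l₀ + i)).2 k hk
      refine ⟨c, fun x hx => ?_⟩
      simp only [fn, hi.ne', if_false] at hx
      refine (hc x hx).trans ?_
      rw [scale]
      gcongr
      linarith

lemma IsRegularBasis.continuous_fn {W : WaveletSystem} {A : ℕ} (hW : W.IsRegularBasis A)
    (i k : ℕ) : Continuous (W.fn i k) := by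
  have hb : ∀ (g : ℝ → ℝ) (gL gR : ℕ → ℝ → ℝ) (l : ℕ), Continuous g → (∀ k, Continuous (gL k)) →
      (∀ k, Continuous (gR k)) → Continuous (boundaryDilate W.e g gL gR l k) := by
    intro g gL gR l h1 h2 h3
    unfold boundaryDilate
    split_ifs
    · exact continuous_const.mul ((h2 k).comp (by fun_prop))
    · exact continuous_const.mul ((h3 _).comp (by fun_prop))
    · exact continuous_const.mul (h1.comp (by fun_prop))
  by_cases hi : i = 0
  · have : W.fn i k = boundaryDilate W.e W.φ W.φL W.φR (W.l₀ + 1) k := by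
      funext x; simp [fn, hi]
    rw [this]
    exact hb _ _ _ _ hW.continuous_φ hW.continuous_φL hW.continuous_φR
  · have : W.fn i k = boundaryDilate W.e W.ψ W.ψL W.ψR (W.l₀ + i) k := by
      funext x; simp [fn, hi]
    rw [this]
    exact hb _ _ _ _ hW.continuous_ψ hW.continuous_ψL hW.continuous_ψR

variable {W : WaveletSystem} {A : ℕ} {C : ℝ}

lemma Localized.abs_fn_le (h : W.Localized C) (i : ℕ) (k : Fin (W.count i)) (x : ℝ) :
    |W.fn i k x| ≤ C * √(W.scale i) :=
  (Finset.single_le_sum (f := fun k : Fin (W.count i) => |W.fn i k x|)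
    (fun _ _ => abs_nonneg _) (Finset.mem_univ k)).trans (h.sum_le i x)

lemma Localized.sum_sq_le (h : W.Localized C) (i : ℕ) (x : ℝ) :
    ∑ k : Fin (W.count i), W.fn i k x ^ 2 ≤ C ^ 2 * W.scale i := by
  have h0 : 0 ≤ C := zero_le_one.trans h.one_le
  calc ∑ k : Fin (W.count i), W.fn i k x ^ 2
      ≤ ∑ k : Fin (W.count i), (C * √(W.scale i)) * |W.fn i k x| := by
        refine Finset.sum_le_sum fun k _ => ?_
        rw [← sq_abs, sq]
        exact mul_le_mul_of_nonneg_right (h.abs_fn_le i k x) (abs_nonneg _)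
    _ ≤ (C * √(W.scale i)) * (C * √(W.scale i)) := by
        rw [← Finset.mul_sum]
        exact mul_le_mul_of_nonneg_left (h.sum_le i x) (by positivity)
    _ = C ^ 2 * W.scale i := by
        rw [mul_mul_mul_comm, Real.mul_self_sqrt (W.scale_pos i).le, sq]

end WaveletSystem

namespace WaveletSystem

variable {W : WaveletSystem} {A : ℕ} {C : ℝ}

lemma Localized.integral_abs_fn_le (hW : W.IsRegularBasis A) (h : W.Localized C) (i : ℕ)
    (k : Fin (W.count i)) : ∫ x : unitInterval, |W.fn i k x| ≤ 2 * C ^ 2 / √(W.scale i) := by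
  have h0 : 0 ≤ C := zero_le_one.trans h.one_le
  have hs := W.scale_pos i
  obtain ⟨c, hc⟩ := h.center i k
  have := integral_abs_le_of_support (g := fun x : unitInterval => W.fn i k x)
    ((hW.continuous_fn i k).comp continuous_subtype_val) (c := c) (ρ := C / W.scale i)
    (B := C * √(W.scale i)) (by positivity) (fun x => h.abs_fn_le i k x) (fun x hx => hc x hx)
  refine this.trans (le_of_eq ?_)
  have h2 : W.scale i = √(W.scale i) * √(W.scale i) := (Real.mul_self_sqrt hs.le).symm
  have h3 : √(W.scale i) ≠ 0 := (Real.sqrt_pos.2 hs).ne'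
  rw [h2, Real.sqrt_mul_self (Real.sqrt_nonneg _)]
  field_simp

/-- The linear combination of the basis functions of the levels in `s` with coefficients `a`. -/
def combo (W : WaveletSystem) (s : Finset ℕ) (a : ℕ → ℕ → ℝ) (x : ℝ) : ℝ :=
  ∑ i ∈ s, ∑ k : Fin (W.count i), a i k * W.fn i k x

lemma IsRegularBasis.continuous_combo (hW : W.IsRegularBasis A) (s : Finset ℕ) (a : ℕ → ℕ → ℝ) :
    Continuous (W.combo s a) := by
  unfold combo
  exact continuous_finsetSum _ fun i _ => continuous_finsetSum _ fun k _ =>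
    continuous_const.mul (hW.continuous_fn i k)

lemma IsRegularBasis.memLp_fn (hW : W.IsRegularBasis A) (i k : ℕ) (p : ℝ≥0∞) :
    MemLp (fun x : unitInterval => W.fn i k x) p volume :=
  memLp_of_continuous_unitInterval ((hW.continuous_fn i k).comp continuous_subtype_val) p

lemma IsRegularBasis.memLp_combo (hW : W.IsRegularBasis A) (s : Finset ℕ) (a : ℕ → ℕ → ℝ)
    (p : ℝ≥0∞) : MemLp (fun x : unitInterval => W.combo s a x) p volume :=
  memLp_of_continuous_unitInterval ((hW.continuous_combo s a).comp continuous_subtype_val) p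

lemma IsRegularBasis.integrable_mul_fn (hW : W.IsRegularBasis A) {f : unitInterval → ℝ}
    (hf : MemLp f 2 volume) (i k : ℕ) :
    Integrable (fun x : unitInterval => f x * W.fn i k x) volume :=
  hf.integrable_mul (hW.memLp_fn i k 2)

lemma IsRegularBasis.integral_mul_combo (hW : W.IsRegularBasis A) {f : unitInterval → ℝ}
    (hf : MemLp f 2 volume) (s : Finset ℕ) (a : ℕ → ℕ → ℝ) :
    ∫ x : unitInterval, f x * W.combo s a x
      = ∑ i ∈ s, ∑ k : Fin (W.count i), a i k * W.coeff f i k := by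
  have h1 : ∀ x : unitInterval, f x * W.combo s a x
      = ∑ i ∈ s, ∑ k : Fin (W.count i), a i k * (f x * W.fn i k x) := fun x => by
    simp only [combo, Finset.mul_sum]
    refine Finset.sum_congr rfl fun i _ => Finset.sum_congr rfl fun k _ => ?_
    ring
  simp_rw [h1]
  have h2 : ∀ i (k : Fin (W.count i)), Integrable
      (fun x : unitInterval => a i k * (f x * W.fn i k x)) volume := fun i k =>
    (hW.integrable_mul_fn hf i k).const_mul _
  rw [integral_finsetSum _ fun i _ => integrable_finsetSum _ fun k _ => h2 i k]
  refine Finset.sum_congr rfl fun i _ => ?_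
  rw [integral_finsetSum _ fun k _ => h2 i k]
  refine Finset.sum_congr rfl fun k _ => ?_
  rw [integral_const_mul, coeff]

lemma IsRegularBasis.coeff_combo (hW : W.IsRegularBasis A) (s : Finset ℕ) (a : ℕ → ℕ → ℝ)
    (i : ℕ) (k : Fin (W.count i)) :
    W.coeff (fun x => W.combo s a x) i k = if i ∈ s then a i k else 0 := by
  have h := hW.integral_mul_combo (hW.memLp_fn i k 2) s a
  rw [coeff]
  simp_rw [mul_comm (W.combo s a _)]
  rw [h]
  have h2 : ∀ i' ∈ s, ∑ k' : Fin (W.count i'), a i' k' * W.coeff (fun x => W.fn i k x) i' k'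
      = if i' = i then a i k else 0 := by
    intro i' _
    by_cases hi : i' = i
    · subst hi
      rw [Finset.sum_eq_single k]
      · rw [coeff, hW.orthonormal _ _ _ _ k.2 k.2]; simp
      · intro k' _ hk'
        rw [coeff, hW.orthonormal _ _ _ _ k.2 k'.2]
        simp [Fin.val_ne_of_ne hk'.symm]
      · simp
    · rw [if_neg hi]
      refine Finset.sum_eq_zero fun k' _ => ?_
      rw [coeff, hW.orthonormal _ _ _ _ k.2 k'.2]
      simp [Ne.symm hi]
  rw [Finset.sum_congr rfl h2, Finset.sum_ite_eq' s i]

lemma IsRegularBasis.integral_combo_sq (hW : W.IsRegularBasis A) (s : Finset ℕ)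
    (a : ℕ → ℕ → ℝ) :
    ∫ x : unitInterval, W.combo s a x ^ 2 = ∑ i ∈ s, ∑ k : Fin (W.count i), a i k ^ 2 := by
  simp_rw [sq (W.combo s a _)]
  rw [hW.integral_mul_combo (hW.memLp_combo s a 2)]
  refine Finset.sum_congr rfl fun i hi => Finset.sum_congr rfl fun k _ => ?_
  rw [hW.coeff_combo, if_pos hi, sq]

lemma IsRegularBasis.bessel (hW : W.IsRegularBasis A) {f : unitInterval → ℝ}
    (hf : MemLp f 2 volume) (s : Finset ℕ) :
    ∑ i ∈ s, ∑ k : Fin (W.count i), W.coeff f i k ^ 2 ≤ ∫ x, f x ^ 2 := by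
  have h0 : 0 ≤ ∫ x : unitInterval, (f x - W.combo s (W.coeff f) x) ^ 2 :=
    integral_nonneg fun x => sq_nonneg _
  have hc := hW.memLp_combo s (W.coeff f) 2
  have h1 : ∫ x : unitInterval, (f x - W.combo s (W.coeff f) x) ^ 2
      = ∫ x : unitInterval, f x ^ 2 - 2 * (f x * W.combo s (W.coeff f) x)
          + W.combo s (W.coeff f) x ^ 2 := by
    congr 1; funext x; ring
  have i1 : Integrable (fun x => f x ^ 2) volume := hf.integrable_sq
  have i2 : Integrable (fun x : unitInterval => 2 * (f x * W.combo s (W.coeff f) x)) volume :=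
    (hf.integrable_mul hc).const_mul 2
  have i3 : Integrable (fun x : unitInterval =>
      f x ^ 2 - 2 * (f x * W.combo s (W.coeff f) x)) volume := i1.sub i2
  rw [h1, integral_add i3 hc.integrable_sq, integral_sub i1 i2, integral_const_mul,
    hW.integral_mul_combo hf, hW.integral_combo_sq] at h0
  simp only [← sq] at h0
  linarith

/-- A square integrable function with sufficiently small wavelet coefficients has a continuous
version, to which its wavelet series converges at every point. -/
lemma IsRegularBasis.synthesis (hW : W.IsRegularBasis A) (hC : W.Localized C)
    {f : unitInterval → ℝ} (hf : MemLp f 2 volume) {c : ℕ → ℝ}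
    (hc : ∀ i (k : Fin (W.count i)), |W.coeff f i k| ≤ c i)
    (hs : Summable fun i => c i * √(W.scale i)) :
    ∃ g : unitInterval → ℝ, Continuous g ∧ f =ᵐ[volume] g ∧
      (∀ x : unitInterval,
        HasSum (fun i => ∑ k : Fin (W.count i), W.coeff f i k * W.fn i k x) (g x)) := by
  have h0 : 0 ≤ C := zero_le_one.trans hC.one_le
  set S : ℕ → unitInterval → ℝ := fun i x => ∑ k : Fin (W.count i), W.coeff f i k * W.fn i k x
    with hS
  have hSc : ∀ i, Continuous (S i) := fun i => continuous_finsetSum _ fun k _ =>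
    continuous_const.mul ((hW.continuous_fn i k).comp continuous_subtype_val)
  have hSb : ∀ i x, ‖S i x‖ ≤ C * (c i * √(W.scale i)) := fun i x => by
    calc ‖S i x‖ ≤ ∑ k : Fin (W.count i), |W.coeff f i k * W.fn i k x| :=
          Finset.abs_sum_le_sum_abs _ _
      _ ≤ ∑ k : Fin (W.count i), c i * |W.fn i k x| := Finset.sum_le_sum fun k _ => by
          rw [abs_mul]; exact mul_le_mul_of_nonneg_right (hc i k) (abs_nonneg _)
      _ ≤ c i * (C * √(W.scale i)) := by
          rw [← Finset.mul_sum]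
          refine mul_le_mul_of_nonneg_left (hC.sum_le i x) ?_
          have : 0 < W.count i := by unfold count; split_ifs <;> positivity
          exact (abs_nonneg _).trans (hc i ⟨0, this⟩)
      _ = _ := by ring
  have hs' : Summable fun i => C * (c i * √(W.scale i)) := hs.mul_left C
  set g : unitInterval → ℝ := fun x => ∑' i, S i x with hg
  have hgc : Continuous g := continuous_tsum hSc hs' hSb
  have hsum : ∀ x, HasSum (fun i => S i x) (g x) := fun x =>
    (Summable.of_norm_bounded hs' fun i => hSb i x).hasSum
  refine ⟨g, hgc, ?_, hsum⟩
  have hgm := memLp_of_continuous_unitInterval hgc 2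
  -- By uniform convergence the coefficients of the sum of the series are those of `f`; completeness
  -- of the basis then identifies the two functions.
  have hcoef : ∀ i (k : Fin (W.count i)), W.coeff g i k = W.coeff f i k := by
    intro i k
    have hb : ∀ x : unitInterval, |W.fn i k x| ≤ C * √(W.scale i) := fun x => hC.abs_fn_le i k x
    have hint : ∀ i', Integrable (fun x : unitInterval => S i' x * W.fn i k x) volume := fun i' =>
      integrable_of_continuous_unitInterval
        ((hSc i').mul ((hW.continuous_fn i k).comp continuous_subtype_val))
    have h1 := hasSum_integral_of_summable_integral_norm (μ := (volume : Measure unitInterval))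
      (F := fun i' (x : unitInterval) => S i' x * W.fn i k x) hint (by
        refine Summable.of_nonneg_of_le (fun i' => integral_nonneg fun x => norm_nonneg _)
          (fun i' => ?_) (hs'.mul_right (C * √(W.scale i)))
        refine (integral_mono (g := fun _ => C * (c i' * √(W.scale i')) * (C * √(W.scale i)))
          (hint i').norm (integrable_const _) fun x => ?_).trans (by simp)
        simp only [norm_mul]
        exact mul_le_mul (hSb i' x) (hb x) (norm_nonneg _) ((norm_nonneg _).trans (hSb i' x)))
    have h2 : ∀ i', ∫ x : unitInterval, S i' x * W.fn i k x
        = if i' = i then W.coeff f i k else 0 := by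
      intro i'
      have h3 := hW.coeff_combo {i'} (W.coeff f) i k
      simp only [coeff, combo, Finset.sum_singleton, Finset.mem_singleton] at h3
      simp only [hS, coeff, h3, eq_comm]
    simp_rw [h2] at h1
    have h4 := h1.unique (hasSum_ite_eq i (W.coeff f i k))
    rw [coeff, ← h4]
    refine integral_congr_ae (ae_of_all _ fun x => ?_)
    simp only [hg]
    rw [tsum_mul_right]
  have h5 : (f - g) =ᵐ[volume] 0 := by
    refine hW.complete (f - g) (hf.sub hgm) fun i k hk => ?_
    have := hcoef i ⟨k, hk⟩
    simp only [coeff] at this ⊢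
    simp only [Pi.sub_apply, sub_mul]
    rw [integral_sub (hW.integrable_mul_fn hf i k) (hW.integrable_mul_fn hgm i k), this, sub_self]
  filter_upwards [h5] with x hx
  simpa [sub_eq_zero] using hx

lemma coeff_congr_ae {f g : unitInterval → ℝ} (h : f =ᵐ[volume] g) (i k : ℕ) :
    W.coeff f i k = W.coeff g i k := by
  refine integral_congr_ae ?_
  filter_upwards [h] with x hx
  rw [hx]

/-- The tail of a uniformly convergent wavelet series is controlled in `L²` by its coefficients. -/
lemma IsRegularBasis.integral_tail_sq_le (hW : W.IsRegularBasis A) (hC : W.Localized C)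
    {f g : unitInterval → ℝ} {c : ℕ → ℝ}
    (hc : ∀ i (k : Fin (W.count i)), |W.coeff f i k| ≤ c i)
    (hs : Summable fun i => c i * √(W.scale i))
    (hsum : ∀ x : unitInterval,
      HasSum (fun i => ∑ k : Fin (W.count i), W.coeff f i k * W.fn i k x) (g x))
    (J : ℕ) {B : ℝ}
    (hB : ∀ J', ∑ i ∈ Finset.Ico J J', ∑ k : Fin (W.count i), W.coeff f i k ^ 2 ≤ B) :
    ∫ x : unitInterval, (g x - W.combo (Finset.range J) (W.coeff f) x) ^ 2 ≤ B := by
  have h0 : 0 ≤ C := zero_le_one.trans hC.one_le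
  have hlim : Filter.Tendsto (fun J' => ∫ x : unitInterval,
      W.combo (Finset.Ico J J') (W.coeff f) x ^ 2) Filter.atTop
      (nhds (∫ x : unitInterval, (g x - W.combo (Finset.range J) (W.coeff f) x) ^ 2)) := by
    refine tendsto_integral_of_dominated_convergence
      (fun _ => (C * ∑' i, c i * √(W.scale i)) ^ 2) (fun J' => ?_) (integrable_const _)
      (fun J' => ae_of_all _ fun x => ?_) (ae_of_all _ fun x => ?_)
    · exact (((hW.continuous_combo _ _).comp continuous_subtype_val).pow 2).aestronglyMeasurable
    · rw [norm_pow]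
      refine pow_le_pow_left₀ (norm_nonneg _) ?_ 2
      have hci : ∀ i, 0 ≤ c i := fun i => by
        have : 0 < W.count i := by unfold count; split_ifs <;> positivity
        exact (abs_nonneg _).trans (hc i ⟨0, this⟩)
      calc ‖W.combo (Finset.Ico J J') (W.coeff f) x‖
          ≤ ∑ i ∈ Finset.Ico J J', ∑ k : Fin (W.count i), |W.coeff f i k * W.fn i k x| :=
            (Finset.abs_sum_le_sum_abs _ _).trans
              (Finset.sum_le_sum fun i _ => Finset.abs_sum_le_sum_abs _ _)
        _ ≤ ∑ i ∈ Finset.Ico J J', C * (c i * √(W.scale i)) := by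
            refine Finset.sum_le_sum fun i _ => ?_
            calc _ ≤ ∑ k : Fin (W.count i), c i * |W.fn i k x| := Finset.sum_le_sum fun k _ => by
                  rw [abs_mul]; exact mul_le_mul_of_nonneg_right (hc i k) (abs_nonneg _)
              _ ≤ c i * (C * √(W.scale i)) := by
                  rw [← Finset.mul_sum]
                  exact mul_le_mul_of_nonneg_left (hC.sum_le i x) (hci i)
              _ = _ := by ring
        _ ≤ C * ∑' i, c i * √(W.scale i) := by
            rw [← Finset.mul_sum]
            exact mul_le_mul_of_nonneg_left
              (hs.sum_le_tsum _ fun i _ => mul_nonneg (hci i) (Real.sqrt_nonneg _)) h0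
    · have h1 := ((hsum x).tendsto_sum_nat).sub_const (W.combo (Finset.range J) (W.coeff f) x)
      have h2 : Filter.Tendsto (fun J' => W.combo (Finset.Ico J J') (W.coeff f) x) Filter.atTop
          (nhds (g x - W.combo (Finset.range J) (W.coeff f) x)) := by
        refine h1.congr' ?_
        filter_upwards [Filter.eventually_ge_atTop J] with J' hJ'
        rw [combo, combo, Finset.sum_Ico_eq_sub _ hJ']
      exact h2.pow 2
  refine le_of_tendsto' hlim fun J' => ?_
  rw [hW.integral_combo_sq]
  exact hB J'

end WaveletSystem

/-! ### Besov balls in terms of the wavelet coefficients -/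

lemma le_ellNorm {ι : Type} {p : ℝ≥0∞} (hp : 1 ≤ p) (a : ι → ℝ≥0∞) (i : ι) :
    a i ≤ ellNorm p a := by
  unfold ellNorm
  split_ifs with h
  · exact le_iSup a i
  · have hp0 : 0 < p.toReal := ENNReal.toReal_pos (by positivity) h
    calc a i = (a i ^ p.toReal) ^ (1 / p.toReal) := by
          rw [← ENNReal.rpow_mul, mul_one_div_cancel hp0.ne', ENNReal.rpow_one]
      _ ≤ _ := ENNReal.rpow_le_rpow (ENNReal.le_tsum i) (by positivity)

lemma ellNorm_le_tsum {ι : Type} {p : ℝ≥0∞} (hp : 1 ≤ p) (a : ι → ℝ≥0∞) :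
    ellNorm p a ≤ ∑' i, a i := by
  unfold ellNorm
  split_ifs with h
  · exact iSup_le fun i => ENNReal.le_tsum i
  · have hp1 : 1 ≤ p.toReal := by
      rw [← ENNReal.toReal_one]; exact ENNReal.toReal_mono h hp
    have hp0 : 0 < p.toReal := by linarith
    have hmul : ∀ x : ℝ≥0∞, x ^ p.toReal = x * x ^ (p.toReal - 1) := fun x => by
      conv_rhs => rw [← ENNReal.rpow_one x, ← ENNReal.rpow_mul, one_mul]
      rw [← ENNReal.rpow_add_of_nonneg _ _ zero_le_one (by linarith)]
      congr 1; ring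
    rw [one_div, ENNReal.rpow_inv_le_iff hp0, hmul, ← ENNReal.tsum_mul_right]
    refine ENNReal.tsum_le_tsum fun i => ?_
    rw [hmul]
    gcongr
    exact ENNReal.le_tsum i

lemma one_div_toReal_eq {p : ℝ≥0∞} : 1 / p.toReal = (p⁻¹).toReal := by
  rw [ENNReal.toReal_inv, one_div]

lemma ellNorm_le_card_mul {ι : Type} [Fintype ι] {p : ℝ≥0∞} (hp : 1 ≤ p) (a : ι → ℝ≥0∞)
    {B : ℝ≥0∞} (hB : ∀ i, a i ≤ B) :
    ellNorm p a ≤ (Fintype.card ι : ℝ≥0∞) ^ (p⁻¹).toReal * B := by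
  unfold ellNorm
  split_ifs with h
  · subst h
    simpa using hB
  · have hp0 : 0 < p.toReal := ENNReal.toReal_pos (by positivity) h
    rw [← one_div_toReal_eq, tsum_fintype]
    calc (∑ i, a i ^ p.toReal) ^ (1 / p.toReal)
        ≤ (∑ _i : ι, B ^ p.toReal) ^ (1 / p.toReal) := by
          gcongr with i _
          exact hB i
      _ = _ := by
          rw [Finset.sum_const, nsmul_eq_mul, ENNReal.mul_rpow_of_nonneg _ _ (by positivity),
            ← ENNReal.rpow_mul, mul_one_div_cancel hp0.ne', ENNReal.rpow_one, Finset.card_univ]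

/-- Hölder's inequality between `ℓ²` and `ℓ^p`, for `p ≥ 2`. -/
lemma sum_sq_le_ellNorm {ι : Type} [Fintype ι] {p : ℝ≥0∞} (hp : 2 ≤ p) (a : ι → ℝ≥0∞) :
    ∑ i, a i ^ 2 ≤ (Fintype.card ι : ℝ≥0∞) ^ (1 - 2 * (p⁻¹).toReal) * ellNorm p a ^ 2 := by
  by_cases h : p = ∞
  · subst h
    simp only [ENNReal.inv_top, ENNReal.toReal_zero, mul_zero, sub_zero, ENNReal.rpow_one]
    calc ∑ i, a i ^ 2 ≤ ∑ _i : ι, ellNorm ∞ a ^ 2 := by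
          gcongr with i _
          exact le_ellNorm (by simp) a i
      _ = _ := by rw [Finset.sum_const, nsmul_eq_mul, Finset.card_univ]
  · have hp2 : 2 ≤ p.toReal := by
      have := ENNReal.toReal_mono h hp
      simpa using this
    set r : ℝ := p.toReal / 2 with hr
    have hr1 : 1 ≤ r := by rw [hr]; linarith
    have hr0 : 0 < r := by linarith
    have hpm := ENNReal.rpow_sum_le_const_mul_sum_rpow (s := Finset.univ)
      (f := fun i => a i ^ 2) hr1
    have hpow : ∀ i, (a i ^ 2) ^ r = a i ^ p.toReal := fun i => by
      rw [← ENNReal.rpow_natCast, ← ENNReal.rpow_mul]; congr 1; rw [hr]; push_cast; ring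
    simp only [hpow, Finset.card_univ] at hpm
    rw [← ENNReal.le_rpow_inv_iff hr0, ENNReal.mul_rpow_of_nonneg _ _ (by positivity),
      ← ENNReal.rpow_mul] at hpm
    refine hpm.trans (le_of_eq ?_)
    rw [ellNorm, if_neg h, tsum_fintype, ← one_div_toReal_eq]
    congr 1
    · congr 1
      rw [hr]; field_simp
    · rw [← ENNReal.rpow_natCast, ← ENNReal.rpow_mul]
      congr 1; rw [hr]; push_cast; field_simp

namespace WaveletSystem

variable {W : WaveletSystem} {A : ℕ} {C : ℝ}

lemma scale_add (W : WaveletSystem) (i J : ℕ) : W.scale (i + J) = W.scale J * 2 ^ i := by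
  unfold scale; ring

lemma hasSum_scale_rpow_neg (W : WaveletSystem) {β : ℝ} (hβ : 0 < β) (J : ℕ) :
    HasSum (fun i => W.scale (i + J) ^ (-β)) (W.scale J ^ (-β) * (1 - (2 : ℝ) ^ (-β))⁻¹) := by
  have h1 : (2 : ℝ) ^ (-β) < 1 := Real.rpow_lt_one_of_one_lt_of_neg (by norm_num) (by linarith)
  have h2 := (hasSum_geometric_of_lt_one (by positivity) h1).mul_left (W.scale J ^ (-β))
  have h3 : (fun i => W.scale (i + J) ^ (-β))
      = fun i => W.scale J ^ (-β) * ((2 : ℝ) ^ (-β)) ^ i := by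
    funext i
    rw [W.scale_add, Real.mul_rpow (W.scale_pos J).le (by positivity), ← Real.rpow_natCast,
      ← Real.rpow_mul (by norm_num), mul_comm (i : ℝ), Real.rpow_mul (by norm_num),
      Real.rpow_natCast]
  rwa [h3]

lemma count_le (W : WaveletSystem) (i : ℕ) : (W.count i : ℝ) ≤ 2 * W.scale i := by
  unfold count scale
  split_ifs with h
  · subst h; push_cast; rw [add_zero, pow_succ]; linarith
  · push_cast
    have : (0 : ℝ) < 2 ^ (W.l₀ + i) := by positivity
    linarith

lemma two_rpow_eq_scale (W : WaveletSystem) (i : ℕ) (s : ℝ) :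
    (2 : ℝ) ^ (((W.l₀ + i : ℕ) : ℝ) * s) = W.scale i ^ s := by
  rw [scale, Real.rpow_mul (by norm_num), Real.rpow_natCast]

end WaveletSystem

section besov

variable {W : WaveletSystem} {A : ℕ} {C : ℝ} {α R : ℝ} {p q : ℝ≥0∞}

lemma toReal_inv_le_half (hp : 2 ≤ p) : (p⁻¹).toReal ≤ 1 / 2 := by
  have h : p⁻¹ ≤ 2⁻¹ := ENNReal.inv_le_inv.2 hp
  have := ENNReal.toReal_mono (by simp) h
  simpa using this

lemma ellNorm_level_le_of_mem (hq : 1 ≤ q) {f : unitInterval → ℝ} (hf : f ∈ besovBall W α p q R)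
    (i : ℕ) : ellNorm p (fun k : Fin (W.count i) => ‖W.coeff f i k‖ₑ)
      ≤ ENNReal.ofReal (R * W.scale i ^ (-(α + 1 / 2 - (p⁻¹).toReal))) := by
  have hs := W.scale_pos i
  have h := (le_ellNorm hq (fun i : ℕ =>
    ENNReal.ofReal ((2 : ℝ) ^ (((W.l₀ + i : ℕ) : ℝ) * (α + 1 / 2 - (p⁻¹).toReal))) *
      ellNorm p fun k : Fin (W.count i) => ‖W.coeff f i k‖ₑ) i).trans hf.2
  simp only [W.two_rpow_eq_scale] at h
  set s := α + 1 / 2 - (p⁻¹).toReal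
  have hpos : 0 < W.scale i ^ s := Real.rpow_pos_of_pos hs _
  have h0 : ENNReal.ofReal (W.scale i ^ s) ≠ 0 := (ENNReal.ofReal_pos.2 hpos).ne'
  rw [mul_comm, ← ENNReal.le_div_iff_mul_le (Or.inl h0) (Or.inl ENNReal.ofReal_ne_top),
    ← ENNReal.ofReal_div_of_pos hpos] at h
  rwa [Real.rpow_neg hs.le, ← div_eq_mul_inv]

lemma abs_coeff_le_of_mem (hR : 0 < R) (hp : 1 ≤ p) (hq : 1 ≤ q) {f : unitInterval → ℝ}
    (hf : f ∈ besovBall W α p q R) (i : ℕ) (k : Fin (W.count i)) :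
    |W.coeff f i k| ≤ R * W.scale i ^ (-(α + 1 / 2 - (p⁻¹).toReal)) := by
  have h := (le_ellNorm hp (fun k : Fin (W.count i) => ‖W.coeff f i k‖ₑ) k).trans
    (ellNorm_level_le_of_mem hq hf i)
  rw [← ofReal_norm, Real.norm_eq_abs] at h
  exact (ENNReal.ofReal_le_ofReal_iff
    (mul_nonneg hR.le (Real.rpow_nonneg (W.scale_pos i).le _))).1 h

/-- Since `p ≥ 2`, the energy of a function in the Besov ball at level `l` is at most of order
`2 ^ (- 2 l α)`. -/
lemma sum_coeff_sq_le_of_mem (hR : 0 < R) (hp : 2 ≤ p) (hq : 1 ≤ q) {f : unitInterval → ℝ}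
    (hf : f ∈ besovBall W α p q R) (i : ℕ) :
    ∑ k : Fin (W.count i), W.coeff f i k ^ 2 ≤ 2 * R ^ 2 * W.scale i ^ (-(2 * α)) := by
  have hs := W.scale_pos i
  have hp' := toReal_inv_le_half hp
  have hp0 : 0 ≤ (p⁻¹).toReal := ENNReal.toReal_nonneg
  set u := (p⁻¹).toReal with hu
  set B : ℝ := R * W.scale i ^ (-(α + 1 / 2 - u)) with hB
  have hB0 : 0 ≤ B := mul_nonneg hR.le (Real.rpow_nonneg hs.le _)
  have h1 := (sum_sq_le_ellNorm hp fun k : Fin (W.count i) => ‖W.coeff f i k‖ₑ)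
  have h2 : ∑ k : Fin (W.count i), ‖W.coeff f i k‖ₑ ^ 2
      = ENNReal.ofReal (∑ k : Fin (W.count i), W.coeff f i k ^ 2) := by
    rw [ENNReal.ofReal_sum_of_nonneg fun _ _ => sq_nonneg _]
    refine Finset.sum_congr rfl fun k _ => ?_
    rw [← ofReal_norm, ← ENNReal.ofReal_pow (norm_nonneg _), Real.norm_eq_abs, sq_abs]
  rw [h2, Fintype.card_fin] at h1
  have h3 : ENNReal.ofReal (∑ k : Fin (W.count i), W.coeff f i k ^ 2)
      ≤ ENNReal.ofReal ((2 * W.scale i) ^ (1 - 2 * u) * B ^ 2) := by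
    refine h1.trans ?_
    rw [ENNReal.ofReal_mul (by positivity), ENNReal.ofReal_pow hB0,
      ← ENNReal.ofReal_rpow_of_nonneg (by positivity) (by linarith)]
    gcongr
    · linarith
    · rw [← ENNReal.ofReal_natCast]
      exact ENNReal.ofReal_le_ofReal (W.count_le i)
    · exact ellNorm_level_le_of_mem hq hf i
  rw [ENNReal.ofReal_le_ofReal_iff (by positivity)] at h3
  refine h3.trans ?_
  have h4 : (2 * W.scale i) ^ (1 - 2 * u) ≤ 2 * W.scale i ^ (1 - 2 * u) := by
    rw [Real.mul_rpow (by norm_num) hs.le]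
    refine mul_le_mul_of_nonneg_right ?_ (Real.rpow_nonneg hs.le _)
    calc (2 : ℝ) ^ (1 - 2 * u) ≤ 2 ^ (1 : ℝ) :=
          Real.rpow_le_rpow_of_exponent_le (by norm_num) (by linarith)
      _ = 2 := Real.rpow_one 2
  have h5 : W.scale i ^ (-(2 * α))
      = W.scale i ^ (1 - 2 * u) * (W.scale i ^ (-(α + 1 / 2 - u))) ^ 2 := by
    rw [← Real.rpow_natCast (W.scale i ^ _), ← Real.rpow_mul hs.le, ← Real.rpow_add hs]
    congr 1; push_cast; ring
  rw [h5, hB, mul_pow]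
  calc _ ≤ 2 * W.scale i ^ (1 - 2 * u) * (R ^ 2 * (W.scale i ^ (-(α + 1 / 2 - u))) ^ 2) := by
        gcongr
    _ = _ := by ring

/-- A finite wavelet sum lies in the Besov ball as soon as the norms of its levels add up to at
most `R`. -/
lemma combo_mem_besovBall (hW : W.IsRegularBasis A) (hq : 1 ≤ q) (s : Finset ℕ) (a : ℕ → ℕ → ℝ)
    (B : ℕ → ℝ) (hB0 : ∀ i ∈ s, 0 ≤ B i)
    (hB : ∀ i ∈ s, ellNorm p (fun k : Fin (W.count i) => ‖a i k‖ₑ) ≤ ENNReal.ofReal (B i))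
    (hp : 1 ≤ p)
    (hR : ∑ i ∈ s, W.scale i ^ (α + 1 / 2 - (p⁻¹).toReal) * B i ≤ R) :
    (fun x : unitInterval => W.combo s a x) ∈ besovBall W α p q R := by
  refine ⟨hW.memLp_combo s a 2, (ellNorm_le_tsum hq _).trans ?_⟩
  simp only [W.two_rpow_eq_scale, hW.coeff_combo]
  rw [tsum_eq_sum (s := s)]
  · refine le_trans ?_ (ENNReal.ofReal_le_ofReal hR)
    rw [ENNReal.ofReal_sum_of_nonneg fun i hi => mul_nonneg
      (Real.rpow_nonneg (W.scale_pos i).le _) (hB0 i hi)]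
    refine Finset.sum_le_sum fun i hi => ?_
    rw [ENNReal.ofReal_mul (Real.rpow_nonneg (W.scale_pos i).le _)]
    simp only [hi, if_true]
    gcongr
    exact hB i hi
  · intro i hi
    simp only [hi, if_false, enorm_zero]
    have := ellNorm_le_tsum hp fun _ : Fin (W.count i) => (0 : ℝ≥0∞)
    simp only [tsum_zero, nonpos_iff_eq_zero] at this
    simp [this]

end besov

/-! ### Approximation in the Besov ball, and wavelets that are large at a point -/

lemma eq_of_ae_eq_unitInterval {f g : unitInterval → ℝ} (hf : Continuous f) (hg : Continuous g)
    (h : f =ᵐ[volume] g) : f = g := by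
  have h1 : Set.IccExtend zero_le_one f =ᵐ[volume.restrict (Set.Icc (0 : ℝ) 1)]
      Set.IccExtend zero_le_one g := by
    have := unitInterval.measurePreserving_coe.map_eq
    change _ =ᵐ[volume.restrict unitInterval] _
    rw [← this]
    have hme : MeasurableSet {x : ℝ | Set.IccExtend (zero_le_one (α := ℝ)) f x
        = Set.IccExtend zero_le_one g x} :=
      measurableSet_eq_fun hf.Icc_extend'.measurable hg.Icc_extend'.measurable
    rw [Filter.EventuallyEq, ae_map_iff measurable_subtype_coe.aemeasurable hme]
    filter_upwards [h] with x hx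
    simpa using hx
  have h2 := Measure.eqOn_Icc_of_ae_eq volume (zero_ne_one (α := ℝ)) h1 hf.Icc_extend'.continuousOn
    hg.Icc_extend'.continuousOn
  funext x
  simpa using h2 x.2

namespace WaveletSystem

variable {W : WaveletSystem} {A : ℕ} {C : ℝ}

lemma Localized.abs_level_le (hC : W.Localized C) {a : ℕ → ℝ} {c : ℝ} {i : ℕ}
    (ha : ∀ k : Fin (W.count i), |a k| ≤ c) (x : ℝ) :
    |∑ k : Fin (W.count i), a k * W.fn i k x| ≤ C * (c * √(W.scale i)) := by
  have : 0 < W.count i := by unfold count; split_ifs <;> positivity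
  have hc : 0 ≤ c := (abs_nonneg _).trans (ha ⟨0, this⟩)
  calc |∑ k : Fin (W.count i), a k * W.fn i k x|
      ≤ ∑ k : Fin (W.count i), |a k * W.fn i k x| := Finset.abs_sum_le_sum_abs _ _
    _ ≤ ∑ k : Fin (W.count i), c * |W.fn i k x| := Finset.sum_le_sum fun k _ => by
        rw [abs_mul]; exact mul_le_mul_of_nonneg_right (ha k) (abs_nonneg _)
    _ ≤ c * (C * √(W.scale i)) := by
        rw [← Finset.mul_sum]
        exact mul_le_mul_of_nonneg_left (hC.sum_le i x) hc
    _ = _ := by ring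

lemma Localized.abs_sub_combo_le (hC : W.Localized C) {a : ℕ → ℕ → ℝ} {c : ℕ → ℝ} {J : ℕ}
    (hc : ∀ i, J ≤ i → ∀ k : Fin (W.count i), |a i k| ≤ c i) {T x y : ℝ}
    (hT : HasSum (fun i => c (i + J) * √(W.scale (i + J))) T)
    (hsum : HasSum (fun i => ∑ k : Fin (W.count i), a i k * W.fn i k x) y) :
    |y - W.combo (Finset.range J) a x| ≤ C * T := by
  have h1 := (hasSum_nat_add_iff' J).2 hsum
  rw [← Real.norm_eq_abs, combo, ← h1.tsum_eq]
  exact tsum_of_norm_bounded (hT.mul_left C) fun i =>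
    hC.abs_level_le (hc (i + J) (by omega)) x

/-- Low frequencies contribute little to a function `b` with small integral. -/
lemma Localized.abs_coeff_le_low (hW : W.IsRegularBasis A) (hC : W.Localized C)
    {b : unitInterval → ℝ} (hb : Continuous b) {T : ℝ} (hT : ∫ x, |b x| ≤ T) (i : ℕ)
    (k : Fin (W.count i)) : |W.coeff b i k| ≤ C * T * √(W.scale i) := by
  have h0 : 0 ≤ C := zero_le_one.trans hC.one_le
  calc |W.coeff b i k| ≤ ∫ x : unitInterval, |b x * W.fn i k x| := abs_integral_le_integral_abs
    _ ≤ ∫ x : unitInterval, |b x| * (C * √(W.scale i)) := by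
        refine integral_mono (integrable_of_continuous_unitInterval
          (hb.mul ((hW.continuous_fn i k).comp continuous_subtype_val)).abs)
          (integrable_of_continuous_unitInterval (hb.abs.mul continuous_const)) fun x => ?_
        rw [abs_mul]
        exact mul_le_mul_of_nonneg_left (hC.abs_fn_le i k x) (abs_nonneg _)
    _ ≤ T * (C * √(W.scale i)) := by
        rw [integral_mul_const]
        exact mul_le_mul_of_nonneg_right hT (by positivity)
    _ = _ := by ring

/-- High frequencies contribute little to a Lipschitz function `b`, as the wavelets integrate to
zero. -/
lemma Localized.abs_coeff_le_high (hW : W.IsRegularBasis A) (hA : 1 ≤ A) (hC : W.Localized C)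
    {b : ℝ → ℝ} (hb : Continuous b) {s : ℝ} (hs : 0 ≤ s) (hLip : ∀ x y, |b x - b y| ≤ s * |x - y|)
    {i : ℕ} (hi : 1 ≤ i) (k : Fin (W.count i)) :
    |W.coeff (fun x => b x) i k| ≤ 2 * C ^ 3 * s * W.scale i ^ (-(3 / 2 : ℝ)) := by
  have h0 : 0 ≤ C := zero_le_one.trans hC.one_le
  have hsc := W.scale_pos i
  obtain ⟨c, hc⟩ := hC.center i k
  have hfn : Continuous fun x : unitInterval => W.fn i k x :=
    (hW.continuous_fn i k).comp continuous_subtype_val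
  have hbI : Continuous fun x : unitInterval => b x := hb.comp continuous_subtype_val
  have hv : ∫ x : unitInterval, W.fn i k x = 0 := by
    have := hW.vanishing_moments i k 0 hi k.2 hA
    simpa using this
  have h1 : W.coeff (fun x => b x) i k = ∫ x : unitInterval, (b x - b c) * W.fn i k x := by
    simp_rw [sub_mul]
    have i1 : Integrable (fun x : unitInterval => b x * W.fn i k x) volume :=
      integrable_of_continuous_unitInterval (hbI.mul hfn)
    have i2 : Integrable (fun x : unitInterval => b c * W.fn i k x) volume :=
      integrable_of_continuous_unitInterval (continuous_const.mul hfn)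
    rw [integral_sub i1 i2, integral_const_mul, hv, mul_zero, sub_zero, coeff]
  rw [h1]
  calc |∫ x : unitInterval, (b x - b c) * W.fn i k x|
      ≤ ∫ x : unitInterval, |(b x - b c) * W.fn i k x| := abs_integral_le_integral_abs
    _ ≤ ∫ x : unitInterval, s * (C / W.scale i) * |W.fn i k x| := by
        refine integral_mono (integrable_of_continuous_unitInterval
          ((hbI.sub continuous_const).mul hfn).abs)
          (integrable_of_continuous_unitInterval (continuous_const.mul hfn.abs)) fun x => ?_
        simp only [abs_mul]
        by_cases hx : W.fn i k x = 0
        · simp [hx]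
        · refine mul_le_mul_of_nonneg_right ((hLip x c).trans ?_) (abs_nonneg _)
          exact mul_le_mul_of_nonneg_left (hc x hx) hs
    _ ≤ s * (C / W.scale i) * (2 * C ^ 2 / √(W.scale i)) := by
        rw [integral_const_mul]
        exact mul_le_mul_of_nonneg_left (hC.integral_abs_fn_le hW i k) (by positivity)
    _ = _ := by
        have h2 : W.scale i ^ (-(3 / 2 : ℝ)) = (W.scale i * √(W.scale i))⁻¹ := by
          rw [Real.rpow_neg hsc.le, Real.sqrt_eq_rpow]
          congr 1
          nth_rewrite 2 [← Real.rpow_one (W.scale i)]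
          rw [← Real.rpow_add hsc]; norm_num
        rw [h2]
        field_simp

/-- At every point `x₀`, the basis functions of a bounded number of levels around `L` have a total
size at least of the order they have on average: `∑ ψ_{lk}(x₀)² ≥ 2 ^ L / 8`. A tent function of
width `2 ^ (-L)` with peak value `1` at `x₀` must be recovered from these levels, because lower
levels see only its small integral and higher levels only its small oscillation. -/
lemma IsRegularBasis.exists_window (hW : W.IsRegularBasis A) (hA : 1 ≤ A) :
    ∃ a : ℕ, ∀ (L : ℕ) (x₀ : unitInterval), W.scale L / 8
      ≤ ∑ i ∈ Finset.Ico (L - a) (L + a), ∑ k : Fin (W.count i), W.fn i k x₀ ^ 2 := by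
  obtain ⟨C, hC⟩ := hW.exists_localized
  have h0 : 0 ≤ C := zero_le_one.trans hC.one_le
  -- With this `a`, the levels outside the window contribute at most `1 / 4` each, below and above.
  obtain ⟨a, ha⟩ := pow_unbounded_of_one_lt (16 * C ^ 4 + 1) (one_lt_two (α := ℝ))
  have ha1 : 1 ≤ a := by
    rcases Nat.eq_zero_or_pos a with rfl | h
    · have : 0 ≤ C ^ 4 := by positivity
      norm_num at ha; linarith
    · exact h
  refine ⟨a, fun L x₀ => ?_⟩
  set s := W.scale L with hs
  have hs0 : 0 < s := W.scale_pos L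
  -- The tent function: Lipschitz with constant `s`, with integral at most `2 / s`.
  set b : ℝ → ℝ := fun x => max 0 (1 - s * |x - x₀|) with hbdef
  have hbc : Continuous b := by fun_prop
  have hbI : Continuous fun x : unitInterval => b x := hbc.comp continuous_subtype_val
  have hb0 : ∀ x, 0 ≤ b x := fun x => le_max_left _ _
  have hb1 : ∀ x, b x ≤ 1 := fun x => max_le zero_le_one (by
    have : 0 ≤ s * |x - x₀| := by positivity
    linarith)
  have hbs : ∀ x, b x ≠ 0 → |x - x₀| ≤ 1 / s := fun x hx => by
    by_contra h
    push Not at h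
    rw [div_lt_iff₀' hs0] at h
    exact hx (max_eq_left (by linarith))
  have hLip : ∀ x y, |b x - b y| ≤ s * |x - y| := fun x y => by
    refine (abs_max_sub_max_le_max _ _ _ _).trans ?_
    rw [sub_self, abs_zero, max_eq_right (abs_nonneg _)]
    have h1 : 1 - s * |x - x₀| - (1 - s * |y - x₀|) = s * (|y - x₀| - |x - x₀|) := by ring
    rw [h1, abs_mul, abs_of_pos hs0]
    refine mul_le_mul_of_nonneg_left ?_ hs0.le
    have := abs_abs_sub_abs_le (y - (x₀ : ℝ)) (x - x₀)
    rwa [sub_sub_sub_cancel_right, abs_sub_comm y x] at this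
  have hbint : ∫ x : unitInterval, |b x| ≤ 2 / s := by
    have := integral_abs_le_of_support hbI (c := x₀) (ρ := 1 / s) (B := 1) (by positivity)
      (fun x => by rw [abs_of_nonneg (hb0 _)]; exact hb1 _) (fun x hx => hbs x hx)
    rw [mul_one, mul_one_div] at this
    exact this
  have hbsq : ∫ x : unitInterval, b x ^ 2 ≤ 2 / s := by
    refine le_trans (integral_mono (integrable_of_continuous_unitInterval (hbI.pow 2))
      (integrable_of_continuous_unitInterval hbI.abs) fun x => ?_) hbint
    change b x ^ 2 ≤ |b x|
    rw [abs_of_nonneg (hb0 _)]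
    nlinarith [hb0 x, hb1 x]
  set f : unitInterval → ℝ := fun x => b x with hf
  have hfm : MemLp f 2 volume := memLp_of_continuous_unitInterval hbI 2
  have hlow : ∀ i (k : Fin (W.count i)), |W.coeff f i k| ≤ C * (2 / s) * √(W.scale i) :=
    hC.abs_coeff_le_low hW hbI hbint
  have hhigh : ∀ i, 1 ≤ i → ∀ k : Fin (W.count i),
      |W.coeff f i k| ≤ 2 * C ^ 3 * s * W.scale i ^ (-(3 / 2 : ℝ)) := fun i hi k =>
    hC.abs_coeff_le_high hW hA hbc hs0.le hLip hi k
  have hsq : ∀ i, W.scale i ^ (-(3 / 2 : ℝ)) * √(W.scale i) = W.scale i ^ (-1 : ℝ) := fun i => by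
    rw [Real.sqrt_eq_rpow, ← Real.rpow_add (W.scale_pos i)]; norm_num
  have hhs : ∀ J, HasSum (fun i => 2 * C ^ 3 * s * W.scale (i + J) ^ (-(3 / 2 : ℝ))
      * √(W.scale (i + J))) (2 * C ^ 3 * s * (W.scale J ^ (-1 : ℝ) * 2)) := fun J => by
    have h1 := (W.hasSum_scale_rpow_neg zero_lt_one J).mul_left (2 * C ^ 3 * s)
    have h2 : (1 - (2 : ℝ) ^ (-1 : ℝ))⁻¹ = 2 := by
      rw [Real.rpow_neg_one]; norm_num
    rw [h2] at h1
    have h3 : (fun i => 2 * C ^ 3 * s * W.scale (i + J) ^ (-(3 / 2 : ℝ)) * √(W.scale (i + J)))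
        = fun i => 2 * C ^ 3 * s * W.scale (i + J) ^ (-1 : ℝ) := by
      funext i; rw [mul_assoc, hsq]
    rwa [h3]
  -- The wavelet series converges at `x₀` to the peak value `1` of the tent.
  have hseries : HasSum (fun i => ∑ k : Fin (W.count i), W.coeff f i k * W.fn i k x₀) 1 := by
    set c : ℕ → ℝ := fun i => 2 * C ^ 3 * s * W.scale i ^ (-(3 / 2 : ℝ))
      + if i = 0 then C * (2 / s) * √(W.scale i) else 0 with hcdef
    have hc : ∀ i (k : Fin (W.count i)), |W.coeff f i k| ≤ c i := fun i k => by
      rcases Nat.eq_zero_or_pos i with hi | hi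
      · have h1 : 0 ≤ 2 * C ^ 3 * s * W.scale i ^ (-(3 / 2 : ℝ)) :=
          mul_nonneg (by positivity) (Real.rpow_nonneg (W.scale_pos i).le _)
        have := hlow i k
        simp only [hcdef, if_pos hi]
        linarith
      · have := hhigh i hi k
        simp only [hcdef, if_neg hi.ne', add_zero]
        exact this
    have hsm : Summable fun i => c i * √(W.scale i) := by
      simp only [hcdef, add_mul]
      refine (hhs 0).summable.add (summable_of_ne_finset_zero (s := {0}) fun i hi => ?_)
      rw [Finset.mem_singleton] at hi
      simp [hi]
    obtain ⟨g, hgc, hfg, hg⟩ := hW.synthesis hC hfm hc hsm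
    have h1 : f = g := eq_of_ae_eq_unitInterval hbI hgc hfg
    have h2 : g x₀ = 1 := by
      rw [← h1]; simp [hf, hbdef]
    rw [← h2]
    exact hg x₀
  have htail := hC.abs_sub_combo_le (J := L + a) (a := W.coeff f)
    (fun i hi k => hhigh i (by omega) k) (hhs (L + a)) hseries
  have htail' : |1 - W.combo (Finset.range (L + a)) (W.coeff f) x₀| ≤ 1 / 4 := by
    refine htail.trans ?_
    have h1 : W.scale (L + a) = s * 2 ^ a := by rw [add_comm, W.scale_add]
    rw [h1, Real.rpow_neg_one, mul_inv]
    have h2 : C * (2 * C ^ 3 * s * (s⁻¹ * ((2 : ℝ) ^ a)⁻¹ * 2)) = 4 * C ^ 4 / 2 ^ a := by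
      field_simp; ring
    rw [h2, div_le_iff₀ (by positivity)]
    linarith
  have hlow' : |W.combo (Finset.range (L - a)) (W.coeff f) x₀| ≤ 1 / 4 := by
    rcases lt_or_ge L a with hL | hL
    · rw [Nat.sub_eq_zero_of_le hL.le]
      simp [combo]
    have h1 : ∀ n, ∑ i ∈ Finset.range n, W.scale i ≤ W.scale n := fun n => by
      induction n with
      | zero => simpa using (W.scale_pos 0).le
      | succ n ih =>
        rw [Finset.sum_range_succ, add_comm n 1, W.scale_add, add_comm] at *
        unfold scale at *
        norm_num
        linarith
    have h2 : W.scale (L - a) = s / 2 ^ a := by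
      rw [eq_div_iff (by positivity), ← W.scale_add, hs]
      congr 1; omega
    calc |W.combo (Finset.range (L - a)) (W.coeff f) x₀|
        ≤ ∑ i ∈ Finset.range (L - a), |∑ k : Fin (W.count i), W.coeff f i k * W.fn i k x₀| :=
          Finset.abs_sum_le_sum_abs _ _
      _ ≤ ∑ i ∈ Finset.range (L - a), 2 * C ^ 2 / s * W.scale i := by
          refine Finset.sum_le_sum fun i _ => (hC.abs_level_le (hlow i) x₀).trans (le_of_eq ?_)
          rw [mul_assoc (C * (2 / s)), Real.mul_self_sqrt (W.scale_pos i).le]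
          ring
      _ ≤ 2 * C ^ 2 / s * (s / 2 ^ a) := by
          rw [← Finset.mul_sum, ← h2]
          exact mul_le_mul_of_nonneg_left (h1 _) (by positivity)
      _ = 2 * C ^ 2 / 2 ^ a := by field_simp
      _ ≤ 1 / 4 := by
          rw [div_le_iff₀ (by positivity)]
          have : C ^ 2 ≤ C ^ 4 := pow_le_pow_right₀ hC.one_le (by norm_num)
          nlinarith [sq_nonneg C]
  have hwin : 1 / 2 ≤ W.combo (Finset.Ico (L - a) (L + a)) (W.coeff f) x₀ := by
    have h1 : W.combo (Finset.Ico (L - a) (L + a)) (W.coeff f) x₀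
        = W.combo (Finset.range (L + a)) (W.coeff f) x₀
          - W.combo (Finset.range (L - a)) (W.coeff f) x₀ := by
      rw [combo, combo, combo, Finset.sum_Ico_eq_sub _ (by omega)]
    rw [h1]
    have := abs_le.1 htail'
    have := abs_le.1 hlow'
    linarith
  -- Weighted Cauchy–Schwarz, with Bessel's inequality for the coefficients of the tent function.
  have hcs : W.combo (Finset.Ico (L - a) (L + a)) (W.coeff f) x₀
      ≤ s / 8 * ∑ i ∈ Finset.Ico (L - a) (L + a), ∑ k : Fin (W.count i), W.coeff f i k ^ 2
        + 2 / s * ∑ i ∈ Finset.Ico (L - a) (L + a), ∑ k : Fin (W.count i), W.fn i k x₀ ^ 2 := by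
    simp only [combo, Finset.mul_sum, ← Finset.sum_add_distrib]
    refine Finset.sum_le_sum fun i _ => Finset.sum_le_sum fun k _ => ?_
    have h1 : 0 ≤ s / 8 * (W.coeff f i k - 4 / s * W.fn i k x₀) ^ 2 := by positivity
    have h2 : s / 8 * (W.coeff f i k - 4 / s * W.fn i k x₀) ^ 2 = s / 8 * W.coeff f i k ^ 2
        + 2 / s * W.fn i k x₀ ^ 2 - W.coeff f i k * W.fn i k x₀ := by
      field_simp; ring
    linarith
  have hbes := (hW.bessel hfm (Finset.Ico (L - a) (L + a))).trans hbsq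
  have h1 : s / 8 * ∑ i ∈ Finset.Ico (L - a) (L + a), ∑ k : Fin (W.count i), W.coeff f i k ^ 2
      ≤ 1 / 4 := by
    calc _ ≤ s / 8 * (2 / s) := by gcongr
      _ = 1 / 4 := by field_simp; norm_num
  have h2 : 1 / 4 ≤ 2 / s *
      ∑ i ∈ Finset.Ico (L - a) (L + a), ∑ k : Fin (W.count i), W.fn i k x₀ ^ 2 := by linarith
  rw [div_mul_eq_mul_div, le_div_iff₀ hs0] at h2
  linarith

end WaveletSystem

section besov

variable {W : WaveletSystem} {A : ℕ} {C : ℝ} {α R : ℝ} {p q : ℝ≥0∞}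

/-- Functions in the Besov ball have a continuous version, are uniformly bounded, and are
approximated by their truncated wavelet series at the rates `2 ^ (- l (α - 1 / p))` uniformly and
`2 ^ (- l α)` in `L²`. -/
lemma besovBall_approx (hW : W.IsRegularBasis A) (hR : 0 < R) (hp : 2 ≤ p) (hq : 1 ≤ q)
    (hν : 0 < α - (p⁻¹).toReal) :
    ∃ B : ℝ, 0 < B ∧ ∀ f ∈ besovBall W α p q R, ∃ g : unitInterval → ℝ, Continuous g ∧
      f =ᵐ[volume] g ∧ (∀ x, |g x| ≤ B) ∧
      (∀ J, ∀ x : unitInterval, |g x - W.combo (Finset.range J) (W.coeff f) x|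
        ≤ B * W.scale J ^ (-(α - (p⁻¹).toReal))) ∧
      (∀ J, ∫ x : unitInterval, (g x - W.combo (Finset.range J) (W.coeff f) x) ^ 2
        ≤ B * W.scale J ^ (-(2 * α))) := by
  obtain ⟨C, hC⟩ := hW.exists_localized
  have h0 : 0 < C := zero_lt_one.trans_le hC.one_le
  have hp1 : 1 ≤ p := one_le_two.trans hp
  have hu0 : 0 ≤ (p⁻¹).toReal := ENNReal.toReal_nonneg
  set ν := α - (p⁻¹).toReal with hνdef
  have hα : 0 < 2 * α := by linarith
  have hgeo : ∀ β : ℝ, 0 < β → 0 < (1 - (2 : ℝ) ^ (-β))⁻¹ := fun β hβ => by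
    have := Real.rpow_lt_one_of_one_lt_of_neg (one_lt_two (α := ℝ)) (show -β < 0 by linarith)
    exact inv_pos.2 (by linarith)
  set K₁ := (1 - (2 : ℝ) ^ (-ν))⁻¹
  set K₂ := (1 - (2 : ℝ) ^ (-(2 * α)))⁻¹
  have hK₁ : 0 < K₁ := hgeo _ hν
  have hK₂ : 0 < K₂ := hgeo _ hα
  refine ⟨C * (R * K₁) + 2 * R ^ 2 * K₂, by positivity, fun f hf => ?_⟩
  set c : ℕ → ℝ := fun i => R * W.scale i ^ (-(α + 1 / 2 - (p⁻¹).toReal))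
  have hc : ∀ i (k : Fin (W.count i)), |W.coeff f i k| ≤ c i := fun i k =>
    abs_coeff_le_of_mem hR hp1 hq hf i k
  have hcs : ∀ i, c i * √(W.scale i) = R * W.scale i ^ (-ν) := fun i => by
    simp only [c]
    rw [Real.sqrt_eq_rpow, mul_assoc, ← Real.rpow_add (W.scale_pos i)]
    congr 2
    rw [hνdef]; ring
  have hT : ∀ J, HasSum (fun i => c (i + J) * √(W.scale (i + J)))
      (R * (W.scale J ^ (-ν) * K₁)) := fun J => by
    simp only [hcs]
    exact (W.hasSum_scale_rpow_neg hν J).mul_left R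
  obtain ⟨g, hgc, hfg, hg⟩ := hW.synthesis hC hf.1 hc (hT 0).summable
  have hsc : ∀ (J : ℕ) (t : ℝ), 0 < W.scale J ^ t :=
    fun J t => Real.rpow_pos_of_pos (W.scale_pos J) t
  have hunif : ∀ J, ∀ x : unitInterval, |g x - W.combo (Finset.range J) (W.coeff f) x|
      ≤ (C * (R * K₁) + 2 * R ^ 2 * K₂) * W.scale J ^ (-ν) := fun J x => by
    refine (hC.abs_sub_combo_le (fun i _ => hc i) (hT J) (hg x)).trans ?_
    have : 0 ≤ 2 * R ^ 2 * K₂ * W.scale J ^ (-ν) := mul_nonneg (by positivity) (hsc J _).le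
    linarith
  refine ⟨g, hgc, hfg, fun x => ?_, hunif, fun J => ?_⟩
  · have h1 := hunif 0 x
    simp only [WaveletSystem.combo, Finset.range_zero, Finset.sum_empty, sub_zero] at h1
    refine h1.trans (mul_le_of_le_one_right (by positivity) ?_)
    exact Real.rpow_le_one_of_one_le_of_nonpos (W.one_le_scale 0) (by linarith)
  · refine (hW.integral_tail_sq_le hC hc (hT 0).summable hg J (B := 2 * R ^ 2 *
      (W.scale J ^ (-(2 * α)) * K₂)) fun J' => ?_).trans ?_
    · have hsum := (W.hasSum_scale_rpow_neg hα J).mul_left (2 * R ^ 2)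
      rw [Finset.sum_Ico_eq_sum_range]
      refine (Finset.sum_le_sum fun i _ => sum_coeff_sq_le_of_mem hR hp hq hf (J + i)).trans ?_
      rw [← hsum.tsum_eq]
      simp only [add_comm J]
      exact hsum.summable.sum_le_tsum _ fun i _ => mul_nonneg (by positivity) (hsc _ _).le
    · have : 0 ≤ C * (R * K₁) * W.scale J ^ (-(2 * α)) := mul_nonneg (by positivity) (hsc J _).le
      linarith

end besov

/-! ### The Laplace mechanism -/

/-- The standard Laplace distribution, with density `exp (- |t|) / 2`. -/
def laplaceMeasure : Measure ℝ :=
  volume.withDensity fun t => ENNReal.ofReal (Real.exp (-|t|) / 2)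

lemma integral_exp_neg_abs : ∫ t : ℝ, Real.exp (-|t|) = 2 := by
  rw [integral_comp_abs (f := fun t => Real.exp (-t)), integral_exp_neg_Ioi_zero, mul_one]

lemma integrable_exp_neg_abs : Integrable fun t : ℝ => Real.exp (-|t|) := by
  by_contra h
  have := integral_undef h
  rw [integral_exp_neg_abs] at this
  norm_num at this

lemma integral_sq_mul_exp_neg_abs : ∫ t : ℝ, t ^ 2 * Real.exp (-|t|) = 4 := by
  have h : ∀ t : ℝ, t ^ 2 * Real.exp (-|t|) = (fun s => s ^ 2 * Real.exp (-s)) |t| := fun t => by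
    simp
  simp_rw [h]
  rw [integral_comp_abs (f := fun s => s ^ 2 * Real.exp (-s))]
  have h2 := Real.Gamma_eq_integral (s := 3) (by norm_num)
  have h3 : Real.Gamma 3 = 2 := by
    rw [show (3 : ℝ) = ((2 : ℕ) : ℝ) + 1 by norm_num, Real.Gamma_nat_eq_factorial]
    norm_num [Nat.factorial]
  rw [h3] at h2
  have h4 : ∫ s in Set.Ioi (0 : ℝ), s ^ 2 * Real.exp (-s) = 2 := by
    rw [h2]
    refine setIntegral_congr_fun measurableSet_Ioi fun s _ => ?_
    rw [mul_comm]
    congr 1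
    rw [← Real.rpow_natCast]; norm_num
  rw [h4]; norm_num

lemma integrable_sq_mul_exp_neg_abs : Integrable fun t : ℝ => t ^ 2 * Real.exp (-|t|) := by
  by_contra h
  have := integral_undef h
  rw [integral_sq_mul_exp_neg_abs] at this
  norm_num at this

lemma laplaceDensity_measurable :
    Measurable fun t : ℝ => ENNReal.ofReal (Real.exp (-|t|) / 2) := by fun_prop

instance : IsProbabilityMeasure laplaceMeasure where
  measure_univ := by
    rw [laplaceMeasure, withDensity_apply _ MeasurableSet.univ, Measure.restrict_univ,
      ← ofReal_integral_eq_lintegral_ofReal (integrable_exp_neg_abs.div_const 2)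
        (ae_of_all _ fun t => by positivity), integral_div, integral_exp_neg_abs]
    norm_num

lemma integral_laplaceMeasure (g : ℝ → ℝ) :
    ∫ t, g t ∂laplaceMeasure = ∫ t, Real.exp (-|t|) / 2 * g t := by
  rw [laplaceMeasure, integral_withDensity_eq_integral_toReal_smul laplaceDensity_measurable
    (ae_of_all _ fun t => ENNReal.ofReal_lt_top)]
  refine integral_congr_ae (ae_of_all _ fun t => ?_)
  simp only [smul_eq_mul]
  rw [ENNReal.toReal_ofReal (by positivity)]

lemma memLp_id_laplaceMeasure : MemLp (fun t : ℝ => t) 2 laplaceMeasure := by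
  refine (memLp_two_iff_integrable_sq measurable_id.aestronglyMeasurable).2 ?_
  rw [laplaceMeasure, integrable_withDensity_iff laplaceDensity_measurable
    (ae_of_all _ fun t => ENNReal.ofReal_lt_top)]
  refine (integrable_sq_mul_exp_neg_abs.div_const 2).congr (ae_of_all _ fun t => ?_)
  simp only [id]
  rw [ENNReal.toReal_ofReal (by positivity)]
  ring

lemma integral_id_laplaceMeasure : ∫ t, t ∂laplaceMeasure = 0 := by
  rw [integral_laplaceMeasure]
  have h := integral_neg_eq_self (fun t : ℝ => Real.exp (-|t|) / 2 * t) volume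
  simp only [abs_neg, mul_neg] at h
  rw [integral_neg] at h
  linarith

lemma integral_sq_laplaceMeasure : ∫ t, t ^ 2 ∂laplaceMeasure = 2 := by
  rw [integral_laplaceMeasure]
  have : ∀ t : ℝ, Real.exp (-|t|) / 2 * t ^ 2 = t ^ 2 * Real.exp (-|t|) / 2 := fun t => by ring
  simp_rw [this]
  rw [integral_div, integral_sq_mul_exp_neg_abs]; norm_num

lemma laplaceMeasure_map_add (c : ℝ) : laplaceMeasure.map (fun t => c + t)
    = laplaceMeasure.withDensity fun t => ENNReal.ofReal (Real.exp (|t| - |t - c|)) := by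
  ext s hs
  have hm : Measurable fun t : ℝ => c + t := by fun_prop
  rw [Measure.map_apply hm hs, laplaceMeasure, ← withDensity_mul _ laplaceDensity_measurable
    (by fun_prop), withDensity_apply _ (hm hs), withDensity_apply _ hs,
    ← lintegral_indicator (hm hs), ← lintegral_indicator hs,
    ← lintegral_add_left_eq_self (μ := volume) (s.indicator _) c]
  refine lintegral_congr fun t => ?_
  by_cases h : c + t ∈ s
  · rw [Set.indicator_of_mem (show t ∈ (fun t => c + t) ⁻¹' s from h), Set.indicator_of_mem h]
    simp only [Pi.mul_apply, add_sub_cancel_left]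
    rw [← ENNReal.ofReal_mul (by positivity), div_mul_eq_mul_div, ← Real.exp_add]
    congr 3; ring
  · rw [Set.indicator_of_notMem (show t ∉ (fun t => c + t) ⁻¹' s from h),
      Set.indicator_of_notMem h]

/-- Adding Laplace noise of scale `b` hides a perturbation of `ℓ₁` size at most `b ε`. -/
lemma laplace_pi_map_le {ι : Type} [Fintype ι] {b ε : ℝ} (hb : 0 < b) (s s' : ι → ℝ)
    (h : ∑ a, |s a - s' a| ≤ b * ε) {S : Set (ι → ℝ)} (hS : MeasurableSet S) :
    ((Measure.pi fun _ : ι => laplaceMeasure).map fun w a => s a + b * w a) S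
      ≤ ENNReal.ofReal (Real.exp ε)
        * ((Measure.pi fun _ : ι => laplaceMeasure).map fun w a => s' a + b * w a) S := by
  set c : ι → ℝ := fun a => (s a - s' a) / b with hc
  set ν := Measure.pi fun _ : ι => laplaceMeasure
  have hm : Measurable fun (w : ι → ℝ) (a : ι) => s' a + b * w a :=
    measurable_pi_iff.2 fun a => by fun_prop
  have hm2 : Measurable fun (w : ι → ℝ) (a : ι) => c a + w a :=
    measurable_pi_iff.2 fun a => by fun_prop
  have h1 : (fun (w : ι → ℝ) (a : ι) => s a + b * w a)
      = (fun (w : ι → ℝ) (a : ι) => s' a + b * w a) ∘ fun (w : ι → ℝ) (a : ι) => c a + w a := by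
    funext w a
    simp only [hc, Function.comp]
    field_simp
    ring
  rw [h1, ← Measure.map_map hm hm2, Measure.map_apply hm hS, Measure.map_apply hm hS]
  have hg : ∀ a, Measurable fun t => ENNReal.ofReal (Real.exp (|t| - |t - c a|)) := fun a => by
    fun_prop
  have hprob : ∀ a, IsProbabilityMeasure (laplaceMeasure.map fun t => c a + t) := fun a =>
    Measure.isProbabilityMeasure_map (by fun_prop)
  -- The density ratio of a shifted Laplace law is `exp (|t| - |t - c|) ≤ exp |c|`.
  have h2 : ν.map (fun (w : ι → ℝ) (a : ι) => c a + w a)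
      = ν.withDensity fun w => ∏ a, ENNReal.ofReal (Real.exp (|w a| - |w a - c a|)) := by
    rw [Measure.pi_map_pi (fun a => by fun_prop)]
    have : ∀ a, IsProbabilityMeasure (laplaceMeasure.withDensity fun t =>
        ENNReal.ofReal (Real.exp (|t| - |t - c a|))) := fun a => by
      rw [← laplaceMeasure_map_add]; exact hprob a
    rw [← pi_withDensity_eq _ _ hg]
    congr 1
    funext a
    exact laplaceMeasure_map_add (c a)
  rw [h2, withDensity_apply _ (hm hS)]
  calc ∫⁻ w in (fun (w : ι → ℝ) (a : ι) => s' a + b * w a) ⁻¹' S,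
        ∏ a, ENNReal.ofReal (Real.exp (|w a| - |w a - c a|)) ∂ν
      ≤ ∫⁻ _ in (fun (w : ι → ℝ) (a : ι) => s' a + b * w a) ⁻¹' S,
          ENNReal.ofReal (Real.exp ε) ∂ν := by
        refine lintegral_mono fun w => ?_
        rw [← ENNReal.ofReal_prod_of_nonneg fun a _ => (Real.exp_pos _).le, ← Real.exp_sum]
        refine ENNReal.ofReal_le_ofReal (Real.exp_le_exp.2 ?_)
        calc ∑ a, (|w a| - |w a - c a|) ≤ ∑ a, |c a| := Finset.sum_le_sum fun a _ => by
              have := abs_sub_abs_le_abs_sub (w a) (w a - c a)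
              simpa using this
          _ = (∑ a, |s a - s' a|) / b := by
              rw [Finset.sum_div]
              refine Finset.sum_congr rfl fun a _ => ?_
              rw [hc, abs_div, abs_of_pos hb]
          _ ≤ ε := by rw [div_le_iff₀ hb]; linarith
    _ = _ := by rw [setLIntegral_const]

/-- The kernel that adds independent Laplace noise of scale `b` to the coordinates of a
statistic `s`. -/
def laplaceKernel {ι Z : Type} [Fintype ι] [MeasurableSpace Z] (s : Z → ι → ℝ) (hs : Measurable s)
    (b : ℝ) : Kernel Z (ι → ℝ) :=
  ((Kernel.deterministic s hs) ×ₖ (Kernel.const Z (Measure.pi fun _ : ι => laplaceMeasure))).map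
    fun p a => p.1 a + b * p.2 a

lemma measurable_add_noise {ι : Type} (b : ℝ) :
    Measurable fun (p : (ι → ℝ) × (ι → ℝ)) (a : ι) => p.1 a + b * p.2 a :=
  measurable_pi_iff.2 fun a => by fun_prop

section laplaceKernel

variable {ι Z : Type} [Fintype ι] [MeasurableSpace Z] {s : Z → ι → ℝ} (hs : Measurable s) (b : ℝ)

instance : IsMarkovKernel (laplaceKernel s hs b) :=
  Kernel.IsMarkovKernel.map _ (measurable_add_noise b)

lemma laplaceKernel_apply (z : Z) : laplaceKernel s hs b z
    = (Measure.pi fun _ : ι => laplaceMeasure).map fun w a => s z a + b * w a := by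
  rw [laplaceKernel, Kernel.map_apply _ (measurable_add_noise b), Kernel.prod_apply,
    Kernel.deterministic_apply, Kernel.const_apply, Measure.dirac_prod,
    Measure.map_map (measurable_add_noise b) (by fun_prop)]
  rfl

lemma bind_laplaceKernel (μ : Measure Z) [IsProbabilityMeasure μ] :
    μ.bind (laplaceKernel s hs b) = (μ.prod (Measure.pi fun _ : ι => laplaceMeasure)).map
      fun p a => s p.1 a + b * p.2 a := by
  have hm : Measurable fun (p : Z × (ι → ℝ)) (a : ι) => s p.1 a + b * p.2 a :=
    (measurable_add_noise b).comp ((hs.comp measurable_fst).prodMk measurable_snd)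
  ext S hS
  rw [Measure.bind_apply hS (Kernel.aemeasurable _), Measure.map_apply hm hS,
    Measure.prod_apply (hm hS)]
  refine lintegral_congr fun z => ?_
  rw [laplaceKernel_apply, Measure.map_apply (measurable_pi_iff.2 fun a => by fun_prop) hS]
  rfl

end laplaceKernel

/-! ### The regression law and clipped responses -/

/-- The law of the pair of the design point and the noise. -/
abbrev noiseLaw : Measure (unitInterval × ℝ) :=
  (volume : Measure unitInterval).prod (gaussianReal 0 1)

lemma measurable_obs {f : unitInterval → ℝ} (hf : Measurable f) :
    Measurable fun w : unitInterval × ℝ => (f w.1 + w.2, w.1) := by fun_prop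

lemma isProbabilityMeasure_regressionLaw {f : unitInterval → ℝ} (hf : Measurable f) :
    IsProbabilityMeasure (regressionLaw f) :=
  Measure.isProbabilityMeasure_map (measurable_obs hf).aemeasurable

lemma regressionLaw_congr {f g : unitInterval → ℝ} (h : f =ᵐ[volume] g) :
    regressionLaw f = regressionLaw g := by
  refine Measure.map_congr ?_
  have := (Measure.quasiMeasurePreserving_fst (μ := (volume : Measure unitInterval))
    (ν := gaussianReal 0 1)).ae_eq_comp h
  filter_upwards [this] with w hw
  simp only [Function.comp] at hw
  rw [hw]

lemma integral_regressionLaw {f : unitInterval → ℝ} (hf : Measurable f)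
    {H : ℝ × unitInterval → ℝ} (hH : Measurable H) :
    ∫ z, H z ∂regressionLaw f = ∫ w, H (f w.1 + w.2, w.1) ∂noiseLaw :=
  integral_map (measurable_obs hf).aemeasurable hH.aestronglyMeasurable

lemma integrable_regressionLaw_iff {f : unitInterval → ℝ} (hf : Measurable f)
    {H : ℝ × unitInterval → ℝ} (hH : Measurable H) :
    Integrable H (regressionLaw f)
      ↔ Integrable (fun w : unitInterval × ℝ => H (f w.1 + w.2, w.1)) noiseLaw :=
  integrable_map_measure hH.aestronglyMeasurable (measurable_obs hf).aemeasurable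

lemma integral_sq_gaussianReal : ∫ t, t ^ 2 ∂gaussianReal 0 1 = 1 := by
  have h := variance_fun_id_gaussianReal (μ := 0) (v := 1)
  rw [variance_of_integral_eq_zero (X := fun x : ℝ => x) measurable_id.aemeasurable
    integral_id_gaussianReal] at h
  simpa using h

lemma integrable_id_gaussianReal : Integrable (fun t : ℝ => t) (gaussianReal 0 1) :=
  (memLp_id_gaussianReal 1).integrable le_rfl

lemma integrable_sq_gaussianReal : Integrable (fun t : ℝ => t ^ 2) (gaussianReal 0 1) :=
  (memLp_id_gaussianReal 2).integrable_sq

/-- Truncation of a real number to `[-τ, τ]`. -/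
def clip (τ y : ℝ) : ℝ := max (-τ) (min τ y)

lemma continuous_clip (τ : ℝ) : Continuous (clip τ) := by unfold clip; fun_prop

lemma abs_clip_le {τ : ℝ} (hτ : 0 ≤ τ) (y : ℝ) : |clip τ y| ≤ τ := by
  unfold clip
  rw [abs_le]
  exact ⟨le_max_left _ _, max_le (by linarith) (min_le_left _ _)⟩

lemma abs_clip_le_abs {τ : ℝ} (hτ : 0 ≤ τ) (y : ℝ) : |clip τ y| ≤ |y| := by
  unfold clip
  rcases le_total 0 y with hy | hy
  · rw [abs_of_nonneg hy, abs_le]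
    exact ⟨le_max_of_le_right (le_min (by linarith) (by linarith)),
      max_le (by linarith) (min_le_right _ _)⟩
  · rw [abs_of_nonpos hy, abs_le]
    exact ⟨le_max_of_le_right (by rw [neg_neg]; exact le_min (by linarith) le_rfl),
      max_le (by linarith) ((min_le_right _ _).trans (by linarith))⟩

/-- Exponential moments control the truncation error: if `|v| ≤ B` then
`E |clip (v + ξ) - (v + ξ)| ≤ 2 exp (- a² / 2)` for truncation at `B + a`. -/
lemma abs_clip_sub_le {B a v t : ℝ} (ha : 1 ≤ a) (hv : |v| ≤ B) :
    |clip (B + a) (v + t) - (v + t)|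
      ≤ Real.exp (-a ^ 2) * (Real.exp (a * t) + Real.exp (-a * t)) := by
  have hB : 0 ≤ B := (abs_nonneg _).trans hv
  have hv' := abs_le.1 hv
  have hexp : ∀ r : ℝ, 0 ≤ r → r ≤ Real.exp (a * r) := fun r hr => by
    have h1 := Real.add_one_le_exp (a * r)
    nlinarith
  have e1 := Real.exp_pos (a * t)
  have e2 := Real.exp_pos (-a * t)
  rw [mul_add, ← Real.exp_add, ← Real.exp_add]
  have p1 := Real.exp_pos (-a ^ 2 + a * t)
  have p2 := Real.exp_pos (-a ^ 2 + -a * t)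
  unfold clip
  rcases le_or_gt (v + t) (B + a) with h1 | h1
  · rw [min_eq_right h1]
    rcases le_or_gt (-(B + a)) (v + t) with h2 | h2
    · rw [max_eq_right h2, sub_self, abs_zero]; linarith
    · rw [max_eq_left h2.le, abs_of_nonneg (by linarith)]
      have h3 := hexp (-t - a) (by linarith)
      have h4 : a * (-t - a) = -a ^ 2 + -a * t := by ring
      rw [h4] at h3
      linarith
  · rw [min_eq_left h1.le, max_eq_right (by linarith), abs_of_nonpos (by linarith)]
    have h3 := hexp (t - a) (by linarith)
    have h4 : a * (t - a) = -a ^ 2 + a * t := by ring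
    rw [h4] at h3
    linarith

lemma integral_exp_mul_gaussianReal (a : ℝ) :
    ∫ t, Real.exp (a * t) ∂gaussianReal 0 1 = Real.exp (a ^ 2 / 2) := by
  have h := congrFun (mgf_id_gaussianReal (μ := 0) (v := 1)) a
  simp only [mgf, id] at h
  rw [h]; congr 1; simp

lemma integral_noiseLaw_mul (f : unitInterval → ℝ) (g : ℝ → ℝ) :
    ∫ w, f w.1 * g w.2 ∂noiseLaw = (∫ x, f x) * ∫ t, g t ∂gaussianReal 0 1 :=
  integral_prod_mul f g

section clippedMean

variable {f u : unitInterval → ℝ} {B : ℝ}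

lemma measurable_clip_mul (hu : Continuous u) (τ : ℝ) :
    Measurable fun z : ℝ × unitInterval => clip τ z.1 * u z.2 :=
  (((continuous_clip τ).comp continuous_fst).mul (hu.comp continuous_snd)).measurable

lemma exists_abs_le_of_continuous (hu : Continuous u) : ∃ M, 0 ≤ M ∧ ∀ x, |u x| ≤ M := by
  obtain ⟨M, hM⟩ := hu.bounded_above_of_compact_support (HasCompactSupport.of_compactSpace u)
  exact ⟨M, (norm_nonneg _).trans (hM 0), hM⟩

lemma memLp_clip_mul (hu : Continuous u) {τ : ℝ} (hτ : 0 ≤ τ) (P : Measure (ℝ × unitInterval))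
    [IsProbabilityMeasure P] : MemLp (fun z => clip τ z.1 * u z.2) 2 P := by
  obtain ⟨M, hM0, hM⟩ := exists_abs_le_of_continuous hu
  refine MemLp.of_bound (measurable_clip_mul hu τ).aestronglyMeasurable (τ * M)
    (ae_of_all _ fun z => ?_)
  rw [norm_mul]
  exact mul_le_mul (abs_clip_le hτ _) (hM _) (norm_nonneg _) hτ

lemma integrable_fst_mul_snd {F : unitInterval → ℝ} {g : ℝ → ℝ} (hF : Continuous F)
    (hg : Integrable g (gaussianReal 0 1)) :
    Integrable (fun w : unitInterval × ℝ => F w.1 * g w.2) noiseLaw :=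
  (integrable_of_continuous_unitInterval hF).mul_prod hg

/-- Clipping does not increase the second moment, which for the response is `f x ^ 2 + 1`. -/
lemma integral_clip_mul_sq_le (hf : Continuous f) (hB : ∀ x, |f x| ≤ B) (hu : Continuous u)
    {τ : ℝ} (hτ : 0 ≤ τ) :
    ∫ z, (clip τ z.1 * u z.2) ^ 2 ∂regressionLaw f ≤ (B ^ 2 + 1) * ∫ x, u x ^ 2 := by
  rw [integral_regressionLaw hf.measurable ((measurable_clip_mul hu τ).pow_const 2)]
  have i1 : Integrable (fun w : unitInterval × ℝ => (f w.1 ^ 2 * u w.1 ^ 2) * 1) noiseLaw :=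
    integrable_fst_mul_snd (g := fun _ => 1) ((hf.pow 2).mul (hu.pow 2)) (integrable_const _)
  have i2 : Integrable (fun w : unitInterval × ℝ => (2 * f w.1 * u w.1 ^ 2) * w.2) noiseLaw :=
    integrable_fst_mul_snd ((continuous_const.mul hf).mul (hu.pow 2)) integrable_id_gaussianReal
  have i3 : Integrable (fun w : unitInterval × ℝ => u w.1 ^ 2 * w.2 ^ 2) noiseLaw :=
    integrable_fst_mul_snd (hu.pow 2) integrable_sq_gaussianReal
  have i12 : Integrable (fun w : unitInterval × ℝ => (f w.1 ^ 2 * u w.1 ^ 2) * 1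
      + (2 * f w.1 * u w.1 ^ 2) * w.2) noiseLaw := i1.add i2
  calc ∫ w, (clip τ (f w.1 + w.2) * u w.1) ^ 2 ∂noiseLaw
      ≤ ∫ w, ((f w.1 ^ 2 * u w.1 ^ 2) * 1 + (2 * f w.1 * u w.1 ^ 2) * w.2
          + u w.1 ^ 2 * w.2 ^ 2) ∂noiseLaw := by
        refine integral_mono_of_nonneg (ae_of_all _ fun w => sq_nonneg _) (i12.add i3)
          (ae_of_all _ fun w => ?_)
        have h1 : (clip τ (f w.1 + w.2)) ^ 2 ≤ (f w.1 + w.2) ^ 2 :=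
          sq_le_sq.2 (abs_clip_le_abs hτ _)
        simp only [mul_pow]
        nlinarith [mul_le_mul_of_nonneg_right h1 (sq_nonneg (u w.1))]
    _ = (∫ x, f x ^ 2 * u x ^ 2) + ∫ x, u x ^ 2 := by
        rw [integral_add i12 i3, integral_add i1 i2,
          integral_noiseLaw_mul (fun x => f x ^ 2 * u x ^ 2) fun _ => 1,
          integral_noiseLaw_mul (fun x => 2 * f x * u x ^ 2) fun t => t,
          integral_noiseLaw_mul (fun x => u x ^ 2) fun t => t ^ 2, integral_id_gaussianReal,
          integral_sq_gaussianReal]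
        simp
    _ ≤ (B ^ 2 + 1) * ∫ x, u x ^ 2 := by
        have : ∫ x, f x ^ 2 * u x ^ 2 ≤ ∫ x, B ^ 2 * u x ^ 2 := by
          refine integral_mono (integrable_of_continuous_unitInterval ((hf.pow 2).mul (hu.pow 2)))
            (integrable_of_continuous_unitInterval (continuous_const.mul (hu.pow 2))) fun x => ?_
          exact mul_le_mul_of_nonneg_right (sq_le_sq' (by linarith [(abs_le.1 (hB x)).1])
            (abs_le.1 (hB x)).2) (sq_nonneg _)
        rw [integral_const_mul] at this
        linarith

lemma integral_abs_le_sqrt (hu : Continuous u) : (∫ x, |u x|) ^ 2 ≤ ∫ x, u x ^ 2 := by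
  have h : 0 ≤ ∫ x, (|u x| - ∫ y, |u y|) ^ 2 := integral_nonneg fun x => sq_nonneg _
  set m := ∫ y, |u y|
  have i1 : Integrable (fun x => u x ^ 2) volume :=
    integrable_of_continuous_unitInterval (hu.pow 2)
  have i2 : Integrable (fun x => 2 * m * |u x|) volume :=
    (integrable_of_continuous_unitInterval hu.abs).const_mul _
  have e : ∀ x, (|u x| - m) ^ 2 = u x ^ 2 - 2 * m * |u x| + m ^ 2 := fun x => by
    rw [sub_sq, sq_abs]; ring
  have i3 : Integrable (fun x => u x ^ 2 - 2 * m * |u x|) volume := i1.sub i2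
  simp_rw [e] at h
  rw [integral_add i3 (integrable_const _), integral_sub i1 i2, integral_const_mul] at h
  simp only [integral_const, probReal_univ, smul_eq_mul, one_mul] at h
  change 0 ≤ _ - 2 * m * m + _ at h
  nlinarith

/-- The bias of the clipped response as an estimator of `∫ f u`. -/
lemma clip_bias_sq_le (hf : Continuous f) (hB : ∀ x, |f x| ≤ B) (hu : Continuous u) {a : ℝ}
    (ha : 1 ≤ a) :
    (∫ z, clip (B + a) z.1 * u z.2 ∂regressionLaw f - ∫ x, f x * u x) ^ 2
      ≤ (2 * Real.exp (-a ^ 2 / 2)) ^ 2 * ∫ x, u x ^ 2 := by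
  rw [integral_regressionLaw hf.measurable (measurable_clip_mul hu _)]
  have hB0 : 0 ≤ B := (abs_nonneg _).trans (hB 0)
  have i1 : Integrable (fun w : unitInterval × ℝ => (f w.1 * u w.1) * 1) noiseLaw :=
    integrable_fst_mul_snd (g := fun _ => 1) (hf.mul hu) (integrable_const _)
  have i2 : Integrable (fun w : unitInterval × ℝ => u w.1 * w.2) noiseLaw :=
    integrable_fst_mul_snd hu integrable_id_gaussianReal
  have i12 : Integrable (fun w : unitInterval × ℝ => (f w.1 * u w.1) * 1 + u w.1 * w.2) noiseLaw :=
    i1.add i2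
  have i0 : Integrable (fun w : unitInterval × ℝ => clip (B + a) (f w.1 + w.2) * u w.1)
      noiseLaw := by
    have := isProbabilityMeasure_regressionLaw hf.measurable
    exact (integrable_regressionLaw_iff hf.measurable (measurable_clip_mul hu _)).1
      ((memLp_clip_mul hu (by linarith) (regressionLaw f)).integrable (by norm_num))
  have e1 : ∫ x, f x * u x = ∫ w, ((f w.1 * u w.1) * 1 + u w.1 * w.2) ∂noiseLaw := by
    rw [integral_add i1 i2, integral_noiseLaw_mul (fun x => f x * u x) fun _ => 1,
      integral_noiseLaw_mul u fun t => t, integral_id_gaussianReal]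
    simp
  rw [e1, ← integral_sub i0 i12]
  have iexp : Integrable (fun t : ℝ => Real.exp (-a ^ 2) * (Real.exp (a * t) + Real.exp (-a * t)))
      (gaussianReal 0 1) :=
    ((integrable_exp_mul_gaussianReal a).add (integrable_exp_mul_gaussianReal (-a))).const_mul _
  have hle : |∫ w : unitInterval × ℝ, (clip (B + a) (f w.1 + w.2) * u w.1
      - ((f w.1 * u w.1) * 1 + u w.1 * w.2)) ∂noiseLaw|
      ≤ (∫ x, |u x|) * (2 * Real.exp (-a ^ 2 / 2)) := by
    calc _ ≤ ∫ w : unitInterval × ℝ, |clip (B + a) (f w.1 + w.2) * u w.1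
            - ((f w.1 * u w.1) * 1 + u w.1 * w.2)| ∂noiseLaw := abs_integral_le_integral_abs
      _ ≤ ∫ w : unitInterval × ℝ, |u w.1|
            * (Real.exp (-a ^ 2) * (Real.exp (a * w.2) + Real.exp (-a * w.2))) ∂noiseLaw := by
          refine integral_mono_of_nonneg (ae_of_all _ fun w => abs_nonneg _)
            (integrable_fst_mul_snd hu.abs iexp) (ae_of_all _ fun w => ?_)
          have e : clip (B + a) (f w.1 + w.2) * u w.1 - ((f w.1 * u w.1) * 1 + u w.1 * w.2)
              = u w.1 * (clip (B + a) (f w.1 + w.2) - (f w.1 + w.2)) := by ring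
          simp only [e, abs_mul]
          exact mul_le_mul_of_nonneg_left (abs_clip_sub_le ha (hB _)) (abs_nonneg _)
      _ = _ := by
          rw [integral_noiseLaw_mul (fun x => |u x|)
            fun t => Real.exp (-a ^ 2) * (Real.exp (a * t) + Real.exp (-a * t)),
            integral_const_mul, integral_add (integrable_exp_mul_gaussianReal a)
            (integrable_exp_mul_gaussianReal (-a)), integral_exp_mul_gaussianReal,
            integral_exp_mul_gaussianReal]
          congr 1
          rw [neg_sq, ← two_mul, mul_left_comm, ← Real.exp_add]
          congr 2; ring
  rw [← sq_abs]
  calc _ ≤ ((∫ x, |u x|) * (2 * Real.exp (-a ^ 2 / 2))) ^ 2 := by gcongr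
    _ = (2 * Real.exp (-a ^ 2 / 2)) ^ 2 * (∫ x, |u x|) ^ 2 := by ring
    _ ≤ _ := by gcongr; exact integral_abs_le_sqrt hu

end clippedMean

/-! ### A private estimator of finitely many linear functionals -/

/-- The statistic of a server: the empirical means of the clipped responses weighted by `u a`. -/
def clippedMean {ι : Type} (u : ι → unitInterval → ℝ) (τ : ℝ) (n : ℕ)
    (z : Fin n → ℝ × unitInterval) (a : ι) : ℝ :=
  ∑ i, clip τ (z i).1 * u a (z i).2 / n

section privateEstimator

variable {ι : Type} {u : ι → unitInterval → ℝ}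

lemma measurable_clippedMean (hu : ∀ a, Continuous (u a)) (τ : ℝ) (n : ℕ) :
    Measurable (clippedMean u τ n) := by
  refine measurable_pi_iff.2 fun a => ?_
  unfold clippedMean
  refine Finset.measurable_sum _ fun i _ => Measurable.div_const ?_ _
  exact (measurable_clip_mul (hu a) τ).comp (measurable_pi_apply i)

variable [Fintype ι]

/-- Changing one observation moves the clipped means by at most `2 τ S / n` in `ℓ₁`, so Laplace
noise of scale `2 τ S / (n ε)` makes them private. -/
lemma isDP_clippedMean (hu : ∀ a, Continuous (u a)) {S τ ε δ : ℝ} (hS : 0 < S)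
    (huS : ∀ x, ∑ a, |u a x| ≤ S) (hτ : 0 < τ) {n : ℕ} (hn : 1 ≤ n) (hε : 0 < ε) :
    IsDP ε δ (laplaceKernel (clippedMean u τ n) (measurable_clippedMean hu τ n)
      (2 * τ * S / (n * ε))) := by
  intro z z' hz s hs
  have hn0 : (0 : ℝ) < n := by exact_mod_cast hn
  rw [laplaceKernel_apply, laplaceKernel_apply]
  refine le_add_of_le_left ?_
  refine laplace_pi_map_le (by positivity) _ _ ?_ hs
  have h1 : ∀ a, |clippedMean u τ n z a - clippedMean u τ n z' a|
      ≤ ∑ i, (if z i ≠ z' i then 1 else 0) *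
        (τ / n * |u a (z i).2| + τ / n * |u a (z' i).2|) := fun a => by
    rw [clippedMean, clippedMean, ← Finset.sum_sub_distrib]
    refine (Finset.abs_sum_le_sum_abs _ _).trans (Finset.sum_le_sum fun i _ => ?_)
    split_ifs with hi
    · rw [one_mul]
      refine (abs_sub _ _).trans (add_le_add ?_ ?_) <;>
      · rw [abs_div, abs_mul, abs_of_pos hn0, div_mul_eq_mul_div]
        gcongr
        exact abs_clip_le hτ.le _
    · rw [not_not] at hi
      rw [hi]; simp
  calc ∑ a, |clippedMean u τ n z a - clippedMean u τ n z' a|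
      ≤ ∑ a, ∑ i, (if z i ≠ z' i then 1 else 0) *
        (τ / n * |u a (z i).2| + τ / n * |u a (z' i).2|) := Finset.sum_le_sum fun a _ => h1 a
    _ = ∑ i, (if z i ≠ z' i then 1 else 0) *
        (τ / n * ∑ a, |u a (z i).2| + τ / n * ∑ a, |u a (z' i).2|) := by
        rw [Finset.sum_comm]
        refine Finset.sum_congr rfl fun i _ => ?_
        rw [← Finset.mul_sum, Finset.sum_add_distrib, Finset.mul_sum, Finset.mul_sum]
    _ ≤ ∑ i, (if z i ≠ z' i then (1 : ℝ) else 0) * (τ / n * S + τ / n * S) := by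
        gcongr with i _
        · exact huS _
        · exact huS _
    _ = (hammingDist z z' : ℝ) * (τ / n * S + τ / n * S) := by
        rw [← Finset.sum_mul, hammingDist, Finset.card_filter]
        push_cast
        rfl
    _ ≤ 1 * (τ / n * S + τ / n * S) := by
        gcongr
        exact_mod_cast hz
    _ = 2 * τ * S / (n * ε) * ε := by field_simp; ring

/-- Mean and variance of one coordinate of the transcript of a server. -/
lemma transcript_moments (hu : ∀ a, Continuous (u a)) {f : unitInterval → ℝ} (hf : Continuous f)
    {B : ℝ} (hB : ∀ x, |f x| ≤ B) {τ : ℝ} (hτ : 0 ≤ τ) {n : ℕ} (hn : 1 ≤ n) (b : ℝ) (a : ι) :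
    let Q := (Measure.pi fun _ : Fin n => regressionLaw f).bind
      (laplaceKernel (clippedMean u τ n) (measurable_clippedMean hu τ n) b)
    let μ := ∫ z, clip τ z.1 * u a z.2 ∂regressionLaw f
    MemLp (fun t => t a - μ) 2 Q ∧ ∫ t, (t a - μ) ∂Q = 0 ∧
      ∫ t, (t a - μ) ^ 2 ∂Q ≤ (B ^ 2 + 1) * (∫ x, u a x ^ 2) / n + 2 * b ^ 2 := by
  intro Q μ
  have := isProbabilityMeasure_regressionLaw hf.measurable
  have hn0 : (0 : ℝ) < n := by exact_mod_cast hn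
  set P := Measure.pi fun _ : Fin n => regressionLaw f
  set ν := Measure.pi fun _ : ι => laplaceMeasure
  set c : ℝ × unitInterval → ℝ := fun z => clip τ z.1 * u a z.2 with hc
  have hcm : Measurable c := measurable_clip_mul (hu a) τ
  have hcL : MemLp c 2 (regressionLaw f) := memLp_clip_mul (hu a) hτ _
  set g : Fin n → ℝ × unitInterval → ℝ := fun _ z => (c z - μ) / n with hg
  have hgm : Measurable (g ⟨0, hn⟩) := (hcm.sub_const μ).div_const _
  have hgL : ∀ i, MemLp (g i) 2 (regressionLaw f) := fun i => by
    have := (hcL.sub (memLp_const μ)).mul_const (n : ℝ)⁻¹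
    refine this.congr_norm hgm.aestronglyMeasurable (ae_of_all _ fun z => ?_)
    simp [hg, div_eq_mul_inv]
  have hci : Integrable c (regressionLaw f) := hcL.integrable (by norm_num)
  have hg0 : ∀ i, ∫ z, g i z ∂regressionLaw f = 0 := fun i => by
    simp only [hg]
    rw [integral_div, integral_sub hci (integrable_const _)]
    simp [μ, hc]
  -- The centred empirical mean, a sum of independent centred variables.
  set X : (Fin n → ℝ × unitInterval) → ℝ := fun z => ∑ i, g i (z i) with hX
  have hXe : ∀ z, clippedMean u τ n z a - μ = X z := fun z => by
    simp only [hX, hg, clippedMean, sub_div, Finset.sum_sub_distrib, hc]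
    congr 1
    simp; field_simp
  have hXL : MemLp X 2 P := memLp_finsetSum _ fun i _ =>
    (hgL i).comp_measurePreserving (measurePreserving_eval _ i)
  have hX0 : ∫ z, X z ∂P = 0 := by
    have hi : ∀ i, Integrable (fun z : Fin n → ℝ × unitInterval => g i (z i)) P := fun i =>
      ((hgL i).comp_measurePreserving (measurePreserving_eval _ i)).integrable (by norm_num)
    simp only [hX]
    rw [integral_finsetSum _ fun i _ => hi i]
    refine Finset.sum_eq_zero fun i _ => ?_
    rw [← hg0 i]
    exact integral_comp_eval (μ := fun _ : Fin n => regressionLaw f) (hgL i).aestronglyMeasurable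
  have hX2 : ∫ z, X z ^ 2 ∂P ≤ (B ^ 2 + 1) * (∫ x, u a x ^ 2) / n := by
    rw [hX, integral_sq_sum_pi _ g hgL hg0]
    have h1 : ∫ z, (c z - μ) ^ 2 ∂regressionLaw f ≤ (B ^ 2 + 1) * ∫ x, u a x ^ 2 := by
      refine le_trans ?_ (integral_clip_mul_sq_le hf hB (hu a) hτ)
      have e : ∀ z, (c z - μ) ^ 2 = c z ^ 2 - 2 * μ * c z + μ ^ 2 := fun z => by ring
      simp_rw [e]
      have i1 : Integrable (fun z => c z ^ 2) (regressionLaw f) := hcL.integrable_sq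
      have i2 : Integrable (fun z => c z ^ 2 - 2 * μ * c z) (regressionLaw f) :=
        i1.sub (hci.const_mul _)
      rw [integral_add i2 (integrable_const _), integral_sub i1 (hci.const_mul _),
        integral_const_mul]
      simp only [integral_const, probReal_univ, smul_eq_mul, one_mul]
      change _ - 2 * μ * μ + _ ≤ _
      nlinarith [sq_nonneg μ]
    have h2 : ∀ i, ∫ z, g i z ^ 2 ∂regressionLaw f
        = (∫ z, (c z - μ) ^ 2 ∂regressionLaw f) / n ^ 2 := fun i => by
      simp only [hg, div_pow]
      rw [integral_div]
    simp only [h2, Finset.sum_const, Finset.card_univ, Fintype.card_fin, nsmul_eq_mul]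
    calc (n : ℝ) * ((∫ z, (c z - μ) ^ 2 ∂regressionLaw f) / n ^ 2)
        = (∫ z, (c z - μ) ^ 2 ∂regressionLaw f) / n := by field_simp
      _ ≤ _ := by gcongr
  have hwL : MemLp (fun w : ι → ℝ => w a) 2 ν := memLp_id_laplaceMeasure.comp_measurePreserving
    (measurePreserving_eval (fun _ : ι => laplaceMeasure) a)
  have hw0 : ∫ w, w a ∂ν = 0 := by
    rw [← integral_id_laplaceMeasure]
    exact integral_comp_eval (μ := fun _ : ι => laplaceMeasure) (f := fun t : ℝ => t)
      aestronglyMeasurable_id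
  have hw2 : ∫ w, w a ^ 2 ∂ν = 2 := by
    rw [← integral_sq_laplaceMeasure]
    exact integral_comp_eval (μ := fun _ : ι => laplaceMeasure) (f := fun t : ℝ => t ^ 2)
      (by fun_prop)
  -- The transcript is the image of the data and the independent noise under `Φ`.
  set Φ : (Fin n → ℝ × unitInterval) × (ι → ℝ) → ι → ℝ :=
    fun p a => clippedMean u τ n p.1 a + b * p.2 a with hΦ
  have hΦm : Measurable Φ := (measurable_add_noise b).comp
    (((measurable_clippedMean hu τ n).comp measurable_fst).prodMk measurable_snd)
  have hmp : MeasurePreserving Φ (P.prod ν) Q := ⟨hΦm, (bind_laplaceKernel _ b P).symm⟩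
  have hΦe : ∀ p, Φ p a - μ = X p.1 + b * p.2 a := fun p => by
    rw [← hXe]; simp only [hΦ]; ring
  have l1 : MemLp (fun p : (Fin n → ℝ × unitInterval) × (ι → ℝ) => X p.1) 2 (P.prod ν) :=
    hXL.comp_measurePreserving measurePreserving_fst
  have l2 : MemLp (fun p : (Fin n → ℝ × unitInterval) × (ι → ℝ) => b * p.2 a) 2 (P.prod ν) :=
    (hwL.comp_measurePreserving measurePreserving_snd).const_mul b
  have hm : Measurable fun t : ι → ℝ => t a - μ := by fun_prop
  refine ⟨?_, ?_, ?_⟩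
  · rw [← hmp.map_eq, memLp_map_measure_iff hm.aestronglyMeasurable hΦm.aemeasurable]
    have : (fun t : ι → ℝ => t a - μ) ∘ Φ = fun p => X p.1 + b * p.2 a := funext hΦe
    rw [this]
    exact l1.add l2
  · rw [← hmp.map_eq, integral_map hΦm.aemeasurable hm.aestronglyMeasurable]
    simp_rw [hΦe]
    rw [integral_add (l1.integrable (by norm_num)) (l2.integrable (by norm_num)),
      integral_const_mul, integral_fun_fst, integral_fun_snd (fun w : ι → ℝ => w a), hX0, hw0]
    simp
  · rw [← hmp.map_eq, integral_map hΦm.aemeasurable (hm.pow_const 2).aestronglyMeasurable]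
    simp_rw [hΦe]
    have e : ∀ p : (Fin n → ℝ × unitInterval) × (ι → ℝ), (X p.1 + b * p.2 a) ^ 2
        = X p.1 ^ 2 + 2 * b * (X p.1 * p.2 a) + b ^ 2 * p.2 a ^ 2 := fun p => by ring
    simp_rw [e]
    have j1 : Integrable (fun p : (Fin n → ℝ × unitInterval) × (ι → ℝ) => X p.1 ^ 2) (P.prod ν) :=
      l1.integrable_sq
    have j2 : Integrable (fun p : (Fin n → ℝ × unitInterval) × (ι → ℝ) =>
        2 * b * (X p.1 * p.2 a)) (P.prod ν) :=
      ((hXL.integrable (by norm_num)).mul_prod (hwL.integrable (by norm_num))).const_mul _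
    have j3 : Integrable (fun p : (Fin n → ℝ × unitInterval) × (ι → ℝ) =>
        b ^ 2 * p.2 a ^ 2) (P.prod ν) :=
      ((hwL.comp_measurePreserving measurePreserving_snd).integrable_sq).const_mul _
    have j12 : Integrable (fun p : (Fin n → ℝ × unitInterval) × (ι → ℝ) =>
        X p.1 ^ 2 + 2 * b * (X p.1 * p.2 a)) (P.prod ν) := j1.add j2
    rw [integral_add j12 j3, integral_add j1 j2, integral_const_mul, integral_const_mul,
      integral_prod_mul X fun w : ι → ℝ => w a, hX0, integral_fun_fst (fun z => X z ^ 2),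
      integral_fun_snd (fun w : ι → ℝ => w a ^ 2), hw2]
    simp only [probReal_univ, smul_eq_mul, one_mul, zero_mul, mul_zero, add_zero]
    linarith

/-- For weights `w` adding up to one there is a private protocol that estimates the functionals
`∫ f u_a` of a bounded regression function with mean squared errors given by the squared truncation
bias, the sampling variance and the variance of the privacy noise. -/
lemma exists_private_estimator (hu : ∀ a, Continuous (u a)) {S : ℝ} (hS : 0 < S)
    (huS : ∀ x, ∑ a, |u a x| ≤ S) {v : ι → unitInterval → ℝ} (hv : ∀ a, Continuous (v a))
    {m : ℕ} {n : Fin m → ℕ} (hn : ∀ j, 1 ≤ n j) {ε δ : Fin m → ℝ} (hε : ∀ j, 0 < ε j)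
    (w : Fin m → ℝ) (hw : ∑ j, w j = 1) {B : ℝ} {r : ℝ} (hr : 1 ≤ r) (hB0 : 0 ≤ B) :
    ∃ (P : Protocol n ε δ) (θ : (Fin m → P.T) → ι → ℝ), Measurable θ ∧
      (∀ t x, P.est t x = ∑ a, θ t a * v a x) ∧
      ∀ f : unitInterval → ℝ, Continuous f → (∀ x, |f x| ≤ B) → ∀ a,
        ∫⁻ t, ENNReal.ofReal ((θ t a - ∫ x, f x * u a x) ^ 2) ∂P.transcriptLaw f
          ≤ ENNReal.ofReal (2 * ∑ j, w j ^ 2 * ((B ^ 2 + 1) * (∫ x, u a x ^ 2) / n j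
              + 2 * (2 * (B + r) * S / (n j * ε j)) ^ 2)
            + 2 * ((2 * Real.exp (-r ^ 2 / 2)) ^ 2 * ∫ x, u a x ^ 2)) := by
  have hτ : 0 < B + r := by linarith
  set K : ∀ j, Kernel (Fin (n j) → ℝ × unitInterval) (ι → ℝ) := fun j =>
    laplaceKernel (clippedMean u (B + r) (n j)) (measurable_clippedMean hu (B + r) (n j))
      (2 * (B + r) * S / (n j * ε j)) with hK
  have hθm : Measurable fun (t : Fin m → ι → ℝ) (a : ι) => ∑ j, w j * t j a :=
    measurable_pi_iff.2 fun a => Finset.measurable_sum _ fun j _ => by fun_prop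
  refine ⟨{ T := ι → ℝ
            K := K
            isDP := fun j => isDP_clippedMean hu hS huS hτ (hn j) (hε j)
            est := fun t x => ∑ a, (∑ j, w j * t j a) * v a x
            measurable_est := ?_ }, fun t a => ∑ j, w j * t j a, hθm, fun t x => rfl, ?_⟩
  · refine Finset.measurable_sum _ fun a _ => Measurable.mul ?_ ?_
    · exact ((measurable_pi_apply a).comp hθm).comp measurable_fst
    · exact (hv a).measurable.comp measurable_snd
  · intro f hf hB a
    change ∫⁻ t, _ ∂(Measure.pi fun j =>
      (Measure.pi fun _ : Fin (n j) => regressionLaw f).bind (K j)) ≤ _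
    have := isProbabilityMeasure_regressionLaw hf.measurable
    set Q : Fin m → Measure (ι → ℝ) := fun j =>
      (Measure.pi fun _ : Fin (n j) => regressionLaw f).bind (K j) with hQ
    set μ := ∫ z, clip (B + r) z.1 * u a z.2 ∂regressionLaw f with hμ
    -- The bias that is caused by clipping.
    set β := μ - ∫ x, f x * u a x with hβ
    have hmom := fun j => transcript_moments hu hf hB hτ.le (hn j)
      (2 * (B + r) * S / (n j * ε j)) a
    have hQp : ∀ j, IsProbabilityMeasure (Q j) := fun j => by
      rw [hQ]; simp only [hK]; infer_instance
    set g : ∀ _ : Fin m, (ι → ℝ) → ℝ := fun j t => w j * (t a - μ) with hg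
    have hgL : ∀ j, MemLp (g j) 2 (Q j) := fun j => (hmom j).1.const_mul (w j)
    have hg0 : ∀ j, ∫ t, g j t ∂Q j = 0 := fun j => by
      simp only [hg]
      rw [integral_const_mul]
      exact mul_eq_zero_of_right _ (hmom j).2.1
    have hsum := integral_sq_sum_pi Q g hgL hg0
    have hGL : MemLp (fun t : Fin m → ι → ℝ => ∑ j, g j (t j)) 2 (Measure.pi Q) :=
      memLp_finsetSum _ fun j _ => (hgL j).comp_measurePreserving (measurePreserving_eval Q j)
    have hpt : ∀ t : Fin m → ι → ℝ, (∑ j, w j * t j a - ∫ x, f x * u a x) ^ 2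
        ≤ 2 * (∑ j, g j (t j)) ^ 2 + 2 * β ^ 2 := fun t => by
      have e : ∑ j, w j * t j a - ∫ x, f x * u a x = (∑ j, g j (t j)) + β := by
        simp only [hg, mul_sub, Finset.sum_sub_distrib, ← Finset.sum_mul, hw, hβ]
        ring
      rw [e]
      nlinarith [sq_nonneg ((∑ j, g j (t j)) - β)]
    have i1 : Integrable (fun t : Fin m → ι → ℝ => 2 * (∑ j, g j (t j)) ^ 2 + 2 * β ^ 2)
        (Measure.pi Q) := (hGL.integrable_sq.const_mul 2).add (integrable_const _)
    calc ∫⁻ t, ENNReal.ofReal ((∑ j, w j * t j a - ∫ x, f x * u a x) ^ 2) ∂Measure.pi Q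
        ≤ ∫⁻ t, ENNReal.ofReal (2 * (∑ j, g j (t j)) ^ 2 + 2 * β ^ 2) ∂Measure.pi Q :=
          lintegral_mono fun t => ENNReal.ofReal_le_ofReal (hpt t)
      _ = ENNReal.ofReal (∫ t, (2 * (∑ j, g j (t j)) ^ 2 + 2 * β ^ 2) ∂Measure.pi Q) :=
          (ofReal_integral_eq_lintegral_ofReal i1 (ae_of_all _ fun t => by positivity)).symm
      _ ≤ _ := by
          refine ENNReal.ofReal_le_ofReal ?_
          rw [integral_add (hGL.integrable_sq.const_mul 2) (integrable_const _),
            integral_const_mul, hsum]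
          simp only [integral_const, probReal_univ, smul_eq_mul, one_mul]
          refine add_le_add (mul_le_mul_of_nonneg_left (Finset.sum_le_sum fun j _ => ?_)
            (by norm_num)) (mul_le_mul_of_nonneg_left ?_ (by norm_num))
          · simp only [hg, mul_pow]
            rw [integral_const_mul]
            exact mul_le_mul_of_nonneg_left
              (by simpa only [mul_pow] using (hmom j).2.2) (sq_nonneg _)
          · exact clip_bias_sq_le hf hB (hu a) hr

end privateEstimator

/-! ### Upper bounds for the minimax risks -/

/-- Weighting the servers by `min (n, n² ε² / D')`, the inverse variances of their transcripts,
balances sampling error and privacy noise. -/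
lemma exists_weights {γ : ℝ} {m : ℕ} {n : Fin m → ℕ} {ε : Fin m → ℝ} {D D' : ℝ}
    (hn : ∀ j, 1 ≤ n j) (hε : ∀ j, 0 < ε j) (hD : SolvesDimensionEq γ n ε D) (hDD : D ≤ D') :
    ∃ w : Fin m → ℝ, ∑ j, w j = 1 ∧
      ∑ j, w j ^ 2 / n j ≤ D' / D ^ (2 * γ + 2) ∧
      ∑ j, w j ^ 2 * (D' / ((n j : ℝ) ^ 2 * ε j ^ 2)) ≤ D' / D ^ (2 * γ + 2) := by
  have hD0 := hD.1
  have hD'0 : 0 < D' := hD0.trans_le hDD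
  have hn0 : ∀ j, (0 : ℝ) < n j := fun j => by exact_mod_cast hn j
  set v : Fin m → ℝ := fun j => min (n j : ℝ) ((n j : ℝ) ^ 2 * ε j ^ 2 / D') with hv
  have hv0 : ∀ j, 0 < v j := fun j =>
    lt_min (hn0 j) (div_pos (mul_pos (pow_pos (hn0 j) 2) (pow_pos (hε j) 2)) hD'0)
  set V := ∑ j, v j with hV
  have hpow : 0 < D ^ (2 * γ + 2) := Real.rpow_pos_of_pos hD0 _
  have hVD : D ^ (2 * γ + 2) ≤ D' * V := by
    rw [hD.2, hV, Finset.mul_sum]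
    refine Finset.sum_le_sum fun j _ => ?_
    rw [hv, mul_min_of_nonneg _ _ hD'0.le, mul_div_cancel₀ _ hD'0.ne', min_comm]
    exact min_le_min_right _ (by rw [mul_comm]; exact mul_le_mul_of_nonneg_right hDD (hn0 j).le)
  have hV0 : 0 < V := by
    by_contra h
    push Not at h
    nlinarith
  have hV1 : 1 / V ≤ D' / D ^ (2 * γ + 2) := by
    rw [div_le_div_iff₀ hV0 hpow]; linarith
  have key : ∀ y : Fin m → ℝ, (∀ j, 0 ≤ y j) → (∀ j, v j * y j ≤ 1) →
      ∑ j, (v j / V) ^ 2 * y j ≤ D' / D ^ (2 * γ + 2) := fun y hy0 hy => by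
    refine le_trans ?_ hV1
    calc ∑ j, (v j / V) ^ 2 * y j ≤ ∑ j, v j / V ^ 2 := Finset.sum_le_sum fun j _ => by
          have : (v j / V) ^ 2 * y j = v j / V ^ 2 * (v j * y j) := by ring
          rw [this]
          exact mul_le_of_le_one_right (div_nonneg (hv0 j).le (by positivity)) (hy j)
      _ = 1 / V := by rw [← Finset.sum_div, ← hV]; field_simp
  refine ⟨fun j => v j / V, ?_, ?_, ?_⟩
  · rw [← Finset.sum_div, ← hV, div_self hV0.ne']
  · have := key (fun j => 1 / n j) (fun j => by have := hn0 j; positivity) fun j => by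
      rw [mul_one_div, div_le_one (hn0 j)]
      exact min_le_left _ _
    simpa only [mul_one_div] using this
  · refine key _ (fun j => by have := hn0 j; positivity) fun j => ?_
    have hp : 0 < (n j : ℝ) ^ 2 * ε j ^ 2 := mul_pos (pow_pos (hn0 j) 2) (pow_pos (hε j) 2)
    have h1 : v j ≤ (n j : ℝ) ^ 2 * ε j ^ 2 / D' := min_le_right _ _
    calc v j * (D' / ((n j : ℝ) ^ 2 * ε j ^ 2))
        ≤ ((n j : ℝ) ^ 2 * ε j ^ 2 / D') * (D' / ((n j : ℝ) ^ 2 * ε j ^ 2)) := by gcongr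
      _ = 1 := by
        have h2 := hn0 j
        have h3 := hε j
        field_simp

lemma half_le_log_of_two_le {N : ℕ} (hN : 2 ≤ N) : 1 / 2 ≤ Real.log N := by
  have h1 := Real.log_two_gt_d9
  have h2 : Real.log 2 ≤ Real.log N := Real.log_le_log (by norm_num) (by exact_mod_cast hN)
  linarith

/-- The solution of the dimension equation satisfies `D ^ (2γ + 1) ≤ N`. -/
lemma SolvesDimensionEq.rpow_le {γ : ℝ} {m : ℕ} {n : Fin m → ℕ} {ε : Fin m → ℝ} {D : ℝ}
    (hD : SolvesDimensionEq γ n ε D) : D ^ (2 * γ + 2) ≤ ((∑ j, n j : ℕ) : ℝ) * D := by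
  rw [hD.2, Nat.cast_sum, Finset.sum_mul]
  exact Finset.sum_le_sum fun j _ => min_le_right _ _

/-- The rate of the private estimator. The functionals `∫ f u_a` are described by a bound `U` on
`∫ u_a²` and by their joint sensitivity `S`. -/
lemma exists_private_estimator_rate (B s₀ : ℝ) (hB0 : 0 ≤ B) (hs₀ : 0 ≤ s₀) :
    ∃ C₁ : ℝ, 0 < C₁ ∧ ∀ {ι : Type} [Fintype ι] (u v : ι → unitInterval → ℝ) (S U : ℝ),
      (∀ a, Continuous (u a)) → (∀ a, Continuous (v a)) → 0 < S → (∀ x, ∑ a, |u a x| ≤ S) →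
      (∀ a, ∫ x, u a x ^ 2 ≤ U) →
      ∀ {γ : ℝ} {m : ℕ} {n : Fin m → ℕ} {ε δ : Fin m → ℝ} {D D' : ℝ}, (∀ j, 1 ≤ n j) →
      2 ≤ ∑ j, n j → (∀ j, 0 < ε j) → SolvesDimensionEq γ n ε D → D ≤ D' → S ^ 2 ≤ s₀ * D' * U →
      ∃ (P : Protocol n ε δ) (θ : (Fin m → P.T) → ι → ℝ), Measurable θ ∧
        (∀ t x, P.est t x = ∑ a, θ t a * v a x) ∧
        ∀ f : unitInterval → ℝ, Continuous f → (∀ x, |f x| ≤ B) → ∀ a,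
          ∫⁻ t, ENNReal.ofReal ((θ t a - ∫ x, f x * u a x) ^ 2) ∂P.transcriptLaw f
            ≤ ENNReal.ofReal (C₁ * U * Real.log ((∑ j, n j : ℕ) : ℝ)
                * (D' / D ^ (2 * γ + 2))) := by
  refine ⟨4 * (B ^ 2 + 1) + 16 * s₀ * (4 * B ^ 2 + 8) + 16, by positivity, ?_⟩
  intro ι _ u v S U hu hv hS huS hU γ m n ε δ D D' hn hN hε hD hDD hSU
  obtain ⟨w, hw1, hw2, hw3⟩ := exists_weights hn hε hD hDD
  set N := ∑ j, n j with hNdef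
  have hN0 : (0 : ℝ) < N := by exact_mod_cast (by omega : 0 < N)
  have hlog := half_le_log_of_two_le hN
  set ℓ := Real.log (N : ℝ) with hℓ
  set r := 2 * √ℓ with hr
  have hr2 : r ^ 2 = 4 * ℓ := by rw [hr, mul_pow, Real.sq_sqrt (by linarith)]; norm_num
  have hr1 : 1 ≤ r := by
    have h0 : 0 ≤ r := by positivity
    nlinarith
  obtain ⟨P, θ, hθ, hest, hmse⟩ := exists_private_estimator (δ := δ) hu hS huS hv hn hε w hw1 hr1
    (r := r) hB0
  refine ⟨P, θ, hθ, hest, fun f hf hfB a => (hmse f hf hfB a).trans (ENNReal.ofReal_le_ofReal ?_)⟩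
  have hD0 := hD.1
  have hD'0 : 0 < D' := hD0.trans_le hDD
  have hpow : 0 < D ^ (2 * γ + 2) := Real.rpow_pos_of_pos hD0 _
  have hU0 : 0 ≤ U := (integral_nonneg fun x => sq_nonneg _).trans (hU a)
  set ρ := D' / D ^ (2 * γ + 2) with hρ
  have hρ0 : 0 ≤ ρ := by positivity
  have hNρ : 1 / (N : ℝ) ≤ ρ := by
    rw [hρ, div_le_div_iff₀ hN0 hpow]
    have := hD.rpow_le
    nlinarith
  have hexp : (2 * Real.exp (-r ^ 2 / 2)) ^ 2 ≤ 4 * ρ := by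
    have h1 : Real.exp (-r ^ 2 / 2) ≤ 1 / N := by
      rw [hr2, one_div, ← Real.exp_log hN0, ← Real.exp_neg, ← hℓ]
      exact Real.exp_le_exp.2 (by linarith)
    have h2 : Real.exp (-r ^ 2 / 2) ≤ 1 := Real.exp_le_one_iff.2 (by nlinarith [sq_nonneg r])
    have h3 := Real.exp_pos (-r ^ 2 / 2)
    rw [mul_pow]
    nlinarith
  have hBr : (B + r) ^ 2 ≤ (4 * B ^ 2 + 8) * ℓ := by
    have h1 : (B + r) ^ 2 ≤ 2 * B ^ 2 + 2 * r ^ 2 := by nlinarith [sq_nonneg (B - r)]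
    rw [hr2] at h1
    nlinarith [sq_nonneg B]
  have hsum : ∑ j, w j ^ 2 * ((B ^ 2 + 1) * (∫ x, u a x ^ 2) / n j
      + 2 * (2 * (B + r) * S / (n j * ε j)) ^ 2)
      ≤ (B ^ 2 + 1) * U * ρ + 8 * (B + r) ^ 2 * (s₀ * U) * ρ := by
    have h1 : ∀ j, w j ^ 2 * ((B ^ 2 + 1) * (∫ x, u a x ^ 2) / n j
        + 2 * (2 * (B + r) * S / (n j * ε j)) ^ 2) ≤ (B ^ 2 + 1) * U * (w j ^ 2 / n j)
        + 8 * (B + r) ^ 2 * (s₀ * U) * (w j ^ 2 * (D' / ((n j : ℝ) ^ 2 * ε j ^ 2))) := fun j => by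
      have hnj : (0 : ℝ) < n j := by exact_mod_cast hn j
      have hεj := hε j
      rw [mul_add]
      refine add_le_add ?_ ?_
      · calc w j ^ 2 * ((B ^ 2 + 1) * (∫ x, u a x ^ 2) / n j)
            = (B ^ 2 + 1) * (∫ x, u a x ^ 2) * (w j ^ 2 / n j) := by ring
          _ ≤ _ := by gcongr; exact hU a
      · calc w j ^ 2 * (2 * (2 * (B + r) * S / (n j * ε j)) ^ 2)
            = 8 * (B + r) ^ 2 * (w j ^ 2 / ((n j : ℝ) ^ 2 * ε j ^ 2)) * S ^ 2 := by
              field_simp; ring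
          _ ≤ 8 * (B + r) ^ 2 * (w j ^ 2 / ((n j : ℝ) ^ 2 * ε j ^ 2)) * (s₀ * D' * U) := by gcongr
          _ = _ := by ring
    refine (Finset.sum_le_sum fun j _ => h1 j).trans ?_
    rw [Finset.sum_add_distrib, ← Finset.mul_sum, ← Finset.mul_sum]
    gcongr
  have hUρ : 0 ≤ U * ρ := mul_nonneg hU0 hρ0
  have e1 : (B ^ 2 + 1) * U * ρ ≤ 2 * (B ^ 2 + 1) * (U * ℓ * ρ) := by
    have : (B ^ 2 + 1) * (U * ρ) * 1 ≤ (B ^ 2 + 1) * (U * ρ) * (2 * ℓ) := by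
      gcongr; linarith
    linarith
  have e2 : 8 * (B + r) ^ 2 * (s₀ * U) * ρ ≤ 8 * s₀ * (4 * B ^ 2 + 8) * (U * ℓ * ρ) := by
    calc 8 * (B + r) ^ 2 * (s₀ * U) * ρ = 8 * s₀ * (U * ρ) * (B + r) ^ 2 := by ring
      _ ≤ 8 * s₀ * (U * ρ) * ((4 * B ^ 2 + 8) * ℓ) := by gcongr
      _ = _ := by ring
  have e3 : (2 * Real.exp (-r ^ 2 / 2)) ^ 2 * ∫ x, u a x ^ 2 ≤ 8 * (U * ℓ * ρ) := by
    calc _ ≤ 4 * ρ * U := by gcongr; exact hU a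
      _ = 4 * (U * ρ) * 1 := by ring
      _ ≤ 4 * (U * ρ) * (2 * ℓ) := by gcongr; linarith
      _ = _ := by ring
  calc _ ≤ 2 * ((B ^ 2 + 1) * U * ρ + 8 * (B + r) ^ 2 * (s₀ * U) * ρ)
        + 2 * ((2 * Real.exp (-r ^ 2 / 2)) ^ 2 * ∫ x, u a x ^ 2) := by gcongr
    _ ≤ 2 * (2 * (B ^ 2 + 1) * (U * ℓ * ρ) + 8 * s₀ * (4 * B ^ 2 + 8) * (U * ℓ * ρ))
        + 2 * (8 * (U * ℓ * ρ)) := by gcongr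
    _ = _ := by ring

/-- The protocol that reveals nothing and estimates the regression function by zero. -/
def zeroProtocol {m : ℕ} (n : Fin m → ℕ) (ε δ : Fin m → ℝ) (hε : ∀ j, 0 < ε j) :
    Protocol n ε δ where
  T := Unit
  K := fun _ => Kernel.const _ (Measure.dirac ())
  isDP := fun j z z' _ A _ => by
    simp only [Kernel.const_apply]
    refine le_add_of_le_left (le_mul_of_one_le_left (by positivity) ?_)
    rw [← ENNReal.ofReal_one]
    exact ENNReal.ofReal_le_ofReal (Real.one_le_exp (hε j).le)
  est := fun _ _ => 0
  measurable_est := measurable_const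

/-- The dyadic resolution level belonging to the dimension `D`. -/
lemma exists_scale_near (W : WaveletSystem) {D : ℝ} (hD : 1 ≤ D) :
    ∃ J : ℕ, D ≤ W.scale J ∧ W.scale J ≤ 2 ^ (W.l₀ + 1) * D := by
  obtain ⟨k, hk1, hk2⟩ := exists_nat_pow_near hD (one_lt_two (α := ℝ))
  refine ⟨k + 1, ?_, ?_⟩
  · refine hk2.le.trans ?_
    unfold WaveletSystem.scale
    exact pow_le_pow_right₀ (by norm_num) (by omega)
  · unfold WaveletSystem.scale
    calc (2 : ℝ) ^ (W.l₀ + (k + 1)) = 2 ^ (W.l₀ + 1) * 2 ^ k := by ring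
      _ ≤ _ := by gcongr

lemma WaveletSystem.sum_scale_le (W : WaveletSystem) (J : ℕ) :
    ∑ i ∈ Finset.range J, W.scale i ≤ W.scale J := by
  induction J with
  | zero => simpa using (W.scale_pos 0).le
  | succ J ih =>
    have : W.scale (J + 1) = 2 * W.scale J := by unfold WaveletSystem.scale; ring
    rw [Finset.sum_range_succ, this]
    linarith

lemma WaveletSystem.sum_sqrt_scale_le (W : WaveletSystem) (J : ℕ) :
    ∑ i ∈ Finset.range J, √(W.scale i) ≤ 4 * √(W.scale J) := by
  induction J with
  | zero => simp
  | succ J ih =>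
    have h1 : W.scale (J + 1) = 2 * W.scale J := by unfold WaveletSystem.scale; ring
    have h2 : (5 / 4 : ℝ) ≤ √2 := Real.le_sqrt_of_sq_le (by norm_num)
    rw [Finset.sum_range_succ, h1, Real.sqrt_mul (by norm_num)]
    nlinarith [Real.sqrt_nonneg (W.scale J)]

lemma Protocol.transcriptLaw_congr {m : ℕ} {n : Fin m → ℕ} {ε δ : Fin m → ℝ}
    (P : Protocol n ε δ) {f g : unitInterval → ℝ} (h : f =ᵐ[volume] g) :
    P.transcriptLaw f = P.transcriptLaw g := by
  rw [Protocol.transcriptLaw, Protocol.transcriptLaw, regressionLaw_congr h]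

lemma Protocol.isProbabilityMeasure_transcriptLaw {m : ℕ} {n : Fin m → ℕ} {ε δ : Fin m → ℝ}
    (P : Protocol n ε δ) {f : unitInterval → ℝ} (hf : Measurable f) :
    IsProbabilityMeasure (P.transcriptLaw f) := by
  have := isProbabilityMeasure_regressionLaw hf
  unfold Protocol.transcriptLaw
  infer_instance

lemma Protocol.globalRisk_congr {m : ℕ} {n : Fin m → ℕ} {ε δ : Fin m → ℝ}
    (P : Protocol n ε δ) {f g : unitInterval → ℝ} (h : f =ᵐ[volume] g) :
    P.globalRisk f = P.globalRisk g := by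
  rw [Protocol.globalRisk, Protocol.globalRisk, P.transcriptLaw_congr h]
  refine lintegral_congr fun t => lintegral_congr_ae ?_
  filter_upwards [h] with x hx
  rw [hx]

section upper

variable {W : WaveletSystem} {A : ℕ} {α R : ℝ} {p q : ℝ≥0∞}

/-- The exponents of the rate: `D'` functionals with variance `D' / D ^ (2 γ + 2)` each cost as
much, up to constants, as the squared bias `D' ^ (- 2 γ)`. -/
lemma rate_arith {γ c D D' : ℝ} (hγ : 0 < γ) (hD : 0 < D) (hDD : D ≤ D') (hDc : D' ≤ c * D) :
    D' * (D' / D ^ (2 * γ + 2)) ≤ c ^ 2 * D ^ (-2 * γ) ∧ D' ^ (-(2 * γ)) ≤ D ^ (-2 * γ) := by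
  have hpow : 0 < D ^ (2 * γ + 2) := Real.rpow_pos_of_pos hD _
  constructor
  · rw [← mul_div_assoc, div_le_iff₀ hpow, mul_assoc, ← Real.rpow_add hD]
    have : -2 * γ + (2 * γ + 2) = ((2 : ℕ) : ℝ) := by push_cast; ring
    rw [this, Real.rpow_natCast, ← mul_pow, ← sq]
    have h0 : 0 ≤ D' := hD.le.trans hDD
    gcongr
  · rw [neg_mul]
    exact Real.rpow_le_rpow_of_nonpos hD hDD (by linarith)

/-- The pointwise minimax risk is at most of the order `log N · D ^ (- 2 ν)`. -/
lemma pointwiseMinimaxRisk_le (hW : W.IsRegularBasis A) (hR : 0 < R) (hp : 2 ≤ p) (hq : 1 ≤ q)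
    (hν : 0 < α - (p⁻¹).toReal) :
    ∃ C : ℝ, 0 < C ∧ ∀ (x₀ : unitInterval) (m : ℕ) (n : Fin m → ℕ) (ε δ : Fin m → ℝ) (D : ℝ),
      (∀ j, 1 ≤ n j) → 2 ≤ ∑ j, n j → (∀ j, 0 < ε j) →
      SolvesDimensionEq (α - (p⁻¹).toReal) n ε D →
      pointwiseMinimaxRisk n ε δ x₀ (besovBall W α p q R) ≤ ENNReal.ofReal C ∧
      pointwiseMinimaxRisk n ε δ x₀ (besovBall W α p q R) ≤ ENNReal.ofReal
        (C * Real.log ((∑ j, n j : ℕ) : ℝ) * D ^ (-2 * (α - (p⁻¹).toReal))) := by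
  obtain ⟨B, hB0, happ⟩ := besovBall_approx hW hR hp hq hν
  obtain ⟨K, hK⟩ := hW.exists_localized
  have hK0 : 0 < K := zero_lt_one.trans_le hK.one_le
  obtain ⟨C₁, hC₁, hest⟩ := exists_private_estimator_rate B (K ^ 2) hB0.le (by positivity)
  set ν := α - (p⁻¹).toReal
  set c : ℝ := 2 ^ (W.l₀ + 1)
  set C := 2 * B ^ 2 + 2 * (C₁ * K ^ 2 * c ^ 2) + 4 * B ^ 2 with hC
  have hball : ∀ f ∈ besovBall W α p q R, Continuous f → (∀ x, |f x| ≤ B) ∧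
      ∀ J, ∀ x : unitInterval, |f x - W.combo (Finset.range J) (W.coeff f) x|
        ≤ B * W.scale J ^ (-ν) := fun f hf hfc => by
    obtain ⟨g, hg, hfg, hgB, hgJ, -⟩ := happ f hf
    rw [eq_of_ae_eq_unitInterval hfc hg hfg] at *
    exact ⟨hgB, hgJ⟩
  refine ⟨C, by positivity, fun x₀ m n ε δ D hn hN hε hD => ?_⟩
  have hlog := half_le_log_of_two_le hN
  set ℓ := Real.log ((∑ j, n j : ℕ) : ℝ)
  have hD0 := hD.1
  have htriv : pointwiseMinimaxRisk n ε δ x₀ (besovBall W α p q R) ≤ ENNReal.ofReal (B ^ 2) := by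
    refine iInf_le_of_le (zeroProtocol n ε δ hε) (iSup₂_le fun f hf => ?_)
    have := (zeroProtocol n ε δ hε).isProbabilityMeasure_transcriptLaw hf.2.measurable
    calc (zeroProtocol n ε δ hε).pointwiseRisk x₀ f
        ≤ ∫⁻ _, ENNReal.ofReal (B ^ 2) ∂(zeroProtocol n ε δ hε).transcriptLaw f := by
          refine lintegral_mono fun t => ENNReal.ofReal_le_ofReal ?_
          change (0 - f x₀) ^ 2 ≤ B ^ 2
          rw [zero_sub, neg_sq]
          exact sq_le_sq' (by linarith [(abs_le.1 ((hball f hf.1 hf.2).1 x₀)).1])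
            (abs_le.1 ((hball f hf.1 hf.2).1 x₀)).2
      _ = _ := by rw [lintegral_const, measure_univ, mul_one]
  have hpos : 0 ≤ C₁ * K ^ 2 * c ^ 2 := by positivity
  refine ⟨htriv.trans (ENNReal.ofReal_le_ofReal (by rw [hC]; nlinarith [sq_nonneg B])), ?_⟩
  -- For `D < 1` the claimed rate is not smaller than a constant.
  rcases lt_or_ge D 1 with hD1 | hD1
  · refine htriv.trans (ENNReal.ofReal_le_ofReal ?_)
    have h1 : 1 ≤ D ^ (-2 * ν) :=
      Real.one_le_rpow_of_pos_of_le_one_of_nonpos hD0 hD1.le (by nlinarith)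
    calc B ^ 2 = (2 * B ^ 2) * (1 / 2) * 1 := by ring
      _ ≤ C * ℓ * D ^ (-2 * ν) := by
        gcongr
        rw [hC]; nlinarith [sq_nonneg B]
  obtain ⟨J, hJ1, hJ2⟩ := exists_scale_near W hD1
  obtain ⟨r1, r2⟩ := rate_arith hν hD0 hJ1 hJ2
  set D' := W.scale J with hD'
  have hD'0 : 0 < D' := W.scale_pos J
  set b : ℕ → ℕ → ℝ := fun i k => W.fn i k x₀
  -- The single functional to be estimated is the value at `x₀` of the truncated series of `f`; it
  -- is represented by the reproducing kernel of the retained levels.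
  set u : Unit → unitInterval → ℝ := fun _ x => W.combo (Finset.range J) b x with hu
  have huS : ∀ x, ∑ a, |u a x| ≤ K ^ 2 * D' := fun x => by
    simp only [hu, Finset.univ_unique, Finset.sum_singleton, WaveletSystem.combo]
    calc _ ≤ ∑ i ∈ Finset.range J, |∑ k : Fin (W.count i), b i k * W.fn i k x| :=
          Finset.abs_sum_le_sum_abs _ _
      _ ≤ ∑ i ∈ Finset.range J, K ^ 2 * W.scale i := Finset.sum_le_sum fun i _ => by
          refine (hK.abs_level_le (fun k => hK.abs_fn_le i k x₀) x).trans (le_of_eq ?_)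
          rw [mul_assoc K (√_), Real.mul_self_sqrt (W.scale_pos i).le]; ring
      _ ≤ K ^ 2 * D' := by
          rw [← Finset.mul_sum]
          exact mul_le_mul_of_nonneg_left (W.sum_scale_le J) (by positivity)
  have huU : ∀ a, ∫ x, u a x ^ 2 ≤ K ^ 2 * D' := fun a => by
    simp only [hu]
    rw [hW.integral_combo_sq]
    calc _ ≤ ∑ i ∈ Finset.range J, K ^ 2 * W.scale i :=
          Finset.sum_le_sum fun i _ => hK.sum_sq_le i x₀
      _ ≤ K ^ 2 * D' := by
          rw [← Finset.mul_sum]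
          exact mul_le_mul_of_nonneg_left (W.sum_scale_le J) (by positivity)
  obtain ⟨P, θ, hθm, hPest, hP⟩ := hest (δ := δ) u (fun _ _ => 1) (K ^ 2 * D') (K ^ 2 * D')
    (fun _ => (hW.continuous_combo _ _).comp continuous_subtype_val) (fun _ => continuous_const)
    (by positivity) huS huU hn hN hε hD hJ1 (by nlinarith)
  refine iInf_le_of_le P (iSup₂_le fun f hf => ?_)
  obtain ⟨hfB, hfJ⟩ := hball f hf.1 hf.2
  have hfu : ∫ x, f x * u () x = W.combo (Finset.range J) (W.coeff f) x₀ := by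
    simp only [hu]
    rw [hW.integral_mul_combo hf.1.1, WaveletSystem.combo]
    refine Finset.sum_congr rfl fun i _ => Finset.sum_congr rfl fun k _ => ?_
    simp only [b]; ring
  have hPf := hP f hf.2 hfB ()
  rw [hfu] at hPf
  have hprob := P.isProbabilityMeasure_transcriptLaw hf.2.measurable
  calc P.pointwiseRisk x₀ f
      ≤ ∫⁻ t, (2 * ENNReal.ofReal ((θ t () - W.combo (Finset.range J) (W.coeff f) x₀) ^ 2)
          + ENNReal.ofReal (2 * (B * D' ^ (-ν)) ^ 2)) ∂P.transcriptLaw f := by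
        refine lintegral_mono fun t => ?_
        rw [hPest]
        simp only [Finset.univ_unique, Finset.sum_singleton, mul_one]
        rw [show (2 : ℝ≥0∞) = ENNReal.ofReal 2 by simp, ← ENNReal.ofReal_mul (by norm_num),
          ← ENNReal.ofReal_add (by positivity) (by positivity)]
        refine ENNReal.ofReal_le_ofReal ?_
        have h1 := hfJ J x₀
        have h2 : (f x₀ - W.combo (Finset.range J) (W.coeff f) x₀) ^ 2 ≤ (B * D' ^ (-ν)) ^ 2 :=
          sq_le_sq' (by linarith [(abs_le.1 h1).1]) (abs_le.1 h1).2
        change (θ t () - f x₀) ^ 2 ≤ _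
        set y := W.combo (Finset.range J) (W.coeff f) x₀
        nlinarith [sq_nonneg (θ t () - y + (f x₀ - y))]
    _ = 2 * (∫⁻ t, ENNReal.ofReal ((θ t () - W.combo (Finset.range J) (W.coeff f) x₀) ^ 2)
          ∂P.transcriptLaw f) + ENNReal.ofReal (2 * (B * D' ^ (-ν)) ^ 2) := by
        rw [lintegral_add_right _ measurable_const, lintegral_const_mul' _ _ (by norm_num),
          lintegral_const, measure_univ, mul_one]
    _ ≤ 2 * ENNReal.ofReal (C₁ * (K ^ 2 * D') * ℓ * (D' / D ^ (2 * ν + 2)))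
          + ENNReal.ofReal (2 * (B * D' ^ (-ν)) ^ 2) := by gcongr
    _ ≤ _ := by
        have hx : 0 ≤ D ^ (-2 * ν) := Real.rpow_nonneg hD0.le _
        have hy : 0 ≤ D' / D ^ (2 * ν + 2) := div_nonneg hD'0.le (Real.rpow_nonneg hD0.le _)
        rw [show (2 : ℝ≥0∞) = ENNReal.ofReal 2 by simp, ← ENNReal.ofReal_mul (by norm_num),
          ← ENNReal.ofReal_add (by positivity) (by positivity)]
        refine ENNReal.ofReal_le_ofReal ?_
        have h1 : (D' ^ (-ν)) ^ 2 = D' ^ (-(2 * ν)) := by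
          rw [← Real.rpow_natCast, ← Real.rpow_mul hD'0.le]; congr 1; push_cast; ring
        rw [mul_pow, h1]
        have h2 : C₁ * (K ^ 2 * D') * ℓ * (D' / D ^ (2 * ν + 2))
            ≤ C₁ * K ^ 2 * ℓ * (c ^ 2 * D ^ (-2 * ν)) := by
          calc _ = C₁ * K ^ 2 * ℓ * (D' * (D' / D ^ (2 * ν + 2))) := by ring
            _ ≤ _ := by gcongr
        have h3 : B ^ 2 * D' ^ (-(2 * ν)) ≤ 2 * B ^ 2 * ℓ * D ^ (-2 * ν) := by
          calc B ^ 2 * D' ^ (-(2 * ν)) ≤ B ^ 2 * D ^ (-2 * ν) := by gcongr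
            _ = B ^ 2 * D ^ (-2 * ν) * 1 := by ring
            _ ≤ B ^ 2 * D ^ (-2 * ν) * (2 * ℓ) := by gcongr; linarith
            _ = _ := by ring
        have h4 : 0 ≤ 2 * B ^ 2 * (ℓ * D ^ (-2 * ν)) := by positivity
        calc _ ≤ 2 * (C₁ * K ^ 2 * ℓ * (c ^ 2 * D ^ (-2 * ν)))
              + 2 * (2 * B ^ 2 * ℓ * D ^ (-2 * ν)) := by gcongr
          _ ≤ C * ℓ * D ^ (-2 * ν) := by rw [hC]; linarith

/-- The global minimax risk is at most of the order `log N · D ^ (- 2 α)`. -/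
lemma globalMinimaxRisk_le (hW : W.IsRegularBasis A) (hR : 0 < R) (hp : 2 ≤ p) (hq : 1 ≤ q)
    (hν : 0 < α - (p⁻¹).toReal) :
    ∃ C : ℝ, 0 < C ∧ ∀ (m : ℕ) (n : Fin m → ℕ) (ε δ : Fin m → ℝ) (D : ℝ),
      (∀ j, 1 ≤ n j) → 2 ≤ ∑ j, n j → (∀ j, 0 < ε j) → SolvesDimensionEq α n ε D →
      globalMinimaxRisk n ε δ (besovBall W α p q R) ≤ ENNReal.ofReal C ∧
      globalMinimaxRisk n ε δ (besovBall W α p q R) ≤ ENNReal.ofReal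
        (C * Real.log ((∑ j, n j : ℕ) : ℝ) * D ^ (-2 * α)) := by
  obtain ⟨B, hB0, happ⟩ := besovBall_approx hW hR hp hq hν
  obtain ⟨K, hK⟩ := hW.exists_localized
  have hK0 : 0 < K := zero_lt_one.trans_le hK.one_le
  obtain ⟨C₁, hC₁, hest⟩ := exists_private_estimator_rate B (16 * K ^ 2) hB0.le (by positivity)
  have hα : 0 < α := by linarith [ENNReal.toReal_nonneg (a := p⁻¹)]
  set c : ℝ := 2 ^ (W.l₀ + 1)
  set C := 2 * B ^ 2 + 4 * (C₁ * c ^ 2) + 4 * B with hC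
  refine ⟨C, by positivity, fun m n ε δ D hn hN hε hD => ?_⟩
  have hlog := half_le_log_of_two_le hN
  set ℓ := Real.log ((∑ j, n j : ℕ) : ℝ)
  have hD0 := hD.1
  have htriv : globalMinimaxRisk n ε δ (besovBall W α p q R) ≤ ENNReal.ofReal (B ^ 2) := by
    refine iInf_le_of_le (zeroProtocol n ε δ hε) (iSup₂_le fun f hf => ?_)
    obtain ⟨g, hg, hfg, hgB, -, -⟩ := happ f hf
    rw [Protocol.globalRisk_congr _ hfg]
    have := (zeroProtocol n ε δ hε).isProbabilityMeasure_transcriptLaw hg.measurable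
    calc (zeroProtocol n ε δ hε).globalRisk g
        ≤ ∫⁻ _, (∫⁻ _ : unitInterval, ENNReal.ofReal (B ^ 2) ∂volume)
            ∂(zeroProtocol n ε δ hε).transcriptLaw g := by
          refine lintegral_mono fun t => lintegral_mono fun x => ENNReal.ofReal_le_ofReal ?_
          change (0 - g x) ^ 2 ≤ B ^ 2
          rw [zero_sub, neg_sq]
          exact sq_le_sq' (by linarith [(abs_le.1 (hgB x)).1]) (abs_le.1 (hgB x)).2
      _ = _ := by
        rw [lintegral_const, lintegral_const, measure_univ, measure_univ, mul_one, mul_one]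
  have hpos : 0 ≤ C₁ * c ^ 2 := by positivity
  refine ⟨htriv.trans (ENNReal.ofReal_le_ofReal (by rw [hC]; nlinarith [sq_nonneg B])), ?_⟩
  -- For `D < 1` the claimed rate is not smaller than a constant.
  rcases lt_or_ge D 1 with hD1 | hD1
  · refine htriv.trans (ENNReal.ofReal_le_ofReal ?_)
    have h1 : 1 ≤ D ^ (-2 * α) :=
      Real.one_le_rpow_of_pos_of_le_one_of_nonpos hD0 hD1.le (by nlinarith)
    calc B ^ 2 = (2 * B ^ 2) * (1 / 2) * 1 := by ring
      _ ≤ C * ℓ * D ^ (-2 * α) := by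
        gcongr
        rw [hC]; linarith
  obtain ⟨J, hJ1, hJ2⟩ := exists_scale_near W hD1
  obtain ⟨r1, r2⟩ := rate_arith hα hD0 hJ1 hJ2
  set D' := W.scale J with hD'
  have hD'0 : 0 < D' := W.scale_pos J
  set u : (Σ i : Fin J, Fin (W.count i)) → unitInterval → ℝ := fun a x => W.fn a.1 a.2 x with hu
  have hcard : (Fintype.card (Σ i : Fin J, Fin (W.count i)) : ℝ) ≤ 2 * D' := by
    rw [Fintype.card_sigma]
    push_cast
    simp only [Fintype.card_fin]
    rw [← Finset.sum_range fun i => (W.count i : ℝ)]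
    calc _ ≤ ∑ i ∈ Finset.range J, 2 * W.scale i := Finset.sum_le_sum fun i _ => W.count_le i
      _ ≤ 2 * D' := by
        rw [← Finset.mul_sum]
        exact mul_le_mul_of_nonneg_left (W.sum_scale_le J) (by norm_num)
  -- The sum over the levels is geometric, so the sensitivity of the vector of all retained
  -- coefficients is of the order of that of the finest level alone.
  have huS : ∀ x, ∑ a, |u a x| ≤ 4 * K * √D' := fun x => by
    rw [Fintype.sum_sigma]
    simp only [hu]
    rw [← Finset.sum_range fun i => ∑ k : Fin (W.count i), |W.fn i k x|]
    calc _ ≤ ∑ i ∈ Finset.range J, K * √(W.scale i) := Finset.sum_le_sum fun i _ => hK.sum_le i x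
      _ ≤ K * (4 * √D') := by
        rw [← Finset.mul_sum]
        exact mul_le_mul_of_nonneg_left (W.sum_sqrt_scale_le J) hK0.le
      _ = _ := by ring
  have huU : ∀ a, ∫ x, u a x ^ 2 ≤ 1 := fun a => by
    have := hW.orthonormal a.1 a.2 a.1 a.2 a.2.2 a.2.2
    simp only [and_self, if_true] at this
    simp only [hu, sq]
    exact this.le
  have huc : ∀ a, Continuous (u a) := fun a => (hW.continuous_fn _ _).comp continuous_subtype_val
  obtain ⟨P, θ, hθm, hPest, hP⟩ := hest (δ := δ) u u (4 * K * √D') 1 huc huc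
    (by positivity) huS huU hn hN hε hD hJ1 (by
      rw [mul_pow, Real.sq_sqrt hD'0.le]; exact le_of_eq (by ring))
  refine iInf_le_of_le P (iSup₂_le fun f hf => ?_)
  obtain ⟨g, hg, hfg, hgB, -, hgJ⟩ := happ f hf
  rw [Protocol.globalRisk_congr _ hfg]
  have hprob := P.isProbabilityMeasure_transcriptLaw hg.measurable
  set y : ℕ → ℕ → ℝ := W.coeff g with hy
  have hcf : W.coeff f = y := by
    funext i k; exact WaveletSystem.coeff_congr_ae hfg i k
  have hgJ' := hgJ J
  rw [hcf] at hgJ'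
  have hcm : Continuous fun x : unitInterval => W.combo (Finset.range J) y x :=
    (hW.continuous_combo _ _).comp continuous_subtype_val
  have herr : ∀ t, ∫⁻ x : unitInterval, ENNReal.ofReal ((P.est t x - g x) ^ 2)
      ≤ 2 * (∑ a, ENNReal.ofReal ((θ t a - ∫ x, g x * u a x) ^ 2))
        + ENNReal.ofReal (2 * (B * D' ^ (-(2 * α)))) := fun t => by
    -- The coefficients of the estimate, extended by zero to all indices.
    set b : ℕ → ℕ → ℝ := fun i k => if h : i < J then
      if h' : k < W.count i then θ t ⟨⟨i, h⟩, ⟨k, h'⟩⟩ else 0 else 0 with hb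
    have hbθ : ∀ (i : Fin J) (k : Fin (W.count i)), b i k = θ t ⟨i, k⟩ := fun i k => by
      simp only [hb, i.2, k.2, dif_pos]
    have hestb : ∀ x, P.est t x = W.combo (Finset.range J) b x := fun x => by
      rw [hPest, Fintype.sum_sigma, WaveletSystem.combo,
        Finset.sum_range fun i => ∑ k : Fin (W.count i), b i k * W.fn i k x]
      refine Finset.sum_congr rfl fun i _ => Finset.sum_congr rfl fun k _ => ?_
      rw [hbθ]
    have hsub : ∀ x, W.combo (Finset.range J) b x - W.combo (Finset.range J) y x
        = W.combo (Finset.range J) (fun i k => b i k - y i k) x := fun x => by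
      simp only [WaveletSystem.combo, sub_mul, Finset.sum_sub_distrib]
    have hL2 : ∫ x : unitInterval, W.combo (Finset.range J) (fun i k => b i k - y i k) x ^ 2
        = ∑ a, (θ t a - ∫ x, g x * u a x) ^ 2 := by
      rw [hW.integral_combo_sq, Fintype.sum_sigma,
        Finset.sum_range fun i => ∑ k : Fin (W.count i), (b i k - y i k) ^ 2]
      refine Finset.sum_congr rfl fun i _ => Finset.sum_congr rfl fun k _ => ?_
      rw [hbθ]
      rfl
    have c1 : Continuous fun x : unitInterval =>
        W.combo (Finset.range J) (fun i k => b i k - y i k) x ^ 2 :=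
      ((hW.continuous_combo _ _).comp continuous_subtype_val).pow 2
    have c2 : Continuous fun x : unitInterval =>
        (g x - W.combo (Finset.range J) y x) ^ 2 := (hg.sub hcm).pow 2
    have j1 := (integrable_of_continuous_unitInterval c1).const_mul 2
    have j2 := (integrable_of_continuous_unitInterval c2).const_mul 2
    calc ∫⁻ x : unitInterval, ENNReal.ofReal ((P.est t x - g x) ^ 2)
        ≤ ∫⁻ x : unitInterval, ENNReal.ofReal
            (2 * W.combo (Finset.range J) (fun i k => b i k - y i k) x ^ 2
              + 2 * (g x - W.combo (Finset.range J) y x) ^ 2) := by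
          refine lintegral_mono fun x => ENNReal.ofReal_le_ofReal ?_
          rw [hestb, ← hsub]
          set s := W.combo (Finset.range J) y x
          set s' := W.combo (Finset.range J) b x
          nlinarith [sq_nonneg (s' - s + (g x - s))]
      _ = ENNReal.ofReal (∫ x : unitInterval,
            (2 * W.combo (Finset.range J) (fun i k => b i k - y i k) x ^ 2
              + 2 * (g x - W.combo (Finset.range J) y x) ^ 2)) :=
          (ofReal_integral_eq_lintegral_ofReal (j1.add j2)
            (ae_of_all _ fun x => add_nonneg (mul_nonneg zero_le_two (sq_nonneg _))
              (mul_nonneg zero_le_two (sq_nonneg _)))).symm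
      _ ≤ ENNReal.ofReal (2 * (∑ a, (θ t a - ∫ x, g x * u a x) ^ 2)
            + 2 * (B * D' ^ (-(2 * α)))) := by
          refine ENNReal.ofReal_le_ofReal ?_
          rw [integral_add j1 j2, integral_const_mul, integral_const_mul, hL2]
          gcongr
      _ = _ := by
          have : 0 ≤ D' ^ (-(2 * α)) := Real.rpow_nonneg hD'0.le _
          have hs : 0 ≤ ∑ a, (θ t a - ∫ x, g x * u a x) ^ 2 :=
            Finset.sum_nonneg fun _ _ => sq_nonneg _
          rw [ENNReal.ofReal_add (mul_nonneg zero_le_two hs)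
              (mul_nonneg zero_le_two (mul_nonneg hB0.le this)),
            ENNReal.ofReal_mul (q := ∑ a, _) zero_le_two,
            ENNReal.ofReal_sum_of_nonneg fun _ _ => sq_nonneg _, ENNReal.ofReal_ofNat]
  have hx : 0 ≤ D ^ (-2 * α) := Real.rpow_nonneg hD0.le _
  have hρ : 0 ≤ D' / D ^ (2 * α + 2) := div_nonneg hD'0.le (Real.rpow_nonneg hD0.le _)
  have hθa : ∀ a, Measurable fun t => ENNReal.ofReal ((θ t a - ∫ x, g x * u a x) ^ 2) := fun a =>
    (((measurable_pi_apply a).comp hθm).sub_const _ |>.pow_const 2).ennreal_ofReal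
  calc P.globalRisk g
      ≤ ∫⁻ t, (2 * (∑ a, ENNReal.ofReal ((θ t a - ∫ x, g x * u a x) ^ 2))
        + ENNReal.ofReal (2 * (B * D' ^ (-(2 * α))))) ∂P.transcriptLaw g :=
        lintegral_mono herr
    _ = 2 * (∑ a, ∫⁻ t, ENNReal.ofReal ((θ t a - ∫ x, g x * u a x) ^ 2) ∂P.transcriptLaw g)
        + ENNReal.ofReal (2 * (B * D' ^ (-(2 * α)))) := by
        rw [lintegral_add_right _ measurable_const, lintegral_const_mul' _ _ (by norm_num),
          lintegral_const, measure_univ, mul_one, lintegral_finsetSum _ fun a _ => hθa a]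
    _ ≤ 2 * (∑ _a : (Σ i : Fin J, Fin (W.count i)),
          ENNReal.ofReal (C₁ * 1 * ℓ * (D' / D ^ (2 * α + 2))))
        + ENNReal.ofReal (2 * (B * D' ^ (-(2 * α)))) := by
        gcongr with a _
        exact hP g hg hgB a
    _ = ENNReal.ofReal (2 * ((Fintype.card (Σ i : Fin J, Fin (W.count i)) : ℝ)
          * (C₁ * 1 * ℓ * (D' / D ^ (2 * α + 2)))) + 2 * (B * D' ^ (-(2 * α)))) := by
        have : 0 ≤ D' ^ (-(2 * α)) := Real.rpow_nonneg hD'0.le _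
        have hr : 0 ≤ C₁ * 1 * ℓ * (D' / D ^ (2 * α + 2)) := by positivity
        rw [Finset.sum_const, Finset.card_univ, nsmul_eq_mul, ENNReal.ofReal_add
            (mul_nonneg (by norm_num) (mul_nonneg (Nat.cast_nonneg _) hr)) (by positivity),
          ENNReal.ofReal_mul (p := 2) (q := (Fintype.card _ : ℝ) * _) zero_le_two,
          ENNReal.ofReal_mul (p := (Fintype.card _ : ℝ)) (Nat.cast_nonneg _),
          ENNReal.ofReal_natCast, ENNReal.ofReal_ofNat]
    _ ≤ _ := by
        refine ENNReal.ofReal_le_ofReal ?_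
        have h2 : (Fintype.card (Σ i : Fin J, Fin (W.count i)) : ℝ)
            * (C₁ * 1 * ℓ * (D' / D ^ (2 * α + 2))) ≤ 2 * C₁ * ℓ * (c ^ 2 * D ^ (-2 * α)) := by
          calc _ ≤ 2 * D' * (C₁ * 1 * ℓ * (D' / D ^ (2 * α + 2))) := by gcongr
            _ = 2 * C₁ * ℓ * (D' * (D' / D ^ (2 * α + 2))) := by ring
            _ ≤ _ := by gcongr
        have h3 : B * D' ^ (-(2 * α)) ≤ 2 * B * ℓ * D ^ (-2 * α) := by
          calc B * D' ^ (-(2 * α)) ≤ B * D ^ (-2 * α) := by gcongr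
            _ = B * D ^ (-2 * α) * 1 := by ring
            _ ≤ B * D ^ (-2 * α) * (2 * ℓ) := by gcongr; linarith
            _ = _ := by ring
        have h4 : 0 ≤ 2 * B ^ 2 * (ℓ * D ^ (-2 * α)) := by positivity
        calc _ ≤ 2 * (2 * C₁ * ℓ * (c ^ 2 * D ^ (-2 * α)))
              + 2 * (2 * B * ℓ * D ^ (-2 * α)) := by gcongr
          _ ≤ C * ℓ * D ^ (-2 * α) := by rw [hC]; linarith

end upper

/-! ### Likelihood ratios of the regression model -/

/-- The density of `regressionLaw f` with respect to the law `regressionLaw 0` of pure noise. -/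
def lik (f : unitInterval → ℝ) (z : ℝ × unitInterval) : ℝ :=
  Real.exp (z.1 * f z.2 - f z.2 ^ 2 / 2)

lemma lik_pos (f : unitInterval → ℝ) (z : ℝ × unitInterval) : 0 < lik f z := Real.exp_pos _

lemma measurable_lik {f : unitInterval → ℝ} (hf : Measurable f) : Measurable (lik f) := by
  unfold lik; fun_prop

/-- The Cameron–Martin formula on the line. -/
lemma lintegral_gaussianReal_add (a : ℝ) {h : ℝ → ℝ≥0∞} (hh : Measurable h) :
    ∫⁻ t, h (a + t) ∂gaussianReal 0 1
      = ∫⁻ t, ENNReal.ofReal (Real.exp (t * a - a ^ 2 / 2)) * h t ∂gaussianReal 0 1 := by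
  have h1 : ∫⁻ t, h (a + t) ∂gaussianReal 0 1 = ∫⁻ t, h t ∂gaussianReal a 1 := by
    rw [← lintegral_map hh (measurable_const_add a), gaussianReal_map_const_add, zero_add]
  rw [h1, gaussianReal_of_var_ne_zero _ one_ne_zero, gaussianReal_of_var_ne_zero _ one_ne_zero,
    lintegral_withDensity_eq_lintegral_mul _ (measurable_gaussianPDF _ _) hh,
    lintegral_withDensity_eq_lintegral_mul _ (measurable_gaussianPDF _ _) (by fun_prop)]
  refine lintegral_congr fun t => ?_
  simp only [Pi.mul_apply, gaussianPDF]
  rw [← mul_assoc, ← ENNReal.ofReal_mul (gaussianPDFReal_nonneg _ _ _)]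
  congr 2
  simp only [gaussianPDFReal]
  rw [mul_assoc _ (Real.exp _), ← Real.exp_add]
  congr 2
  simp only [NNReal.coe_one]
  ring

lemma lintegral_regressionLaw_zero {H : ℝ × unitInterval → ℝ≥0∞} (hH : Measurable H) :
    ∫⁻ z, H z ∂regressionLaw 0 = ∫⁻ x : unitInterval, ∫⁻ t, H (t, x) ∂gaussianReal 0 1 := by
  have hm : Measurable fun w : unitInterval × ℝ => ((0 : unitInterval → ℝ) w.1 + w.2, w.1) :=
    measurable_obs measurable_const
  rw [regressionLaw, lintegral_map hH hm]
  refine (lintegral_prod _ (hH.comp hm).aemeasurable).trans ?_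
  simp

lemma regressionLaw_eq_withDensity {f : unitInterval → ℝ} (hf : Measurable f) :
    regressionLaw f = (regressionLaw 0).withDensity fun z => ENNReal.ofReal (lik f z) := by
  refine Measure.ext_of_lintegral _ fun g hg => ?_
  have hl : Measurable fun z => ENNReal.ofReal (lik f z) := (measurable_lik hf).ennreal_ofReal
  rw [lintegral_withDensity_eq_lintegral_mul _ hl hg, lintegral_regressionLaw_zero (hl.mul hg),
    regressionLaw, lintegral_map hg (measurable_obs hf)]
  refine (lintegral_prod _ (hg.comp (measurable_obs hf)).aemeasurable).trans ?_
  refine lintegral_congr fun x => ?_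
  exact lintegral_gaussianReal_add (f x) (h := fun t => g (t, x))
    (hg.comp (measurable_id.prodMk measurable_const))

lemma integrable_lik {f : unitInterval → ℝ} (hf : Measurable f) :
    Integrable (lik f) (regressionLaw 0) := by
  have := isProbabilityMeasure_regressionLaw hf
  refine ⟨(measurable_lik hf).aestronglyMeasurable, ?_⟩
  have h : ∫⁻ z, ENNReal.ofReal (lik f z) ∂regressionLaw 0 = 1 := by
    rw [← setLIntegral_univ, ← withDensity_apply _ MeasurableSet.univ,
      ← regressionLaw_eq_withDensity hf, measure_univ]
  rw [hasFiniteIntegral_iff_ofReal (ae_of_all _ fun z => (lik_pos f z).le), h]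
  exact ENNReal.one_lt_top

lemma integral_regressionLaw_eq_lik {f : unitInterval → ℝ} (hf : Measurable f)
    (H : ℝ × unitInterval → ℝ) :
    ∫ z, H z ∂regressionLaw f = ∫ z, lik f z * H z ∂regressionLaw 0 := by
  rw [regressionLaw_eq_withDensity hf, integral_withDensity_eq_integral_toReal_smul
    (measurable_lik hf).ennreal_ofReal (ae_of_all _ fun _ => ENNReal.ofReal_lt_top)]
  refine integral_congr_ae (ae_of_all _ fun z => ?_)
  simp only [ENNReal.toReal_ofReal (lik_pos f z).le, smul_eq_mul]

lemma integrable_exp_mul_sub_gaussianReal (a c : ℝ) :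
    Integrable (fun t => Real.exp (t * a - c)) (gaussianReal 0 1) := by
  have h : (fun t : ℝ => Real.exp (t * a - c)) = fun t => Real.exp (-c) * Real.exp (a * t) := by
    funext t; rw [← Real.exp_add]; congr 1; ring
  rw [h]
  exact (integrable_exp_mul_gaussianReal a).const_mul _

lemma integral_exp_mul_sub_gaussianReal (a c : ℝ) :
    ∫ t, Real.exp (t * a - c) ∂gaussianReal 0 1 = Real.exp (a ^ 2 / 2 - c) := by
  have h : (fun t : ℝ => Real.exp (t * a - c)) = fun t => Real.exp (-c) * Real.exp (a * t) := by
    funext t; rw [← Real.exp_add]; congr 1; ring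
  rw [h, integral_const_mul, integral_exp_mul_gaussianReal, ← Real.exp_add]
  congr 1; ring

/-- The Hellinger affinity of the laws of one observation. -/
lemma lintegral_sqrt_lik {f : unitInterval → ℝ} (hf : Measurable f) :
    ∫⁻ z, ENNReal.ofReal √(lik f z) ∂regressionLaw 0
      = ∫⁻ x, ENNReal.ofReal (Real.exp (-(f x ^ 2 / 8))) := by
  rw [lintegral_regressionLaw_zero (measurable_lik hf).sqrt.ennreal_ofReal]
  refine lintegral_congr fun x => ?_
  have h : ∀ t, √(lik f (t, x)) = Real.exp (t * (f x / 2) - f x ^ 2 / 4) := fun t => by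
    rw [lik, Real.sqrt_eq_iff_mul_self_eq (Real.exp_pos _).le (Real.exp_pos _).le, ← Real.exp_add]
    congr 1; ring
  simp only [h]
  rw [← ofReal_integral_eq_lintegral_ofReal (integrable_exp_mul_sub_gaussianReal _ _)
    (ae_of_all _ fun _ => (Real.exp_pos _).le), integral_exp_mul_sub_gaussianReal]
  congr 2; ring

/-- Twice the total variation distance of two unit normal laws with means `0` and `a`. -/
lemma integral_abs_exp_sub_one_le {a : ℝ} (ha : |a| ≤ 1) :
    ∫ t, |Real.exp (t * a - a ^ 2 / 2) - 1| ∂gaussianReal 0 1 ≤ 2 * |a| := by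
  rcases eq_or_ne a 0 with rfl | h0
  · simp
  have ha0 : 0 < |a| := abs_pos.2 h0
  set e : ℝ → ℝ := fun t => Real.exp (t * a - a ^ 2 / 2)
  have i1 : Integrable e (gaussianReal 0 1) := integrable_exp_mul_sub_gaussianReal _ _
  have hsq : ∀ t, e t ^ 2 = Real.exp (t * (2 * a) - a ^ 2) := fun t => by
    rw [sq, ← Real.exp_add]; congr 1; ring
  have i2 : Integrable (fun t => e t ^ 2) (gaussianReal 0 1) := by
    simp only [hsq]; exact integrable_exp_mul_sub_gaussianReal _ _
  have e1 : ∫ t, e t ∂gaussianReal 0 1 = 1 := by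
    rw [integral_exp_mul_sub_gaussianReal]; simp
  have e2 : ∫ t, e t ^ 2 ∂gaussianReal 0 1 = Real.exp (a ^ 2) := by
    simp only [hsq]; rw [integral_exp_mul_sub_gaussianReal]; congr 1; ring
  have i3 : Integrable (fun t => (e t - 1) ^ 2) (gaussianReal 0 1) := by
    have : (fun t => (e t - 1) ^ 2) = fun t => e t ^ 2 - 2 * e t + 1 := by funext t; ring
    rw [this]
    exact (i2.sub (i1.const_mul 2)).add (integrable_const 1)
  have e3 : ∫ t, (e t - 1) ^ 2 ∂gaussianReal 0 1 = Real.exp (a ^ 2) - 1 := by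
    have : (fun t => (e t - 1) ^ 2) = fun t => e t ^ 2 - 2 * e t + 1 := by funext t; ring
    have i4 : Integrable (fun t => e t ^ 2 - 2 * e t) (gaussianReal 0 1) :=
      i2.sub (i1.const_mul 2)
    rw [this, integral_add i4 (integrable_const 1), integral_sub i2 (i1.const_mul 2),
      integral_const_mul, e1, e2]
    simp; ring
  have h2 : Real.exp (a ^ 2) - 1 ≤ 2 * a ^ 2 := by
    have := Real.abs_exp_sub_one_le (x := a ^ 2) (by
      rw [abs_of_nonneg (sq_nonneg a)]; exact (sq_le_one_iff_abs_le_one a).2 ha)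
    rw [abs_of_nonneg (sq_nonneg a)] at this
    exact (le_abs_self _).trans this
  -- `2 |u| ≤ u² / |a| + |a|`
  calc ∫ t, |e t - 1| ∂gaussianReal 0 1
      ≤ ∫ t, ((e t - 1) ^ 2 * (2 * |a|)⁻¹ + |a| / 2) ∂gaussianReal 0 1 := by
        refine integral_mono (i1.sub (integrable_const 1)).abs
          ((i3.mul_const _).add (integrable_const _)) fun t => ?_
        change |e t - 1| ≤ (e t - 1) ^ 2 * (2 * |a|)⁻¹ + |a| / 2
        have h := sq_nonneg (|e t - 1| - |a|)
        rw [← sq_abs (e t - 1), ← sub_nonneg]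
        have : |e t - 1| ^ 2 * (2 * |a|)⁻¹ + |a| / 2 - |e t - 1|
            = (|e t - 1| - |a|) ^ 2 * (2 * |a|)⁻¹ := by field_simp; ring
        rw [this]; positivity
    _ = (Real.exp (a ^ 2) - 1) * (2 * |a|)⁻¹ + |a| / 2 := by
        rw [integral_add (i3.mul_const _) (integrable_const _), integral_mul_const, e3]; simp
    _ ≤ 2 * a ^ 2 * (2 * |a|)⁻¹ + |a| / 2 := by gcongr
    _ = 3 / 2 * |a| := by rw [← sq_abs a]; field_simp; ring
    _ ≤ 2 * |a| := by linarith

/-- The total variation distance of the laws of one observation is at most of the order `‖f‖₁`, and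
not merely `‖f‖₂`: this is what a narrow bump gains under privacy. -/
lemma integral_abs_lik_sub_one_le {f : unitInterval → ℝ} (hf : Continuous f)
    (hf1 : ∀ x, |f x| ≤ 1) : ∫ z, |lik f z - 1| ∂regressionLaw 0 ≤ 2 * ∫ x, |f x| := by
  have hm : Measurable fun z => |lik f z - 1| := by
    have := measurable_lik hf.measurable; fun_prop
  have hi : Integrable (fun x => 2 * |f x|) (volume : Measure unitInterval) :=
    integrable_of_continuous_unitInterval (by fun_prop)
  have h0 : 0 ≤ ∫ x, 2 * |f x| := integral_nonneg fun x => by positivity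
  rw [← integral_const_mul, integral_eq_lintegral_of_nonneg_ae (ae_of_all _ fun z => abs_nonneg _)
    hm.aestronglyMeasurable]
  refine ENNReal.toReal_le_of_le_ofReal h0 ?_
  rw [lintegral_regressionLaw_zero hm.ennreal_ofReal,
    ofReal_integral_eq_lintegral_ofReal hi (ae_of_all _ fun x => by positivity)]
  refine lintegral_mono fun x => ?_
  have i : Integrable (fun t => |lik f (t, x) - 1|) (gaussianReal 0 1) :=
    ((integrable_exp_mul_sub_gaussianReal (f x) (f x ^ 2 / 2)).sub (integrable_const 1)).abs
  rw [← ofReal_integral_eq_lintegral_ofReal i (ae_of_all _ fun _ => abs_nonneg _)]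
  exact ENNReal.ofReal_le_ofReal (integral_abs_exp_sub_one_le (hf1 x))

/-! ### Hellinger affinity and two point lower bounds -/

/-- The Hellinger affinity `∫ √(p₀ p₁)` of `Q₀` and `Q₁` is at least `r`, in a form that is
convenient for transcripts: it is enough that `Q₀` and `Q₁` are images, under one map `τ`, of
measures with densities `p₀` and `p₁` and affinity at least `r`. -/
def AffinityGE {T : Type} [MeasurableSpace T] (Q₀ Q₁ : Measure T) (r : ℝ) : Prop :=
  ∃ (Ω : Type) (_ : MeasurableSpace Ω) (ρ : Measure Ω) (τ : Ω → T) (p₀ p₁ : Ω → ℝ),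
    IsProbabilityMeasure ρ ∧ Measurable τ ∧ Measurable p₀ ∧ Measurable p₁ ∧
    (∀ ω, 0 ≤ p₀ ω) ∧ (∀ ω, 0 ≤ p₁ ω) ∧
    Q₀ = (ρ.withDensity fun ω => ENNReal.ofReal (p₀ ω)).map τ ∧
    Q₁ = (ρ.withDensity fun ω => ENNReal.ofReal (p₁ ω)).map τ ∧
    ENNReal.ofReal r ≤ ∫⁻ ω, ENNReal.ofReal √(p₀ ω * p₁ ω) ∂ρ

section affinity

variable {T : Type} [MeasurableSpace T]

/-- For densities `a`, `b` that differ at most by a factor `E` outside a small part, `√(a b)` is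
close to their mean. -/
lemma sqrt_mul_ge {a b E : ℝ} (ha : 0 ≤ a) (hb : 0 ≤ b) (hE : 1 ≤ E) :
    (a + b) / 2 - max (b - E * a) 0 - max (a - E * b) 0 - (E - 1) ^ 2 * (a + b) ≤ √(a * b) := by
  set x := √a with hx
  set y := √b with hy
  have hxa : a = x ^ 2 := (Real.sq_sqrt ha).symm
  have hyb : b = y ^ 2 := (Real.sq_sqrt hb).symm
  have hx0 : 0 ≤ x := Real.sqrt_nonneg _
  have hy0 : 0 ≤ y := Real.sqrt_nonneg _
  rw [Real.sqrt_mul ha, ← hx, ← hy, hxa, hyb]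
  set e := √E
  have he1 : 1 ≤ e := Real.one_le_sqrt.2 hE
  have heE : E = e ^ 2 := (Real.sq_sqrt (by linarith)).symm
  have hE1 : (e - 1) ^ 2 ≤ (E - 1) ^ 2 := by
    have : e - 1 ≤ E - 1 := by nlinarith
    exact pow_le_pow_left₀ (by linarith) this 2
  -- the claim is `(x - y)² / 2 ≤ (y² - e² x²)⁺ + (x² - e² y²)⁺ + (E - 1)² (x² + y²)`
  have key : ∀ u v : ℝ, 0 ≤ u → u ≤ v →
      (v - u) ^ 2 ≤ 2 * max (v ^ 2 - E * u ^ 2) 0 + 2 * (E - 1) ^ 2 * (u ^ 2 + v ^ 2) := by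
    intro u v hu huv
    have h2 : (e - 1) ^ 2 * u ^ 2 ≤ (E - 1) ^ 2 * u ^ 2 := by gcongr
    have h3 : 0 ≤ (E - 1) ^ 2 * v ^ 2 := by positivity
    rcases le_total v (e * u) with h | h
    · have h1 : (v - u) ^ 2 ≤ ((e - 1) * u) ^ 2 := pow_le_pow_left₀ (by linarith) (by linarith) 2
      have h4 := le_max_right (v ^ 2 - E * u ^ 2) 0
      nlinarith [sq_nonneg ((E - 1) * u)]
    · have h1 : (v - e * u) ^ 2 ≤ v ^ 2 - E * u ^ 2 := by
        rw [heE]; nlinarith [mul_nonneg (by linarith : 0 ≤ e) hu]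
      have h4 := le_max_left (v ^ 2 - E * u ^ 2) 0
      nlinarith [sq_nonneg ((v - e * u) - (e - 1) * u)]
  have hm1 := le_max_right (y ^ 2 - E * x ^ 2) 0
  have hm2 := le_max_right (x ^ 2 - E * y ^ 2) 0
  rcases le_total x y with h | h
  · have := key x y hx0 h; nlinarith
  · have := key y x hy0 h; nlinarith

/-- Measures that are indistinguishable up to a factor `E` close to `1` and a small additive error
`b` have affinity close to `1`. -/
lemma affinityGE_of_indistinguishable (Q₀ Q₁ : Measure T) [IsProbabilityMeasure Q₀]
    [IsProbabilityMeasure Q₁] {E b : ℝ} (hE : 1 ≤ E)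
    (h1 : ∀ A, MeasurableSet A → Q₁.real A ≤ E * Q₀.real A + b)
    (h0 : ∀ A, MeasurableSet A → Q₀.real A ≤ E * Q₁.real A + b) :
    AffinityGE Q₀ Q₁ (1 - 2 * b - 2 * (E - 1) ^ 2) := by
  set ρ : Measure T := (2⁻¹ : ℝ≥0∞) • (Q₀ + Q₁) with hρ
  have hprob : IsProbabilityMeasure ρ := ⟨by
    simp [hρ, ENNReal.inv_two_add_inv_two]⟩
  have hac : ∀ Q : Measure T, Q ≤ Q₀ + Q₁ → Q ≪ ρ := fun Q hQ =>
    (Measure.absolutelyContinuous_of_le hQ).trans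
      (Measure.absolutelyContinuous_smul (by norm_num))
  have hd : ∀ Q : Measure T, IsProbabilityMeasure Q → Q ≤ Q₀ + Q₁ →
      Q = (ρ.withDensity fun ω => ENNReal.ofReal (Q.rnDeriv ρ ω).toReal).map id := by
    intro Q _ hQ
    rw [Measure.map_id, withDensity_congr_ae (g := Q.rnDeriv ρ),
      Measure.withDensity_rnDeriv_eq _ _ (hac Q hQ)]
    filter_upwards [Q.rnDeriv_lt_top ρ] with ω hω
    exact ENNReal.ofReal_toReal hω.ne
  have hc0 := hac Q₀ (Measure.le_add_right le_rfl)
  have hc1 := hac Q₁ (Measure.le_add_left le_rfl)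
  set p₀ : T → ℝ := fun ω => (Q₀.rnDeriv ρ ω).toReal with hp₀
  set p₁ : T → ℝ := fun ω => (Q₁.rnDeriv ρ ω).toReal with hp₁
  have hm0 : Measurable p₀ := (Measure.measurable_rnDeriv _ _).ennreal_toReal
  have hm1 : Measurable p₁ := (Measure.measurable_rnDeriv _ _).ennreal_toReal
  have hn0 : ∀ ω, 0 ≤ p₀ ω := fun _ => ENNReal.toReal_nonneg
  have hn1 : ∀ ω, 0 ≤ p₁ ω := fun _ => ENNReal.toReal_nonneg
  refine ⟨T, inferInstance, ρ, id, p₀, p₁, hprob, measurable_id, hm0, hm1, hn0, hn1,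
    hd Q₀ inferInstance (Measure.le_add_right le_rfl),
    hd Q₁ inferInstance (Measure.le_add_left le_rfl), ?_⟩
  have i0 : Integrable p₀ ρ := Measure.integrable_toReal_rnDeriv
  have i1 : Integrable p₁ ρ := Measure.integrable_toReal_rnDeriv
  have s0 : ∀ A, ∫ ω in A, p₀ ω ∂ρ = Q₀.real A := fun A =>
    Measure.setIntegral_toReal_rnDeriv hc0 A
  have s1 : ∀ A, ∫ ω in A, p₁ ω ∂ρ = Q₁.real A := fun A =>
    Measure.setIntegral_toReal_rnDeriv hc1 A
  have t0 : ∫ ω, p₀ ω ∂ρ = 1 := by rw [← setIntegral_univ, s0]; simp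
  have t1 : ∫ ω, p₁ ω ∂ρ = 1 := by rw [← setIntegral_univ, s1]; simp
  -- Indistinguishability, applied to the set where one density exceeds `E` times the other.
  have pos : ∀ {f g : T → ℝ} {Qf Qg : Measure T}, Measurable f → Measurable g → Integrable f ρ →
      Integrable g ρ → (∀ A, ∫ ω in A, f ω ∂ρ = Qf.real A) → (∀ A, ∫ ω in A, g ω ∂ρ = Qg.real A) →
      (∀ A, MeasurableSet A → Qf.real A ≤ E * Qg.real A + b) →
      Integrable (fun ω => max (f ω - E * g ω) 0) ρ ∧ ∫ ω, max (f ω - E * g ω) 0 ∂ρ ≤ b := by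
    intro f g Qf Qg hf hg hif hig hsf hsg h
    have hi : Integrable (fun ω => f ω - E * g ω) ρ := hif.sub (hig.const_mul E)
    refine ⟨hi.pos_part, ?_⟩
    have hA : MeasurableSet {ω | 0 < f ω - E * g ω} :=
      measurableSet_lt measurable_const (hf.sub (hg.const_mul E))
    have heq : (fun ω => max (f ω - E * g ω) 0)
        = {ω | 0 < f ω - E * g ω}.indicator (fun ω => f ω - E * g ω) := by
      funext ω
      by_cases hω : 0 < f ω - E * g ω
      · rw [Set.indicator_of_mem (by exact hω), max_eq_left hω.le]
      · rw [Set.indicator_of_notMem (by exact hω), max_eq_right (not_lt.1 hω)]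
    rw [heq, integral_indicator hA, integral_sub hif.integrableOn (hig.const_mul E).integrableOn,
      integral_const_mul, hsf, hsg]
    linarith [h _ hA]
  obtain ⟨j1, k1⟩ := pos hm1 hm0 i1 i0 s1 s0 h1
  obtain ⟨j0, k0⟩ := pos hm0 hm1 i0 i1 s0 s1 h0
  have j2 : Integrable (fun ω => (p₀ ω + p₁ ω) / 2) ρ := (i0.add i1).div_const 2
  have j3 : Integrable (fun ω => (E - 1) ^ 2 * (p₀ ω + p₁ ω)) ρ := (i0.add i1).const_mul _
  have j4 : Integrable (fun ω => √(p₀ ω * p₁ ω)) ρ := by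
    refine (i0.add i1).mono' (hm0.mul hm1).sqrt.aestronglyMeasurable (ae_of_all _ fun ω => ?_)
    rw [Real.norm_eq_abs, abs_of_nonneg (Real.sqrt_nonneg _)]
    refine Real.sqrt_le_iff.2 ⟨add_nonneg (hn0 ω) (hn1 ω), ?_⟩
    simp only [Pi.add_apply]
    nlinarith [hn0 ω, hn1 ω, mul_nonneg (hn0 ω) (hn1 ω)]
  rw [← ofReal_integral_eq_lintegral_ofReal j4 (ae_of_all _ fun _ => Real.sqrt_nonneg _)]
  refine ENNReal.ofReal_le_ofReal ?_
  calc 1 - 2 * b - 2 * (E - 1) ^ 2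
      ≤ ∫ ω, ((p₀ ω + p₁ ω) / 2 - max (p₁ ω - E * p₀ ω) 0 - max (p₀ ω - E * p₁ ω) 0
          - (E - 1) ^ 2 * (p₀ ω + p₁ ω)) ∂ρ := by
        have j5 : Integrable (fun ω => (p₀ ω + p₁ ω) / 2 - max (p₁ ω - E * p₀ ω) 0) ρ := j2.sub j1
        have j6 : Integrable (fun ω => (p₀ ω + p₁ ω) / 2 - max (p₁ ω - E * p₀ ω) 0
          - max (p₀ ω - E * p₁ ω) 0) ρ := j5.sub j0
        rw [integral_sub j6 j3, integral_sub j5 j0, integral_sub j2 j1, integral_div,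
          integral_const_mul, integral_add i0 i1, t0, t1]
        linarith
    _ ≤ _ := integral_mono (((j2.sub j1).sub j0).sub j3) j4 fun ω =>
        sqrt_mul_ge (hn0 ω) (hn1 ω) hE

/-- The affinity is nonnegative; the trivial case of `affinityGE_of_indistinguishable` supplies
densities. -/
lemma affinityGE_of_nonpos (Q₀ Q₁ : Measure T) [IsProbabilityMeasure Q₀] [IsProbabilityMeasure Q₁]
    {r : ℝ} (hr : r ≤ 0) : AffinityGE Q₀ Q₁ r := by
  obtain ⟨Ω, mΩ, ρ, τ, p₀, p₁, h1, h2, h3, h4, h5, h6, h7, h8, -⟩ :=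
    affinityGE_of_indistinguishable Q₀ Q₁ (E := 1) (b := 1) le_rfl
      (fun A _ => by linarith [measureReal_le_one (μ := Q₁) (s := A),
        measureReal_nonneg (μ := Q₀) (s := A)])
      (fun A _ => by linarith [measureReal_le_one (μ := Q₀) (s := A),
        measureReal_nonneg (μ := Q₁) (s := A)])
  exact ⟨Ω, mΩ, ρ, τ, p₀, p₁, h1, h2, h3, h4, h5, h6, h7, h8, by
    rw [ENNReal.ofReal_of_nonpos hr]; exact zero_le⟩

/-- The affinity of product measures is the product of the affinities. -/
lemma AffinityGE.pi {ι : Type} [Fintype ι] {Q₀ Q₁ : ι → Measure T}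
    [∀ j, IsProbabilityMeasure (Q₀ j)] [∀ j, IsProbabilityMeasure (Q₁ j)] {r : ι → ℝ}
    (h : ∀ j, AffinityGE (Q₀ j) (Q₁ j) (r j)) (hr : ∀ j, 0 ≤ r j) :
    AffinityGE (Measure.pi Q₀) (Measure.pi Q₁) (∏ j, r j) := by
  choose Ω mΩ ρ τ p₀ p₁ hρ hτ hm0 hm1 hn0 hn1 h0 h1 ha using h
  have key : ∀ (Q : ι → Measure T) (p : ∀ j, Ω j → ℝ), (∀ j, IsProbabilityMeasure (Q j)) →
      (∀ j, Measurable (p j)) → (∀ j ω, 0 ≤ p j ω) →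
      (∀ j, Q j = ((ρ j).withDensity fun ω => ENNReal.ofReal (p j ω)).map (τ j)) →
      Measure.pi Q = ((Measure.pi ρ).withDensity fun ω => ENNReal.ofReal (∏ j, p j (ω j))).map
        fun ω j => τ j (ω j) := by
    intro Q p hQ hm hn heq
    have hprob : ∀ j, IsProbabilityMeasure
        ((ρ j).withDensity fun ω => ENNReal.ofReal (p j ω)) := fun j => by
      have : IsProbabilityMeasure
          (((ρ j).withDensity fun ω => ENNReal.ofReal (p j ω)).map (τ j)) := heq j ▸ hQ j
      exact Measure.isProbabilityMeasure_of_map (τ j)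
    have hE : (fun ω : ∀ j, Ω j => ENNReal.ofReal (∏ j, p j (ω j)))
        = fun ω => ∏ j, ENNReal.ofReal (p j (ω j)) := by
      funext ω; exact ENNReal.ofReal_prod_of_nonneg fun j _ => hn j _
    have hmp : ∀ j, SigmaFinite
        (((ρ j).withDensity fun ω => ENNReal.ofReal (p j ω)).map (τ j)) := fun j => by
      rw [← heq j]; infer_instance
    rw [hE, ← pi_withDensity_eq ρ (fun j ω => ENNReal.ofReal (p j ω))
      (fun j => (hm j).ennreal_ofReal),
      Measure.pi_map_pi (f := fun j => τ j) fun j => (hτ j).aemeasurable]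
    congr 1
    funext j
    exact heq j
  refine ⟨∀ j, Ω j, inferInstance, Measure.pi ρ, fun ω j => τ j (ω j),
    fun ω => ∏ j, p₀ j (ω j), fun ω => ∏ j, p₁ j (ω j), inferInstance,
    measurable_pi_iff.2 fun j => (hτ j).comp (measurable_pi_apply j),
    Finset.measurable_prod _ fun j _ => (hm0 j).comp (measurable_pi_apply j),
    Finset.measurable_prod _ fun j _ => (hm1 j).comp (measurable_pi_apply j),
    fun ω => Finset.prod_nonneg fun j _ => hn0 j _, fun ω => Finset.prod_nonneg fun j _ => hn1 j _,
    key Q₀ p₀ inferInstance hm0 hn0 h0, key Q₁ p₁ inferInstance hm1 hn1 h1, ?_⟩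
  have hE : (fun ω : ∀ j, Ω j => ENNReal.ofReal √((∏ j, p₀ j (ω j)) * ∏ j, p₁ j (ω j)))
      = fun ω => ∏ j, ENNReal.ofReal √(p₀ j (ω j) * p₁ j (ω j)) := by
    funext ω
    rw [← Finset.prod_mul_distrib, Real.sqrt_prod _ fun j _ => mul_nonneg (hn0 j _) (hn1 j _),
      ENNReal.ofReal_prod_of_nonneg fun j _ => Real.sqrt_nonneg _]
  have hmm : ∀ j, Measurable fun ω : Ω j => ENNReal.ofReal √(p₀ j ω * p₁ j ω) := fun j =>
    ((hm0 j).mul (hm1 j)).sqrt.ennreal_ofReal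
  rw [hE, ENNReal.ofReal_prod_of_nonneg fun j _ => hr j]
  have h2 := lintegral_prod_eq_prod_lintegral_of_indepFun (μ := Measure.pi ρ) Finset.univ
    (fun j (ω : ∀ j, Ω j) => ENNReal.ofReal √(p₀ j (ω j) * p₁ j (ω j)))
    (iIndepFun_pi (X := fun j ω => ENNReal.ofReal √(p₀ j ω * p₁ j ω))
      (fun j => (hmm j).aemeasurable))
    (fun j => (hmm j).comp (measurable_pi_apply j))
  rw [h2]
  refine Finset.prod_le_prod' fun j _ => (ha j).trans (le_of_eq ?_)
  exact ((measurePreserving_eval ρ j).lintegral_comp (hmm j)).symm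

/-- Le Cam's two point bound: if the affinity is at least `1/2`, no estimator is closer than
`|a₁ - a₀| / 4` to both of the values `a₀`, `a₁` in mean square. -/
lemma AffinityGE.le_max_risk {Q₀ Q₁ : Measure T} [IsProbabilityMeasure Q₀]
    [IsProbabilityMeasure Q₁] (h : AffinityGE Q₀ Q₁ (1 / 2)) {g : T → ℝ} (hg : Measurable g)
    {a₀ a₁ : ℝ} : ENNReal.ofReal ((a₁ - a₀) ^ 2 / 16)
      ≤ max (∫⁻ t, ENNReal.ofReal ((g t - a₀) ^ 2) ∂Q₀)
        (∫⁻ t, ENNReal.ofReal ((g t - a₁) ^ 2) ∂Q₁) := by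
  obtain ⟨Ω, mΩ, ρ, τ, p₀, p₁, hρ, hτ, hm0, hm1, hn0, hn1, h0, h1, ha⟩ := h
  set r := max (∫⁻ t, ENNReal.ofReal ((g t - a₀) ^ 2) ∂Q₀)
    (∫⁻ t, ENNReal.ofReal ((g t - a₁) ^ 2) ∂Q₁) with hr
  rcases eq_or_ne a₁ a₀ with rfl | hne
  · simp
  set Δ := |a₁ - a₀| with hΔ
  have hΔ0 : 0 < Δ := abs_pos.2 (sub_ne_zero.2 hne)
  have hint : ∀ (p : Ω → ℝ) (Q : Measure T) (a : ℝ), Measurable p →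
      Q = (ρ.withDensity fun ω => ENNReal.ofReal (p ω)).map τ →
      ∫⁻ t, ENNReal.ofReal ((g t - a) ^ 2) ∂Q
        = ∫⁻ ω, ENNReal.ofReal (p ω) * ENNReal.ofReal ((g (τ ω) - a) ^ 2) ∂ρ := by
    intro p Q a hp hQ
    have hm : Measurable fun t => ENNReal.ofReal ((g t - a) ^ 2) :=
      ((hg.sub_const a).pow_const 2).ennreal_ofReal
    rw [hQ, lintegral_map hm hτ]
    exact lintegral_withDensity_eq_lintegral_mul _ hp.ennreal_ofReal (hm.comp hτ)
  have hone : ∀ (p : Ω → ℝ) (Q : Measure T), IsProbabilityMeasure Q →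
      Q = (ρ.withDensity fun ω => ENNReal.ofReal (p ω)).map τ →
      ∫⁻ ω, ENNReal.ofReal (p ω) ∂ρ = 1 := by
    intro p Q hQ heq
    rw [← setLIntegral_univ, ← withDensity_apply _ MeasurableSet.univ,
      ← Set.preimage_univ (f := τ), ← Measure.map_apply hτ MeasurableSet.univ, ← heq, measure_univ]
  set c : ℝ := 4 / Δ with hc
  have hc0 : 0 < c := by positivity
  -- `√(p₀ p₁) Δ ≤ √(p₀ p₁) (|g - a₀| + |g - a₁|)`, and `2 u v ≤ c u² + c⁻¹ v²` for each term
  have hpt : ∀ ω, ENNReal.ofReal Δ * ENNReal.ofReal √(p₀ ω * p₁ ω)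
      ≤ ENNReal.ofReal (c / 2) * (ENNReal.ofReal (p₀ ω) * ENNReal.ofReal ((g (τ ω) - a₀) ^ 2))
      + ENNReal.ofReal (c / 2) * (ENNReal.ofReal (p₁ ω) * ENNReal.ofReal ((g (τ ω) - a₁) ^ 2))
      + (ENNReal.ofReal (Δ / 8) * ENNReal.ofReal (p₀ ω)
      + ENNReal.ofReal (Δ / 8) * ENNReal.ofReal (p₁ ω)) := by
    intro ω
    have q0 := hn0 ω
    have q1 := hn1 ω
    simp only [← ENNReal.ofReal_mul hΔ0.le, ← ENNReal.ofReal_mul q0, ← ENNReal.ofReal_mul q1,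
      ← ENNReal.ofReal_mul (show 0 ≤ c / 2 by positivity),
      ← ENNReal.ofReal_mul (show 0 ≤ Δ / 8 by positivity)]
    rw [← ENNReal.ofReal_add (by positivity) (by positivity),
      ← ENNReal.ofReal_add (by positivity) (by positivity),
      ← ENNReal.ofReal_add (by positivity) (by positivity)]
    refine ENNReal.ofReal_le_ofReal ?_
    set x := |g (τ ω) - a₀| with hx
    set y := |g (τ ω) - a₁| with hy
    have htri : Δ ≤ x + y := by
      rw [hΔ, hx, hy, ← abs_neg (g (τ ω) - a₁)]
      refine le_trans (le_of_eq ?_) (abs_add_le _ _)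
      congr 1; ring
    rw [← sq_abs (g (τ ω) - a₀), ← sq_abs (g (τ ω) - a₁), ← hx, ← hy, Real.sqrt_mul q0]
    set u := √(p₀ ω) with hu
    set v := √(p₁ ω) with hv
    have hu2 : p₀ ω = u ^ 2 := (Real.sq_sqrt q0).symm
    have hv2 : p₁ ω = v ^ 2 := (Real.sq_sqrt q1).symm
    have hu0 : 0 ≤ u := Real.sqrt_nonneg _
    have hv0 : 0 ≤ v := Real.sqrt_nonneg _
    rw [hu2, hv2]
    have hΔc : Δ / 8 = 1 / (2 * c) := by rw [hc]; field_simp; norm_num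
    have amgm : ∀ s t : ℝ, s * t ≤ c / 2 * s ^ 2 + Δ / 8 * t ^ 2 := by
      intro s t
      rw [hΔc]
      have : c / 2 * s ^ 2 + 1 / (2 * c) * t ^ 2 - s * t = (c * s - t) ^ 2 / (2 * c) := by
        field_simp; ring
      have h2 : 0 ≤ (c * s - t) ^ 2 / (2 * c) := by positivity
      linarith
    have a1 := amgm (u * x) v
    have a2 := amgm (v * y) u
    have : Δ * (u * v) ≤ (x + y) * (u * v) := by gcongr
    nlinarith
  have hmain : ENNReal.ofReal (Δ * (1 / 2)) ≤ ENNReal.ofReal c * r + ENNReal.ofReal (Δ / 4) := by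
    have e0 : ∀ p : Ω → ℝ, Measurable p → ∀ a : ℝ, Measurable fun ω =>
        ENNReal.ofReal (p ω) * ENNReal.ofReal ((g (τ ω) - a) ^ 2) := fun p hp a =>
      hp.ennreal_ofReal.mul (((hg.comp hτ).sub_const a).pow_const 2).ennreal_ofReal
    calc ENNReal.ofReal (Δ * (1 / 2))
        ≤ ∫⁻ ω, ENNReal.ofReal Δ * ENNReal.ofReal √(p₀ ω * p₁ ω) ∂ρ := by
          rw [lintegral_const_mul' _ _ ENNReal.ofReal_ne_top, ENNReal.ofReal_mul hΔ0.le]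
          gcongr
      _ ≤ _ := lintegral_mono hpt
      _ = ENNReal.ofReal (c / 2) * (∫⁻ t, ENNReal.ofReal ((g t - a₀) ^ 2) ∂Q₀)
          + ENNReal.ofReal (c / 2) * (∫⁻ t, ENNReal.ofReal ((g t - a₁) ^ 2) ∂Q₁)
          + (ENNReal.ofReal (Δ / 8) * 1 + ENNReal.ofReal (Δ / 8) * 1) := by
          have f0 : Measurable fun ω => ENNReal.ofReal (Δ / 8) * ENNReal.ofReal (p₀ ω) :=
            hm0.ennreal_ofReal.const_mul _
          have f1 : Measurable fun ω => ENNReal.ofReal (Δ / 8) * ENNReal.ofReal (p₀ ω)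
              + ENNReal.ofReal (Δ / 8) * ENNReal.ofReal (p₁ ω) :=
            f0.add (hm1.ennreal_ofReal.const_mul _)
          rw [lintegral_add_right _ f1, lintegral_add_left ((e0 _ hm0 _).const_mul _),
            lintegral_add_left f0]
          simp only [lintegral_const_mul' _ _ ENNReal.ofReal_ne_top]
          rw [← hint p₀ Q₀ a₀ hm0 h0, ← hint p₁ Q₁ a₁ hm1 h1, hone p₀ Q₀ inferInstance h0,
            hone p₁ Q₁ inferInstance h1]
      _ ≤ ENNReal.ofReal (c / 2) * r + ENNReal.ofReal (c / 2) * r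
          + (ENNReal.ofReal (Δ / 8) * 1 + ENNReal.ofReal (Δ / 8) * 1) := by
          gcongr
          · exact le_max_left _ _
          · exact le_max_right _ _
      _ = _ := by
          rw [← add_mul, mul_one, ← ENNReal.ofReal_add (by positivity) (by positivity),
            ← ENNReal.ofReal_add (by positivity) (by positivity)]
          congr 2 <;> ring_nf
  rcases eq_or_ne r ∞ with hr' | hr'
  · rw [hr']; exact le_top
  refine (ENNReal.ofReal_le_iff_le_toReal hr').2 ?_
  rw [← ENNReal.ofReal_toReal hr', ← ENNReal.ofReal_mul hc0.le,
    ← ENNReal.ofReal_add (by positivity) (by positivity),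
    ENNReal.ofReal_le_ofReal_iff (by positivity)] at hmain
  have h2 : Δ / 4 ≤ 4 / Δ * r.toReal := by rw [hc] at hmain; linarith
  rw [← sq_abs, ← hΔ]
  have h3 : Δ / 4 * Δ ≤ 4 / Δ * r.toReal * Δ := by gcongr
  have h4 : 4 / Δ * r.toReal * Δ = 4 * r.toReal := by field_simp
  rw [h4] at h3
  nlinarith

end affinity

/-! ### Affinity of the transcripts of one server -/

lemma AffinityGE.mono {T : Type} [MeasurableSpace T] {Q₀ Q₁ : Measure T} {r r' : ℝ}
    (h : AffinityGE Q₀ Q₁ r) (hr : r' ≤ r) : AffinityGE Q₀ Q₁ r' := by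
  obtain ⟨Ω, mΩ, ρ, τ, p₀, p₁, h1, h2, h3, h4, h5, h6, h7, h8, h9⟩ := h
  exact ⟨Ω, mΩ, ρ, τ, p₀, p₁, h1, h2, h3, h4, h5, h6, h7, h8,
    (ENNReal.ofReal_le_ofReal hr).trans h9⟩

lemma withDensity_compProd {X T : Type*} [MeasurableSpace X] [MeasurableSpace T] (μ : Measure X)
    [SFinite μ] (K : Kernel X T) [IsSFiniteKernel K] {g : X → ℝ≥0∞} (hg : Measurable g) :
    (μ.withDensity g) ⊗ₘ K = (μ ⊗ₘ K).withDensity fun w => g w.1 := by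
  refine Measure.ext_of_lintegral _ fun F hF => ?_
  have hgf : Measurable fun w : X × T => g w.1 := hg.comp measurable_fst
  rw [Measure.lintegral_compProd hF, lintegral_withDensity_eq_lintegral_mul _ hgf hF,
    Measure.lintegral_compProd (hgf.mul hF),
    lintegral_withDensity_eq_lintegral_mul _ hg hF.lintegral_kernel_prod_right']
  refine lintegral_congr fun x => ?_
  simp only [Pi.mul_apply]
  exact (lintegral_const_mul (g x) (hF.comp measurable_prodMk_left)).symm

lemma withDensity_compProd_map_snd {X T : Type*} [MeasurableSpace X] [MeasurableSpace T]
    (μ : Measure X) [IsProbabilityMeasure μ] (K : Kernel X T) [IsMarkovKernel K] {g : X → ℝ≥0∞}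
    (hg : Measurable g) :
    ((μ ⊗ₘ K).withDensity fun w => g w.1).map Prod.snd = (μ.withDensity g).bind K := by
  rw [← withDensity_compProd _ _ hg]
  exact Measure.snd_compProd _ _

section server

variable {n : ℕ} {T : Type} [MeasurableSpace T] {f : unitInterval → ℝ}

/-- The likelihood of the `n` observations of a server. -/
lemma pi_regressionLaw_eq_withDensity (hf : Measurable f) (n : ℕ) :
    (Measure.pi fun _ : Fin n => regressionLaw f)
      = (Measure.pi fun _ : Fin n => regressionLaw 0).withDensity
        fun z => ENNReal.ofReal (∏ i, lik f (z i)) := by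
  have := isProbabilityMeasure_regressionLaw hf
  have := isProbabilityMeasure_regressionLaw (f := 0) measurable_const
  have h : SigmaFinite ((regressionLaw 0).withDensity fun z => ENNReal.ofReal (lik f z)) := by
    rw [← regressionLaw_eq_withDensity hf]; infer_instance
  have h2 := pi_withDensity_eq (fun _ : Fin n => regressionLaw 0)
    (fun _ z => ENNReal.ofReal (lik f z)) fun _ => (measurable_lik hf).ennreal_ofReal
  rw [← regressionLaw_eq_withDensity hf] at h2
  rw [h2]
  congr 1
  funext z
  exact (ENNReal.ofReal_prod_of_nonneg fun j _ => (lik_pos f (z j)).le).symm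

/-- The transcripts are no more informative than the data. -/
lemma affinityGE_transcript (hf : Continuous f) (K : Kernel (Fin n → ℝ × unitInterval) T)
    [IsMarkovKernel K] :
    AffinityGE ((Measure.pi fun _ : Fin n => regressionLaw 0).bind K)
      ((Measure.pi fun _ : Fin n => regressionLaw f).bind K) (1 - n * ∫ x, f x ^ 2) := by
  have := isProbabilityMeasure_regressionLaw hf.measurable
  have hp0 := isProbabilityMeasure_regressionLaw (f := 0) measurable_const
  set μ := Measure.pi fun _ : Fin n => regressionLaw 0
  have hlm : Measurable fun z : Fin n → ℝ × unitInterval => ∏ i, lik f (z i) :=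
    Finset.measurable_prod _ fun i _ =>
      (measurable_lik hf.measurable).comp (measurable_pi_apply i)
  refine ⟨(Fin n → ℝ × unitInterval) × T, inferInstance, μ ⊗ₘ K, Prod.snd, fun _ => 1,
    fun w => ∏ i, lik f (w.1 i), inferInstance, measurable_snd, measurable_const,
    hlm.comp measurable_fst, fun _ => zero_le_one,
    fun w => Finset.prod_nonneg fun i _ => (lik_pos f _).le, ?_, ?_, ?_⟩
  · rw [withDensity_compProd_map_snd μ K (g := fun _ => ENNReal.ofReal 1) measurable_const]
    simp
  · rw [withDensity_compProd_map_snd μ K (g := fun z => ENNReal.ofReal (∏ i, lik f (z i)))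
      hlm.ennreal_ofReal, ← pi_regressionLaw_eq_withDensity hf.measurable]
  have hsl : Measurable fun z => ENNReal.ofReal √(lik f z) :=
    (measurable_lik hf.measurable).sqrt.ennreal_ofReal
  have h1 : ∫⁻ w, ENNReal.ofReal √(1 * ∏ i, lik f (w.1 i)) ∂(μ ⊗ₘ K)
      = ∏ _i : Fin n, ∫⁻ x, ENNReal.ofReal (Real.exp (-(f x ^ 2 / 8))) := by
    have hm : Measurable fun z : Fin n → ℝ × unitInterval =>
        ENNReal.ofReal √(1 * ∏ i, lik f (z i)) :=
      (hlm.const_mul 1).sqrt.ennreal_ofReal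
    refine (Measure.lintegral_compProd (hm.comp measurable_fst)).trans ?_
    simp only [Function.comp, lintegral_const, measure_univ, mul_one]
    have hE : (fun z : Fin n → ℝ × unitInterval => ENNReal.ofReal √(1 * ∏ i, lik f (z i)))
        = fun z => ∏ i, ENNReal.ofReal √(lik f (z i)) := by
      funext z
      rw [one_mul, Real.sqrt_prod _ fun j _ => (lik_pos f _).le,
        ENNReal.ofReal_prod_of_nonneg fun j _ => Real.sqrt_nonneg _]
    rw [hE, lintegral_prod_eq_prod_lintegral_of_indepFun (μ := μ) Finset.univ
      (fun i (z : Fin n → ℝ × unitInterval) => ENNReal.ofReal √(lik f (z i)))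
      (iIndepFun_pi (X := fun _ z => ENNReal.ofReal √(lik f z)) fun _ => hsl.aemeasurable)
      (fun i => hsl.comp (measurable_pi_apply i))]
    refine Finset.prod_congr rfl fun i _ => ?_
    rw [← lintegral_sqrt_lik hf.measurable]
    exact (measurePreserving_eval (fun _ : Fin n => regressionLaw 0) i).lintegral_comp hsl
  rw [h1, Finset.prod_const, Finset.card_univ, Fintype.card_fin]
  set S := ∫ x, f x ^ 2 with hS
  have hS0 : 0 ≤ S := integral_nonneg fun x => sq_nonneg _
  have i1 : Integrable (fun x => f x ^ 2) (volume : Measure unitInterval) :=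
    integrable_of_continuous_unitInterval (hf.pow 2)
  have i2 : Integrable (fun x => Real.exp (-(f x ^ 2 / 8))) (volume : Measure unitInterval) :=
    integrable_of_continuous_unitInterval (by fun_prop)
  have h2 : ENNReal.ofReal (max (1 - S) 0)
      ≤ ∫⁻ x, ENNReal.ofReal (Real.exp (-(f x ^ 2 / 8))) := by
    rw [← ofReal_integral_eq_lintegral_ofReal i2 (ae_of_all _ fun _ => (Real.exp_pos _).le)]
    refine ENNReal.ofReal_le_ofReal (max_le ?_ (integral_nonneg fun _ => (Real.exp_pos _).le))
    calc 1 - S = ∫ x, (1 - f x ^ 2) := by rw [integral_sub (integrable_const _) i1]; simp [hS]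
      _ ≤ _ := integral_mono ((integrable_const _).sub i1) i2 fun x => by
        have := Real.add_one_le_exp (-(f x ^ 2 / 8))
        change 1 - f x ^ 2 ≤ Real.exp (-(f x ^ 2 / 8))
        nlinarith [sq_nonneg (f x)]
  calc ENNReal.ofReal (1 - n * S) ≤ ENNReal.ofReal (max (1 - S) 0 ^ n) := by
        refine ENNReal.ofReal_le_ofReal ?_
        rcases le_total S 1 with h | h
        · rw [max_eq_left (by linarith)]
          have := one_add_mul_le_pow (a := -S) (by linarith) n
          calc 1 - n * S = 1 + n * -S := by ring
            _ ≤ (1 + -S) ^ n := this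
            _ = _ := by ring
        · rcases Nat.eq_zero_or_pos n with rfl | hn
          · simp
          · have : (1 : ℝ) ≤ n := by exact_mod_cast hn
            exact le_trans (by nlinarith) (pow_nonneg (le_max_right _ _) n)
    _ = ENNReal.ofReal (max (1 - S) 0) ^ n := ENNReal.ofReal_pow (le_max_right _ _) n
    _ ≤ _ := by gcongr

/-- Exchanging the law of one observation, for the probability `k` of an event under a private
mechanism. The density `l` integrates to `1`, so constants may be subtracted from `k` in
`∫ k (l - 1)`. -/
lemma abs_integral_mul_sub_integral_le {Z : Type*} [MeasurableSpace Z] (P : Measure Z)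
    [IsProbabilityMeasure P] {l k : Z → ℝ} (hl : Integrable l P) (hl1 : ∫ z, l z ∂P = 1)
    (hkm : Measurable k) (hk0 : ∀ z, 0 ≤ k z) (hk1 : ∀ z, k z ≤ 1) {s δ : ℝ} (hs : 0 ≤ s)
    (h : ∀ z z', k z ≤ (1 + s) * k z' + δ) (z' : Z) :
    |∫ z, l z * k z ∂P - ∫ z, k z ∂P| ≤ (∫ z, |l z - 1| ∂P) * (s * k z' + δ) := by
  have hk : ∀ z, ‖k z‖ ≤ 1 := fun z => by
    rw [Real.norm_eq_abs, abs_of_nonneg (hk0 z)]; exact hk1 z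
  have ik : Integrable k P := Integrable.of_bound hkm.aestronglyMeasurable 1 (ae_of_all _ hk)
  have ilk : Integrable (fun z => l z * k z) P :=
    hl.mul_bdd (c := 1) hkm.aestronglyMeasurable (ae_of_all _ hk)
  have il1 : Integrable (fun z => l z - 1) P := hl.sub (integrable_const 1)
  have e1 : ∫ z, (l z - 1) ∂P = 0 := by rw [integral_sub hl (integrable_const 1), hl1]; simp
  have e2 : ∫ z, l z * k z ∂P - ∫ z, k z ∂P = ∫ z, (l z - 1) * (k z - k z') ∂P := by
    have : (fun z => (l z - 1) * (k z - k z')) = fun z => (l z * k z - k z) - (l z - 1) * k z' := by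
      funext z; ring
    rw [this, integral_sub (f := fun z => l z * k z - k z) (ilk.sub ik) (il1.mul_const _),
      integral_sub ilk ik, integral_mul_const, e1]
    ring
  rw [e2, ← integral_mul_const]
  refine (abs_integral_le_integral_abs).trans (integral_mono_of_nonneg
    (ae_of_all _ fun _ => abs_nonneg _) (il1.abs.mul_const _) (ae_of_all _ fun z => ?_))
  simp only [abs_mul]
  refine mul_le_mul_of_nonneg_left ?_ (abs_nonneg _)
  have h1 := h z z'
  have h2 := h z' z
  rw [abs_le]
  constructor
  · rcases le_total (k z') (k z) with h3 | h3
    · nlinarith [mul_nonneg hs (hk0 z')]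
    · nlinarith [mul_le_mul_of_nonneg_left h3 hs]
  · linarith

/-- Differential privacy limits the effect of a change of the regression function on the law of the
transcript. -/
lemma affinityGE_private (hf : Continuous f) (hf1 : ∀ x, |f x| ≤ 1)
    {K : Kernel (Fin n → ℝ × unitInterval) T} [IsMarkovKernel K] {ε δ : ℝ} (hε : 0 ≤ ε)
    (hδ : 0 ≤ δ) (hK : IsDP ε δ K) {a : ℝ} (ha : 2 * (∫ x, |f x|) * (Real.exp ε - 1) ≤ a) :
    AffinityGE ((Measure.pi fun _ : Fin n => regressionLaw 0).bind K)
      ((Measure.pi fun _ : Fin n => regressionLaw f).bind K)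
      (1 - (8 * (n * a) ^ 2 + 12 * ((∫ x, |f x|) * (n * δ)))) := by
  have hp1 := isProbabilityMeasure_regressionLaw hf.measurable
  have hp0 := isProbabilityMeasure_regressionLaw (f := 0) measurable_const
  set L := ∫ x, |f x| with hL
  have hL0 : 0 ≤ L := integral_nonneg fun _ => abs_nonneg _
  have hs : 0 ≤ Real.exp ε - 1 := by linarith [Real.add_one_le_exp ε]
  have ha0 : 0 ≤ a := le_trans (by positivity) ha
  set Q₀ := (Measure.pi fun _ : Fin n => regressionLaw 0).bind K with hQ₀
  set Q₁ := (Measure.pi fun _ : Fin n => regressionLaw f).bind K with hQ₁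
  have hn0 : (0 : ℝ) ≤ n := Nat.cast_nonneg n
  -- If `n a > 1`, the claimed bound is negative.
  rcases lt_or_ge 1 (n * a) with hna | hna
  · refine affinityGE_of_nonpos _ _ ?_
    have : 0 ≤ 12 * (L * (n * δ)) := by positivity
    nlinarith
  have hlik := integrable_lik hf.measurable
  have hlik1 : ∫ z, lik f z ∂regressionLaw 0 = 1 := by
    have := integral_regressionLaw_eq_lik hf.measurable fun _ => 1
    simpa using this.symm
  have hτ := integral_abs_lik_sub_one_le hf hf1
  set E := (1 + a) ^ n with hE
  have hE1 : 1 ≤ E := one_le_pow₀ (by linarith)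
  have hEna : E ≤ Real.exp (n * a) := by
    rw [hE, Real.exp_nat_mul]
    exact pow_le_pow_left₀ (by linarith) (by linarith [Real.add_one_le_exp a]) n
  have hE3 : E - 1 ≤ 2 * (n * a) := by
    have := Real.abs_exp_sub_one_le (x := n * a) (by rw [abs_of_nonneg (by positivity)]; exact hna)
    rw [abs_of_nonneg (show 0 ≤ n * a by positivity)] at this
    linarith [le_abs_self (Real.exp (n * a) - 1)]
  set b := 2 * L * δ with hb
  have hb0 : 0 ≤ b := by positivity
  -- one step of the hybrid argument, in both directions
  have key : ∀ A, MeasurableSet A → Q₁.real A ≤ E * Q₀.real A + E * (n * b)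
      ∧ Q₀.real A ≤ E * Q₁.real A + E * (n * b) := by
    intro A hA
    have hFm : Measurable fun z => (K z).real A := (K.measurable_coe hA).ennreal_toReal
    have hF1 : ∀ z, (K z).real A ≤ 1 := fun z => measureReal_le_one
    have hreal : ∀ μ : Measure (Fin n → ℝ × unitInterval), IsProbabilityMeasure μ →
        (μ.bind K).real A = ∫ z, (K z).real A ∂μ := by
      intro μ _
      rw [measureReal_def, Measure.bind_apply hA K.aemeasurable,
        ← integral_toReal (K.measurable_coe hA).aemeasurable
          (ae_of_all _ fun z => measure_lt_top _ _)]
      rfl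
    have hdp : ∀ z (j : Fin n) x x', (K (Function.update z j x)).real A
        ≤ (1 + (Real.exp ε - 1)) * (K (Function.update z j x')).real A + δ := by
      intro z j x x'
      have hd : hammingDist (Function.update z j x) (Function.update z j x') ≤ 1 := by
        rw [hammingDist]
        refine (Finset.card_le_card (t := {j}) fun i hi => ?_).trans (by simp)
        by_contra hij
        simp only [Finset.mem_singleton] at hij
        simp [Function.update_of_ne hij] at hi
      have := hK _ _ hd A hA
      have h2 := ENNReal.toReal_mono (by
        exact ENNReal.add_ne_top.2 ⟨ENNReal.mul_ne_top ENNReal.ofReal_ne_top (measure_ne_top _ _),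
          ENNReal.ofReal_ne_top⟩) this
      rw [ENNReal.toReal_add (ENNReal.mul_ne_top ENNReal.ofReal_ne_top (measure_ne_top _ _))
        ENNReal.ofReal_ne_top, ENNReal.toReal_mul, ENNReal.toReal_ofReal (Real.exp_pos _).le,
        ENNReal.toReal_ofReal hδ] at h2
      rw [add_sub_cancel]
      exact h2
    -- The observation `x'` is arbitrary; averaging over it under either law gives both directions.
    have hex : ∀ z (j : Fin n) x', |∫ x, (K (Function.update z j x)).real A ∂regressionLaw f
        - ∫ x, (K (Function.update z j x)).real A ∂regressionLaw 0|
        ≤ a * (K (Function.update z j x')).real A + b := by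
      intro z j x'
      have hkm : Measurable fun x => (K (Function.update z j x)).real A :=
        hFm.comp (measurable_update z)
      rw [integral_regressionLaw_eq_lik hf.measurable]
      refine (abs_integral_mul_sub_integral_le _ hlik hlik1 hkm (fun _ => measureReal_nonneg)
        (fun _ => measureReal_le_one) hs (fun x x' => hdp z j x x') x').trans ?_
      have hk := measureReal_nonneg (μ := K (Function.update z j x')) (s := A)
      calc _ ≤ 2 * L * ((Real.exp ε - 1) * (K (Function.update z j x')).real A + δ) := by gcongr
        _ = 2 * L * (Real.exp ε - 1) * (K (Function.update z j x')).real A + b := by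
            rw [hb]; ring
        _ ≤ _ := by gcongr
    have havg : ∀ (P : Measure (ℝ × unitInterval)), IsProbabilityMeasure P → ∀ z (j : Fin n),
        |∫ x, (K (Function.update z j x)).real A ∂regressionLaw f
        - ∫ x, (K (Function.update z j x)).real A ∂regressionLaw 0|
        ≤ a * (∫ x, (K (Function.update z j x)).real A ∂P) + b := by
      intro P _ z j
      have hi : Integrable (fun x => (K (Function.update z j x)).real A) P :=
        Integrable.of_bound (hFm.comp (measurable_update z)).aestronglyMeasurable 1
          (ae_of_all _ fun x => by
            rw [Real.norm_eq_abs, abs_of_nonneg measureReal_nonneg]; exact measureReal_le_one)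
      have := integral_mono (integrable_const _) ((hi.const_mul a).add (integrable_const b))
        fun x' => hex z j x'
      rw [integral_add' (hi.const_mul a) (integrable_const b), integral_const_mul] at this
      simpa using this
    constructor
    · rw [hreal _ inferInstance, hreal _ inferInstance]
      have := integral_pi_le_of_exchange (regressionLaw 0) (regressionLaw f) ha0 hb0
        (fun z : Fin n → ℝ × unitInterval => (K z).real A) hFm (fun _ => measureReal_nonneg) hF1
        fun z j => by linarith [(abs_le.1 (havg (regressionLaw 0) hp0 z j)).2]
      rw [Fintype.card_fin] at this
      linarith
    · rw [hreal _ inferInstance, hreal _ inferInstance]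
      have := integral_pi_le_of_exchange (regressionLaw f) (regressionLaw 0) ha0 hb0
        (fun z : Fin n → ℝ × unitInterval => (K z).real A) hFm (fun _ => measureReal_nonneg) hF1
        fun z j => by linarith [(abs_le.1 (havg (regressionLaw f) hp1 z j)).1]
      rw [Fintype.card_fin] at this
      linarith
  refine (affinityGE_of_indistinguishable Q₀ Q₁ hE1 (fun A hA => (key A hA).1)
    (fun A hA => (key A hA).2)).mono ?_
  have h1 : (E - 1) ^ 2 ≤ (2 * (n * a)) ^ 2 := pow_le_pow_left₀ (by linarith) hE3 2
  have h2 : E * (n * b) ≤ 3 * (n * b) := by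
    gcongr
    linarith
  rw [hb] at h2 ⊢
  nlinarith

end server

/-! ### The equation for the dimension -/

/-- The Weierstrass product inequality. -/
lemma one_sub_sum_le_prod {ι : Type*} (s : Finset ι) (h : ι → ℝ) (h0 : ∀ j ∈ s, 0 ≤ h j)
    (h1 : ∀ j ∈ s, h j ≤ 1) : 1 - ∑ j ∈ s, h j ≤ ∏ j ∈ s, (1 - h j) := by
  classical
  induction s using Finset.induction_on with
  | empty => simp
  | insert i s hi ih =>
    rw [Finset.sum_insert hi, Finset.prod_insert hi]
    have ih' := ih (fun j hj => h0 j (Finset.mem_insert_of_mem hj))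
      fun j hj => h1 j (Finset.mem_insert_of_mem hj)
    have a0 := h0 i (Finset.mem_insert_self i s)
    have a1 := h1 i (Finset.mem_insert_self i s)
    have a2 : 0 ≤ ∑ j ∈ s, h j :=
      Finset.sum_nonneg fun j hj => h0 j (Finset.mem_insert_of_mem hj)
    nlinarith [mul_le_mul_of_nonneg_left ih' (sub_nonneg.2 a1), mul_nonneg a0 a2]

lemma SolvesDimensionEq.sum_min_le_mul {γ : ℝ} {m : ℕ} {n : Fin m → ℕ} {ε : Fin m → ℝ} {D D' : ℝ}
    (hD : SolvesDimensionEq γ n ε D) (h : D ≤ D') :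
    ∑ j, min ((n j : ℝ) ^ 2 * ε j ^ 2) ((n j : ℝ) * D') ≤ D' * D ^ (2 * γ + 1) := by
  have hD0 := hD.1
  have hD'0 : 0 < D' := hD0.trans_le h
  have hr : 1 ≤ D' / D := (one_le_div hD0).2 h
  calc ∑ j, min ((n j : ℝ) ^ 2 * ε j ^ 2) ((n j : ℝ) * D')
      ≤ ∑ j, D' / D * min ((n j : ℝ) ^ 2 * ε j ^ 2) ((n j : ℝ) * D) := by
        refine Finset.sum_le_sum fun j _ => ?_
        rw [mul_min_of_nonneg _ _ (by positivity)]
        refine min_le_min (le_mul_of_one_le_left (by positivity) hr) (le_of_eq ?_)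
        field_simp
    _ = D' * D ^ (2 * γ + 1) := by
        rw [← Finset.mul_sum, ← hD.2, show 2 * γ + 2 = 2 * γ + 1 + 1 by ring,
          Real.rpow_add_one hD0.ne']
        field_simp

/-- At a dimension above its solution the dimension equation becomes an inequality. -/
lemma SolvesDimensionEq.sum_min_le {γ : ℝ} {m : ℕ} {n : Fin m → ℕ} {ε : Fin m → ℝ} {D D' : ℝ}
    (hD : SolvesDimensionEq γ n ε D) (hγ : 0 < γ) (h : D ≤ D') :
    ∑ j, min ((n j : ℝ) ^ 2 * ε j ^ 2) ((n j : ℝ) * D') ≤ D' ^ (2 * γ + 2) := by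
  have hD0 := hD.1
  have hD'0 : 0 < D' := hD0.trans_le h
  calc _ ≤ D' * D ^ (2 * γ + 1) := hD.sum_min_le_mul h
    _ ≤ D' * D' ^ (2 * γ + 1) := by gcongr
    _ = D' ^ (2 * γ + 1 + 1) := by rw [Real.rpow_add_one hD'0.ne' (2 * γ + 1), mul_comm]
    _ = _ := by congr 1; ring

/-- After division by `D`, the left side of the dimension equation is strictly increasing and the
right side is decreasing. -/
lemma existsUnique_solvesDimensionEq {γ : ℝ} {m : ℕ} {n : Fin m → ℕ} {ε : Fin m → ℝ} (hγ : 0 < γ)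
    (hm : 0 < m) (hn : ∀ j, 1 ≤ n j) (hε : ∀ j, 0 < ε j) :
    ∃! D : ℝ, SolvesDimensionEq γ n ε D := by
  have hlt : ∀ D D' : ℝ, SolvesDimensionEq γ n ε D → SolvesDimensionEq γ n ε D' → ¬ D < D' := by
    intro D D' h h' hlt
    have h1 := h.sum_min_le_mul hlt.le
    have h'0 := h'.1
    rw [← h'.2, show 2 * γ + 2 = 2 * γ + 1 + 1 by ring, Real.rpow_add_one h'0.ne',
      mul_comm] at h1
    have h2 : D ^ (2 * γ + 1) < D' ^ (2 * γ + 1) := Real.rpow_lt_rpow h.1.le hlt (by linarith)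
    exact absurd (le_of_mul_le_mul_left h1 h'0) (not_le.2 h2)
  suffices hex : ∃ D, SolvesDimensionEq γ n ε D by
    obtain ⟨D, hD⟩ := hex
    exact ⟨D, hD, fun D' hD' => le_antisymm (not_lt.1 (hlt D D' hD hD'))
      (not_lt.1 (hlt D' D hD' hD))⟩
  set j₀ : Fin m := ⟨0, hm⟩
  have hn0 : ∀ j, (1 : ℝ) ≤ n j := fun j => by exact_mod_cast hn j
  set F : ℝ → ℝ := fun D => D ^ (2 * γ + 2)
    - ∑ j, min ((n j : ℝ) ^ 2 * ε j ^ 2) ((n j : ℝ) * D) with hF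
  set N : ℝ := ∑ j, (n j : ℝ) with hN
  have hN1 : 1 ≤ N := (hn0 j₀).trans (Finset.single_le_sum (f := fun j => (n j : ℝ))
    (fun j _ => by linarith [hn0 j]) (Finset.mem_univ j₀))
  have hsplit : ∀ D : ℝ, 0 < D → D ^ (2 * γ + 2) = D ^ (2 * γ + 1) * D := fun D hD => by
    rw [← Real.rpow_add_one hD.ne']; congr 1; ring
  set D₁ : ℝ := min (1 / 2) ((n j₀ : ℝ) * ε j₀ ^ 2)
  have hpos : 0 < (n j₀ : ℝ) * ε j₀ ^ 2 :=
    mul_pos (by linarith [hn0 j₀]) (pow_pos (hε j₀) 2)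
  have hD₁ : 0 < D₁ := lt_min (by norm_num) hpos
  have hD₁2 : D₁ ≤ 1 / 2 := min_le_left _ _
  -- Near zero the sum is at least linear in `D`, and `D ^ (2 γ + 2)` is smaller.
  have h1 : F D₁ ≤ 0 := by
    have h2 : D₁ ≤ ∑ j, min ((n j : ℝ) ^ 2 * ε j ^ 2) ((n j : ℝ) * D₁) := by
      refine le_trans (le_min ?_ ?_) (Finset.single_le_sum
        (f := fun j => min ((n j : ℝ) ^ 2 * ε j ^ 2) ((n j : ℝ) * D₁))
        (fun j _ => le_min (by positivity) (by positivity)) (Finset.mem_univ j₀))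
      · calc D₁ ≤ (n j₀ : ℝ) * ε j₀ ^ 2 := min_le_right _ _
          _ ≤ n j₀ * ((n j₀ : ℝ) * ε j₀ ^ 2) := le_mul_of_one_le_left hpos.le (hn0 j₀)
          _ = _ := by ring
      · exact le_mul_of_one_le_left hD₁.le (hn0 j₀)
    have h3 : D₁ ^ (2 * γ + 1) ≤ 1 :=
      Real.rpow_le_one hD₁.le (by linarith) (by linarith)
    have h4 : D₁ ^ (2 * γ + 1) * D₁ ≤ 1 * D₁ := by gcongr
    simp only [hF, hsplit D₁ hD₁]
    linarith
  -- At `D = N` the sum is at most `N ^ 2`.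
  have h2 : 0 ≤ F N := by
    have h3 : ∑ j, min ((n j : ℝ) ^ 2 * ε j ^ 2) ((n j : ℝ) * N) ≤ N * N := by
      rw [hN, Finset.sum_mul]
      exact Finset.sum_le_sum fun j _ => min_le_right _ _
    have h4 : N ≤ N ^ (2 * γ + 1) := by
      conv_lhs => rw [← Real.rpow_one N]
      exact Real.rpow_le_rpow_of_exponent_le hN1 (by linarith)
    have h5 : N * N ≤ N ^ (2 * γ + 1) * N := by gcongr
    simp only [hF, hsplit N (by linarith)]
    linarith
  have hcont : Continuous F := by
    refine (continuous_id.rpow_const fun _ => Or.inr (by linarith)).sub ?_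
    exact continuous_finsetSum _ fun j _ =>
      continuous_const.min (continuous_const.mul continuous_id)
  obtain ⟨D, hD, hD0⟩ := intermediate_value_Icc (by linarith : D₁ ≤ N) hcont.continuousOn
    (show (0 : ℝ) ∈ Set.Icc (F D₁) (F N) from ⟨h1, h2⟩)
  exact ⟨D, hD₁.trans_le hD.1, sub_eq_zero.1 hD0⟩

/-- Replacing `D ∨ 1` by a dyadic number of the same order costs a constant. -/
lemma min_rpow_one_le {γ c D D' : ℝ} (hγ : 0 < γ) (hc : 0 < c) (hD : 0 < D) (hD' : 0 < D')
    (h : D' ≤ c * max D 1) : c ^ (-2 * γ) * min (D ^ (-2 * γ)) 1 ≤ D' ^ (-2 * γ) := by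
  have hm : 0 < max D 1 := lt_max_of_lt_left hD
  have h1 : min (D ^ (-2 * γ)) 1 ≤ (max D 1) ^ (-2 * γ) := by
    rcases le_total D 1 with hD1 | hD1
    · rw [max_eq_right hD1, Real.one_rpow]; exact min_le_right _ _
    · rw [max_eq_left hD1]; exact min_le_left _ _
  calc c ^ (-2 * γ) * min (D ^ (-2 * γ)) 1 ≤ c ^ (-2 * γ) * (max D 1) ^ (-2 * γ) := by gcongr
    _ = (c * max D 1) ^ (-2 * γ) := (Real.mul_rpow hc.le hm.le).symm
    _ ≤ _ := Real.rpow_le_rpow_of_nonpos hD' h (by linarith)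

/-! ### The pointwise lower bound -/

section lower

variable {W : WaveletSystem} {A : ℕ} {α R : ℝ} {p q : ℝ≥0∞}

/-- The least favourable alternative for the value at `x₀`: a multiple of the reproducing kernel
`∑ ψ_{ik}(x₀) ψ_{ik}` of a few levels around `J`, of height `D' ^ (-ν)` at `x₀` and of width
`1 / D'`, where `D' = 2 ^ (l₀ + J)`. -/
lemma exists_bump (hW : W.IsRegularBasis A) (hA : 1 ≤ A) (hp : 1 ≤ p) (hq : 1 ≤ q)
    (hν : 0 < α - (p⁻¹).toReal) :
    ∃ Γ : ℝ, 1 ≤ Γ ∧ ∀ (x₀ : unitInterval) (J : ℕ) (u : ℝ), 0 < u → u ≤ R →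
      ∃ f : unitInterval → ℝ, Continuous f ∧ f ∈ besovBall W α p q R ∧
        u / Γ * W.scale J ^ (-(α - (p⁻¹).toReal)) / 8 ≤ f x₀ ∧
        (∀ x, |f x| ≤ u * W.scale J ^ (-(α - (p⁻¹).toReal))) ∧
        ∫ x, |f x| ≤ u * W.scale J ^ (-(α - (p⁻¹).toReal) - 1) ∧
        ∫ x, f x ^ 2 ≤ u ^ 2 * W.scale J ^ (-2 * (α - (p⁻¹).toReal) - 1) := by
  obtain ⟨K, hK⟩ := hW.exists_localized
  obtain ⟨a, ha⟩ := hW.exists_window hA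
  have hK1 := hK.one_le
  have hK0 : 0 < K := zero_lt_one.trans_le hK1
  set ν := α - (p⁻¹).toReal with hνdef
  -- bounds the number of levels times the constants that occur in the norms of the bump
  set w : ℝ := (2 * a) * (2 : ℝ) ^ ((a : ℝ) * (ν + 1)) with hw
  have hw0 : 0 ≤ w := by positivity
  set Γ : ℝ := 1 + 2 * K ^ 3 * w with hΓ
  have hΓ1 : 1 ≤ Γ := by rw [hΓ]; linarith [show 0 ≤ 2 * K ^ 3 * w by positivity]
  refine ⟨Γ, hΓ1, fun x₀ J u hu huR => ?_⟩
  have hΓ0 : 0 < Γ := by linarith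
  set D' := W.scale J with hD'
  have hD'0 : 0 < D' := W.scale_pos J
  set s := Finset.Ico (J - a) (J + a) with hs
  have hcard : (s.card : ℝ) ≤ 2 * a := by
    rw [hs, Nat.card_Ico]
    have : J + a - (J - a) ≤ 2 * a := by omega
    exact_mod_cast this
  have hsc : ∀ i ∈ s, W.scale i ≤ 2 ^ a * D' := fun i hi => by
    rw [hD', WaveletSystem.scale, WaveletSystem.scale, ← pow_add]
    have : i < J + a := (Finset.mem_Ico.1 hi).2
    exact pow_le_pow_right₀ one_le_two (by omega)
  have hpow : ∀ b : ℝ, 0 ≤ b → b ≤ ν + 1 → ∑ i ∈ s, W.scale i ^ b ≤ w * D' ^ b := by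
    intro b hb hb'
    calc ∑ i ∈ s, W.scale i ^ b ≤ ∑ _i ∈ s, (2 : ℝ) ^ ((a : ℝ) * (ν + 1)) * D' ^ b := by
          refine Finset.sum_le_sum fun i hi => ?_
          calc W.scale i ^ b ≤ (2 ^ a * D') ^ b :=
                Real.rpow_le_rpow (W.scale_pos i).le (hsc i hi) hb
            _ = (2 : ℝ) ^ ((a : ℝ) * b) * D' ^ b := by
                rw [Real.mul_rpow (by positivity) hD'0.le, ← Real.rpow_natCast,
                  ← Real.rpow_mul (by norm_num)]
            _ ≤ _ := by gcongr; norm_num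
      _ = s.card * ((2 : ℝ) ^ ((a : ℝ) * (ν + 1)) * D' ^ b) := by
          rw [Finset.sum_const, nsmul_eq_mul]
      _ ≤ 2 * a * ((2 : ℝ) ^ ((a : ℝ) * (ν + 1)) * D' ^ b) := by gcongr
      _ = _ := by rw [hw]; ring
  have hK3 : K ≤ 2 * K ^ 3 := by nlinarith [pow_le_pow_left₀ zero_le_one hK1 2, pow_pos hK0 2]
  have hK2 : K ^ 2 ≤ 2 * K ^ 3 := by nlinarith [pow_pos hK0 2]
  set t := u / Γ * D' ^ (-ν - 1) with ht
  have ht0 : 0 < t := by positivity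
  have htΓ : ∀ x b, 0 ≤ x → x ≤ 2 * K ^ 3 → t * (x * (w * D' ^ b)) ≤ u * D' ^ (b - ν - 1) := by
    intro x b hx0 hx
    have h1 : x * w ≤ Γ := by
      have := mul_le_mul_of_nonneg_right hx hw0
      rw [hΓ]; linarith
    calc t * (x * (w * D' ^ b)) = u * (x * w / Γ) * (D' ^ (-ν - 1) * D' ^ b) := by
          rw [ht]; field_simp
      _ ≤ u * 1 * (D' ^ (-ν - 1) * D' ^ b) := by gcongr; exact (div_le_one hΓ0).2 h1
      _ = _ := by rw [← Real.rpow_add hD'0]; ring_nf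
  set c : ℕ → ℕ → ℝ := fun i k => t * W.fn i k x₀ with hc
  set f : unitInterval → ℝ := fun x => W.combo s c x with hf
  have hcont : Continuous f := (hW.continuous_combo s c).comp continuous_subtype_val
  have hcsum : ∀ i, ∑ k : Fin (W.count i), |c i k| ≤ t * (K * √(W.scale i)) := fun i => by
    simp only [hc, abs_mul, abs_of_pos ht0, ← Finset.mul_sum]
    gcongr
    exact hK.sum_le i x₀
  have habs : ∀ x, |f x| ≤ ∑ i ∈ s, ∑ k : Fin (W.count i), |c i k| * |W.fn i k x| := fun x => by
    refine (Finset.abs_sum_le_sum_abs _ _).trans (Finset.sum_le_sum fun i _ => ?_)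
    refine (Finset.abs_sum_le_sum_abs _ _).trans (le_of_eq ?_)
    simp only [abs_mul]
  refine ⟨f, hcont, ?_, ?_, fun x => ?_, ?_, ?_⟩
  · refine combo_mem_besovBall hW hq s c (fun i => t * (K * √(W.scale i)))
      (fun i _ => by positivity) (fun i _ => ?_) hp ?_
    · refine (ellNorm_le_tsum hp _).trans ?_
      rw [tsum_fintype]
      refine le_trans (le_of_eq ?_) (ENNReal.ofReal_le_ofReal (hcsum i))
      rw [ENNReal.ofReal_sum_of_nonneg fun _ _ => abs_nonneg _]
      simp only [Real.enorm_eq_ofReal_abs]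
    · calc _ = t * (K * ∑ i ∈ s, W.scale i ^ (ν + 1)) := by
            rw [Finset.mul_sum, Finset.mul_sum]
            refine Finset.sum_congr rfl fun i _ => ?_
            rw [show ν + 1 = (α + 1 / 2 - (p⁻¹).toReal) + 1 / 2 by rw [hνdef]; ring,
              Real.rpow_add (W.scale_pos i), Real.sqrt_eq_rpow]
            ring
        _ ≤ t * (K * (w * D' ^ (ν + 1))) := by gcongr; exact hpow _ (by linarith) le_rfl
        _ ≤ u * D' ^ (ν + 1 - ν - 1) := htΓ K _ hK0.le hK3
        _ = u := by rw [show ν + 1 - ν - 1 = 0 by ring]; simp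
        _ ≤ R := huR
  · calc u / Γ * D' ^ (-ν) / 8 = t * (D' / 8) := by
          rw [ht, show -ν = (-ν - 1) + 1 by ring, Real.rpow_add_one hD'0.ne']
          ring_nf
      _ ≤ t * ∑ i ∈ s, ∑ k : Fin (W.count i), W.fn i k x₀ ^ 2 := by gcongr; exact ha J x₀
      _ = f x₀ := by
          simp only [hf, WaveletSystem.combo, hc, Finset.mul_sum]
          refine Finset.sum_congr rfl fun i _ => Finset.sum_congr rfl fun k _ => by ring
  · calc |f x| ≤ ∑ i ∈ s, t * (K ^ 2 * W.scale i ^ (1 : ℝ)) := by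
          refine (habs x).trans (Finset.sum_le_sum fun i _ => ?_)
          calc _ ≤ ∑ k : Fin (W.count i), |c i k| * (K * √(W.scale i)) := by
                gcongr with k _
                exact hK.abs_fn_le i k x
            _ ≤ t * (K * √(W.scale i)) * (K * √(W.scale i)) := by
                rw [← Finset.sum_mul]
                gcongr
                exact hcsum i
            _ = _ := by
                rw [Real.rpow_one]
                nth_rewrite 3 [← Real.mul_self_sqrt (W.scale_pos i).le]
                ring
      _ ≤ t * (K ^ 2 * (w * D' ^ (1 : ℝ))) := by
          rw [← Finset.mul_sum, ← Finset.mul_sum]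
          gcongr
          exact hpow 1 zero_le_one (by linarith)
      _ ≤ u * D' ^ (1 - ν - 1) := htΓ _ _ (by positivity) hK2
      _ = _ := by ring_nf
  · have hi : ∀ i (k : Fin (W.count i)), Integrable (fun x : unitInterval => |c i k| * |W.fn i k x|)
        volume := fun i k => integrable_of_continuous_unitInterval
          (((hW.continuous_fn i k).comp continuous_subtype_val).abs.const_mul _)
    calc ∫ x, |f x| ≤ ∫ x : unitInterval, ∑ i ∈ s, ∑ k : Fin (W.count i), |c i k| * |W.fn i k x| :=
          integral_mono (integrable_of_continuous_unitInterval hcont.abs)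
            (integrable_finsetSum _ fun i _ => integrable_finsetSum _ fun k _ => hi i k) habs
      _ = ∑ i ∈ s, ∑ k : Fin (W.count i), |c i k| * ∫ x : unitInterval, |W.fn i k x| := by
          rw [integral_finsetSum _ fun i _ => integrable_finsetSum _ fun k _ => hi i k]
          refine Finset.sum_congr rfl fun i _ => ?_
          rw [integral_finsetSum _ fun k _ => hi i k]
          simp only [integral_const_mul]
      _ ≤ ∑ i ∈ s, t * (2 * K ^ 3 * W.scale i ^ (0 : ℝ)) := by
          refine Finset.sum_le_sum fun i _ => ?_
          have hsi : 0 < √(W.scale i) := Real.sqrt_pos.2 (W.scale_pos i)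
          calc _ ≤ ∑ k : Fin (W.count i), |c i k| * (2 * K ^ 2 / √(W.scale i)) := by
                gcongr with k _
                exact hK.integral_abs_fn_le hW i k
            _ ≤ t * (K * √(W.scale i)) * (2 * K ^ 2 / √(W.scale i)) := by
                rw [← Finset.sum_mul]
                gcongr
                exact hcsum i
            _ = _ := by rw [Real.rpow_zero]; field_simp
      _ ≤ t * (2 * K ^ 3 * (w * D' ^ (0 : ℝ))) := by
          rw [← Finset.mul_sum, ← Finset.mul_sum]
          gcongr
          exact hpow 0 le_rfl (by linarith)
      _ ≤ u * D' ^ (0 - ν - 1) := htΓ _ _ (by positivity) le_rfl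
      _ = _ := by ring_nf
  · have htt : t ≤ u * D' ^ (-ν - 1) := by
      rw [ht]; gcongr; exact div_le_self hu.le hΓ1
    calc ∫ x, f x ^ 2 = ∑ i ∈ s, ∑ k : Fin (W.count i), c i k ^ 2 := hW.integral_combo_sq s c
      _ ≤ ∑ i ∈ s, t * (t * (K ^ 2 * W.scale i ^ (1 : ℝ))) := by
          refine Finset.sum_le_sum fun i _ => ?_
          simp only [hc, mul_pow, ← Finset.mul_sum]
          rw [Real.rpow_one, sq t, mul_assoc]
          gcongr
          exact hK.sum_sq_le i x₀
      _ ≤ t * (t * (K ^ 2 * (w * D' ^ (1 : ℝ)))) := by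
          rw [← Finset.mul_sum, ← Finset.mul_sum, ← Finset.mul_sum]
          gcongr
          exact hpow 1 zero_le_one (by linarith)
      _ ≤ (u * D' ^ (-ν - 1)) * (u * D' ^ (1 - ν - 1)) :=
          mul_le_mul htt (htΓ _ _ (by positivity) hK2) (by positivity) (by positivity)
      _ = u ^ 2 * (D' ^ (-ν - 1) * D' ^ (1 - ν - 1)) := by ring
      _ = _ := by rw [← Real.rpow_add hD'0]; ring_nf

/-- The pointwise minimax risk is at least of the order `D ^ (- 2 ν) ∧ 1`. -/
lemma le_pointwiseMinimaxRisk (hW : W.IsRegularBasis A) (hA : 1 ≤ A) (hR : 0 < R) (hp : 1 ≤ p)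
    (hq : 1 ≤ q) (hν : 0 < α - (p⁻¹).toReal) (Cε : ℝ) :
    ∃ η c : ℝ, 0 < η ∧ 0 < c ∧ ∀ (x₀ : unitInterval) (m : ℕ) (n : Fin m → ℕ) (ε δ : Fin m → ℝ)
      (D : ℝ), (∀ j, 0 < ε j ∧ ε j ≤ Cε) → (∀ j, 0 ≤ δ j) →
      SolvesDimensionEq (α - (p⁻¹).toReal) n ε D → ∑ j, (n j : ℝ) * δ j ≤ η →
      ENNReal.ofReal (c * min (D ^ (-2 * (α - (p⁻¹).toReal))) 1)
        ≤ pointwiseMinimaxRisk n ε δ x₀ (besovBall W α p q R) := by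
  obtain ⟨Γ, hΓ1, hbump⟩ := exists_bump (α := α) hW hA hp hq hν
  have hΓ0 : 0 < Γ := by linarith
  set ν := α - (p⁻¹).toReal
  set E := Real.exp |Cε| with hE
  have hE1 : 1 ≤ E := Real.one_le_exp (abs_nonneg _)
  have hE0 : 0 < E := by linarith
  set u := min (min R 1) (1 / (12 * E)) with hu
  have hu0 : 0 < u := lt_min (lt_min hR one_pos) (by positivity)
  have huR : u ≤ R := (min_le_left _ _).trans (min_le_left _ _)
  have hu1 : u ≤ 1 := (min_le_left _ _).trans (min_le_right _ _)
  have huE : u * E ≤ 1 / 12 := by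
    calc u * E ≤ 1 / (12 * E) * E := by gcongr; exact min_le_right _ _
      _ = 1 / 12 := by field_simp
  set c₀ : ℝ := 2 ^ (W.l₀ + 1) with hc₀
  have hc₀0 : 0 < c₀ := by positivity
  refine ⟨1 / 48, (u / Γ / 8) ^ 2 / 16 * c₀ ^ (-2 * ν), by norm_num, by positivity,
    fun x₀ m n ε δ D hε hδ hD hη => le_iInf fun P => ?_⟩
  have hD0 := hD.1
  obtain ⟨J, hJ1, hJ2⟩ := exists_scale_near W (le_max_right D 1)
  set D' := W.scale J with hD'
  have hD'0 : 0 < D' := W.scale_pos J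
  have hD'1 : 1 ≤ D' := W.one_le_scale J
  have hDD' : D ≤ D' := (le_max_left _ _).trans hJ1
  obtain ⟨f, hfc, hfB, hfx, hfs, hfL, hfS⟩ := hbump x₀ J u hu0 huR
  have hDν : D' ^ (-ν) ≤ 1 := Real.rpow_le_one_of_one_le_of_nonpos hD'1 (by linarith)
  have hDν1 : D' ^ (-ν - 1) ≤ 1 := Real.rpow_le_one_of_one_le_of_nonpos hD'1 (by linarith)
  have hf1 : ∀ x, |f x| ≤ 1 := fun x => (hfs x).trans (mul_le_one₀ hu1 (by positivity) hDν)
  have hz : (0 : unitInterval → ℝ) ∈ besovBall W α p q R := by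
    have := combo_mem_besovBall (α := α) hW hq ∅ (fun _ _ => 0) (fun _ => 0) (by simp) (by simp) hp
      (R := R) (by simpa using hR.le)
    have h0 : (fun x : unitInterval => W.combo ∅ (fun _ _ => 0) x) = 0 := by
      funext x; simp [WaveletSystem.combo]
    rwa [h0] at this
  have hP0 := P.isProbabilityMeasure_transcriptLaw (f := 0) measurable_const
  have hP1 := P.isProbabilityMeasure_transcriptLaw hfc.measurable
  have hr1 := isProbabilityMeasure_regressionLaw hfc.measurable
  have hr0 := isProbabilityMeasure_regressionLaw (f := 0) measurable_const
  -- the loss of affinity at server `j`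
  set h : Fin m → ℝ := fun j => 32 * (u * E) ^ 2 * D' ^ (-2 * ν - 2)
    * min ((n j : ℝ) ^ 2 * ε j ^ 2) (n j * D') + 12 * ((∫ x, |f x|) * (n j * δ j)) with hh
  have hL0 : 0 ≤ ∫ x, |f x| := integral_nonneg fun _ => abs_nonneg _
  have hL1 : ∫ x, |f x| ≤ 1 := hfL.trans (mul_le_one₀ hu1 (by positivity) hDν1)
  have hh0 : ∀ j, 0 ≤ h j := fun j => by have := hδ j; positivity
  have hhsum : ∑ j, h j ≤ 1 / 2 := by
    simp only [hh, Finset.sum_add_distrib, ← Finset.mul_sum]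
    have h1 : D' ^ (-2 * ν - 2) * ∑ j, min ((n j : ℝ) ^ 2 * ε j ^ 2) ((n j : ℝ) * D') ≤ 1 := by
      calc _ ≤ D' ^ (-2 * ν - 2) * D' ^ (2 * ν + 2) := by
            gcongr; exact hD.sum_min_le hν hDD'
        _ = 1 := by rw [← Real.rpow_add hD'0]; simp
    have h2 : (u * E) ^ 2 ≤ (1 / 12) ^ 2 := pow_le_pow_left₀ (by positivity) huE 2
    have h3 : (∫ x, |f x|) * ∑ j, (n j : ℝ) * δ j ≤ 1 * (1 / 48) := by
      refine mul_le_mul hL1 hη ?_ zero_le_one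
      exact Finset.sum_nonneg fun j _ => mul_nonneg (Nat.cast_nonneg _) (hδ j)
    have h4 : 32 * (u * E) ^ 2 * (D' ^ (-2 * ν - 2)
        * ∑ j, min ((n j : ℝ) ^ 2 * ε j ^ 2) ((n j : ℝ) * D')) ≤ 32 * (1 / 12) ^ 2 * 1 := by
      gcongr
    rw [← mul_assoc] at h4
    linarith
  have hh1 : ∀ j, h j ≤ 1 / 2 := fun j =>
    (Finset.single_le_sum (fun j _ => hh0 j) (Finset.mem_univ j)).trans hhsum
  have haff : ∀ j, AffinityGE ((Measure.pi fun _ : Fin (n j) => regressionLaw 0).bind (P.K j))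
      ((Measure.pi fun _ : Fin (n j) => regressionLaw f).bind (P.K j)) (1 - h j) := by
    intro j
    have hδ' : 0 ≤ 12 * ((∫ x, |f x|) * (n j * δ j)) := by have := hδ j; positivity
    rcases le_total ((n j : ℝ) ^ 2 * ε j ^ 2) (n j * D') with hc | hc
    · have he : Real.exp (ε j) - 1 ≤ ε j * E := by
        have h1 : 1 - ε j ≤ Real.exp (-ε j) := by linarith [Real.add_one_le_exp (-ε j)]
        have h2 : Real.exp (ε j) ≤ E :=
          Real.exp_le_exp.2 ((hε j).2.trans (le_abs_self _))
        have h3 : Real.exp (ε j) * Real.exp (-ε j) = 1 := by rw [← Real.exp_add]; simp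
        nlinarith [mul_le_mul_of_nonneg_left h1 (Real.exp_pos (ε j)).le, (hε j).1]
      have hεE : 0 ≤ ε j * E := mul_nonneg (hε j).1.le hE0.le
      refine (affinityGE_private hfc hf1 (hε j).1.le (hδ j) (P.isDP j)
        (a := 2 * (u * D' ^ (-ν - 1)) * (ε j * E)) ?_).mono ?_
      · have : 0 ≤ Real.exp (ε j) - 1 := by linarith [Real.add_one_le_exp (ε j), (hε j).1]
        gcongr
      · have hD2 : (D' ^ (-ν - 1)) ^ 2 = D' ^ (-2 * ν - 2) := by
          rw [← Real.rpow_natCast, ← Real.rpow_mul hD'0.le]; congr 1; push_cast; ring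
        simp only [hh, min_eq_left hc]
        rw [← hD2]
        exact le_of_eq (by ring)
    · refine (affinityGE_transcript hfc (P.K j)).mono ?_
      simp only [hh, min_eq_right hc]
      have h1 : (n j : ℝ) * ∫ x, f x ^ 2 ≤ n j * (u ^ 2 * D' ^ (-2 * ν - 1)) := by gcongr
      have h2 : D' ^ (-2 * ν - 1) = D' ^ (-2 * ν - 2) * D' := by
        rw [← Real.rpow_add_one hD'0.ne']; congr 1; ring
      have h3 : 32 * (u * E) ^ 2 * D' ^ (-2 * ν - 2) * (n j * D')
          = n j * (u ^ 2 * D' ^ (-2 * ν - 1)) * (32 * E ^ 2) := by rw [h2]; ring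
      have h4 : 0 ≤ (n j : ℝ) * (u ^ 2 * D' ^ (-2 * ν - 1)) := by positivity
      have h5 : 1 ≤ 32 * E ^ 2 := by nlinarith only [hE1]
      have h6 := le_mul_of_one_le_right h4 h5
      rw [h3]
      linarith only [h1, h6, hδ']
  have hpi := AffinityGE.pi haff fun j => by linarith only [hh1 j]
  have hhalf : AffinityGE (P.transcriptLaw 0) (P.transcriptLaw f) (1 / 2) := by
    refine AffinityGE.mono hpi ?_
    have := one_sub_sum_le_prod Finset.univ h (fun j _ => hh0 j)
      fun j _ => (hh1 j).trans (by norm_num)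
    exact le_trans (by linarith only [hhsum]) this
  have hg : Measurable fun t => P.est t x₀ :=
    P.measurable_est.comp (measurable_id.prodMk measurable_const)
  have hcam := hhalf.le_max_risk hg (a₀ := (0 : unitInterval → ℝ) x₀) (a₁ := f x₀)
  have hval : (u / Γ / 8) ^ 2 / 16 * c₀ ^ (-2 * ν) * min (D ^ (-2 * ν)) 1
      ≤ (f x₀ - (0 : unitInterval → ℝ) x₀) ^ 2 / 16 := by
    have h1 := min_rpow_one_le hν hc₀0 hD0 hD'0 hJ2
    have h2 : (u / Γ * D' ^ (-ν) / 8) ^ 2 ≤ f x₀ ^ 2 := pow_le_pow_left₀ (by positivity) hfx 2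
    have h3 : (D' ^ (-ν)) ^ 2 = D' ^ (-2 * ν) := by
      rw [← Real.rpow_natCast, ← Real.rpow_mul hD'0.le]; congr 1; push_cast; ring
    calc _ = (u / Γ / 8) ^ 2 / 16 * (c₀ ^ (-2 * ν) * min (D ^ (-2 * ν)) 1) := by ring
      _ ≤ (u / Γ / 8) ^ 2 / 16 * D' ^ (-2 * ν) := by gcongr
      _ = (u / Γ * D' ^ (-ν) / 8) ^ 2 / 16 := by rw [← h3]; ring
      _ ≤ _ := by rw [Pi.zero_apply, sub_zero]; gcongr
  have r0 : P.pointwiseRisk x₀ 0 ≤ ⨆ f ∈ {f ∈ besovBall W α p q R | Continuous f},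
      P.pointwiseRisk x₀ f :=
    le_iSup₂ (f := fun g (_ : g ∈ {f ∈ besovBall W α p q R | Continuous f}) =>
      P.pointwiseRisk x₀ g) 0 ⟨hz, continuous_const⟩
  have r1 : P.pointwiseRisk x₀ f ≤ ⨆ f ∈ {f ∈ besovBall W α p q R | Continuous f},
      P.pointwiseRisk x₀ f :=
    le_iSup₂ (f := fun g (_ : g ∈ {f ∈ besovBall W α p q R | Continuous f}) =>
      P.pointwiseRisk x₀ g) f ⟨hfB, hfc⟩
  exact (ENNReal.ofReal_le_ofReal hval).trans (hcam.trans (max_le r0 r1))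

end lower

/-! ### Conditional expectations given the transcript -/

/-- The conditional expectation `g` of `V` given the second coordinate, as a function of this
coordinate. -/
lemma exists_condExp_snd {X T : Type*} [MeasurableSpace X] [MeasurableSpace T]
    (μ : Measure (X × T)) [IsProbabilityMeasure μ] {V : X × T → ℝ} (hV : MemLp V 2 μ) :
    ∃ g : T → ℝ, Measurable g ∧ MemLp (fun w : X × T => g w.2) 2 μ ∧
      (∀ h : T → ℝ, Measurable h → MemLp (fun w : X × T => h w.2) 2 μ →
        ∫ w, h w.2 * V w ∂μ = ∫ w, h w.2 * g w.2 ∂μ) ∧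
      ∀ B : ℝ, (∀ w, |V w| ≤ B) → ∀ᵐ w ∂μ, |g w.2| ≤ B := by
  set m : MeasurableSpace (X × T) := MeasurableSpace.comap Prod.snd inferInstance with hm
  have hle : m ≤ Prod.instMeasurableSpace := measurable_snd.comap_le
  have hG : StronglyMeasurable[m] (μ[V|m]) := stronglyMeasurable_condExp
  obtain ⟨g, hgm, hg⟩ := hG.measurable.exists_eq_measurable_comp
  have hgV : (fun w : X × T => g w.2) = μ[V|m] := hg.symm
  have hmem : MemLp (μ[V|m]) 2 μ := hV.condExp (by norm_num)
  refine ⟨g, hgm, hgV ▸ hmem, fun h hhm hh => ?_, fun B hB => ?_⟩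
  · have hhs : StronglyMeasurable[m] fun w : X × T => h w.2 :=
      (hhm.comp (comap_measurable Prod.snd)).stronglyMeasurable
    have hint : Integrable (fun w => h w.2 * V w) μ := hh.integrable_mul hV
    have h1 : μ[fun w => h w.2 * V w|m] =ᵐ[μ] fun w => h w.2 * (μ[V|m]) w :=
      condExp_mul_of_stronglyMeasurable_left hhs hint (hV.integrable (by norm_num))
    rw [← integral_condExp hle, integral_congr_ae h1]
    exact integral_congr_ae (ae_of_all _ fun w => by rw [← hgV])
  · have := ae_bdd_abs_condExp_of_ae_bdd_abs (m := m) (μ := μ) (f := V) (R := B) (ae_of_all _ hB)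
    filter_upwards [this] with w hw
    rw [← hgV] at hw
    exact hw

/-- The Cauchy–Schwarz inequality, in terms of bounds on the second moments. -/
lemma integral_mul_le_sqrt {Ω : Type*} [MeasurableSpace Ω] {μ : Measure Ω} {f g : Ω → ℝ}
    (hf : MemLp f 2 μ) (hg : MemLp g 2 μ) {a b : ℝ} (ha : 0 ≤ a) (hb : 0 ≤ b)
    (hfa : ∫ x, f x ^ 2 ∂μ ≤ a ^ 2) (hgb : ∫ x, g x ^ 2 ∂μ ≤ b ^ 2) :
    ∫ x, f x * g x ∂μ ≤ a * b := by
  have i1 := hf.integrable_sq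
  have i2 := hg.integrable_sq
  have i3 : Integrable (fun x => f x * g x) μ := hf.integrable_mul hg
  have key : ∀ c : ℝ, 0 < c → ∫ x, f x * g x ∂μ ≤ c / 2 * a ^ 2 + 1 / (2 * c) * b ^ 2 := by
    intro c hc
    calc ∫ x, f x * g x ∂μ ≤ ∫ x, (c / 2 * f x ^ 2 + 1 / (2 * c) * g x ^ 2) ∂μ := by
          refine integral_mono i3 ((i1.const_mul _).add (i2.const_mul _)) fun x => ?_
          have : c / 2 * f x ^ 2 + 1 / (2 * c) * g x ^ 2 - f x * g x
              = (c * f x - g x) ^ 2 / (2 * c) := by field_simp; ring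
          have h2 : 0 ≤ (c * f x - g x) ^ 2 / (2 * c) := by positivity
          simp only
          linarith
      _ = c / 2 * ∫ x, f x ^ 2 ∂μ + 1 / (2 * c) * ∫ x, g x ^ 2 ∂μ := by
          rw [integral_add (i1.const_mul _) (i2.const_mul _), integral_const_mul,
            integral_const_mul]
      _ ≤ _ := by gcongr
  refine le_of_forall_pos_le_add fun e he => ?_
  -- the optimal `c` is `b / a`; both numbers are perturbed to be positive
  have hlim : Filter.Tendsto (fun t : ℝ => (a + t) * (b + t)) (nhdsWithin 0 (Set.Ioi 0))
      (nhds ((a + 0) * (b + 0))) := by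
    refine Filter.Tendsto.mono_left ?_ nhdsWithin_le_nhds
    exact (Continuous.tendsto (by fun_prop) 0)
  refine (ge_of_tendsto hlim ?_).trans (by simp [he.le])
  filter_upwards [self_mem_nhdsWithin] with t (ht : 0 < t)
  have ha' : 0 < a + t := by linarith
  have hb' : 0 < b + t := by linarith
  refine (key ((b + t) / (a + t)) (by positivity)).trans ?_
  calc (b + t) / (a + t) / 2 * a ^ 2 + 1 / (2 * ((b + t) / (a + t))) * b ^ 2
      ≤ (b + t) / (a + t) / 2 * (a + t) ^ 2 + 1 / (2 * ((b + t) / (a + t))) * (b + t) ^ 2 := by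
        gcongr <;> linarith
    _ = (a + t) * (b + t) := by field_simp; ring

section dp

variable {n : ℕ} {T : Type} [MeasurableSpace T] {ε δ : ℝ}
  {K : Kernel (Fin n → ℝ × unitInterval) T}

/-- Differential privacy for expectations of bounded nonnegative functions, by the layer cake
formula. -/
lemma IsDP.integral_le [IsMarkovKernel K] (hK : IsDP ε δ K) (hδ : 0 ≤ δ)
    {z z' : Fin n → ℝ × unitInterval} (hz : hammingDist z z' ≤ 1) {h : T → ℝ} (hm : Measurable h)
    {B : ℝ} (h0 : ∀ t, 0 ≤ h t) (hB : ∀ t, h t ≤ B) :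
    ∫ t, h t ∂K z ≤ Real.exp ε * ∫ t, h t ∂K z' + B * δ := by
  obtain ⟨t₀⟩ : Nonempty T := nonempty_of_isProbabilityMeasure (K z)
  have hB0 : 0 ≤ B := (h0 t₀).trans (hB t₀)
  have hi : ∀ z, Integrable h (K z) := fun z =>
    Integrable.of_bound hm.aestronglyMeasurable B (ae_of_all _ fun t => by
      rw [Real.norm_eq_abs, abs_of_nonneg (h0 t)]; exact hB t)
  have hI : ∀ z, 0 ≤ ∫ t, h t ∂K z := fun z => integral_nonneg h0
  have hcake : ∀ z, ENNReal.ofReal (∫ t, h t ∂K z)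
      = ∫⁻ s in Set.Ioi (0 : ℝ), K z {t | s ≤ h t} := fun z => by
    rw [ofReal_integral_eq_lintegral_ofReal (hi z) (ae_of_all _ h0),
      lintegral_eq_lintegral_meas_le _ (ae_of_all _ h0) hm.aemeasurable]
  have hA : ∀ s, MeasurableSet {t | s ≤ h t} := fun s => measurableSet_le measurable_const hm
  have hmeas : Measurable fun s : ℝ => K z' {t | s ≤ h t} := by
    refine Antitone.measurable fun s s' hss => measure_mono fun t (ht : s' ≤ h t) => ?_
    exact hss.trans ht
  refine (ENNReal.ofReal_le_ofReal_iff (by have := hI z'; positivity)).1 ?_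
  rw [ENNReal.ofReal_add (mul_nonneg (Real.exp_pos _).le (hI z')) (by positivity),
    ENNReal.ofReal_mul (Real.exp_pos _).le, hcake, hcake]
  calc ∫⁻ s in Set.Ioi (0 : ℝ), K z {t | s ≤ h t}
      ≤ ∫⁻ s in Set.Ioi (0 : ℝ), (ENNReal.ofReal (Real.exp ε) * K z' {t | s ≤ h t}
          + (Set.Ioc 0 B).indicator (fun _ => ENNReal.ofReal δ) s) := by
        refine setLIntegral_mono' measurableSet_Ioi fun s hs => ?_
        by_cases hsB : s ≤ B
        · rw [Set.indicator_of_mem (show s ∈ Set.Ioc 0 B from ⟨hs, hsB⟩)]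
          exact hK z z' hz _ (hA s)
        · have : {t | s ≤ h t} = ∅ :=
            Set.eq_empty_of_forall_notMem fun t ht => hsB (le_trans ht (hB t))
          rw [this, measure_empty]
          exact zero_le
    _ = ENNReal.ofReal (Real.exp ε) * (∫⁻ s in Set.Ioi (0 : ℝ), K z' {t | s ≤ h t})
          + ∫⁻ s in Set.Ioi (0 : ℝ), (Set.Ioc 0 B).indicator (fun _ => ENNReal.ofReal δ) s := by
        rw [lintegral_add_left (hmeas.const_mul _), lintegral_const_mul _ hmeas]
    _ ≤ _ := by
        gcongr
        rw [lintegral_indicator_const measurableSet_Ioc, mul_comm, ENNReal.ofReal_mul hB0]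
        gcongr
        refine (Measure.restrict_apply_le _ _).trans ?_
        simp

/-- The effect of one observation on the expectation of a bounded function of the transcript. -/
lemma IsDP.abs_integral_sub_le [IsMarkovKernel K] (hK : IsDP ε δ K) (hε : 0 ≤ ε) (hδ : 0 ≤ δ)
    {z z' : Fin n → ℝ × unitInterval} (hz : hammingDist z z' ≤ 1) {h : T → ℝ} (hm : Measurable h)
    {B : ℝ} (hB : ∀ t, |h t| ≤ B) :
    |∫ t, h t ∂K z - ∫ t, h t ∂K z'|
      ≤ (Real.exp ε - 1) * ∫ t, |h t| ∂K z' + 2 * (B * δ) := by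
  have hm1 : Measurable fun t => max (h t) 0 := hm.max measurable_const
  have hm2 : Measurable fun t => max (-h t) 0 := hm.neg.max measurable_const
  have b1 : ∀ t, max (h t) 0 ≤ B := fun t =>
    max_le ((le_abs_self _).trans (hB t)) ((abs_nonneg _).trans (hB t))
  have b2 : ∀ t, max (-h t) 0 ≤ B := fun t =>
    max_le ((neg_le_abs _).trans (hB t)) ((abs_nonneg _).trans (hB t))
  have i1 : ∀ z, Integrable (fun t => max (h t) 0) (K z) := fun z =>
    Integrable.of_bound hm1.aestronglyMeasurable B (ae_of_all _ fun t => by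
      rw [Real.norm_eq_abs, abs_of_nonneg (le_max_right _ _)]; exact b1 t)
  have i2 : ∀ z, Integrable (fun t => max (-h t) 0) (K z) := fun z =>
    Integrable.of_bound hm2.aestronglyMeasurable B (ae_of_all _ fun t => by
      rw [Real.norm_eq_abs, abs_of_nonneg (le_max_right _ _)]; exact b2 t)
  -- Apply the bound for nonnegative functions to the positive and the negative part.
  have e1 : ∀ z, ∫ t, h t ∂K z = ∫ t, max (h t) 0 ∂K z - ∫ t, max (-h t) 0 ∂K z := fun z => by
    rw [← integral_sub (i1 z) (i2 z)]
    refine integral_congr_ae (ae_of_all _ fun t => ?_)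
    simp only
    rcases le_total 0 (h t) with h0 | h0
    · rw [max_eq_left h0, max_eq_right (by linarith)]; ring
    · rw [max_eq_right h0, max_eq_left (by linarith)]; ring
  have e2 : ∫ t, |h t| ∂K z' = ∫ t, max (h t) 0 ∂K z' + ∫ t, max (-h t) 0 ∂K z' := by
    rw [← integral_add (i1 z') (i2 z')]
    refine integral_congr_ae (ae_of_all _ fun t => ?_)
    simp only
    rcases le_total 0 (h t) with h0 | h0
    · rw [max_eq_left h0, max_eq_right (by linarith), abs_of_nonneg h0]; ring
    · rw [max_eq_right h0, max_eq_left (by linarith), abs_of_nonpos h0]; ring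
  have hz' : hammingDist z' z ≤ 1 := by rwa [hammingDist_comm]
  have hs : 0 ≤ Real.exp ε - 1 := by linarith [Real.add_one_le_exp ε]
  obtain ⟨t₀⟩ : Nonempty T := nonempty_of_isProbabilityMeasure (K z)
  have hBδ : 0 ≤ B * δ := mul_nonneg ((abs_nonneg _).trans (hB t₀)) hδ
  have key : ∀ k : T → ℝ, Measurable k → (∀ t, 0 ≤ k t) → (∀ t, k t ≤ B) →
      |∫ t, k t ∂K z - ∫ t, k t ∂K z'| ≤ (Real.exp ε - 1) * ∫ t, k t ∂K z' + B * δ := by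
    intro k hk k0 kB
    have d1 := hK.integral_le hδ hz hk k0 kB
    have d2 := hK.integral_le hδ hz' hk k0 kB
    have p1 : 0 ≤ ∫ t, k t ∂K z := integral_nonneg k0
    have p2 : 0 ≤ ∫ t, k t ∂K z' := integral_nonneg k0
    rw [abs_le]
    constructor
    · rcases le_total (∫ t, k t ∂K z') (∫ t, k t ∂K z) with h3 | h3
      · nlinarith [mul_nonneg hs p2]
      · nlinarith [mul_le_mul_of_nonneg_left h3 hs]
    · linarith
  have k1 := key _ hm1 (fun _ => le_max_right _ _) b1
  have k2 := key _ hm2 (fun _ => le_max_right _ _) b2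
  rw [e1 z, e1 z', e2]
  rw [abs_le] at k1 k2 ⊢
  constructor <;> linarith [k1.1, k1.2, k2.1, k2.2]

end dp

/-! ### The score of a coefficient -/

/-- The contribution of one observation to the score, at `f`, of the coefficient of `g`. -/
def score (f g : unitInterval → ℝ) (z : ℝ × unitInterval) : ℝ := (z.1 - f z.2) * g z.2

section score

variable {f g : unitInterval → ℝ}

lemma measurable_score (hf : Continuous f) (hg : Continuous g) : Measurable (score f g) := by
  unfold score
  exact ((continuous_fst.sub (hf.comp continuous_snd)).mul (hg.comp continuous_snd)).measurable

lemma integral_comp_score (hf : Continuous f) (hg : Continuous g) {φ : ℝ → ℝ}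
    (hφ : Measurable φ) :
    ∫ z, φ (score f g z) ∂regressionLaw f = ∫ w, φ (g w.1 * w.2) ∂noiseLaw := by
  refine (integral_regressionLaw hf.measurable (hφ.comp (measurable_score hf hg))).trans ?_
  refine integral_congr_ae (ae_of_all _ fun w => ?_)
  simp only [score, Function.comp]
  congr 1; ring

lemma integrable_comp_score_iff (hf : Continuous f) (hg : Continuous g) {φ : ℝ → ℝ}
    (hφ : Measurable φ) : Integrable (fun z => φ (score f g z)) (regressionLaw f)
      ↔ Integrable (fun w : unitInterval × ℝ => φ (g w.1 * w.2)) noiseLaw := by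
  refine (integrable_regressionLaw_iff hf.measurable (hφ.comp (measurable_score hf hg))).trans ?_
  refine integrable_congr (ae_of_all _ fun w => ?_)
  simp only [score, Function.comp]
  congr 1; ring

lemma memLp_score (hf : Continuous f) (hg : Continuous g) :
    MemLp (score f g) 2 (regressionLaw f) := by
  rw [memLp_two_iff_integrable_sq (measurable_score hf hg).aestronglyMeasurable]
  rw [integrable_comp_score_iff hf hg (φ := fun t => t ^ 2) (by fun_prop)]
  simp only [mul_pow]
  exact integrable_fst_mul_snd (F := fun x => g x ^ 2) (hg.pow 2) integrable_sq_gaussianReal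

lemma integral_score (hf : Continuous f) (hg : Continuous g) :
    ∫ z, score f g z ∂regressionLaw f = 0 := by
  rw [integral_comp_score hf hg (φ := fun t => t) measurable_id,
    integral_noiseLaw_mul g fun t => t, integral_id_gaussianReal, mul_zero]

lemma integral_score_sq (hf : Continuous f) (hg : Continuous g) :
    ∫ z, score f g z ^ 2 ∂regressionLaw f = ∫ x, g x ^ 2 := by
  rw [integral_comp_score hf hg (φ := fun t => t ^ 2) (by fun_prop)]
  simp only [mul_pow]
  rw [integral_noiseLaw_mul (fun x => g x ^ 2) fun t => t ^ 2, integral_sq_gaussianReal, mul_one]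

lemma integral_abs_score_le (hf : Continuous f) (hg : Continuous g) :
    ∫ z, |score f g z| ∂regressionLaw f ≤ ∫ x, |g x| := by
  rw [integral_comp_score hf hg (φ := fun t => |t|) (by fun_prop)]
  simp only [abs_mul]
  rw [integral_noiseLaw_mul (fun x => |g x|) fun t => |t|]
  have h : ∫ t, |t| ∂gaussianReal 0 1 ≤ 1 := by
    calc ∫ t, |t| ∂gaussianReal 0 1 ≤ ∫ t, (t ^ 2 + 1) / 2 ∂gaussianReal 0 1 := by
          refine integral_mono integrable_id_gaussianReal.abs
            ((integrable_sq_gaussianReal.add (integrable_const 1)).div_const 2) fun t => ?_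
          change |t| ≤ (t ^ 2 + 1) / 2
          nlinarith [sq_nonneg (|t| - 1), sq_abs t]
      _ = 1 := by
          rw [integral_div, integral_add integrable_sq_gaussianReal (integrable_const 1),
            integral_sq_gaussianReal]
          simp
  exact mul_le_of_le_one_right (integral_nonneg fun _ => abs_nonneg _) h

/-- The score of one observation is sub-Gaussian with variance proxy `A ^ 2` if `|g| ≤ A`. -/
lemma exp_score (hf : Continuous f) (hg : Continuous g) {A : ℝ} (hA : ∀ x, |g x| ≤ A) (l : ℝ) :
    Integrable (fun z => Real.exp (l * score f g z)) (regressionLaw f) ∧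
      ∫ z, Real.exp (l * score f g z) ∂regressionLaw f ≤ Real.exp (l ^ 2 * A ^ 2 / 2) := by
  have hφ : Measurable fun t => Real.exp (l * t) := by fun_prop
  have hi : Integrable (fun w : unitInterval × ℝ => Real.exp (l * (g w.1 * w.2))) noiseLaw := by
    have hb := (integrable_fst_mul_snd (F := fun _ => (1 : ℝ)) continuous_const
      (integrable_exp_mul_gaussianReal (μ := 0) (v := 1) (|l| * A))).add
      (integrable_fst_mul_snd (F := fun _ => (1 : ℝ)) continuous_const
      (integrable_exp_mul_gaussianReal (μ := 0) (v := 1) (-(|l| * A))))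
    refine hb.mono' ?_ (ae_of_all _ fun w => ?_)
    · exact (Continuous.aestronglyMeasurable (by fun_prop))
    · rw [Real.norm_eq_abs, abs_of_pos (Real.exp_pos _)]
      have h1 : l * (g w.1 * w.2) ≤ |l| * A * |w.2| := by
        refine (le_abs_self _).trans ?_
        rw [abs_mul, abs_mul, mul_assoc]
        have := hA w.1
        gcongr
      simp only [Pi.add_apply, one_mul]
      rcases le_total 0 w.2 with h | h
      · rw [abs_of_nonneg h] at h1
        linarith [Real.exp_le_exp.2 h1, Real.exp_pos (-(|l| * A) * w.2)]
      · rw [abs_of_nonpos h] at h1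
        have h2 : |l| * A * -w.2 = -(|l| * A) * w.2 := by ring
        rw [h2] at h1
        linarith [Real.exp_le_exp.2 h1, Real.exp_pos (|l| * A * w.2)]
  refine ⟨(integrable_comp_score_iff hf hg hφ).2 hi, ?_⟩
  rw [integral_comp_score hf hg hφ, integral_prod _ hi]
  calc ∫ x, ∫ t, Real.exp (l * (g x * t)) ∂gaussianReal 0 1
      = ∫ x, Real.exp ((l * g x) ^ 2 / 2) := by
        refine integral_congr_ae (ae_of_all _ fun x => ?_)
        simp only
        rw [← integral_exp_mul_gaussianReal]
        simp only [mul_assoc]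
    _ ≤ ∫ _ : unitInterval, Real.exp (l ^ 2 * A ^ 2 / 2) := by
        refine integral_mono (integrable_of_continuous_unitInterval (by fun_prop))
          (integrable_const _) fun x => Real.exp_le_exp.2 ?_
        rw [mul_pow]
        have : g x ^ 2 ≤ A ^ 2 := sq_le_sq' (by linarith [(abs_le.1 (hA x)).1]) (abs_le.1 (hA x)).2
        gcongr
    _ = _ := by simp

variable {n : ℕ}

/-- The score of a local data set. -/
def scoreSum (f g : unitInterval → ℝ) (z : Fin n → ℝ × unitInterval) : ℝ := ∑ i, score f g (z i)

lemma measurable_scoreSum (hf : Continuous f) (hg : Continuous g) :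
    Measurable (scoreSum (n := n) f g) := by
  unfold scoreSum
  exact Finset.measurable_sum _ fun i _ => (measurable_score hf hg).comp (measurable_pi_apply i)

lemma memLp_scoreSum (hf : Continuous f) (hg : Continuous g) :
    MemLp (scoreSum f g) 2 (Measure.pi fun _ : Fin n => regressionLaw f) := by
  have := isProbabilityMeasure_regressionLaw hf.measurable
  exact memLp_finsetSum _ fun i _ => (memLp_score hf hg).comp_measurePreserving
    (measurePreserving_eval (fun _ : Fin n => regressionLaw f) i)

lemma integral_scoreSum (hf : Continuous f) (hg : Continuous g) :
    ∫ z, scoreSum f g z ∂(Measure.pi fun _ : Fin n => regressionLaw f) = 0 := by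
  have := isProbabilityMeasure_regressionLaw hf.measurable
  have hS : Integrable (score f g) (regressionLaw f) :=
    (memLp_score hf hg).integrable (by norm_num)
  have hmp := measurePreserving_eval (fun _ : Fin n => regressionLaw f)
  have hi : ∀ i, Integrable (fun z : Fin n → ℝ × unitInterval => score f g (z i))
    (Measure.pi fun _ : Fin n => regressionLaw f) := fun i =>
    (hmp i).integrable_comp_of_integrable hS
  unfold scoreSum
  rw [integral_finsetSum _ fun i _ => hi i]
  refine Finset.sum_eq_zero fun i _ => ?_
  have h := integral_map (μ := Measure.pi fun _ : Fin n => regressionLaw f)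
    (hmp i).measurable.aemeasurable (f := score f g)
    (measurable_score hf hg).aestronglyMeasurable
  rw [(hmp i).map_eq, integral_score hf hg] at h
  exact h.symm

lemma integral_scoreSum_sq (hf : Continuous f) (hg : Continuous g) :
    ∫ z, scoreSum f g z ^ 2 ∂(Measure.pi fun _ : Fin n => regressionLaw f) = n * ∫ x, g x ^ 2 := by
  have := isProbabilityMeasure_regressionLaw hf.measurable
  have h := integral_sq_sum_pi (fun _ : Fin n => regressionLaw f) (fun _ => score f g)
    (fun _ => memLp_score hf hg) fun _ => integral_score hf hg
  unfold scoreSum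
  rw [h, integral_score_sq hf hg]
  simp

lemma exp_scoreSum (hf : Continuous f) (hg : Continuous g) {A : ℝ} (hA : ∀ x, |g x| ≤ A) (l : ℝ) :
    Integrable (fun z => Real.exp (l * scoreSum f g z))
        (Measure.pi fun _ : Fin n => regressionLaw f) ∧
      ∫ z, Real.exp (l * scoreSum f g z) ∂(Measure.pi fun _ : Fin n => regressionLaw f)
        ≤ Real.exp (n * (l ^ 2 * A ^ 2 / 2)) := by
  have := isProbabilityMeasure_regressionLaw hf.measurable
  obtain ⟨h1, h2⟩ := exp_score hf hg hA l
  have e : (fun z : Fin n → ℝ × unitInterval => Real.exp (l * scoreSum f g z))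
      = fun z => ∏ i, Real.exp (l * score f g (z i)) := by
    funext z
    rw [← Real.exp_sum, scoreSum, Finset.mul_sum]
  rw [e]
  refine ⟨Integrable.fintype_prod (f := fun _ z => Real.exp (l * score f g z)) fun _ => h1, ?_⟩
  rw [integral_fintype_prod_eq_prod (fun _ z => Real.exp (l * score f g z)), Finset.prod_const,
    Finset.card_univ, Fintype.card_fin, Real.exp_nat_mul]
  exact pow_le_pow_left₀ (integral_nonneg fun _ => (Real.exp_pos _).le) h2 n

lemma clip_eq_self {τ y : ℝ} (h : |y| ≤ τ) : clip τ y = y := by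
  unfold clip
  rw [min_eq_right (abs_le.1 h).2, max_eq_right (abs_le.1 h).1]

lemma abs_sub_clip_le {τ : ℝ} (hτ : 0 ≤ τ) (y : ℝ) : |y - clip τ y| ≤ |y| := by
  unfold clip
  rcases le_total τ y with h | h
  · rw [min_eq_left h, max_eq_right (by linarith), abs_of_nonneg (by linarith),
      abs_of_nonneg (by linarith)]
    linarith
  · rw [min_eq_right h]
    rcases le_total (-τ) y with h1 | h1
    · rw [max_eq_right h1]; simp
    · rw [max_eq_left h1, abs_of_nonpos (by linarith), abs_of_nonpos (by linarith)]
      linarith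

/-- The score has Gaussian tails at the scale `A √n`, where `A` bounds `g`. -/
lemma integral_sq_scoreSum_sub_clip_le (hf : Continuous f) (hg : Continuous g) {A : ℝ}
    (hA0 : 0 < A) (hA : ∀ x, |g x| ≤ A) (hn : 1 ≤ n) {u : ℝ} (hu : 0 < u) (r : ℕ) :
    ∫ z, (scoreSum f g z - clip (A * √n / u) (scoreSum f g z)) ^ 2
        ∂(Measure.pi fun _ : Fin n => regressionLaw f)
      ≤ 4 * ((2 * r + 2).factorial : ℝ) * (A ^ 2 * n) * u ^ (2 * r) := by
  have := isProbabilityMeasure_regressionLaw hf.measurable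
  have hn0 : (0 : ℝ) < n := by exact_mod_cast hn
  have hsn : 0 < √(n : ℝ) := Real.sqrt_pos.2 hn0
  set a := A * √n with ha
  have ha0 : 0 < a := by positivity
  have ha2 : a ^ 2 = A ^ 2 * n := by rw [ha, mul_pow, Real.sq_sqrt hn0.le]
  obtain ⟨i1, e1⟩ := exp_scoreSum (n := n) hf hg hA a⁻¹
  obtain ⟨i2, e2⟩ := exp_scoreSum (n := n) hf hg hA (-a⁻¹)
  have hexp : ∀ l : ℝ, l ^ 2 = (a ^ 2)⁻¹ → n * (l ^ 2 * A ^ 2 / 2) = 1 / 2 := by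
    intro l hl
    rw [hl, ha2]; field_simp
  rw [hexp _ (by rw [inv_pow])] at e1
  rw [hexp _ (by rw [neg_sq, inv_pow])] at e2
  set μ := Measure.pi fun _ : Fin n => regressionLaw f
  set F : ℝ := ((2 * r + 2).factorial : ℝ) with hF
  have hF0 : 0 < F := by rw [hF]; exact_mod_cast Nat.factorial_pos _
  -- Beyond the clipping level `a / u` one has `u v ≥ 1` for `v = |w| / a`, so powers of `u v` may
  -- be inserted, and `v ^ (2 r + 2)` is absorbed by the exponential.
  have hpt : ∀ w : ℝ, (w - clip (a / u) w) ^ 2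
      ≤ F * a ^ 2 * u ^ (2 * r) * (Real.exp (a⁻¹ * w) + Real.exp (-a⁻¹ * w)) := by
    intro w
    rcases le_or_gt |w| (a / u) with h | h
    · rw [clip_eq_self h, sub_self, zero_pow two_ne_zero]
      positivity
    set v := |a⁻¹ * w| with hv
    have hv0 : 0 ≤ v := abs_nonneg _
    have hwv : |w| = a * v := by
      rw [hv, abs_mul, abs_of_pos (inv_pos.2 ha0)]; field_simp
    have huv : 1 ≤ u * v := by
      rw [hwv, div_lt_iff₀ hu] at h
      have : a * 1 ≤ a * (u * v) := by linarith
      exact le_of_mul_le_mul_left this ha0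
    have h1 : v ^ (2 * r + 2) ≤ F * Real.exp v := by
      have := Real.pow_div_factorial_le_exp v hv0 (2 * r + 2)
      rw [div_le_iff₀ (by exact_mod_cast Nat.factorial_pos _)] at this
      linarith
    have h2 : Real.exp v ≤ Real.exp (a⁻¹ * w) + Real.exp (-a⁻¹ * w) := by
      rcases le_total 0 (a⁻¹ * w) with h | h
      · rw [hv, abs_of_nonneg h]; linarith [Real.exp_pos (-a⁻¹ * w)]
      · rw [hv, abs_of_nonpos h, neg_mul]; linarith [Real.exp_pos (a⁻¹ * w)]
    calc (w - clip (a / u) w) ^ 2 ≤ |w| ^ 2 := by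
          rw [← sq_abs (w - _)]
          exact pow_le_pow_left₀ (abs_nonneg _) (abs_sub_clip_le (by positivity) w) 2
      _ = a ^ 2 * v ^ 2 * 1 := by rw [hwv]; ring
      _ ≤ a ^ 2 * v ^ 2 * (u * v) ^ (2 * r) := by gcongr; exact one_le_pow₀ huv
      _ = a ^ 2 * u ^ (2 * r) * v ^ (2 * r + 2) := by ring
      _ ≤ a ^ 2 * u ^ (2 * r) * (F * (Real.exp (a⁻¹ * w) + Real.exp (-a⁻¹ * w))) := by
          gcongr
          exact h1.trans (by gcongr)
      _ = _ := by ring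
  have hm := measurable_scoreSum (n := n) hf hg
  calc _ ≤ ∫ z, F * a ^ 2 * u ^ (2 * r) * (Real.exp (a⁻¹ * scoreSum f g z)
            + Real.exp (-a⁻¹ * scoreSum f g z)) ∂μ :=
        integral_mono_of_nonneg (ae_of_all _ fun _ => sq_nonneg _) ((i1.add i2).const_mul _)
          (ae_of_all _ fun z => hpt _)
    _ ≤ F * a ^ 2 * u ^ (2 * r) * (2 + 2) := by
        have h3 : Real.exp (1 / 2) ≤ 2 := by
          have := Real.exp_one_lt_d9
          have h4 : Real.exp (1 / 2) ^ 2 = Real.exp 1 := by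
            rw [← Real.exp_nat_mul]; norm_num
          nlinarith [Real.exp_pos (1 / 2)]
        rw [integral_const_mul, integral_add i1 i2]
        gcongr <;> linarith
    _ = _ := by rw [ha2]; ring

end score

/-! ### The information about one coefficient in the transcript of one server -/

/-- A projection has a smaller second moment. -/
lemma integral_sq_le_of_orthogonal {Ω : Type*} [MeasurableSpace Ω] {μ : Measure Ω} {g V : Ω → ℝ}
    (hg : MemLp g 2 μ) (hV : MemLp V 2 μ) (h : ∫ x, g x * V x ∂μ = ∫ x, g x * g x ∂μ) :
    ∫ x, g x ^ 2 ∂μ ≤ ∫ x, V x ^ 2 ∂μ := by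
  have h0 : 0 ≤ ∫ x, (V x - g x) ^ 2 ∂μ := integral_nonneg fun _ => sq_nonneg _
  have i1 := hV.integrable_sq
  have i2 := hg.integrable_sq
  have i3 : Integrable (fun x => g x * V x) μ := hg.integrable_mul hV
  have i4 : Integrable (fun x => V x ^ 2 + g x ^ 2) μ := i1.add i2
  have e : ∀ x, (V x - g x) ^ 2 = V x ^ 2 + g x ^ 2 - 2 * (g x * V x) := fun x => by ring
  simp only [e] at h0
  rw [integral_sub i4 (i3.const_mul 2), integral_add i1 i2, integral_const_mul, h] at h0
  simp only [← sq] at h0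
  linarith

section information

variable {n : ℕ} {T : Type} [MeasurableSpace T] {ε δ : ℝ}
  {K : Kernel (Fin n → ℝ × unitInterval) T} {f g : unitInterval → ℝ}

/-- The score of a single observation has mean zero, so its correlation with a function of the
transcript is only due to the dependence of the transcript on this observation. -/
lemma integral_mul_scoreSum_le [IsMarkovKernel K] (hK : IsDP ε δ K) (hε : 0 ≤ ε) (hδ : 0 ≤ δ)
    (hf : Continuous f) (hg : Continuous g) {h : T → ℝ} (hm : Measurable h) {B : ℝ}
    (hB0 : 0 ≤ B) (hB : ∀ t, |h t| ≤ B) :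
    ∫ w, h w.2 * scoreSum f g w.1 ∂((Measure.pi fun _ : Fin n => regressionLaw f) ⊗ₘ K)
      ≤ n * ((∫ x, |g x|) * ((Real.exp ε - 1)
        * (∫ w, |h w.2| ∂((Measure.pi fun _ : Fin n => regressionLaw f) ⊗ₘ K))
        + 2 * (B * δ))) := by
  have hP := isProbabilityMeasure_regressionLaw hf.measurable
  set P := regressionLaw f
  set μ := Measure.pi fun _ : Fin n => P with hμ
  set L := ∫ x, |g x|
  have hL0 : 0 ≤ L := integral_nonneg fun _ => abs_nonneg _
  have hs : 0 ≤ Real.exp ε - 1 := by linarith [Real.add_one_le_exp ε]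
  have hmsnd : Measurable fun w : (Fin n → ℝ × unitInterval) × T => h w.2 := hm.comp measurable_snd
  have hk : Measurable fun z => ∫ t, h t ∂K z :=
    (hm.stronglyMeasurable.integral_kernel (κ := K)).measurable
  have hkB : ∀ z, |∫ t, h t ∂K z| ≤ B := fun z => by
    have := norm_integral_le_of_norm_le_const (μ := K z) (f := h) (ae_of_all _ hB)
    simpa using this
  have hka : Measurable fun z => ∫ t, |h t| ∂K z :=
    ((continuous_abs.measurable.comp hm).stronglyMeasurable.integral_kernel (κ := K)).measurable
  have hkaB : ∀ z, |∫ t, |h t| ∂K z| ≤ B := fun z => by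
    have := norm_integral_le_of_norm_le_const (μ := K z) (f := fun t => |h t|) (C := B)
      (ae_of_all _ fun t => by rw [Real.norm_eq_abs, abs_abs]; exact hB t)
    simpa using this
  have ika : Integrable (fun z => ∫ t, |h t| ∂K z) μ :=
    Integrable.of_bound hka.aestronglyMeasurable B (ae_of_all _ hkaB)
  have hfst : MeasurePreserving (Prod.fst : (Fin n → ℝ × unitInterval) × T → _) (μ ⊗ₘ K) μ :=
    ⟨measurable_fst, Measure.fst_compProd μ K⟩
  have hWi : Integrable (scoreSum f g) μ := (memLp_scoreSum hf hg).integrable (by norm_num)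
  have hint : Integrable (fun w => h w.2 * scoreSum f g w.1) (μ ⊗ₘ K) :=
    (hfst.integrable_comp_of_integrable hWi).bdd_mul hmsnd.aestronglyMeasurable
      (ae_of_all _ fun w => hB w.2)
  have hinta : Integrable (fun w => |h w.2|) (μ ⊗ₘ K) :=
    Integrable.of_bound (continuous_abs.measurable.comp hmsnd).aestronglyMeasurable B
      (ae_of_all _ fun w => by rw [Real.norm_eq_abs, abs_abs]; exact hB w.2)
  rw [Measure.integral_compProd hint, Measure.integral_compProd hinta]
  have hpull : ∀ z, ∫ t, h t * scoreSum f g z ∂K z = (∫ t, h t ∂K z) * scoreSum f g z :=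
    fun z => integral_mul_const _ _
  simp only [hpull]
  have hSi : ∀ i, Integrable (fun z : Fin n → ℝ × unitInterval => score f g (z i)) μ := fun i =>
    (measurePreserving_eval (fun _ : Fin n => P) i).integrable_comp_of_integrable
      ((memLp_score hf hg).integrable (by norm_num))
  have hSk : ∀ i, Integrable (fun z : Fin n → ℝ × unitInterval =>
      (∫ t, h t ∂K z) * score f g (z i)) μ := fun i =>
    (hSi i).bdd_mul hk.aestronglyMeasurable (ae_of_all _ hkB)
  -- Draw the observation `i` anew; the mean of the transcript functional over the remaining
  -- randomness depends on it only as far as privacy permits.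
  have hone : ∀ i : Fin n, ∫ z, (∫ t, h t ∂K z) * score f g (z i) ∂μ
      ≤ L * ((Real.exp ε - 1) * (∫ z, ∫ t, |h t| ∂K z ∂μ) + 2 * (B * δ)) := by
    intro i
    have hmp := measurePreserving_update_pi (fun _ : Fin n => P) (fun _ => P) i fun _ _ => rfl
    have hF : Measurable fun z : Fin n → ℝ × unitInterval => (∫ t, h t ∂K z) * score f g (z i) :=
      hk.mul ((measurable_score hf hg).comp (measurable_pi_apply i))
    have hFi := hmp.integrable_comp_of_integrable (hSk i)
    have e1 : ∫ z, (∫ t, h t ∂K z) * score f g (z i) ∂μ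
        = ∫ z, ∫ x, (∫ t, h t ∂K (Function.update z i x)) * score f g x ∂P ∂μ := by
      have e0 := integral_map (μ := μ.prod P) hmp.measurable.aemeasurable hF.aestronglyMeasurable
      rw [hmp.map_eq] at e0
      refine (e0.trans (integral_prod _ hFi)).trans
        (integral_congr_ae (ae_of_all _ fun z => integral_congr_ae (ae_of_all _ fun x => ?_)))
      simp only [Function.update_self]
    rw [e1]
    have hin : ∀ z, ∫ x, (∫ t, h t ∂K (Function.update z i x)) * score f g x ∂P
        ≤ L * ((Real.exp ε - 1) * (∫ t, |h t| ∂K z) + 2 * (B * δ)) := by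
      intro z
      have hku : Measurable fun x => ∫ t, h t ∂K (Function.update z i x) :=
        hk.comp (measurable_update z)
      have iS : Integrable (score f g) P := (memLp_score hf hg).integrable (by norm_num)
      have ikS : Integrable (fun x => (∫ t, h t ∂K (Function.update z i x)) * score f g x) P :=
        iS.bdd_mul hku.aestronglyMeasurable (ae_of_all _ fun x => hkB _)
      -- Subtracting a constant is free because the score is centred.
      have e2 : ∫ x, (∫ t, h t ∂K (Function.update z i x)) * score f g x ∂P
          = ∫ x, (∫ t, h t ∂K (Function.update z i x) - ∫ t, h t ∂K z) * score f g x ∂P := by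
        simp only [sub_mul]
        rw [integral_sub ikS (iS.const_mul _), integral_const_mul, integral_score hf hg]
        ring
      rw [e2]
      set b := (Real.exp ε - 1) * (∫ t, |h t| ∂K z) + 2 * (B * δ) with hb
      have hb0 : 0 ≤ b := by
        have : 0 ≤ ∫ t, |h t| ∂K z := integral_nonneg fun _ => abs_nonneg _
        positivity
      have hd : ∀ x, hammingDist (Function.update z i x) z ≤ 1 := fun x => by
        rw [hammingDist]
        refine (Finset.card_le_card (t := {i}) fun j hj => ?_).trans (by simp)
        by_contra hij
        simp only [Finset.mem_singleton] at hij
        simp [Function.update_of_ne hij] at hj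
      calc _ ≤ ∫ x, b * |score f g x| ∂P := by
            refine (le_abs_self _).trans ((abs_integral_le_integral_abs).trans
              (integral_mono_of_nonneg (ae_of_all _ fun _ => abs_nonneg _) (iS.abs.const_mul b)
                (ae_of_all _ fun x => ?_)))
            simp only [abs_mul]
            exact mul_le_mul_of_nonneg_right (hK.abs_integral_sub_le hε hδ (hd x) hm hB)
              (abs_nonneg _)
        _ = b * ∫ x, |score f g x| ∂P := integral_const_mul _ _
        _ ≤ b * L := by gcongr; exact integral_abs_score_le hf hg
        _ = _ := mul_comm _ _
    have i5 : Integrable (fun z => L * ((Real.exp ε - 1) * (∫ t, |h t| ∂K z) + 2 * (B * δ))) μ :=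
      ((ika.const_mul _).add (integrable_const _)).const_mul _
    refine (integral_mono (by
      have := hFi.integral_prod_left
      simpa only [Function.comp, Function.update_self] using this) i5 hin).trans (le_of_eq ?_)
    rw [integral_const_mul, integral_add (ika.const_mul _) (integrable_const _),
      integral_const_mul]
    simp
  calc ∫ z, (∫ t, h t ∂K z) * scoreSum f g z ∂μ
      = ∑ i, ∫ z, (∫ t, h t ∂K z) * score f g (z i) ∂μ := by
        rw [← integral_finsetSum _ fun i _ => hSk i]
        simp only [scoreSum, Finset.mul_sum]
    _ ≤ ∑ _i : Fin n, L * ((Real.exp ε - 1) * (∫ z, ∫ t, |h t| ∂K z ∂μ) + 2 * (B * δ)) :=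
        Finset.sum_le_sum fun i _ => hone i
    _ = _ := by simp

/-- The projection `G` of the score on the transcript. Its second moment, the Fisher information
in the transcript, is at most that of the data, and is restricted by differential privacy. -/
lemma exists_score_projection [IsMarkovKernel K] (hK : IsDP ε δ K) (hε : 0 ≤ ε) (hδ : 0 ≤ δ)
    (hf : Continuous f) (hg : Continuous g) (hg1 : ∫ x, g x ^ 2 ≤ 1) {A : ℝ}
    (hA0 : 0 < A) (hA : ∀ x, |g x| ≤ A) (hn : 1 ≤ n) {u : ℝ} (hu : 0 < u) (r : ℕ) {w : ℝ}
    (hw0 : 0 ≤ w) (hw : 4 * ((2 * r + 2).factorial : ℝ) * (A ^ 2 * n) * u ^ (2 * r) ≤ w ^ 2) :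
    ∃ (G : T → ℝ) (J : ℝ), Measurable G ∧ 0 ≤ J ∧
      MemLp (fun w : (Fin n → ℝ × unitInterval) × T => G w.2) 2
        ((Measure.pi fun _ : Fin n => regressionLaw f) ⊗ₘ K) ∧
      (∀ h : T → ℝ, Measurable h →
        MemLp (fun w : (Fin n → ℝ × unitInterval) × T => h w.2) 2
          ((Measure.pi fun _ : Fin n => regressionLaw f) ⊗ₘ K) →
        ∫ w, h w.2 * scoreSum f g w.1 ∂((Measure.pi fun _ : Fin n => regressionLaw f) ⊗ₘ K)
        = ∫ w, h w.2 * G w.2 ∂((Measure.pi fun _ : Fin n => regressionLaw f) ⊗ₘ K)) ∧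
      ∫ w, G w.2 ^ 2 ∂((Measure.pi fun _ : Fin n => regressionLaw f) ⊗ₘ K) = J ^ 2 ∧
      J ^ 2 ≤ n ∧
      J ^ 2 ≤ n * ((∫ x, |g x|) * ((Real.exp ε - 1) * (J + w) + 2 * (A * √n / u * δ)))
        + w * √n := by
  have hP := isProbabilityMeasure_regressionLaw hf.measurable
  set μ := Measure.pi fun _ : Fin n => regressionLaw f with hμ
  set ρ := μ ⊗ₘ K with hρ
  set B := A * √n / u with hB
  have hB0 : 0 ≤ B := by positivity
  have hn0 : (0 : ℝ) ≤ n := Nat.cast_nonneg n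
  have hfst : MeasurePreserving (Prod.fst : (Fin n → ℝ × unitInterval) × T → _) ρ μ :=
    ⟨measurable_fst, Measure.fst_compProd μ K⟩
  have hWm := measurable_scoreSum (n := n) hf hg
  set W : (Fin n → ℝ × unitInterval) × T → ℝ := fun w => scoreSum f g w.1 with hW
  have mW : MemLp W 2 ρ := (memLp_scoreSum hf hg).comp_measurePreserving hfst
  have hcm : Measurable fun w => clip B (W w) :=
    (continuous_clip B).measurable.comp (hWm.comp measurable_fst)
  have m1 : MemLp (fun w => clip B (W w)) 2 ρ :=
    MemLp.of_bound hcm.aestronglyMeasurable B (ae_of_all _ fun w => abs_clip_le hB0 _)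
  have m2 : MemLp (fun w => W w - clip B (W w)) 2 ρ := mW.sub m1
  have sW : ∫ w, W w ^ 2 ∂ρ ≤ n := by
    have h1 : ∫ w, W w ^ 2 ∂ρ = ∫ z, scoreSum f g z ^ 2 ∂μ := by
      rw [← hfst.map_eq, integral_map hfst.measurable.aemeasurable
        (hWm.pow_const 2).aestronglyMeasurable]
    rw [h1, integral_scoreSum_sq hf hg]
    exact mul_le_of_le_one_right hn0 hg1
  have s2 : ∫ w, (W w - clip B (W w)) ^ 2 ∂ρ ≤ w ^ 2 := by
    have h1 : ∫ w, (W w - clip B (W w)) ^ 2 ∂ρ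
        = ∫ z, (scoreSum f g z - clip B (scoreSum f g z)) ^ 2 ∂μ := by
      rw [← hfst.map_eq, integral_map hfst.measurable.aemeasurable
        (f := fun z => (scoreSum f g z - clip B (scoreSum f g z)) ^ 2)
        ((hWm.sub ((continuous_clip B).measurable.comp hWm)).pow_const 2).aestronglyMeasurable]
    rw [h1]
    exact (integral_sq_scoreSum_sub_clip_le hf hg hA0 hA hn hu r).trans hw
  -- The score is split into its clipped part, whose projection is bounded, and a small remainder.
  obtain ⟨g₁, hg₁, mg₁, o₁, b₁⟩ := exists_condExp_snd ρ m1
  obtain ⟨g₂, hg₂, mg₂, o₂, -⟩ := exists_condExp_snd ρ m2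
  -- a version of the first projection that is bounded everywhere
  set h₁ : T → ℝ := fun t => clip B (g₁ t) with hh₁
  have hh₁m : Measurable h₁ := (continuous_clip B).measurable.comp hg₁
  have hh₁B : ∀ t, |h₁ t| ≤ B := fun t => abs_clip_le hB0 _
  have hae : (fun w : (Fin n → ℝ × unitInterval) × T => h₁ w.2) =ᵐ[ρ] fun w => g₁ w.2 := by
    filter_upwards [b₁ B fun w => abs_clip_le hB0 _] with x hx
    exact clip_eq_self hx
  have mh₁ : MemLp (fun w : (Fin n → ℝ × unitInterval) × T => h₁ w.2) 2 ρ :=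
    (memLp_congr_ae hae).2 mg₁
  set G : T → ℝ := fun t => h₁ t + g₂ t with hG
  have hGm : Measurable G := hh₁m.add hg₂
  have mG : MemLp (fun w : (Fin n → ℝ × unitInterval) × T => G w.2) 2 ρ := mh₁.add mg₂
  have oG : ∀ h : T → ℝ, Measurable h →
      MemLp (fun w : (Fin n → ℝ × unitInterval) × T => h w.2) 2 ρ →
      ∫ w, h w.2 * W w ∂ρ = ∫ w, h w.2 * G w.2 ∂ρ := by
    intro h hm mh
    have e1 : ∀ w, h w.2 * W w = h w.2 * clip B (W w) + h w.2 * (W w - clip B (W w)) :=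
      fun w => by ring
    have e2 : ∀ w : (Fin n → ℝ × unitInterval) × T,
        h w.2 * G w.2 = h w.2 * h₁ w.2 + h w.2 * g₂ w.2 := fun w => by simp only [hG]; ring
    have j1 : Integrable (fun w => h w.2 * clip B (W w)) ρ := mh.integrable_mul m1
    have j2 : Integrable (fun w => h w.2 * (W w - clip B (W w))) ρ := mh.integrable_mul m2
    have j3 : Integrable (fun w : (Fin n → ℝ × unitInterval) × T => h w.2 * h₁ w.2) ρ :=
      mh.integrable_mul mh₁
    have j4 : Integrable (fun w : (Fin n → ℝ × unitInterval) × T => h w.2 * g₂ w.2) ρ :=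
      mh.integrable_mul mg₂
    simp only [e1, e2]
    rw [integral_add j1 j2, integral_add j3 j4, o₁ h hm mh, o₂ h hm mh]
    congr 1
    refine integral_congr_ae ?_
    filter_upwards [hae] with x hx
    simp only at hx
    rw [hx]
  have hself : ∀ (k : T → ℝ) (V : (Fin n → ℝ × unitInterval) × T → ℝ),
      MemLp (fun w : (Fin n → ℝ × unitInterval) × T => k w.2) 2 ρ → MemLp V 2 ρ →
      ∫ w, k w.2 * V w ∂ρ = ∫ w, k w.2 * k w.2 ∂ρ → ∫ w, k w.2 ^ 2 ∂ρ ≤ ∫ w, V w ^ 2 ∂ρ :=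
    fun k V hk hV h => integral_sq_le_of_orthogonal hk hV h
  have sg₂ : ∫ w, g₂ w.2 ^ 2 ∂ρ ≤ w ^ 2 := (hself g₂ _ mg₂ m2 (o₂ g₂ hg₂ mg₂)).trans s2
  have hJ0 : 0 ≤ ∫ w, G w.2 ^ 2 ∂ρ := integral_nonneg fun _ => sq_nonneg _
  set J := √(∫ w, G w.2 ^ 2 ∂ρ) with hJ
  have hJ2 : ∫ w, G w.2 ^ 2 ∂ρ = J ^ 2 := (Real.sq_sqrt hJ0).symm
  have hJn : 0 ≤ J := Real.sqrt_nonneg _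
  refine ⟨G, J, hGm, hJn, mG, oG, hJ2, ?_, ?_⟩
  · rw [← hJ2]
    exact (hself G W mG mW (oG G hGm mG)).trans sW
  have hsqn : (√(n : ℝ)) ^ 2 = n := Real.sq_sqrt hn0
  have hone : MemLp (fun _ : (Fin n → ℝ × unitInterval) × T => (1 : ℝ)) 2 ρ := memLp_const 1
  have mabs : ∀ k : T → ℝ, MemLp (fun w : (Fin n → ℝ × unitInterval) × T => k w.2) 2 ρ →
      ∀ c : ℝ, 0 ≤ c → ∫ w, k w.2 ^ 2 ∂ρ ≤ c ^ 2 → ∫ w, |k w.2| ∂ρ ≤ c := by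
    intro k mk c hc hkc
    have := integral_mul_le_sqrt (a := c) (b := 1) mk.abs hone hc zero_le_one
      (by simpa only [Pi.abs_apply, sq_abs] using hkc) (by simp)
    simpa using this
  have hh₁abs : ∫ w, |h₁ w.2| ∂ρ ≤ J + w := by
    have k1 := mabs G mG J hJn hJ2.le
    have k2 := mabs g₂ mg₂ w hw0 sg₂
    have l1 : Integrable (fun w : (Fin n → ℝ × unitInterval) × T => |G w.2|) ρ :=
      (mG.integrable (by norm_num)).abs
    have l2 : Integrable (fun w : (Fin n → ℝ × unitInterval) × T => |g₂ w.2|) ρ :=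
      (mg₂.integrable (by norm_num)).abs
    calc ∫ w, |h₁ w.2| ∂ρ ≤ ∫ w, (|G w.2| + |g₂ w.2|) ∂ρ := by
          refine integral_mono (mh₁.integrable (by norm_num)).abs (l1.add l2) fun x => ?_
          have : h₁ x.2 = G x.2 - g₂ x.2 := by simp only [hG]; ring
          simp only [this]
          exact abs_sub _ _
      _ ≤ _ := by rw [integral_add l1 l2]; linarith
  have q1 := integral_mul_scoreSum_le hK hε hδ hf hg hh₁m hB0 hh₁B
  have q2 : ∫ w, g₂ w.2 * W w ∂ρ ≤ w * √n :=
    integral_mul_le_sqrt mg₂ mW hw0 (Real.sqrt_nonneg _) sg₂ (by rw [hsqn]; exact sW)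
  have hL0 : 0 ≤ ∫ x, |g x| := integral_nonneg fun _ => abs_nonneg _
  have hs : 0 ≤ Real.exp ε - 1 := by linarith [Real.add_one_le_exp ε]
  have q3 : ∫ w, G w.2 * W w ∂ρ = ∫ w, h₁ w.2 * W w ∂ρ + ∫ w, g₂ w.2 * W w ∂ρ := by
    have l1 : Integrable (fun w => h₁ w.2 * W w) ρ := mh₁.integrable_mul mW
    have l2 : Integrable (fun w => g₂ w.2 * W w) ρ := mg₂.integrable_mul mW
    rw [← integral_add l1 l2]
    refine integral_congr_ae (ae_of_all _ fun x => ?_)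
    simp only [hG]; ring
  -- The information is itself the correlation of the projection with the score.
  have q4 : J ^ 2 = ∫ w, G w.2 * W w ∂ρ := by
    rw [oG G hGm mG, ← hJ2]
    simp only [sq]
  rw [q4, q3]
  refine add_le_add (q1.trans ?_) q2
  gcongr

end information

/-- The choice `u = x ^ κ`, where `x = √n ε² / Δ`, of the clipping level makes all contributions to
the information of order `n² ε² / Δ` in the regime `n ε² < Δ`. -/
lemma exists_information_arith {κ K Cε C : ℝ} (hκ : 0 < κ) (hK : 0 ≤ K) (hC : 0 < C) :
    ∃ (r : ℕ) (C' : ℝ), 0 < C' ∧ ∀ (n : ℕ) (ε δ Δ : ℝ), 1 ≤ n → 0 < ε → ε ≤ Cε → 0 ≤ δ → 1 ≤ Δ →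
      δ ≤ K * (√n * ε ^ 2 / Δ) ^ (1 + κ) → n * ε ^ 2 < Δ →
      ∃ u w : ℝ, 0 < u ∧ 0 ≤ w ∧
        4 * ((2 * r + 2).factorial : ℝ) * ((C * √Δ) ^ 2 * n) * u ^ (2 * r) ≤ w ^ 2 ∧
        ∀ J L : ℝ, 0 ≤ J → 0 ≤ L → L ≤ C / √Δ →
          J ^ 2 ≤ n * (L * ((Real.exp ε - 1) * (J + w) + 2 * (C * √Δ * √n / u * δ))) + w * √n →
          J ^ 2 ≤ C' * (n ^ 2 * ε ^ 2 / Δ) := by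
  obtain ⟨r, hr⟩ := exists_nat_ge (2 / κ)
  have hrκ : 2 ≤ κ * r := by
    rw [div_le_iff₀ hκ] at hr; linarith
  set F : ℝ := √(4 * ((2 * r + 2).factorial : ℝ)) with hF
  have hF0 : 0 ≤ F := Real.sqrt_nonneg _
  set E : ℝ := Real.exp Cε with hE
  have hE0 : 0 < E := Real.exp_pos _
  refine ⟨r, 2 * ((C * E) ^ 2 / 2 + C * E * (F * C * Cε ^ 2) + 2 * C ^ 2 * K + F * C * Cε ^ 2) + 1,
    ?_, fun n ε δ Δ hn hε hεC hδ hΔ hδK hpriv => ?_⟩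
  · positivity
  have hn0 : (0 : ℝ) < n := by exact_mod_cast hn
  have hn1 : (1 : ℝ) ≤ n := by exact_mod_cast hn
  have hΔ0 : 0 < Δ := by linarith
  set v := √(n : ℝ) with hv
  set d := √Δ with hd
  have hv0 : 0 < v := Real.sqrt_pos.2 hn0
  have hd0 : 0 < d := Real.sqrt_pos.2 hΔ0
  have hv2 : (n : ℝ) = v ^ 2 := (Real.sq_sqrt hn0.le).symm
  have hd2 : Δ = d ^ 2 := (Real.sq_sqrt hΔ0.le).symm
  have hv1 : 1 ≤ v := Real.one_le_sqrt.2 hn1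
  have hd1 : 1 ≤ d := Real.one_le_sqrt.2 hΔ
  rw [hv2, hd2] at hpriv
  have hve : v * ε < d := by
    have : (v * ε) ^ 2 < d ^ 2 := by rw [mul_pow]; exact hpriv
    exact lt_of_pow_lt_pow_left₀ 2 hd0.le this
  set x := v * ε ^ 2 / Δ with hx
  have hx0 : 0 < x := by positivity
  have hx1 : x ≤ 1 := by
    rw [hx, div_le_one hΔ0, hd2]
    nlinarith [mul_le_mul_of_nonneg_right hv1 (by positivity : 0 ≤ v * ε ^ 2)]
  set u := x ^ κ with hu
  have hu0 : 0 < u := Real.rpow_pos_of_pos hx0 κ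
  have hur : u ^ r ≤ x ^ 2 := by
    rw [hu, ← Real.rpow_natCast (x ^ κ) r, ← Real.rpow_mul hx0.le, ← Real.rpow_natCast x 2]
    exact Real.rpow_le_rpow_of_exponent_ge hx0 hx1 (by exact_mod_cast hrκ)
  set w := F * C * d * v * u ^ r with hw
  have hw0 : 0 ≤ w := by positivity
  refine ⟨u, w, hu0, hw0, le_of_eq ?_, fun J L hJ hL hLC hJ2 => ?_⟩
  · have : F ^ 2 = 4 * ((2 * r + 2).factorial : ℝ) := Real.sq_sqrt (by positivity)
    rw [← this, hv2, hw]; ring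
  set S := n * ε / d with hS
  have hS0 : 0 < S := by positivity
  have hS2 : n ^ 2 * ε ^ 2 / Δ = S ^ 2 := by rw [hS, hd2]; field_simp
  have hxd : x = v * ε ^ 2 / d ^ 2 := by rw [hx, hd2]
  have hSv : S = v ^ 2 * ε / d := by rw [hS, hv2]
  have hε2 : ε ^ 2 ≤ Cε ^ 2 := pow_le_pow_left₀ hε.le hεC 2
  have hw1 : w ≤ F * C * d * v * x ^ 2 := by rw [hw]; gcongr
  have hwS : w ≤ F * C * Cε ^ 2 * S := by
    refine hw1.trans ?_
    have e : F * C * d * v * x ^ 2 = F * C * ε ^ 2 * S * (v * ε / d) * (1 / d) := by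
      rw [hxd, hSv]; field_simp
    rw [e]
    have a1 : v * ε / d ≤ 1 := by rw [div_le_one hd0]; exact hve.le
    have a2 : 1 / d ≤ 1 := by rw [div_le_one hd0]; exact hd1
    calc F * C * ε ^ 2 * S * (v * ε / d) * (1 / d) ≤ F * C * Cε ^ 2 * S * 1 * 1 := by gcongr
      _ = _ := by ring
  have hwv : w * v ≤ F * C * Cε ^ 2 * S ^ 2 := by
    have e : F * C * d * v * x ^ 2 * v = F * C * ε ^ 2 * S ^ 2 * (1 / d) := by
      rw [hxd, hSv]; field_simp
    have a2 : 1 / d ≤ 1 := by rw [div_le_one hd0]; exact hd1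
    calc w * v ≤ F * C * d * v * x ^ 2 * v := by gcongr
      _ = F * C * ε ^ 2 * S ^ 2 * (1 / d) := e
      _ ≤ F * C * Cε ^ 2 * S ^ 2 * 1 := by gcongr
      _ = _ := by ring
  have hexp : Real.exp ε - 1 ≤ ε * E := by
    -- `1 - ε ≤ exp (-ε)`, multiplied by `exp ε`
    have h1 := Real.add_one_le_exp (-ε)
    have h2 : Real.exp ε * Real.exp (-ε) = 1 := by rw [← Real.exp_add]; simp
    have h3 : Real.exp ε ≤ E := Real.exp_le_exp.2 hεC
    calc Real.exp ε - 1 = Real.exp ε * (1 - Real.exp (-ε)) := by rw [mul_sub, h2, mul_one]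
      _ ≤ E * ε := by
          have h4 : 1 - Real.exp (-ε) ≤ ε := by linarith only [h1]
          have h5 : 0 ≤ 1 - Real.exp (-ε) := by
            linarith only [Real.exp_le_one_iff.2 (by linarith only [hε] : -ε ≤ 0)]
          gcongr
      _ = ε * E := mul_comm _ _
  have hexp0 : 0 ≤ Real.exp ε - 1 := by linarith [Real.add_one_le_exp ε]
  have hnL : n * L * (Real.exp ε - 1) ≤ C * E * S := by
    calc n * L * (Real.exp ε - 1) ≤ n * (C / d) * (ε * E) := by gcongr
      _ = _ := by rw [hS]; field_simp
  -- Here the factors `u = x ^ κ` from the clipping level and from the condition on `δ` cancel.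
  have hδt : n * L * (2 * (C * d * v / u * δ)) ≤ 2 * C ^ 2 * K * S ^ 2 := by
    have e1 : x ^ (1 + κ) = x * u := by rw [Real.rpow_add hx0, Real.rpow_one]
    calc n * L * (2 * (C * d * v / u * δ))
        ≤ n * (C / d) * (2 * (C * d * v / u * (K * (x * u)))) := by
          rw [← e1]; gcongr
      _ = _ := by rw [hxd, hSv, hv2]; field_simp
  rw [hS2]
  have hJS : n * L * (Real.exp ε - 1) * J ≤ C * E * S * J := by gcongr
  have hJw : n * L * (Real.exp ε - 1) * w ≤ C * E * S * (F * C * Cε ^ 2 * S) := by gcongr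
  have hfin : J ^ 2 ≤ C * E * S * J + C * E * S * (F * C * Cε ^ 2 * S) + 2 * C ^ 2 * K * S ^ 2
      + F * C * Cε ^ 2 * S ^ 2 := by
    refine hJ2.trans ?_
    linarith only [hJS, hJw, hδt, hwv]
  -- The term linear in `J` is absorbed by the inequality of arithmetic and geometric means.
  nlinarith only [hfin, sq_nonneg (J - C * E * S), sq_nonneg S]

section information

variable {C κ K Cε : ℝ}

/-- Up to a constant, the transcript of a server contains the information `(n² ε² / Δ) ∧ n` about
the coefficient of a function that is localized at the scale `1 / Δ`. -/
lemma exists_information_le (hκ : 0 < κ) (hK : 0 ≤ K) (hC : 0 < C) (Cε : ℝ) :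
    ∃ C' : ℝ, 0 < C' ∧ ∀ (n : ℕ) (ε δ Δ : ℝ), 1 ≤ n → 0 < ε → ε ≤ Cε → 0 ≤ δ → 1 ≤ Δ →
      δ ≤ K * (√n * ε ^ 2 / Δ) ^ (1 + κ) →
      ∀ {T : Type} [MeasurableSpace T] (Q : Kernel (Fin n → ℝ × unitInterval) T)
        [IsMarkovKernel Q] (f g : unitInterval → ℝ), IsDP ε δ Q → Continuous f → Continuous g →
      ∫ x, g x ^ 2 ≤ 1 → (∀ x, |g x| ≤ C * √Δ) → ∫ x, |g x| ≤ C / √Δ →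
      ∃ G : T → ℝ, Measurable G ∧
        MemLp (fun w : (Fin n → ℝ × unitInterval) × T => G w.2) 2
          ((Measure.pi fun _ : Fin n => regressionLaw f) ⊗ₘ Q) ∧
        (∀ h : T → ℝ, Measurable h →
          MemLp (fun w : (Fin n → ℝ × unitInterval) × T => h w.2) 2
            ((Measure.pi fun _ : Fin n => regressionLaw f) ⊗ₘ Q) →
          ∫ w, h w.2 * scoreSum f g w.1 ∂((Measure.pi fun _ : Fin n => regressionLaw f) ⊗ₘ Q)
          = ∫ w, h w.2 * G w.2 ∂((Measure.pi fun _ : Fin n => regressionLaw f) ⊗ₘ Q)) ∧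
        ∫ w, G w.2 ^ 2 ∂((Measure.pi fun _ : Fin n => regressionLaw f) ⊗ₘ Q)
          ≤ C' * (min ((n : ℝ) ^ 2 * ε ^ 2) (n * Δ) / Δ) := by
  obtain ⟨r, C', hC', H⟩ := exists_information_arith (Cε := Cε) hκ hK hC
  refine ⟨max C' 1, lt_max_of_lt_left hC', fun n ε δ Δ hn hε hεC hδ hΔ hδK T _ Q _ f g hQ hf hg hg2
    hgA hgL => ?_⟩
  have hΔ0 : 0 < Δ := by linarith
  have hn0 : (0 : ℝ) < n := by exact_mod_cast hn
  have hA0 : 0 < C * √Δ := mul_pos hC (Real.sqrt_pos.2 hΔ0)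
  rcases lt_or_ge ((n : ℝ) * ε ^ 2) Δ with hlt | hge
  · obtain ⟨u, w, hu, hw0, hw, H'⟩ := H n ε δ Δ hn hε hεC hδ hΔ hδK hlt
    obtain ⟨G, J, hG, hJ, mG, oG, eG, -, b2⟩ :=
      exists_score_projection hQ hε.le hδ hf hg hg2 hA0 hgA hn hu r hw0 hw
    refine ⟨G, hG, mG, oG, ?_⟩
    rw [eG, min_eq_left (by nlinarith)]
    refine (H' J _ hJ (integral_nonneg fun _ => abs_nonneg _) hgL b2).trans ?_
    gcongr
    exact le_max_left _ _
  · obtain ⟨G, J, hG, hJ, mG, oG, eG, b1, -⟩ :=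
      exists_score_projection hQ hε.le hδ hf hg hg2 hA0 hgA hn one_pos 0
        (Real.sqrt_nonneg _) (Real.sq_sqrt (x := 4 * ((2 * 0 + 2).factorial : ℝ)
          * ((C * √Δ) ^ 2 * n) * 1 ^ (2 * 0)) (by positivity)).ge
    refine ⟨G, hG, mG, oG, ?_⟩
    rw [eG, min_eq_right (by nlinarith), mul_div_assoc, div_self hΔ0.ne', mul_one]
    refine b1.trans (le_mul_of_one_le_left hn0.le (le_max_right _ _))

end information

/-- If every factor of a product measure has a projection of its score on its second component,
the mean of the product of the total score with a function of the second components only sees the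
sum of the projections. -/
lemma integral_mul_sum_le_of_projection {ι : Type} [Fintype ι] {X : ι → Type} {T : Type}
    [∀ j, MeasurableSpace (X j)] [MeasurableSpace T] (ρ : ∀ j, Measure (X j × T))
    [∀ j, IsProbabilityMeasure (ρ j)] {V : ∀ j, X j × T → ℝ} {G : ι → T → ℝ}
    (hV : ∀ j, MemLp (V j) 2 (ρ j)) (hV0 : ∀ j, ∫ w, V j w ∂ρ j = 0)
    (mG : ∀ j, MemLp (fun w : X j × T => G j w.2) 2 (ρ j))
    (oG : ∀ j, ∀ h : T → ℝ, Measurable h → MemLp (fun w : X j × T => h w.2) 2 (ρ j) →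
      ∫ w, h w.2 * V j w ∂ρ j = ∫ w, h w.2 * G j w.2 ∂ρ j)
    {h : (ι → T) → ℝ} (hm : Measurable h) {B : ℝ} (hB : ∀ t, |h t| ≤ B) {a b : ℝ} (ha : 0 ≤ a)
    (hb : 0 ≤ b) (hha : ∫ ω, h (fun j => (ω j).2) ^ 2 ∂Measure.pi ρ ≤ a ^ 2)
    (hGb : ∑ j, ∫ w, G j w.2 ^ 2 ∂ρ j ≤ b ^ 2) :
    |∫ ω, h (fun j => (ω j).2) * ∑ j, V j (ω j) ∂Measure.pi ρ| ≤ a * b := by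
  classical
  have hG0 : ∀ j, ∫ w, G j w.2 ∂ρ j = 0 := fun j => by
    have := oG j (fun _ => 1) measurable_const (memLp_const 1)
    simpa [hV0 j] using this.symm
  have hτ : Measurable fun (ω : ∀ j, X j × T) j => (ω j).2 :=
    measurable_pi_iff.2 fun j => measurable_snd.comp (measurable_pi_apply j)
  have hev : ∀ j, MeasurePreserving (fun ω : ∀ j, X j × T => ω j) (Measure.pi ρ) (ρ j) :=
    fun j => measurePreserving_eval ρ j
  have hVi : ∀ j, MemLp (fun ω : ∀ j, X j × T => V j (ω j)) 2 (Measure.pi ρ) := fun j =>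
    (hV j).comp_measurePreserving (hev j)
  have hGi : ∀ j, MemLp (fun ω : ∀ j, X j × T => G j (ω j).2) 2 (Measure.pi ρ) := fun j =>
    (mG j).comp_measurePreserving (hev j)
  have mh : MemLp (fun ω : ∀ j, X j × T => h fun j => (ω j).2) 2 (Measure.pi ρ) :=
    MemLp.of_bound (hm.comp hτ).aestronglyMeasurable B (ae_of_all _ fun ω => hB _)
  have hswap : ∀ (j : ι) (U : X j × T → ℝ), MemLp U 2 (ρ j) →
      ∫ ω, h (fun i => (ω i).2) * U (ω j) ∂Measure.pi ρ
        = ∫ ω, ∫ w, h (Function.update (fun i => (ω i).2) j w.2) * U w ∂ρ j ∂Measure.pi ρ := by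
    intro j U hU
    have hmp := measurePreserving_update_pi ρ ρ j fun _ _ => rfl
    have hUi : MemLp (fun ω : ∀ j, X j × T => U (ω j)) 2 (Measure.pi ρ) :=
      hU.comp_measurePreserving (hev j)
    have hi : Integrable (fun ω : ∀ j, X j × T => h (fun i => (ω i).2) * U (ω j))
      (Measure.pi ρ) := mh.integrable_mul hUi
    have hi' := hmp.integrable_comp_of_integrable hi
    have e0 := integral_map (μ := (Measure.pi ρ).prod (ρ j)) hmp.measurable.aemeasurable
      (f := fun ω : ∀ j, X j × T => h (fun i => (ω i).2) * U (ω j))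
      (by rw [hmp.map_eq]; exact hi.aestronglyMeasurable)
    rw [hmp.map_eq] at e0
    refine (e0.trans (integral_prod _ hi')).trans
      (integral_congr_ae (ae_of_all _ fun ω => integral_congr_ae (ae_of_all _ fun w => ?_)))
    have e : (fun i => (Function.update ω j w i).2) = Function.update (fun i => (ω i).2) j w.2 := by
      funext i
      by_cases hi : i = j
      · subst hi; simp
      · simp [Function.update_of_ne hi]
    simp only [Function.update_self, e]
  -- Given the transcripts of the other servers, `h` is a function of the transcript `j` alone.
  have hproj : ∀ j, ∫ ω, h (fun i => (ω i).2) * V j (ω j) ∂Measure.pi ρ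
      = ∫ ω, h (fun i => (ω i).2) * G j (ω j).2 ∂Measure.pi ρ := by
    intro j
    rw [hswap j (V j) (hV j), hswap j (fun w => G j w.2) (mG j)]
    refine integral_congr_ae (ae_of_all _ fun ω => ?_)
    have hmu : Measurable fun t => h (Function.update (fun i => (ω i).2) j t) :=
      hm.comp (measurable_update _)
    exact oG j _ hmu (MemLp.of_bound (hmu.comp measurable_snd).aestronglyMeasurable B
      (ae_of_all _ fun w => hB _))
  have hsum : ∫ ω, h (fun j => (ω j).2) * ∑ j, V j (ω j) ∂Measure.pi ρ
      = ∫ ω, h (fun j => (ω j).2) * ∑ j, G j (ω j).2 ∂Measure.pi ρ := by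
    simp only [Finset.mul_sum]
    have i1 : ∀ j, Integrable (fun ω : ∀ j, X j × T => h (fun i => (ω i).2) * V j (ω j))
      (Measure.pi ρ) := fun j => mh.integrable_mul (hVi j)
    have i2 : ∀ j, Integrable (fun ω : ∀ j, X j × T => h (fun i => (ω i).2) * G j (ω j).2)
      (Measure.pi ρ) := fun j => mh.integrable_mul (hGi j)
    rw [integral_finsetSum _ fun j _ => i1 j, integral_finsetSum _ fun j _ => i2 j]
    exact Finset.sum_congr rfl fun j _ => hproj j
  have mS : MemLp (fun ω : ∀ j, X j × T => ∑ j, G j (ω j).2) 2 (Measure.pi ρ) :=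
    memLp_finsetSum _ fun j _ => hGi j
  have hS2 : ∫ ω, (∑ j, G j (ω j).2) ^ 2 ∂Measure.pi ρ ≤ b ^ 2 := by
    rw [integral_sq_sum_pi ρ (fun j w => G j w.2) mG hG0]
    exact hGb
  rw [hsum, abs_le]
  refine ⟨?_, integral_mul_le_sqrt mh mS ha hb hha hS2⟩
  have := integral_mul_le_sqrt mh.neg mS ha hb (by simpa using hha) hS2
  simp only [Pi.neg_apply, neg_mul, integral_neg] at this
  linarith

/-! ### The van Trees argument -/

lemma integral_unitInterval_eq (φ : ℝ → ℝ) :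
    ∫ x : unitInterval, φ x = ∫ t in (0 : ℝ)..1, φ t := by
  rw [intervalIntegral.integral_of_le zero_le_one, ← integral_Icc_eq_integral_Ioc]
  exact integral_subtype_comap measurableSet_Icc φ

/-- The multivariate van Trees argument, for the uniform prior on the cube `[0,1] ^ ι`: `Λ θ` is the
likelihood at `θ`, the score in the coordinate `k` is `S k θ`, and `M k` estimates `s θ k`. -/
lemma exists_van_trees {ι Ω : Type} [Fintype ι] [DecidableEq ι] [MeasurableSpace Ω]
    (ρ : Measure Ω) [IsProbabilityMeasure ρ] {s : ℝ} (hs : 0 ≤ s) {M : ι → Ω → ℝ}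
    (hM : ∀ k, Measurable (M k)) (hM0 : ∀ k ω, 0 ≤ M k ω) (hMs : ∀ k ω, M k ω ≤ s)
    {Λ : (ι → ℝ) → Ω → ℝ} {S : ι → (ι → ℝ) → Ω → ℝ} (hΛ0 : ∀ θ ω, 0 ≤ Λ θ ω)
    (mΛ : Measurable (Function.uncurry Λ)) (mS : ∀ k, Measurable (Function.uncurry (S k)))
    (cS : ∀ k ω, Continuous fun θ => S k θ ω)
    (hd : ∀ k θ ω t, HasDerivAt (fun t => Λ (Function.update θ k t) ω)
      (S k (Function.update θ k t) ω * Λ (Function.update θ k t) ω) t)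
    (iΛ : ∀ θ, Integrable (Λ θ) ρ) (h1 : ∀ θ, ∫ ω, Λ θ ω ∂ρ = 1) {b : ι → ℝ}
    (iS : ∀ k θ, Integrable (fun ω => S k θ ω * Λ θ ω) ρ)
    (bS : ∀ k θ, ∫ ω, |S k θ ω| * Λ θ ω ∂ρ ≤ b k) :
    ∃ θ : ι → ℝ, (∀ k, 0 ≤ θ k ∧ θ k ≤ 1) ∧ Fintype.card ι * (s / 6)
      ≤ ∑ k, ∫ ω, (M k ω - s * θ k) * (θ k * (1 - θ k) * S k θ ω + (1 - 2 * θ k)) * Λ θ ω ∂ρ := by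
  set ν : Measure (ι → unitInterval) := Measure.pi fun _ => volume
  set v : (ι → unitInterval) → ι → ℝ := fun θ k => θ k with hv
  have hvm : Measurable v := by
    refine measurable_pi_iff.2 fun k => ?_
    exact measurable_subtype_coe.comp (measurable_pi_apply k)
  have hv01 : ∀ θ k, 0 ≤ v θ k ∧ v θ k ≤ 1 := fun θ k => ⟨(θ k).2.1, (θ k).2.2⟩
  set F : ι → (ι → ℝ) → Ω → ℝ := fun k θ ω =>
    (M k ω - s * θ k) * (θ k * (1 - θ k) * S k θ ω + (1 - 2 * θ k)) * Λ θ ω with hF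
  set H : ι → (ι → ℝ) → Ω → ℝ := fun k θ ω => F k θ ω - s * (θ k * (1 - θ k)) * Λ θ ω with hH
  have mF : ∀ k, Measurable (Function.uncurry (F k)) := fun k => by
    have e1 : Measurable fun w : (ι → ℝ) × Ω => w.1 k := (measurable_pi_apply k).comp measurable_fst
    have e2 : Measurable fun w : (ι → ℝ) × Ω => M k w.2 := (hM k).comp measurable_snd
    exact ((e2.sub (e1.const_mul s)).mul (((e1.mul (e1.const_sub 1)).mul (mS k)).add
      ((e1.const_mul 2).const_sub 1))).mul mΛ
  -- An integrable bound, needed for Fubini's theorem only.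
  have bF : ∀ k θ ω, 0 ≤ θ k ∧ θ k ≤ 1 → |F k θ ω| ≤ s * (|S k θ ω| * Λ θ ω + Λ θ ω) := by
    intro k θ ω ⟨h0, h1⟩
    have q1 : |M k ω - s * θ k| ≤ s := by
      rw [abs_le]
      constructor <;> nlinarith [hM0 k ω, hMs k ω]
    have q2 : |θ k * (1 - θ k)| ≤ 1 := by rw [abs_le]; constructor <;> nlinarith
    have q3 : |1 - 2 * θ k| ≤ 1 := by rw [abs_le]; constructor <;> linarith
    have q4 : |θ k * (1 - θ k) * S k θ ω + (1 - 2 * θ k)| ≤ |S k θ ω| + 1 := by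
      refine (abs_add_le _ _).trans (add_le_add ?_ q3)
      rw [abs_mul]
      exact mul_le_of_le_one_left (abs_nonneg _) q2
    simp only [hF, abs_mul, abs_of_nonneg (hΛ0 θ ω)]
    calc |M k ω - s * θ k| * |θ k * (1 - θ k) * S k θ ω + (1 - 2 * θ k)| * Λ θ ω
        ≤ s * (|S k θ ω| + 1) * Λ θ ω := by
          have := hΛ0 θ ω
          gcongr
      _ = _ := by ring
  have iB : ∀ k θ, Integrable (fun ω => s * (|S k θ ω| * Λ θ ω + Λ θ ω)) ρ := fun k θ => by
    have : (fun ω => |S k θ ω| * Λ θ ω) = fun ω => |S k θ ω * Λ θ ω| := by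
      funext ω; rw [abs_mul, abs_of_nonneg (hΛ0 θ ω)]
    have h2 : Integrable (fun ω => |S k θ ω| * Λ θ ω) ρ := by rw [this]; exact (iS k θ).abs
    exact (h2.add (iΛ θ)).const_mul s
  have mFθ : ∀ k θ, Measurable (F k θ) := fun k θ => (mF k).comp measurable_prodMk_left
  have iFθ : ∀ k θ, (∀ k, 0 ≤ θ k ∧ θ k ≤ 1) → Integrable (F k θ) ρ := fun k θ hθ =>
    (iB k θ).mono' (mFθ k θ).aestronglyMeasurable (ae_of_all _ fun ω => bF k θ ω (hθ k))
  have hw : Measurable fun w : (ι → unitInterval) × Ω => (v w.1, w.2) :=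
    (hvm.comp measurable_fst).prodMk measurable_snd
  have iFF : ∀ k, Integrable (fun w : (ι → unitInterval) × Ω => F k (v w.1) w.2) (ν.prod ρ) := by
    intro k
    have hm : Measurable fun w : (ι → unitInterval) × Ω => F k (v w.1) w.2 := (mF k).comp hw
    refine (integrable_prod_iff hm.aestronglyMeasurable).2
      ⟨ae_of_all _ fun θ => iFθ k _ (hv01 θ), ?_⟩
    refine Integrable.of_bound (hm.norm.stronglyMeasurable.integral_prod_right).aestronglyMeasurable
      (s * (b k + 1)) (ae_of_all _ fun θ => ?_)
    rw [Real.norm_eq_abs, abs_of_nonneg (integral_nonneg fun _ => norm_nonneg _)]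
    calc ∫ ω, ‖F k (v θ) ω‖ ∂ρ ≤ ∫ ω, s * (|S k (v θ) ω| * Λ (v θ) ω + Λ (v θ) ω) ∂ρ :=
          integral_mono (iFθ k _ (hv01 θ)).norm (iB k _) fun ω => bF k _ ω (hv01 θ k)
      _ = s * (∫ ω, |S k (v θ) ω| * Λ (v θ) ω ∂ρ + 1) := by
          have h2 : Integrable (fun ω => |S k (v θ) ω| * Λ (v θ) ω) ρ := by
            have : (fun ω => |S k (v θ) ω| * Λ (v θ) ω) = fun ω => |S k (v θ) ω * Λ (v θ) ω| := by
              funext ω; rw [abs_mul, abs_of_nonneg (hΛ0 _ ω)]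
            rw [this]; exact (iS k _).abs
          rw [integral_const_mul, integral_add h2 (iΛ _), h1]
      _ ≤ _ := by
          have := bS k (v θ)
          gcongr
  have iLL : ∀ k, Integrable (fun w : (ι → unitInterval) × Ω =>
      s * (v w.1 k * (1 - v w.1 k)) * Λ (v w.1) w.2) (ν.prod ρ) := by
    intro k
    have e1 : Measurable fun w : (ι → unitInterval) × Ω => v w.1 k :=
      (measurable_pi_apply k).comp (hvm.comp measurable_fst)
    have i0 : Integrable (fun w : (ι → unitInterval) × Ω => Λ (v w.1) w.2) (ν.prod ρ) := by
      have hm : Measurable fun w : (ι → unitInterval) × Ω => Λ (v w.1) w.2 := mΛ.comp hw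
      refine (integrable_prod_iff hm.aestronglyMeasurable).2 ⟨ae_of_all _ fun θ => iΛ (v θ), ?_⟩
      have : ∀ θ, ∫ ω, ‖Λ (v θ) ω‖ ∂ρ = 1 := fun θ => by
        simp only [Real.norm_eq_abs, abs_of_nonneg (hΛ0 _ _), h1]
      simp only [this]
      exact integrable_const _
    refine i0.bdd_mul (c := s) ((e1.mul (e1.const_sub 1)).const_mul s).aestronglyMeasurable
      (ae_of_all _ fun w => ?_)
    obtain ⟨q0, q1⟩ := hv01 w.1 k
    rw [Real.norm_eq_abs, abs_of_nonneg (mul_nonneg hs (mul_nonneg q0 (by linarith)))]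
    exact mul_le_of_le_one_right hs (by nlinarith)
  have iHH : ∀ k, Integrable (fun w : (ι → unitInterval) × Ω => H k (v w.1) w.2) (ν.prod ρ) :=
    fun k => (iFF k).sub (iLL k)
  -- in each coordinate, `H k` is the derivative of `(M k - s t) t (1 - t) Λ`
  have hline : ∀ k θ ω, ∫ t : unitInterval, H k (Function.update θ k t) ω = 0 := by
    intro k θ ω
    rw [integral_unitInterval_eq fun t => H k (Function.update θ k t) ω]
    have hder : ∀ t, HasDerivAt
        (fun t => (M k ω - s * t) * (t * (1 - t)) * Λ (Function.update θ k t) ω)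
        (H k (Function.update θ k t) ω) t := by
      intro t
      have e1 : HasDerivAt (fun t : ℝ => M k ω - s * t) (-s) t := by
        simpa using ((hasDerivAt_id t).const_mul s).const_sub (M k ω)
      have e2 : HasDerivAt (fun t : ℝ => t * (1 - t)) (1 - 2 * t) t := by
        have := (hasDerivAt_id t).mul ((hasDerivAt_id t).const_sub 1)
        refine this.congr_deriv ?_
        simp only [id]; ring
      refine ((e1.mul e2).mul (hd k θ ω t)).congr_deriv ?_
      simp only [hH, hF, Function.update_self, Pi.mul_apply]
      ring
    have cu : Continuous fun t : ℝ => Function.update θ k t :=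
      continuous_const.update k continuous_id
    have cΛ : Continuous fun t => Λ (Function.update θ k t) ω :=
      continuous_iff_continuousAt.2 fun t => (hd k θ ω t).continuousAt
    have cH : Continuous fun t => H k (Function.update θ k t) ω := by
      have cS' : Continuous fun t => S k (Function.update θ k t) ω := (cS k ω).comp cu
      have c1 : Continuous fun t : ℝ => t * (1 - t) := by fun_prop
      have c2 : Continuous fun t : ℝ => M k ω - s * t := by fun_prop
      have c3 : Continuous fun t : ℝ => 1 - 2 * t := by fun_prop
      simp only [hH, hF, Function.update_self]
      exact ((c2.mul ((c1.mul cS').add c3)).mul cΛ).sub ((c1.const_mul s).mul cΛ)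
    rw [intervalIntegral.integral_eq_sub_of_hasDerivAt (fun t _ => hder t)
      (cH.intervalIntegrable _ _)]
    simp
  -- By Fubini's theorem it suffices to integrate along the lines parallel to the axis `k`.
  have hzero : ∀ k, ∫ w, H k (v w.1) w.2 ∂ν.prod ρ = 0 := by
    intro k
    rw [integral_prod_symm _ (iHH k)]
    refine integral_eq_zero_of_ae ?_
    filter_upwards [(iHH k).prod_left_ae] with ω hω
    have hmp := measurePreserving_update_pi (fun _ : ι => (volume : Measure unitInterval))
      (fun _ => volume) k fun _ _ => rfl
    have e0 := integral_map (μ := ν.prod volume) hmp.measurable.aemeasurable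
      (f := fun θ : ι → unitInterval => H k (v θ) ω)
      (by rw [hmp.map_eq]; exact hω.aestronglyMeasurable)
    rw [hmp.map_eq] at e0
    refine (e0.trans (integral_prod _ (hmp.integrable_comp_of_integrable hω))).trans ?_
    refine integral_eq_zero_of_ae (ae_of_all _ fun θ => ?_)
    rw [Pi.zero_apply, ← hline k (v θ) ω]
    refine integral_congr_ae (ae_of_all _ fun t => ?_)
    have e : v (Function.update θ k t) = Function.update (v θ) k (t : ℝ) := by
      funext i
      by_cases hi : i = k
      · subst hi; simp [hv]
      · simp [hv, Function.update_of_ne hi]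
    simp only [e]
  have hmean : ∀ k, ∫ θ, ∫ ω, F k (v θ) ω ∂ρ ∂ν = s / 6 := by
    intro k
    have e1 : ∫ w, F k (v w.1) w.2 ∂ν.prod ρ
        = ∫ w, s * (v w.1 k * (1 - v w.1 k)) * Λ (v w.1) w.2 ∂ν.prod ρ := by
      have := hzero k
      simp only [hH] at this
      rw [integral_sub (iFF k) (iLL k)] at this
      linarith
    rw [integral_integral (iFF k), e1, integral_prod _ (iLL k)]
    simp only [integral_const_mul, h1, mul_one]
    have hmp := measurePreserving_eval (fun _ : ι => (volume : Measure unitInterval)) k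
    have e2 : ∫ θ, v θ k * (1 - v θ k) ∂ν = ∫ t : unitInterval, (t : ℝ) * (1 - t) := by
      rw [← hmp.map_eq, integral_map hmp.measurable.aemeasurable
        (Continuous.aestronglyMeasurable (by fun_prop))]
    rw [e2, integral_unitInterval_eq fun t => t * (1 - t)]
    have e3 : ∀ t : ℝ, t * (1 - t) = t - t ^ 2 := fun t => by ring
    simp only [e3]
    rw [intervalIntegral.integral_sub (by simp) (by simp)]
    simp only [integral_id, integral_pow]
    ring
  have iF' : ∀ k, Integrable (fun θ => ∫ ω, F k (v θ) ω ∂ρ) ν := fun k => (iFF k).integral_prod_left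
  obtain ⟨θ, hθ⟩ := exists_integral_le (μ := ν) (f := fun θ => ∑ k, ∫ ω, F k (v θ) ω ∂ρ)
    (integrable_finsetSum _ fun k _ => iF' k)
  refine ⟨v θ, hv01 θ, le_trans (le_of_eq ?_) hθ⟩
  rw [integral_finsetSum _ fun k _ => iF' k]
  simp [hmean]

/-! ### The joint law of the data and the transcripts -/

section joint

variable {m : ℕ} {n : Fin m → ℕ} {T : Type}

/-- The likelihood of `f`, with respect to the regression function `0`. -/
def jointLik (f : unitInterval → ℝ) (ω : ∀ j, (Fin (n j) → ℝ × unitInterval) × T) : ℝ :=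
  ∏ j, ∏ i, lik f ((ω j).1 i)

/-- The score, at `f`, of the coefficient of `g`. -/
def jointScore (f g : unitInterval → ℝ) (ω : ∀ j, (Fin (n j) → ℝ × unitInterval) × T) : ℝ :=
  ∑ j, scoreSum f g (ω j).1

lemma jointLik_nonneg (f : unitInterval → ℝ) (ω : ∀ j, (Fin (n j) → ℝ × unitInterval) × T) :
    0 ≤ jointLik f ω :=
  Finset.prod_nonneg fun _ _ => Finset.prod_nonneg fun _ _ => (lik_pos _ _).le

variable [MeasurableSpace T]

/-- The joint law of the data and the transcripts of all servers, when the transcripts are drawn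
from the kernels `K`. -/
def jointLaw (K : ∀ j, Kernel (Fin (n j) → ℝ × unitInterval) T) (f : unitInterval → ℝ) :
    Measure (∀ j, (Fin (n j) → ℝ × unitInterval) × T) :=
  Measure.pi fun j => (Measure.pi fun _ : Fin (n j) => regressionLaw f) ⊗ₘ K j

variable (K : ∀ j, Kernel (Fin (n j) → ℝ × unitInterval) T) [∀ j, IsMarkovKernel (K j)]
  {f g : unitInterval → ℝ}

lemma isProbabilityMeasure_jointLaw (hf : Measurable f) : IsProbabilityMeasure (jointLaw K f) := by
  have := isProbabilityMeasure_regressionLaw hf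
  unfold jointLaw
  infer_instance

lemma measurable_jointLik (hf : Measurable f) : Measurable (jointLik (n := n) (T := T) f) := by
  refine Finset.measurable_prod _ fun j _ => Finset.measurable_prod _ fun i _ => ?_
  exact (measurable_lik hf).comp ((measurable_pi_apply i).comp
    (measurable_fst.comp (measurable_pi_apply j)))

/-- Given the data, the law of the transcripts does not depend on the regression function, so the
likelihood of data and transcripts is that of the data. -/
lemma jointLaw_eq_withDensity (hf : Measurable f) : jointLaw K f
    = (jointLaw K 0).withDensity fun ω => ENNReal.ofReal (jointLik f ω) := by
  have h0 := isProbabilityMeasure_regressionLaw (f := 0) measurable_const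
  have h1 := isProbabilityMeasure_regressionLaw hf
  have hm : ∀ j, Measurable fun z : Fin (n j) → ℝ × unitInterval =>
      ENNReal.ofReal (∏ i, lik f (z i)) := fun j =>
    (Finset.measurable_prod _ fun i _ =>
      (measurable_lik hf).comp (measurable_pi_apply i)).ennreal_ofReal
  have e : ∀ j, (Measure.pi fun _ : Fin (n j) => regressionLaw f) ⊗ₘ K j
      = ((Measure.pi fun _ : Fin (n j) => regressionLaw 0) ⊗ₘ K j).withDensity
        fun w => ENNReal.ofReal (∏ i, lik f (w.1 i)) := fun j => by
    rw [pi_regressionLaw_eq_withDensity hf, withDensity_compProd _ _ (hm j)]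
  have h2 : ∀ j, SigmaFinite (((Measure.pi fun _ : Fin (n j) => regressionLaw 0) ⊗ₘ
      K j).withDensity fun w => ENNReal.ofReal (∏ i, lik f (w.1 i))) := fun j => by
    rw [← e j]; infer_instance
  unfold jointLaw
  simp only [e]
  refine (pi_withDensity_eq (fun j => (Measure.pi fun _ : Fin (n j) => regressionLaw 0) ⊗ₘ K j)
    (fun j w => ENNReal.ofReal (∏ i, lik f (w.1 i))) fun j => (hm j).comp measurable_fst).trans ?_
  congr 1
  funext ω
  exact (ENNReal.ofReal_prod_of_nonneg fun j _ =>
    Finset.prod_nonneg fun _ _ => (lik_pos _ _).le).symm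

lemma integral_jointLaw (hf : Measurable f)
    (H : (∀ j, (Fin (n j) → ℝ × unitInterval) × T) → ℝ) :
    ∫ ω, H ω ∂jointLaw K f = ∫ ω, H ω * jointLik f ω ∂jointLaw K 0 := by
  rw [jointLaw_eq_withDensity K hf, integral_withDensity_eq_integral_toReal_smul
    (measurable_jointLik hf).ennreal_ofReal (ae_of_all _ fun _ => ENNReal.ofReal_lt_top)]
  refine integral_congr_ae (ae_of_all _ fun z => ?_)
  simp only [ENNReal.toReal_ofReal (jointLik_nonneg f z), smul_eq_mul, mul_comm]

lemma integrable_jointLaw_iff (hf : Measurable f)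
    {H : (∀ j, (Fin (n j) → ℝ × unitInterval) × T) → ℝ} :
    Integrable H (jointLaw K f) ↔ Integrable (fun ω => H ω * jointLik f ω) (jointLaw K 0) := by
  rw [jointLaw_eq_withDensity K hf, integrable_withDensity_iff
    (measurable_jointLik hf).ennreal_ofReal (ae_of_all _ fun _ => ENNReal.ofReal_lt_top)]
  simp only [ENNReal.toReal_ofReal (jointLik_nonneg f _)]

lemma measurable_transcripts :
    Measurable fun (ω : ∀ j, (Fin (n j) → ℝ × unitInterval) × T) j => (ω j).2 :=
  measurable_pi_iff.2 fun j => measurable_snd.comp (measurable_pi_apply j)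

lemma measurePreserving_fst_jointLaw (hf : Measurable f) (j : Fin m) :
    MeasurePreserving (fun ω : ∀ j, (Fin (n j) → ℝ × unitInterval) × T => (ω j).1) (jointLaw K f)
      (Measure.pi fun _ : Fin (n j) => regressionLaw f) := by
  have := isProbabilityMeasure_regressionLaw hf
  have h1 : MeasurePreserving (Prod.fst : (Fin (n j) → ℝ × unitInterval) × T → _)
      ((Measure.pi fun _ : Fin (n j) => regressionLaw f) ⊗ₘ K j)
      (Measure.pi fun _ : Fin (n j) => regressionLaw f) :=
    ⟨measurable_fst, Measure.fst_compProd _ _⟩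
  exact h1.comp (measurePreserving_eval (fun j =>
    (Measure.pi fun _ : Fin (n j) => regressionLaw f) ⊗ₘ K j) j)

lemma memLp_jointScore (hf : Continuous f) (hg : Continuous g) :
    MemLp (jointScore f g) 2 (jointLaw K f) :=
  memLp_finsetSum _ fun j _ => (memLp_scoreSum hf hg).comp_measurePreserving
    (measurePreserving_fst_jointLaw K hf.measurable j)

lemma integral_abs_jointScore_le (hf : Continuous f) (hg : Continuous g) :
    ∫ ω, |jointScore f g ω| ∂jointLaw K f ≤ ∑ j, (n j : ℝ) * ∫ x, |g x| := by
  have := isProbabilityMeasure_regressionLaw hf.measurable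
  have hmp : ∀ j (i : Fin (n j)), MeasurePreserving
      (fun ω : ∀ j, (Fin (n j) → ℝ × unitInterval) × T => (ω j).1 i) (jointLaw K f)
      (regressionLaw f) := fun j i =>
    (measurePreserving_eval (fun _ : Fin (n j) => regressionLaw f) i).comp
      (measurePreserving_fst_jointLaw K hf.measurable j)
  have hS : Integrable (fun z => |score f g z|) (regressionLaw f) :=
    ((memLp_score hf hg).integrable (by norm_num)).abs
  have hi : ∀ j (i : Fin (n j)), Integrable (fun ω : ∀ j, (Fin (n j) → ℝ × unitInterval) × T =>
      |score f g ((ω j).1 i)|) (jointLaw K f) := fun j i =>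
    (hmp j i).integrable_comp_of_integrable hS
  calc ∫ ω, |jointScore f g ω| ∂jointLaw K f
      ≤ ∫ ω, ∑ j, ∑ i, |score f g ((ω j).1 i)| ∂jointLaw K f := by
        refine integral_mono_of_nonneg (ae_of_all _ fun _ => abs_nonneg _)
          (integrable_finsetSum _ fun j _ => integrable_finsetSum _ fun i _ => hi j i)
          (ae_of_all _ fun ω => ?_)
        exact (Finset.abs_sum_le_sum_abs _ _).trans
          (Finset.sum_le_sum fun j _ => Finset.abs_sum_le_sum_abs _ _)
    _ = ∑ j, ∑ i : Fin (n j), ∫ ω, |score f g ((ω j).1 i)| ∂jointLaw K f := by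
        rw [integral_finsetSum _ fun j _ => integrable_finsetSum _ fun i _ => hi j i]
        exact Finset.sum_congr rfl fun j _ => integral_finsetSum _ fun i _ => hi j i
    _ ≤ ∑ j, ∑ _i : Fin (n j), ∫ x, |g x| := by
        refine Finset.sum_le_sum fun j _ => Finset.sum_le_sum fun i _ => ?_
        refine le_trans (le_of_eq ?_) (integral_abs_score_le hf hg)
        rw [← (hmp j i).map_eq, integral_map (hmp j i).measurable.aemeasurable]
        rw [(hmp j i).map_eq]
        exact hS.aestronglyMeasurable
    _ = _ := by simp

end joint

lemma Protocol.transcriptLaw_eq_map {m : ℕ} {n : Fin m → ℕ} {ε δ : Fin m → ℝ}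
    (P : Protocol n ε δ) {f : unitInterval → ℝ} (hf : Measurable f) :
    P.transcriptLaw f = (jointLaw P.K f).map fun ω j => (ω j).2 := by
  have := isProbabilityMeasure_regressionLaw hf
  have h : ∀ j, ((Measure.pi fun _ : Fin (n j) => regressionLaw f) ⊗ₘ P.K j).map Prod.snd
      = (Measure.pi fun _ : Fin (n j) => regressionLaw f).bind (P.K j) := fun j =>
    Measure.snd_compProd _ _
  have h2 : ∀ j, SigmaFinite
      (((Measure.pi fun _ : Fin (n j) => regressionLaw f) ⊗ₘ P.K j).map Prod.snd) := fun j => by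
    rw [h j]; infer_instance
  unfold Protocol.transcriptLaw jointLaw
  rw [Measure.pi_map_pi (f := fun _ => Prod.snd) fun j => measurable_snd.aemeasurable]
  simp only [h]

/-! ### Derivatives of the likelihood along a finite dimensional family -/

section family

variable {m : ℕ} {n : Fin m → ℕ} {T : Type} {ι : Type} [Fintype ι]

/-- The regression functions `s ∑ₖ θₖ gₖ`. -/
def family (s : ℝ) (g : ι → unitInterval → ℝ) (θ : ι → ℝ) (x : unitInterval) : ℝ :=
  s * ∑ k, θ k * g k x

variable {s : ℝ} {g : ι → unitInterval → ℝ}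

lemma continuous_family (hg : ∀ k, Continuous (g k)) (θ : ι → ℝ) : Continuous (family s g θ) := by
  unfold family
  fun_prop

lemma family_update [DecidableEq ι] (θ : ι → ℝ) (k : ι) (t : ℝ) (x : unitInterval) :
    family s g (Function.update θ k t) x = family s g θ x + s * ((t - θ k) * g k x) := by
  have : ∀ i, Function.update θ k t i * g i x
      = θ i * g i x + if i = k then (t - θ k) * g k x else 0 := by
    intro i
    by_cases hi : i = k
    · subst hi; simp; ring
    · simp [hi]
  simp only [family, this, Finset.sum_add_distrib, Finset.sum_ite_eq', Finset.mem_univ, if_true]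
  ring

/-- The partial derivatives of the log-likelihood are the scores of the coefficients. -/
lemma hasDerivAt_jointLik_family [DecidableEq ι] (θ : ι → ℝ) (k : ι)
    (ω : ∀ j, (Fin (n j) → ℝ × unitInterval) × T) (t : ℝ) :
    HasDerivAt (fun t => jointLik (family s g (Function.update θ k t)) ω)
      (s * jointScore (family s g (Function.update θ k t)) (g k) ω
        * jointLik (family s g (Function.update θ k t)) ω) t := by
  have e : ∀ f : unitInterval → ℝ, jointLik f ω
      = Real.exp (∑ j, ∑ i, (((ω j).1 i).1 * f ((ω j).1 i).2 - f ((ω j).1 i).2 ^ 2 / 2)) := by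
    intro f
    simp only [jointLik, lik, Real.exp_sum]
  simp only [e]
  have h1 : ∀ x, HasDerivAt (fun t => family s g (Function.update θ k t) x) (s * g k x) t := by
    intro x
    simp only [family_update]
    have := ((((hasDerivAt_id t).sub_const (θ k)).mul_const (g k x)).const_mul s).const_add
      (family s g θ x)
    simpa using this
  have h2 : HasDerivAt (fun t => ∑ j, ∑ i,
      (((ω j).1 i).1 * family s g (Function.update θ k t) ((ω j).1 i).2
        - family s g (Function.update θ k t) ((ω j).1 i).2 ^ 2 / 2))
      (s * jointScore (family s g (Function.update θ k t)) (g k) ω) t := by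
    simp only [jointScore, scoreSum, Finset.mul_sum]
    refine HasDerivAt.fun_sum fun j _ => HasDerivAt.fun_sum fun i _ => ?_
    have h3 := h1 ((ω j).1 i).2
    refine ((h3.const_mul ((ω j).1 i).1).sub ((h3.pow 2).div_const 2)).congr_deriv ?_
    simp only [score]
    push_cast
    ring
  exact h2.exp.congr_deriv (mul_comm _ _)

lemma measurable_family (hg : ∀ k, Continuous (g k)) :
    Measurable fun w : (ι → ℝ) × unitInterval => family s g w.1 w.2 := by
  unfold family
  refine Measurable.const_mul (Finset.measurable_sum _ fun k _ => ?_) s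
  exact ((measurable_pi_apply k).comp measurable_fst).mul ((hg k).measurable.comp measurable_snd)

lemma continuous_jointScore_family (k : ι) (ω : ∀ j, (Fin (n j) → ℝ × unitInterval) × T) :
    Continuous fun θ : ι → ℝ => jointScore (family s g θ) (g k) ω := by
  unfold jointScore scoreSum score family
  fun_prop

variable [MeasurableSpace T]

lemma measurable_obs_apply {ι : Type} (j : Fin m) (i : Fin (n j)) :
    Measurable fun w : (ι → ℝ) × (∀ j, (Fin (n j) → ℝ × unitInterval) × T) => (w.2 j).1 i :=
  (measurable_pi_apply i).comp (measurable_fst.comp ((measurable_pi_apply j).comp measurable_snd))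

lemma measurable_jointLik_family (hg : ∀ k, Continuous (g k)) :
    Measurable fun w : (ι → ℝ) × (∀ j, (Fin (n j) → ℝ × unitInterval) × T) =>
      jointLik (family s g w.1) w.2 := by
  refine Finset.measurable_prod _ fun j _ => Finset.measurable_prod _ fun i _ => ?_
  have h1 := measurable_obs_apply (ι := ι) (T := T) j i
  have h2 : Measurable fun w : (ι → ℝ) × (∀ j, (Fin (n j) → ℝ × unitInterval) × T) =>
      family s g w.1 ((w.2 j).1 i).2 :=
    (measurable_family hg).comp (measurable_fst.prodMk h1.snd)
  exact Real.measurable_exp.comp ((h1.fst.mul h2).sub ((h2.pow_const 2).div_const 2))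

lemma measurable_jointScore_family (hg : ∀ k, Continuous (g k)) (k : ι) :
    Measurable fun w : (ι → ℝ) × (∀ j, (Fin (n j) → ℝ × unitInterval) × T) =>
      jointScore (family s g w.1) (g k) w.2 := by
  refine Finset.measurable_sum _ fun j _ => Finset.measurable_sum _ fun i _ => ?_
  have h1 := measurable_obs_apply (ι := ι) (T := T) j i
  have h2 : Measurable fun w : (ι → ℝ) × (∀ j, (Fin (n j) → ℝ × unitInterval) × T) =>
      family s g w.1 ((w.2 j).1 i).2 :=
    (measurable_family hg).comp (measurable_fst.prodMk h1.snd)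
  exact (h1.fst.sub h2).mul ((hg k).measurable.comp h1.snd)

end family

/-- The van Trees lower bound for the sum of the risks of estimators of the coefficients in
`s ∑ₖ θₖ gₖ`, when the information about each coefficient is at most `b ^ 2`. -/
lemma Protocol.exists_le_sum_sqrt_risk {m : ℕ} {n : Fin m → ℕ} {ε δ : Fin m → ℝ}
    (P : Protocol n ε δ) {ι : Type} [Fintype ι] [DecidableEq ι] {s b : ℝ} (hs : 0 ≤ s)
    (hb : 0 ≤ b) {g : ι → unitInterval → ℝ} (hg : ∀ k, Continuous (g k))
    {M : ι → (Fin m → P.T) → ℝ} (hM : ∀ k, Measurable (M k)) (hM0 : ∀ k t, 0 ≤ M k t)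
    (hMs : ∀ k t, M k t ≤ s)
    (hinfo : ∀ θ : ι → ℝ, (∀ k, 0 ≤ θ k ∧ θ k ≤ 1) → ∀ k, ∃ G : Fin m → P.T → ℝ,
      (∀ j, MemLp (fun w : (Fin (n j) → ℝ × unitInterval) × P.T => G j w.2) 2
        ((Measure.pi fun _ : Fin (n j) => regressionLaw (family s g θ)) ⊗ₘ P.K j)) ∧
      (∀ j, ∀ h : P.T → ℝ, Measurable h →
        MemLp (fun w : (Fin (n j) → ℝ × unitInterval) × P.T => h w.2) 2
          ((Measure.pi fun _ : Fin (n j) => regressionLaw (family s g θ)) ⊗ₘ P.K j) →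
        ∫ w, h w.2 * scoreSum (family s g θ) (g k) w.1
          ∂((Measure.pi fun _ : Fin (n j) => regressionLaw (family s g θ)) ⊗ₘ P.K j)
        = ∫ w, h w.2 * G j w.2
          ∂((Measure.pi fun _ : Fin (n j) => regressionLaw (family s g θ)) ⊗ₘ P.K j)) ∧
      ∑ j, ∫ w, G j w.2 ^ 2
        ∂((Measure.pi fun _ : Fin (n j) => regressionLaw (family s g θ)) ⊗ₘ P.K j) ≤ b ^ 2) :
    ∃ θ : ι → ℝ, (∀ k, 0 ≤ θ k ∧ θ k ≤ 1) ∧ Fintype.card ι * (s / 6)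
      ≤ (s * b / 4 + 1) * ∑ k, √(∫ t, (M k t - s * θ k) ^ 2 ∂P.transcriptLaw (family s g θ)) := by
  have hfc : ∀ θ, Continuous (family s g θ) := continuous_family hg
  have hprob : ∀ θ, IsProbabilityMeasure (jointLaw P.K (family s g θ)) := fun θ =>
    isProbabilityMeasure_jointLaw P.K (hfc θ).measurable
  have hprob0 : IsProbabilityMeasure (jointLaw P.K 0) :=
    isProbabilityMeasure_jointLaw P.K measurable_const
  set τ : (∀ j, (Fin (n j) → ℝ × unitInterval) × P.T) → Fin m → P.T := fun ω j => (ω j).2 with hτ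
  have mτ : Measurable τ := measurable_transcripts
  obtain ⟨θ, hθ, H⟩ := exists_van_trees (jointLaw P.K 0) hs (M := fun k ω => M k (τ ω))
    (fun k => (hM k).comp mτ) (fun k ω => hM0 k _) (fun k ω => hMs k _)
    (Λ := fun θ => jointLik (family s g θ))
    (S := fun k θ ω => s * jointScore (family s g θ) (g k) ω)
    (fun θ ω => jointLik_nonneg _ ω) (measurable_jointLik_family hg)
    (fun k => (measurable_jointScore_family hg k).const_mul s)
    (fun k ω => (continuous_jointScore_family k ω).const_mul s)
    (fun k θ ω t => hasDerivAt_jointLik_family θ k ω t)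
    (fun θ => by
      simpa using (integrable_jointLaw_iff P.K (hfc θ).measurable).1 (integrable_const (1 : ℝ)))
    (fun θ => by
      simpa using (integral_jointLaw P.K (hfc θ).measurable fun _ => (1 : ℝ)).symm)
    (b := fun k => s * ∑ j, (n j : ℝ) * ∫ x, |g k x|)
    (fun k θ => (integrable_jointLaw_iff P.K (hfc θ).measurable).1
      (((memLp_jointScore P.K (hfc θ) (hg k)).integrable (by norm_num)).const_mul s))
    (fun k θ => by
      rw [← integral_jointLaw P.K (hfc θ).measurable
        fun ω => |s * jointScore (family s g θ) (g k) ω|]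
      simp only [abs_mul, abs_of_nonneg hs, integral_const_mul]
      exact mul_le_mul_of_nonneg_left (integral_abs_jointScore_le P.K (hfc θ) (hg k)) hs)
  refine ⟨θ, hθ, H.trans ?_⟩
  rw [Finset.mul_sum]
  refine Finset.sum_le_sum fun k _ => ?_
  set f := family s g θ with hf
  have hp := hprob θ
  have := isProbabilityMeasure_regressionLaw (hfc θ).measurable
  -- `h` is the error of the estimate of the coefficient `k`, and `r` its risk.
  set h : (Fin m → P.T) → ℝ := fun t => M k t - s * θ k with hh
  have hhm : Measurable h := (hM k).sub_const _
  have hhB : ∀ t, |h t| ≤ s := fun t => by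
    obtain ⟨h0, h1⟩ := hθ k
    rw [abs_le]
    constructor <;> simp only [hh] <;> nlinarith [hM0 k t, hMs k t]
  set r := ∫ t, h t ^ 2 ∂P.transcriptLaw f with hr
  have hr0 : 0 ≤ r := integral_nonneg fun _ => sq_nonneg _
  have hr2 : ∫ ω, h (τ ω) ^ 2 ∂jointLaw P.K f = √r ^ 2 := by
    rw [Real.sq_sqrt hr0, hr, P.transcriptLaw_eq_map (hfc θ).measurable,
      integral_map mτ.aemeasurable (hhm.pow_const 2).aestronglyMeasurable]
  obtain ⟨G, mG, oG, bG⟩ := hinfo θ hθ k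
  have hS0 : ∀ j, ∫ w, scoreSum f (g k) w.1
      ∂((Measure.pi fun _ : Fin (n j) => regressionLaw f) ⊗ₘ P.K j) = 0 := fun j => by
    have h1 : MeasurePreserving (Prod.fst : (Fin (n j) → ℝ × unitInterval) × P.T → _)
        ((Measure.pi fun _ : Fin (n j) => regressionLaw f) ⊗ₘ P.K j)
        (Measure.pi fun _ : Fin (n j) => regressionLaw f) :=
      ⟨measurable_fst, Measure.fst_compProd _ _⟩
    have h2 := integral_map (μ := (Measure.pi fun _ : Fin (n j) => regressionLaw f) ⊗ₘ P.K j)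
      h1.measurable.aemeasurable (f := scoreSum f (g k))
      (measurable_scoreSum (hfc θ) (hg k)).aestronglyMeasurable
    rw [h1.map_eq] at h2
    exact h2.symm.trans (integral_scoreSum (hfc θ) (hg k))
  have hmain : |∫ ω, h (τ ω) * jointScore f (g k) ω ∂jointLaw P.K f| ≤ √r * b :=
    integral_mul_sum_le_of_projection
      (fun j => (Measure.pi fun _ : Fin (n j) => regressionLaw f) ⊗ₘ P.K j)
      (V := fun j w => scoreSum f (g k) w.1)
      (fun j => (memLp_scoreSum (hfc θ) (hg k)).comp_measurePreserving
        ⟨measurable_fst, Measure.fst_compProd _ _⟩) hS0 mG oG hhm hhB (Real.sqrt_nonneg r) hb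
      hr2.le bG
  have mh : MemLp (fun ω => h (τ ω)) 2 (jointLaw P.K f) :=
    MemLp.of_bound (hhm.comp mτ).aestronglyMeasurable s (ae_of_all _ fun ω => hhB _)
  have mS : MemLp (jointScore f (g k)) 2 (jointLaw P.K f) := memLp_jointScore P.K (hfc θ) (hg k)
  obtain ⟨h0, h1⟩ := hθ k
  have hc : ∫ ω, h (τ ω) * (1 - 2 * θ k) ∂jointLaw P.K f ≤ √r * 1 :=
    integral_mul_le_sqrt mh (memLp_const _) (Real.sqrt_nonneg r) zero_le_one hr2.le (by
      simp only [integral_const, probReal_univ, one_smul, one_pow]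
      nlinarith)
  have e : ∫ ω, (M k (τ ω) - s * θ k)
      * (θ k * (1 - θ k) * (s * jointScore f (g k) ω) + (1 - 2 * θ k)) * jointLik f ω
        ∂jointLaw P.K 0
      = θ k * (1 - θ k) * s * ∫ ω, h (τ ω) * jointScore f (g k) ω ∂jointLaw P.K f
        + ∫ ω, h (τ ω) * (1 - 2 * θ k) ∂jointLaw P.K f := by
    have i1 : Integrable (fun ω => h (τ ω) * jointScore f (g k) ω) (jointLaw P.K f) :=
      mh.integrable_mul mS
    have i2 : Integrable (fun ω => h (τ ω) * (1 - 2 * θ k)) (jointLaw P.K f) :=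
      (mh.integrable (by norm_num)).mul_const _
    rw [← integral_jointLaw P.K (hfc θ).measurable fun ω => (M k (τ ω) - s * θ k)
      * (θ k * (1 - θ k) * (s * jointScore f (g k) ω) + (1 - 2 * θ k)), ← integral_const_mul,
      ← integral_add (i1.const_mul _) i2]
    refine integral_congr_ae (ae_of_all _ fun ω => ?_)
    simp only [hh]
    ring
  refine (le_of_eq e).trans ?_
  have ha : θ k * (1 - θ k) * s ≤ s / 4 := by
    have : θ k * (1 - θ k) ≤ 1 / 4 := by nlinarith only [sq_nonneg (θ k - 1 / 2)]
    nlinarith only [this, hs]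
  have ha0 : 0 ≤ θ k * (1 - θ k) * s := mul_nonneg (mul_nonneg h0 (by linarith)) hs
  calc θ k * (1 - θ k) * s * ∫ ω, h (τ ω) * jointScore f (g k) ω ∂jointLaw P.K f
        + ∫ ω, h (τ ω) * (1 - 2 * θ k) ∂jointLaw P.K f
      ≤ s / 4 * (√r * b) + √r * 1 := by
        refine add_le_add ?_ hc
        refine (mul_le_mul_of_nonneg_left ((le_abs_self _).trans hmain) ha0).trans ?_
        exact mul_le_mul_of_nonneg_right ha (mul_nonneg (Real.sqrt_nonneg r) hb)
    _ = _ := by ring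

/-! ### The global lower bound -/

section globalLower

variable {W : WaveletSystem} {A : ℕ} {α R : ℝ} {p q : ℝ≥0∞}

/-- By Bessel's inequality the integrated risk is at least the sum of the risks of the empirical
coefficients of one level, also after these have been projected onto a range `[0, s]` that contains
the true coefficients. -/
lemma sum_risk_le_globalRisk (hW : W.IsRegularBasis A) {m : ℕ} {n : Fin m → ℕ} {ε δ : Fin m → ℝ}
    (P : Protocol n ε δ) (i : ℕ) {s : ℝ} (hs : 0 ≤ s) {f : unitInterval → ℝ} (hf : Continuous f)
    {c : Fin (W.count i) → ℝ} (hc0 : ∀ k, 0 ≤ c k) (hcs : ∀ k, c k ≤ s)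
    (hfc : ∀ k : Fin (W.count i), W.coeff f i k = c k) {M : Fin (W.count i) → (Fin m → P.T) → ℝ}
    (hM : ∀ k, Measurable (M k))
    (hMdef : ∀ k t, M k t = max 0 (min s (W.coeff (P.est t) i k))) :
    ENNReal.ofReal (∑ k, ∫ t, (M k t - c k) ^ 2 ∂P.transcriptLaw f) ≤ P.globalRisk f := by
  have := P.isProbabilityMeasure_transcriptLaw hf.measurable
  have hM0 : ∀ k t, 0 ≤ M k t := fun k t => by rw [hMdef]; exact le_max_left _ _
  have hMs : ∀ k t, M k t ≤ s := fun k t => by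
    rw [hMdef]; exact max_le hs (min_le_left _ _)
  have hint : ∀ k, Integrable (fun t => (M k t - c k) ^ 2) (P.transcriptLaw f) := fun k => by
    refine Integrable.of_bound (((hM k).sub_const _).pow_const 2).aestronglyMeasurable (s ^ 2)
      (ae_of_all _ fun t => ?_)
    rw [Real.norm_eq_abs, abs_of_nonneg (sq_nonneg _)]
    exact sq_le_sq' (by linarith [hM0 k t, hcs k]) (by linarith [hMs k t, hc0 k])
  rw [← integral_finsetSum _ fun k _ => hint k, ofReal_integral_eq_lintegral_ofReal
    (integrable_finsetSum _ fun k _ => hint k)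
    (ae_of_all _ fun t => Finset.sum_nonneg fun k _ => sq_nonneg _)]
  refine lintegral_mono fun t => ?_
  have hem : Measurable (P.est t) := P.measurable_est.comp measurable_prodMk_left
  have hdm : Measurable fun x => P.est t x - f x := hem.sub hf.measurable
  by_cases hfin : ∫⁻ x, ENNReal.ofReal ((P.est t x - f x) ^ 2) = ∞
  · rw [hfin]; exact le_top
  have hi : Integrable (fun x => (P.est t x - f x) ^ 2) (volume : Measure unitInterval) := by
    refine ⟨(hdm.pow_const 2).aestronglyMeasurable, ?_⟩
    rw [hasFiniteIntegral_iff_ofReal (ae_of_all _ fun x => sq_nonneg _)]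
    exact lt_top_iff_ne_top.2 hfin
  have hd2 : MemLp (fun x => P.est t x - f x) 2 (volume : Measure unitInterval) :=
    (memLp_two_iff_integrable_sq hdm.aestronglyMeasurable).2 hi
  have hf2 : MemLp f 2 (volume : Measure unitInterval) := memLp_of_continuous_unitInterval hf 2
  have he2 : MemLp (P.est t) 2 (volume : Measure unitInterval) := by
    have := hd2.add hf2
    refine this.congr_norm hem.aestronglyMeasurable (ae_of_all _ fun x => ?_)
    simp
  rw [← ofReal_integral_eq_lintegral_ofReal hi (ae_of_all _ fun x => sq_nonneg _)]
  refine ENNReal.ofReal_le_ofReal (le_trans ?_ (hW.bessel hd2 {i}))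
  rw [Finset.sum_singleton]
  refine Finset.sum_le_sum fun k _ => ?_
  have hsub : W.coeff (fun x => P.est t x - f x) i k = W.coeff (P.est t) i k - c k := by
    rw [← hfc k]
    simp only [WaveletSystem.coeff, sub_mul]
    exact integral_sub (hW.integrable_mul_fn he2 i k) (hW.integrable_mul_fn hf2 i k)
  rw [hsub, hMdef, sq_le_sq]
  -- the projection onto `[0, s]` is a contraction
  have h0 := hc0 k
  have h1 := hcs k
  set y := W.coeff (P.est t) i k
  rcases le_total y 0 with hy | hy
  · rw [min_eq_right (hy.trans hs), max_eq_left hy, abs_of_nonpos (by linarith),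
      abs_of_nonpos (by linarith)]
    linarith
  rcases le_total s y with hy' | hy'
  · rw [min_eq_left hy', max_eq_right hs, abs_of_nonneg (by linarith),
      abs_of_nonneg (by linarith)]
    linarith
  · rw [min_eq_right hy', max_eq_right hy]

lemma measurable_coeff_est {m : ℕ} {n : Fin m → ℕ} {ε δ : Fin m → ℝ} (hW : W.IsRegularBasis A)
    (P : Protocol n ε δ) (i k : ℕ) : Measurable fun t => W.coeff (P.est t) i k := by
  have hg : Measurable fun w : (Fin m → P.T) × unitInterval => W.fn i k w.2 :=
    ((hW.continuous_fn i k).comp continuous_subtype_val).measurable.comp measurable_snd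
  exact (P.measurable_est.mul hg).stronglyMeasurable.integral_prod_right.measurable

/-- The least favourable prior of the global lower bound lives on one level: combinations with
coefficients in `[0, s]`, for `s` of the order `2 ^ (- l (α + 1 / 2))`, are in the Besov ball. -/
lemma family_mem_besovBall (hW : W.IsRegularBasis A) (hp : 1 ≤ p) (hq : 1 ≤ q) (hR : 0 < R)
    (i : ℕ) {θ : Fin (W.count i) → ℝ} (hθ : ∀ k, 0 ≤ θ k ∧ θ k ≤ 1) :
    family (R / 2 * W.scale i ^ (-(α + 1 / 2)))
      (fun (k : Fin (W.count i)) (x : unitInterval) => W.fn i k x) θ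
        ∈ besovBall W α p q R ∧
      ∀ k : Fin (W.count i), W.coeff (family (R / 2 * W.scale i ^ (-(α + 1 / 2)))
        (fun (k : Fin (W.count i)) (x : unitInterval) => W.fn i k x) θ) i k
          = R / 2 * W.scale i ^ (-(α + 1 / 2)) * θ k := by
  set s := R / 2 * W.scale i ^ (-(α + 1 / 2)) with hs
  have hΔ := W.scale_pos i
  have hΔr := Real.rpow_pos_of_pos hΔ (-(α + 1 / 2))
  have hs0 : 0 ≤ s := by positivity
  set a : ℕ → ℕ → ℝ := fun _ k => s * if h : k < W.count i then θ ⟨k, h⟩ else 0 with ha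
  have hak : ∀ k : Fin (W.count i), a i k = s * θ k := fun k => by
    simp only [ha, k.2, dif_pos]
  have e : family s (fun (k : Fin (W.count i)) (x : unitInterval) => W.fn i k x) θ
      = fun x : unitInterval => W.combo {i} a x := by
    funext x
    rw [WaveletSystem.combo, Finset.sum_singleton, family, Finset.mul_sum]
    refine Finset.sum_congr rfl fun k _ => ?_
    rw [hak]; ring
  rw [e]
  refine ⟨?_, fun k => ?_⟩
  · set u := (p⁻¹).toReal with hu
    have hu0 : 0 ≤ u := ENNReal.toReal_nonneg
    have hu1 : u ≤ 1 := by
      rw [hu, ← ENNReal.toReal_one]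
      exact ENNReal.toReal_mono ENNReal.one_ne_top (ENNReal.inv_le_one.2 hp)
    refine combo_mem_besovBall hW hq {i} a (fun i => (2 * W.scale i) ^ u * s)
      (fun j _ => mul_nonneg (Real.rpow_nonneg (by linarith [W.scale_pos j]) _) hs0) ?_ hp ?_
    · intro j hj
      rw [Finset.mem_singleton.1 hj]
      refine (ellNorm_le_card_mul hp _ (B := ENNReal.ofReal s) fun k => ?_).trans ?_
      · rw [hak, Real.enorm_eq_ofReal (mul_nonneg hs0 (hθ k).1)]
        exact ENNReal.ofReal_le_ofReal (mul_le_of_le_one_right hs0 (hθ k).2)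
      · rw [Fintype.card_fin, ENNReal.ofReal_mul (p := (2 * W.scale i) ^ u) (by positivity),
          ← ENNReal.ofReal_rpow_of_nonneg (by positivity) hu0]
        gcongr
        rw [← ENNReal.ofReal_natCast]
        exact ENNReal.ofReal_le_ofReal (W.count_le i)
    · rw [Finset.sum_singleton, Real.mul_rpow zero_le_two hΔ.le, hs]
      have h1 : W.scale i ^ (α + 1 / 2 - u) * W.scale i ^ u * W.scale i ^ (-(α + 1 / 2)) = 1 := by
        rw [← Real.rpow_add hΔ, ← Real.rpow_add hΔ]
        ring_nf
        exact Real.rpow_zero _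
      have h2 : (2 : ℝ) ^ u ≤ 2 := by
        conv_rhs => rw [← Real.rpow_one 2]
        exact Real.rpow_le_rpow_of_exponent_le one_le_two hu1
      calc _ = (2 : ℝ) ^ u * (R / 2) * (W.scale i ^ (α + 1 / 2 - u) * W.scale i ^ u
            * W.scale i ^ (-(α + 1 / 2))) := by ring
        _ ≤ 2 * (R / 2) * 1 := by rw [h1]; gcongr
        _ = R := by ring
  · rw [hW.coeff_combo, if_pos (Finset.mem_singleton_self i), hak]

/-- The global minimax risk is at least of the order `D ^ (- 2 α) ∧ 1`. -/
lemma le_globalMinimaxRisk (hW : W.IsRegularBasis A) (hR : 0 < R) (hp : 2 ≤ p)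
    (hq : 1 ≤ q) (hα : 0 < α) (Cε : ℝ) {κ K : ℝ} (hκ : 0 < κ) (hK : 0 < K) :
    ∃ c : ℝ, 0 < c ∧ ∀ (m : ℕ) (n : Fin m → ℕ) (ε δ : Fin m → ℝ) (D : ℝ), (∀ j, 1 ≤ n j) →
      (∀ j, 0 < ε j ∧ ε j ≤ Cε) → (∀ j, 0 ≤ δ j) → SolvesDimensionEq α n ε D →
      (∀ j, δ j ≤ K * (Real.sqrt (n j) * ε j ^ 2 / max D 1) ^ (1 + κ)) →
      ENNReal.ofReal (c * min (D ^ (-2 * α)) 1)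
        ≤ globalMinimaxRisk n ε δ (besovBall W α p q R) := by
  obtain ⟨C₀, hC₀⟩ := hW.exists_localized
  have hC₀1 := hC₀.one_le
  have hp1 : 1 ≤ p := le_trans (by norm_num) hp
  -- `c₀` bounds the ratio of the scale of the chosen level and `D ∨ 1`
  set c₀ : ℝ := 2 ^ (W.l₀ + 1) with hc₀
  have hc₀0 : 0 < c₀ := by positivity
  obtain ⟨CI, hCI, hinfo⟩ := exists_information_le (K := K * c₀ ^ (1 + κ)) (C := 2 * C₀ ^ 2) hκ
    (by positivity) (by positivity) Cε
  set L : ℝ := R / 2 * √CI / 4 + 1 with hL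
  have hL0 : 0 < L := by positivity
  set c : ℝ := (R / 2) ^ 2 / (36 * L ^ 2) with hc
  have hc0 : 0 < c := by positivity
  refine ⟨c * c₀ ^ (-2 * α), by positivity, fun m n ε δ D hn hε hδ hD hδK => ?_⟩
  have hD0 := hD.1
  obtain ⟨i, hi1, hi2⟩ := exists_scale_near W (D := max D 1) (le_max_right _ _)
  set Δ := W.scale i with hΔ
  have hΔ1 : 1 ≤ Δ := W.one_le_scale i
  have hΔ0 : 0 < Δ := W.scale_pos i
  have hmax : 0 < max D 1 := lt_max_of_lt_left hD0
  have hmin := min_rpow_one_le hα hc₀0 hD0 hΔ0 hi2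
  refine le_trans (ENNReal.ofReal_le_ofReal
    (show c * c₀ ^ (-2 * α) * min (D ^ (-2 * α)) 1 ≤ c * Δ ^ (-2 * α) by
      rw [mul_assoc]; gcongr)) (le_iInf fun P => ?_)
  set s : ℝ := R / 2 * Δ ^ (-(α + 1 / 2)) with hs
  have hΔr := Real.rpow_pos_of_pos hΔ0 (-(α + 1 / 2))
  have hs0 : 0 < s := by positivity
  set b : ℝ := √CI * Δ ^ (α + 1 / 2) with hb
  have hb0 : 0 ≤ b := by positivity
  have hsb : s * b = R / 2 * √CI := by
    have : Δ ^ (-(α + 1 / 2)) * Δ ^ (α + 1 / 2) = 1 := by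
      rw [← Real.rpow_add hΔ0]; simp
    rw [hs, hb]
    linear_combination R / 2 * √CI * this
  have hb2 : CI / Δ * Δ ^ (2 * α + 2) = b ^ 2 := by
    rw [hb, mul_pow, Real.sq_sqrt hCI.le, ← Real.rpow_natCast (Δ ^ _), ← Real.rpow_mul hΔ0.le,
      div_mul_eq_mul_div, mul_div_assoc]
    congr 1
    rw [div_eq_iff hΔ0.ne', ← Real.rpow_add_one hΔ0.ne']
    congr 1; push_cast; ring
  set g : Fin (W.count i) → unitInterval → ℝ := fun k x => W.fn i k x with hg
  have hgc : ∀ k, Continuous (g k) := fun k =>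
    (hW.continuous_fn i k).comp continuous_subtype_val
  -- The coefficients of the estimator, projected onto the range `[0, s]` of the true ones.
  set M : Fin (W.count i) → (Fin m → P.T) → ℝ := fun k t =>
    max 0 (min s (W.coeff (P.est t) i k)) with hMdef
  have hM : ∀ k, Measurable (M k) := fun k =>
    measurable_const.max (measurable_const.min (measurable_coeff_est hW P i k))
  obtain ⟨θ, hθ, H⟩ := P.exists_le_sum_sqrt_risk hs0.le hb0 hgc hM
    (fun k t => le_max_left _ _) (fun k t => max_le hs0.le (min_le_left _ _))
    (fun θ hθ k => by
      have hj : ∀ j, ∃ G : P.T → ℝ, Measurable G ∧ _ := fun j =>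
        hinfo (n j) (ε j) (δ j) Δ (hn j) (hε j).1 (hε j).2 (hδ j) hΔ1 (by
          refine (hδK j).trans ?_
          rw [mul_assoc, ← Real.mul_rpow hc₀0.le (by positivity)]
          gcongr
          rw [← mul_div_assoc, div_le_div_iff₀ hmax hΔ0]
          calc √(n j) * ε j ^ 2 * Δ ≤ √(n j) * ε j ^ 2 * (c₀ * max D 1) := by gcongr
            _ = _ := by ring) (P.K j) (family s g θ) (g k) (P.isDP j)
          (continuous_family (s := s) hgc θ) (hgc k)
          (by
            have := hW.orthonormal i k i k k.2 k.2
            simp only [and_self, if_true] at this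
            simp only [hg, sq]
            exact this.le)
          (fun x => (hC₀.abs_fn_le i k x).trans (by
            have : C₀ ≤ 2 * C₀ ^ 2 := by nlinarith
            gcongr))
          (hC₀.integral_abs_fn_le hW i k)
      choose G hGm mG oG bG using hj
      refine ⟨G, mG, oG, (Finset.sum_le_sum fun j _ => bG j).trans ?_⟩
      rw [← hb2, ← Finset.mul_sum, ← Finset.sum_div, ← mul_div_assoc, div_mul_eq_mul_div]
      have := hD.sum_min_le hα ((le_max_left D 1).trans hi1)
      gcongr)
  obtain ⟨hball, hcoef⟩ := family_mem_besovBall (α := α) hW hp1 hq hR i hθ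
  set f := family s g θ with hf
  have hrisk := sum_risk_le_globalRisk hW P i hs0.le (continuous_family (s := s) hgc θ)
    (c := fun k => s * θ k) (fun k => mul_nonneg hs0.le (hθ k).1)
    (fun k => mul_le_of_le_one_right hs0.le (hθ k).2) hcoef hM fun k t => rfl
  refine le_trans (le_trans (ENNReal.ofReal_le_ofReal ?_) hrisk)
    (le_iSup₂ (f := fun f (_ : f ∈ besovBall W α p q R) => P.globalRisk f) f hball)
  set r : Fin (W.count i) → ℝ := fun k => ∫ t, (M k t - s * θ k) ^ 2 ∂P.transcriptLaw f with hr
  have hr0 : ∀ k, 0 ≤ r k := fun k => integral_nonneg fun _ => sq_nonneg _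
  -- Cauchy–Schwarz turns the bound on the sum of the root risks into one on the sum of the risks.
  have hcs : (∑ k, √(r k)) ^ 2 ≤ W.count i * ∑ k, r k := by
    have := sq_sum_le_card_mul_sum_sq (s := Finset.univ) (f := fun k => √(r k))
    simpa only [Real.sq_sqrt (hr0 _), Finset.card_univ, Fintype.card_fin] using this
  rw [hsb, Fintype.card_fin] at H
  set N : ℝ := (W.count i : ℝ) with hN
  have hNΔ : Δ ≤ N := by
    rw [hN, hΔ, WaveletSystem.count, WaveletSystem.scale]
    split_ifs with h
    · subst h; push_cast; exact pow_le_pow_right₀ one_le_two (by omega)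
    · push_cast; exact le_rfl
  have hN0 : 0 < N := hΔ0.trans_le hNΔ
  have h1 : (N * (s / 6)) ^ 2 ≤ L ^ 2 * (N * ∑ k, r k) := by
    calc (N * (s / 6)) ^ 2 ≤ (L * ∑ k, √(r k)) ^ 2 :=
          pow_le_pow_left₀ (by positivity) H 2
      _ = L ^ 2 * (∑ k, √(r k)) ^ 2 := mul_pow _ _ _
      _ ≤ _ := by gcongr
  have h2 : N * s ^ 2 ≤ 36 * L ^ 2 * ∑ k, r k := by
    have : N * (N * s ^ 2) ≤ N * (36 * L ^ 2 * ∑ k, r k) := by linarith only [h1]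
    exact le_of_mul_le_mul_left this hN0
  have h3 : (R / 2) ^ 2 * Δ ^ (-2 * α) = Δ * s ^ 2 := by
    have : Δ ^ (-2 * α) = Δ * (Δ ^ (-(α + 1 / 2))) ^ 2 := by
      rw [← Real.rpow_natCast (Δ ^ _), ← Real.rpow_mul hΔ0.le]
      conv_rhs => rw [mul_comm, ← Real.rpow_add_one hΔ0.ne']
      congr 1; push_cast; ring
    rw [this, hs]; ring
  rw [hc, div_mul_eq_mul_div, div_le_iff₀ (by positivity), h3]
  calc Δ * s ^ 2 ≤ N * s ^ 2 := by gcongr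
    _ ≤ _ := by linarith only [h2]

end globalLower

/-! ### The factor `M` -/

/-- A quantity between `c (d ∧ 1)` and `C₁ ∧ (C₁ L d)` is, up to constants, equal to
`(M d) ∧ 1` for some `M` with `1 ≤ M ≲ L`. -/
lemma exists_factor {c C₁ C L d : ℝ} {r : ℝ≥0∞} (hC₁ : 0 < C₁) (hd : 0 < d)
    (hL : 1 ≤ C * L) (hC1 : 1 ≤ C) (hCC : C₁ ≤ C) (h0 : ENNReal.ofReal (c * min d 1) ≤ r)
    (h1 : r ≤ ENNReal.ofReal C₁) (h2 : r ≤ ENNReal.ofReal (C₁ * L * d)) :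
    ∃ M : ℝ, 1 ≤ M ∧ M ≤ C * L ∧ ENNReal.ofReal (min c C₁ * min (M * d) 1) ≤ r
      ∧ r ≤ ENNReal.ofReal (C * min (M * d) 1) := by
  have hr : r ≠ ∞ := ne_top_of_le_ne_top ENNReal.ofReal_ne_top h1
  have hL0 : 0 < L := by
    by_contra h
    nlinarith [not_lt.1 h]
  set s := r.toReal with hs
  have hs0 : 0 ≤ s := ENNReal.toReal_nonneg
  have e0 : c * min d 1 ≤ s := (ENNReal.ofReal_le_iff_le_toReal hr).1 h0
  have e1 : s ≤ C₁ := ENNReal.toReal_le_of_le_ofReal hC₁.le h1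
  have e2 : s ≤ C₁ * L * d := ENNReal.toReal_le_of_le_ofReal (by positivity) h2
  refine ⟨max 1 (s / (C₁ * d)), le_max_left _ _, max_le hL ?_, ?_, ?_⟩
  · rw [div_le_iff₀ (by positivity)]
    calc s ≤ L * (C₁ * d) := by linarith
      _ ≤ C * L * (C₁ * d) := by gcongr; exact le_mul_of_one_le_left hL0.le hC1
  · refine (ENNReal.ofReal_le_iff_le_toReal hr).2 ?_
    rcases le_total 1 (s / (C₁ * d)) with h | h
    · rw [max_eq_right h]
      calc min c C₁ * min (s / (C₁ * d) * d) 1 ≤ C₁ * (s / (C₁ * d) * d) := by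
            gcongr
            · exact min_le_right _ _
            · exact min_le_left _ _
        _ = s := by field_simp
    · rw [max_eq_left h, one_mul]
      refine le_trans ?_ e0
      gcongr
      exact min_le_left _ _
  · refine (ENNReal.le_ofReal_iff_toReal_le hr (by positivity)).2 ?_
    have hm : s / C₁ ≤ min (max 1 (s / (C₁ * d)) * d) 1 := by
      refine le_min ?_ ((div_le_one hC₁).2 e1)
      calc s / C₁ = s / (C₁ * d) * d := by field_simp
        _ ≤ _ := by gcongr; exact le_max_right _ _
    calc s = C₁ * (s / C₁) := by field_simp
      _ ≤ _ := by gcongr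

end

theorem mainTheorem1 (A : ℕ) (W : WaveletSystem) (hW : W.IsRegularBasis A)
    (α R : ℝ) (p q : ℝ≥0∞) (hα : α < A) (hR : 0 < R) (hp : 2 ≤ p) (hq : 1 ≤ q)
    (hν : 1 / 2 < α - (p⁻¹).toReal) (Cε : ℝ) (hCε : 0 < Cε) :
    -- the defining equation has exactly one positive solution
    (∀ (γ : ℝ) (m : ℕ) (n : Fin m → ℕ) (ε : Fin m → ℝ), 0 < γ → 0 < m →
      (∀ j, 1 ≤ n j) → (∀ j, 0 < ε j) → ∃! D : ℝ, SolvesDimensionEq γ n ε D) ∧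
    -- global risk
    (∀ κ K δbar : ℝ, 0 < κ → 0 < K → δbar < 1 →
      ∃ c C : ℝ, 0 < c ∧ 0 < C ∧
        ∀ (m : ℕ) (n : Fin m → ℕ) (ε δ : Fin m → ℝ) (D : ℝ),
          (∀ j, 1 ≤ n j) → 2 ≤ ∑ j, n j →
          (∀ j, 0 < ε j ∧ ε j ≤ Cε) → (∀ j, 0 ≤ δ j) → (⨅ j, δ j) ≤ δbar →
          SolvesDimensionEq α n ε D →
          (∀ j, δ j ≤ K * (Real.sqrt (n j) * ε j ^ 2 / max D 1) ^ (1 + κ)) →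
          ∃ M : ℝ, 1 ≤ M ∧
            (0 < (⨅ j, δ j) →
              M ≤ C * Real.log ((∑ j, n j : ℕ) : ℝ) * Real.log (1 / ⨅ j, δ j)) ∧
            ENNReal.ofReal (c * min (M * D ^ (-2 * α)) 1)
              ≤ globalMinimaxRisk n ε δ (besovBall W α p q R) ∧
            globalMinimaxRisk n ε δ (besovBall W α p q R)
              ≤ ENNReal.ofReal (C * min (M * D ^ (-2 * α)) 1)) ∧
    -- pointwise risk
    (∃ η c C : ℝ, 0 < η ∧ 0 < c ∧ 0 < C ∧
      ∀ x₀ : unitInterval, 0 < x₀ → x₀ < 1 →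
        ∀ (m : ℕ) (n : Fin m → ℕ) (ε δ : Fin m → ℝ) (D : ℝ),
          (∀ j, 1 ≤ n j) → 2 ≤ ∑ j, n j →
          (∀ j, 0 < ε j ∧ ε j ≤ Cε) → (∀ j, 0 ≤ δ j) →
          SolvesDimensionEq (α - (p⁻¹).toReal) n ε D →
          ∑ j, (n j : ℝ) * δ j ≤ η →
          ∃ M : ℝ, 1 ≤ M ∧ M ≤ C * Real.log ((∑ j, n j : ℕ) : ℝ) ∧
            ENNReal.ofReal (c * min (M * D ^ (-2 * (α - (p⁻¹).toReal))) 1)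
              ≤ pointwiseMinimaxRisk n ε δ x₀ (besovBall W α p q R) ∧
            pointwiseMinimaxRisk n ε δ x₀ (besovBall W α p q R)
              ≤ ENNReal.ofReal (C * min (M * D ^ (-2 * (α - (p⁻¹).toReal))) 1)) := by
  have hα0 : 0 < α - (p⁻¹).toReal := by linarith
  have hαpos : 1 / 2 < α := by linarith [ENNReal.toReal_nonneg (a := p⁻¹)]
  have hA : 1 ≤ A := by
    rcases Nat.eq_zero_or_pos A with rfl | h
    · simp only [Nat.cast_zero] at hα; linarith
    · exact h
  have hp1 : 1 ≤ p := le_trans (by norm_num) hp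
  refine ⟨fun γ m n ε hγ hm hn hε => existsUnique_solvesDimensionEq hγ hm hn hε, ?_, ?_⟩
  · intro κ K δbar hκ hK hδbar
    obtain ⟨c, hc, hlow⟩ := le_globalMinimaxRisk (α := α) hW hR hp hq (by linarith) Cε hκ hK
    obtain ⟨C₁, hC₁, hup⟩ := globalMinimaxRisk_le hW hR hp hq hα0
    set b := max δbar (1 / 2) with hb
    have hb0 : 0 < b := lt_max_of_lt_right (by norm_num)
    have hb1 : b < 1 := max_lt hδbar (by norm_num)
    have hlb : 0 < Real.log (1 / b) := Real.log_pos ((one_lt_div hb0).2 hb1)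
    set C := max 2 C₁ with hC
    have hC2 : 2 ≤ C := le_max_left _ _
    refine ⟨min c C₁, max C (C / Real.log (1 / b)), lt_min hc hC₁, by positivity,
      fun m n ε δ D hn hN hε hδ hδb hD hδK => ?_⟩
    have hlog := half_le_log_of_two_le hN
    obtain ⟨M, hM1, hM2, hM3, hM4⟩ := exists_factor hC₁ (Real.rpow_pos_of_pos hD.1 (-2 * α))
      (C := C) (L := Real.log ((∑ j, n j : ℕ) : ℝ)) (by nlinarith) (by linarith)
      (le_max_right _ _) (hlow m n ε δ D hn hε hδ hD hδK)
      (hup m n ε δ D hn hN (fun j => (hε j).1) hD).1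
      (hup m n ε δ D hn hN (fun j => (hε j).1) hD).2
    refine ⟨M, hM1, fun hpos => ?_, hM3, hM4.trans (ENNReal.ofReal_le_ofReal ?_)⟩
    · -- `log (1 / min δ)` is bounded below because `min δ ≤ δbar < 1`
      have h1 : Real.log (1 / b) ≤ Real.log (1 / ⨅ j, δ j) :=
        Real.log_le_log (by positivity)
          (one_div_le_one_div_of_le hpos (hδb.trans (le_max_left _ _)))
      calc M ≤ C * Real.log ((∑ j, n j : ℕ) : ℝ) := hM2
        _ = C / Real.log (1 / b) * Real.log ((∑ j, n j : ℕ) : ℝ) * Real.log (1 / b) := by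
            field_simp
        _ ≤ _ := by
            have h2 : 0 ≤ Real.log ((∑ j, n j : ℕ) : ℝ) := by linarith
            gcongr
            exact le_max_right _ _
    · have : 0 ≤ min (M * D ^ (-2 * α)) 1 :=
        le_min (mul_nonneg (by linarith) (Real.rpow_nonneg hD.1.le _)) zero_le_one
      gcongr
      exact le_max_left _ _
  · obtain ⟨η, c, hη, hc, hlow⟩ := le_pointwiseMinimaxRisk (α := α) hW hA hR hp1 hq hα0 Cε
    obtain ⟨C₁, hC₁, hup⟩ := pointwiseMinimaxRisk_le hW hR hp hq hα0
    refine ⟨η, min c C₁, max 2 C₁, hη, lt_min hc hC₁, by positivity,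
      fun x₀ _ _ m n ε δ D hn hN hε hδ hD hδη => ?_⟩
    have hlog := half_le_log_of_two_le hN
    have hC2 : 2 ≤ max 2 C₁ := le_max_left _ _
    exact exists_factor hC₁
      (Real.rpow_pos_of_pos hD.1 (-2 * (α - (p⁻¹).toReal))) (by nlinarith) (by linarith)
      (le_max_right _ _) (hlow x₀ m n ε δ D hε hδ hD hδη)
      (hup x₀ m n ε δ D hn hN (fun j => (hε j).1) hD).1
      (hup x₀ m n ε δ D hn hN (fun j => (hε j).1) hD).2
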